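/- Let $\mathbb F\in\{\mathbb R,\mathbb C,\mathbb H\}$, $d=\dim_{\mathbb R}\mathbb F\in\{1,2,4\}$, let $q\ge 1$ be an integer and put $\gamma=d(q-\tfrac12)+1$. Let $\overline{A_0}=\{x\in\mathbb R^q:\ \tfrac{\pi}{2}\ge x_1\ge\dots\ge x_q\ge 0\}$, let $B_q=\{w\in M_q(\mathbb F): w^*w<I\}$ with Lebesgue measure $dw$, and let $U_0(q,\mathbb F)$ be the identity component of the unitary group $U(q,\mathbb F)$, with normalized Haar measure $dv$. Let $\Delta$ be the determinant on $M_q(\mathbb F)$ for $\mathbb F=\mathbb R,\mathbb C$, and the Dieudonné determinant $\Delta(X)=(\det_{\mathbb C}X)^{1/2}$ for $\mathbb F=\mathbb H$, where $X$ is regarded as a complex $2q\times 2q$ matrix. For $x\in\mathbb R^q$ write $\sin\underline x$, $\cos\underline x$ for the diagonal matrices with entries $\sin x_i$, $\cos x_i$. For $X\in M_q(\mathbb F)$ let $\operatorname{spec}_s(X)$ be the vector of singular values of $X$ (the square roots of the eigenvalues of $X^*X$, with multiplicity), and let $\arccos(\operatorname{spec}_s(X))\in\overline{A_0}$ be the vector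 of their arccosines arranged in decreasing order. Let $\mu\in\mathbb C$ with $\operatorname{Re}\mu>\gamma-1$. Then $\Delta(I-w^*w)^{\mu-\gamma}$ is integrable over $B_q$ and $$\kappa_\mu=\int_{B_q}\Delta(I-w^*w)^{\mu-\gamma}\,dw\neq 0 .$$ For $x,y\in\overline{A_0}$ and $f\in C(\overline{A_0})$ put $$(\delta_x*_\mu\delta_y)(f)=\frac1{\kappa_\mu}\int_{B_q}\int_{U_0(q,\mathbb F)} f\bigl(\arccos(\operatorname{spec}_s(-\sin\underline x\,w\sin\underline y+\cos\underline x\,v\cos\underline y))\bigr)\,\Delta(I-w^*w)^{\mu-\gamma}\,dv\,dw .$$ (1) There is a bilinear, weakly continuous (that is, jointly continuous on pairs of positive measures for the weak topology), associative and commutative convolution $*_\mu$ on the space $M_b(\overline{A_0})$ of bounded complex Borel measures whose products of point measures are given by this formula. The measures $\delta_x*_\mu\delta_y$ have total mass $1$, and $\delta_0$ is neutral. (2) If $\mu$ is real, then the $\delta_x*_\mu\delta_y$ are probability measures and $(\overline{A_0},*_\mu)$ is a compact commutative hypergroup (in the sense of Jewett) with neutral element $0$ and with the identity mapping as involution. That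 is, in addition to (1), convolution preserves positivity, $\operatorname{supp}(\delta_x*_\mu\delta_y)$ is compact and depends continuously on $(x,y)$ in the Michael topology, and $0\in\operatorname{supp}(\delta_x*_\mu\delta_y)$ if and only if $x=y$. (3) Suppose that $\mu=pd/2$ with $p\in\mathbb N$ (then $p\ge 2q$). Let $U=SU(p+q,\mathbb F)$, i.e. $SO(p+q)$, $SU(p+q)$ or $Sp(p+q)$, and let $K=S(U(p,\mathbb F)\times U(q,\mathbb F))$ be its subgroup of block diagonal matrices, i.e. $S(O(p)\times O(q))$, $S(U(p)\times U(q))$ or $Sp(p)\times Sp(q)$, with normalized Haar measure $dk$. Let $b_x\in U$ be the rotation by $x_j$ in the plane of the $j$-th and $(p+j)$-th coordinates, $1\le j\le q$. Then $x\mapsto Kb_xK$ is a homeomorphism of $\overline{A_0}$ onto the double coset space $U/\!/K$, and it identifies $*_\mu$ with the double coset hypergroup: it carries $\delta_x*_\mu\delta_y$ to $\int_K\delta_{KgkhK}\,dk$ whenever $x,y$ correspond to $KgK,KhK$, it maps $0$ to $K$, and $Kg^{-1}K=KgK$ for all $g\in U$. The average $\int\delta_{KgkhK}\,dk$ is unchanged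 if $K$ is replaced by its identity component with its normalized Haar measure (for $\mathbb F=\mathbb R$ this component is $SO(p)\times SO(q)$). -/

import Mathlib

open MeasureTheory Matrix Quaternion

noncomputable section

/-! ## Bounded measures and hypergroups -/

/-- A finite positive measure, regarded as an element of the space of bounded complex measures. -/
def finiteToComplex {X : Type*} [MeasurableSpace X] (m : FiniteMeasure X) :
    ComplexMeasure X :=
  SignedMeasure.toComplexMeasure (Measure.toSignedMeasure (m : Measure X)) 0

/-- The point measure at `x` as a bounded complex measure. -/
def pointMass {X : Type*} [MeasurableSpace X] (x : X) : ComplexMeasure X :=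
  finiteToComplex ⟨Measure.dirac x, inferInstance⟩

/-- The integral of a real function against a bounded complex measure. -/
def cintegral {X : Type*} [MeasurableSpace X] (c : ComplexMeasure X) (f : X → ℝ) : ℂ :=
  ∫ᵛ x, f x ∂•c

/-- Bilinear products on the space `M_b(X)` of bounded complex Borel measures. On a second
countable locally compact Hausdorff space every such measure is regular. -/
abbrev MeasureProduct (X : Type*) [MeasurableSpace X] :=
  ComplexMeasure X →ₗ[ℂ] ComplexMeasure X →ₗ[ℂ] ComplexMeasure X

/-- Weak continuity of a bilinear product of bounded measures: its restriction to pairs of positive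
measures is jointly continuous, where measures carry the weak topology (tested against bounded
continuous functions). Real test functions suffice, by linearity. -/
def WeaklyContinuous {X : Type*} [TopologicalSpace X] [MeasurableSpace X] [OpensMeasurableSpace X]
    (conv : MeasureProduct X) : Prop :=
  ∀ f : BoundedContinuousFunction X ℝ,
    Continuous fun m : FiniteMeasure X × FiniteMeasure X =>
      cintegral (conv (finiteToComplex m.1) (finiteToComplex m.2)) f

/-- Hypergroups in the sense of Jewett, on a second countable locally compact Hausdorff space. -/
structure Hypergroup (X : Type*) [TopologicalSpace X] [T2Space X] [LocallyCompactSpace X]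
    [SecondCountableTopology X] [MeasurableSpace X] [BorelSpace X] where
  /-- the convolution on `M_b(X)` -/
  conv : MeasureProduct X
  assoc : ∀ a b c, conv (conv a b) c = conv a (conv b c)
  nonneg : ∀ m n : FiniteMeasure X, ∃ r : FiniteMeasure X,
    conv (finiteToComplex m) (finiteToComplex n) = finiteToComplex r
  weaklyContinuous : WeaklyContinuous conv
  /-- the convolution of two point measures, which is a probability measure -/
  point : X → X → ProbabilityMeasure X
  conv_point : ∀ x y, conv (pointMass x) (pointMass y) =
    finiteToComplex (point x y).toFiniteMeasure
  isCompact_support : ∀ x y, IsCompact (point x y : Measure X).support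
  /-- continuity of the supports for the Michael topology, which is generated by the sets
  `{A | A ∩ V ≠ ∅ and A ⊆ W}` with `V`, `W` open -/
  continuous_support : ∀ V W : Set X, IsOpen V → IsOpen W →
    IsOpen {z : X × X | ((point z.1 z.2 : Measure X).support ∩ V).Nonempty ∧
      (point z.1 z.2 : Measure X).support ⊆ W}
  /-- the neutral element -/
  e : X
  e_conv : ∀ x, conv (pointMass e) (pointMass x) = pointMass x
  conv_e : ∀ x, conv (pointMass x) (pointMass e) = pointMass x
  /-- the involution -/
  inv : X → X
  continuous_inv : Continuous inv
  inv_inv : ∀ x, inv (inv x) = x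
  point_inv : ∀ x y, (point (inv x) (inv y) : Measure X) = (point y x : Measure X).map inv
  e_mem_support_iff : ∀ x y, e ∈ (point x y : Measure X).support ↔ x = inv y

/-! ## The alcove -/

/-- The closed alcove `π/2 ≥ x₁ ≥ … ≥ x_q ≥ 0`. -/
def alcove (q : ℕ) : Set (Fin q → ℝ) :=
  {x | Antitone x ∧ ∀ i, x i ∈ Set.Icc 0 (Real.pi / 2)}

theorem isCompact_alcove (q : ℕ) : IsCompact (alcove q) := by
  have h1 : IsCompact (Set.univ.pi fun _ : Fin q => Set.Icc (0 : ℝ) (Real.pi / 2)) :=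
    isCompact_univ_pi fun _ => isCompact_Icc
  refine h1.of_isClosed_subset ?_ fun x hx i _ => hx.2 i
  have h2 : alcove q = (⋂ i : Fin q, ⋂ j : Fin q, ⋂ _ : i ≤ j, {x | x j ≤ x i}) ∩
      (Set.univ.pi fun _ : Fin q => Set.Icc (0 : ℝ) (Real.pi / 2)) := by
    ext x
    simp only [alcove, Antitone, Set.mem_inter_iff, Set.mem_iInter, Set.mem_pi, Set.mem_univ,
      Set.mem_ofPred_eq, true_imp_iff]
  rw [h2]
  refine IsClosed.inter ?_ h1.isClosed
  exact isClosed_iInter fun i => isClosed_iInter fun j => isClosed_iInter fun _ =>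
    isClosed_le (continuous_apply j) (continuous_apply i)

instance (q : ℕ) : CompactSpace (alcove q) := isCompact_iff_compactSpace.1 (isCompact_alcove q)

instance (q : ℕ) : Zero (alcove q) :=
  ⟨⟨0, fun _ _ _ => le_rfl, fun _ => ⟨le_rfl, by simp only [Pi.zero_apply]; positivity⟩⟩⟩

/-! ## Matrices over the real numbers, the complex numbers and the quaternions -/

instance {m n F : Type*} [MeasurableSpace F] : MeasurableSpace (Matrix m n F) :=
  inferInstanceAs (MeasurableSpace (m → n → F))

instance {m n F : Type*} [Countable m] [Countable n] [TopologicalSpace F]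
    [SecondCountableTopology F] [MeasurableSpace F] [BorelSpace F] : BorelSpace (Matrix m n F) :=
  inferInstanceAs (BorelSpace (m → n → F))

instance {m n F : Type*} [TopologicalSpace F] [LocallyCompactSpace F] [Finite m] [Finite n] :
    LocallyCompactSpace (Matrix m n F) :=
  inferInstanceAs (LocallyCompactSpace (m → n → F))

/-- Lebesgue measure on the matrices of a given size. -/
instance {m n F : Type*} [Fintype m] [Fintype n] [MeasureSpace F] : MeasureSpace (Matrix m n F) :=
  inferInstanceAs (MeasureSpace (m → n → F))

instance : MeasurableSpace ℍ[ℝ] := borel _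

instance : BorelSpace ℍ[ℝ] := ⟨rfl⟩

/-- A determinant for square matrices over `F`. -/
class HasDet (F : Type) [Semiring F] [TopologicalSpace F] where
  det : ∀ (n : Type) [Fintype n] [DecidableEq n], Matrix n n F →* ℂ
  continuous_det : ∀ (n : Type) [Fintype n] [DecidableEq n], Continuous (det n)

instance : HasDet ℝ where
  det _ _ _ := (Complex.ofRealHom : ℝ →* ℂ).comp Matrix.detMonoidHom
  continuous_det _ _ _ := Complex.continuous_ofReal.comp continuous_id.matrix_det

instance : HasDet ℂ where
  det _ _ _ := Matrix.detMonoidHom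
  continuous_det _ _ _ := continuous_id.matrix_det

/-- A quaternionic matrix `A₁ + A₂ j`, with `A₁` and `A₂` complex, as the complex matrix
`[[A₁, A₂], [-conj A₂, conj A₁]]`. -/
def quaternionToComplex (n : Type) [Fintype n] [DecidableEq n] :
    Matrix n n ℍ[ℝ] →* Matrix (n ⊕ n) (n ⊕ n) ℂ where
  toFun A := Matrix.fromBlocks
    (A.map fun a => ⟨a.re, a.imI⟩) (A.map fun a => ⟨a.imJ, a.imK⟩)
    (A.map fun a => ⟨-a.imJ, a.imK⟩) (A.map fun a => ⟨a.re, -a.imI⟩)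
  map_one' := by
    rw [← Matrix.fromBlocks_one]
    congr 1 <;> ext i j <;> by_cases h : i = j <;>
      simp [Matrix.one_apply, h, Complex.ext_iff]
  map_mul' A B := by
    rw [Matrix.fromBlocks_multiply]
    have hre (s : n → ℍ[ℝ]) : (∑ k, s k).re = ∑ k, (s k).re :=
      map_sum (AddMonoidHom.mk' (fun a : ℍ[ℝ] => a.re) fun _ _ => rfl) s _
    have hI (s : n → ℍ[ℝ]) : (∑ k, s k).imI = ∑ k, (s k).imI :=
      map_sum (AddMonoidHom.mk' (fun a : ℍ[ℝ] => a.imI) fun _ _ => rfl) s _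
    have hJ (s : n → ℍ[ℝ]) : (∑ k, s k).imJ = ∑ k, (s k).imJ :=
      map_sum (AddMonoidHom.mk' (fun a : ℍ[ℝ] => a.imJ) fun _ _ => rfl) s _
    have hK (s : n → ℍ[ℝ]) : (∑ k, s k).imK = ∑ k, (s k).imK :=
      map_sum (AddMonoidHom.mk' (fun a : ℍ[ℝ] => a.imK) fun _ _ => rfl) s _
    congr 1 <;> ext i j <;> apply Complex.ext <;>
      simp only [Matrix.map_apply, Matrix.mul_apply, Matrix.add_apply, Complex.add_re,
        Complex.add_im, Complex.re_sum, Complex.im_sum, Complex.mul_re, Complex.mul_im,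
        hre, hI, hJ, hK, ← Finset.sum_add_distrib, ← Finset.sum_neg_distrib] <;>
      refine Finset.sum_congr rfl fun k _ => ?_ <;> simp <;> ring

/-- The Dieudonné determinant: the square root of the complex determinant of a quaternionic matrix,
which is a nonnegative real number. -/
instance : HasDet ℍ[ℝ] where
  det n _ _ :=
    { toFun A := (Real.sqrt ‖(quaternionToComplex n A).det‖ : ℝ)
      map_one' := by simp
      map_mul' A B := by simp [Real.sqrt_mul] }
  continuous_det n _ _ := by
    have h : Continuous (quaternionToComplex n) := by
      have hc (f : ℍ[ℝ] → ℂ) (hr : Continuous fun a => (f a).re)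
          (hi : Continuous fun a => (f a).im) : Continuous f :=
        Complex.equivRealProdCLM.symm.continuous.comp (hr.prodMk hi)
      refine Continuous.matrix_fromBlocks ?_ ?_ ?_ ?_ <;>
        refine Continuous.matrix_map continuous_id ?_ <;> apply hc
      · exact Quaternion.continuous_re
      · exact Quaternion.continuous_imI
      · exact Quaternion.continuous_imJ
      · exact Quaternion.continuous_imK
      · exact Quaternion.continuous_imJ.neg
      · exact Quaternion.continuous_imK
      · exact Quaternion.continuous_re
      · exact Quaternion.continuous_imI.neg
    exact Complex.continuous_ofReal.comp (Real.continuous_sqrt.comp h.matrix_det.norm)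

/-- A type of scalars together with the structure that the constructions below use. Only
`ScalarField.real`, `ScalarField.complex` and `ScalarField.quaternion` are of interest. -/
structure ScalarField where
  carrier : Type
  [normedRing : NormedRing carrier]
  [starRing : StarRing carrier]
  [normedStarGroup : NormedStarGroup carrier]
  [normedAlgebra : NormedAlgebra ℝ carrier]
  [properSpace : ProperSpace carrier]
  [measureSpace : MeasureSpace carrier]
  [borelSpace : BorelSpace carrier]
  [hasDet : HasDet carrier]

instance : CoeSort ScalarField Type := ⟨ScalarField.carrier⟩

attribute [instance] ScalarField.normedRing ScalarField.starRing ScalarField.normedStarGroup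
  ScalarField.normedAlgebra ScalarField.properSpace ScalarField.measureSpace ScalarField.borelSpace
  ScalarField.hasDet

abbrev ScalarField.real : ScalarField := ⟨ℝ⟩

abbrev ScalarField.complex : ScalarField := ⟨ℂ⟩

abbrev ScalarField.quaternion : ScalarField := ⟨ℍ[ℝ]⟩

section SingularValues

variable {F : Type} [NormedRing F] [StarRing F] [NormedAlgebra ℝ F]

/-- `σ` lists the singular values of `X` in decreasing order: the numbers `σᵢ²` are the eigenvalues,
with multiplicity, of `X* X`. -/
def IsSingularSpectrum {q : ℕ} (X : Matrix (Fin q) (Fin q) F) (σ : Fin q → ℝ) : Prop :=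
  Antitone σ ∧ (∀ i, 0 ≤ σ i) ∧ ∃ u ∈ unitary (Matrix (Fin q) (Fin q) F),
    Xᴴ * X = u * Matrix.diagonal (fun i => algebraMap ℝ F (σ i ^ 2)) * uᴴ

open Classical in
/-- The singular spectrum `σ₁ ≥ … ≥ σ_q ≥ 0` of a square matrix. -/
def singularSpectrum {q : ℕ} (X : Matrix (Fin q) (Fin q) F) : Fin q → ℝ :=
  if h : ∃ σ, IsSingularSpectrum X σ then h.choose else 0

theorem singularSpectrum_antitone_nonneg {q : ℕ} (X : Matrix (Fin q) (Fin q) F) :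
    Antitone (singularSpectrum X) ∧ ∀ i, 0 ≤ singularSpectrum X i := by
  unfold singularSpectrum
  split_ifs with h
  · exact ⟨h.choose_spec.1, h.choose_spec.2.1⟩
  · exact ⟨fun _ _ _ => le_rfl, fun _ => le_rfl⟩

/-- The arccosines of the singular values of `X`, arranged in decreasing order. -/
def singularAngles {q : ℕ} (X : Matrix (Fin q) (Fin q) F) : alcove q :=
  ⟨fun i => Real.arccos (singularSpectrum X i.rev),
    fun _ _ hij => Real.arccos_le_arccos
      ((singularSpectrum_antitone_nonneg X).1 (Fin.rev_le_rev.2 hij)),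
    fun _ => ⟨Real.arccos_nonneg _,
      Real.arccos_le_pi_div_two.2 ((singularSpectrum_antitone_nonneg X).2 _)⟩⟩

end SingularValues

variable (F : Type) [NormedRing F] [StarRing F] [NormedStarGroup F] [NormedAlgebra ℝ F]
  [ProperSpace F] [MeasureSpace F] [BorelSpace F] [HasDet F]

/-- The unitary group `U(n, F)`. -/
abbrev unitaryMatrices (n : Type) [Fintype n] [DecidableEq n] := unitary (Matrix n n F)

instance (n : Type) [Fintype n] [DecidableEq n] : LocallyCompactSpace (unitaryMatrices F n) :=
  (isClosed_unitary (R := Matrix n n F)).isClosedEmbedding_subtypeVal.locallyCompactSpace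

/-- The identity component `U₀(q, F)` of `U(q, F)`. -/
abbrev unitaryComponent (q : ℕ) : Subgroup (unitaryMatrices F (Fin q)) :=
  Subgroup.connectedComponentOfOne (unitaryMatrices F (Fin q))

instance (q : ℕ) : LocallyCompactSpace (unitaryComponent F q) :=
  (isClosed_connectedComponent (x := (1 : unitaryMatrices F (Fin q)))
    ).isClosedEmbedding_subtypeVal.locallyCompactSpace

/-- The normalized Haar measure of a compact group. -/
def normalizedHaar (G : Type*) [TopologicalSpace G] [Group G] [IsTopologicalGroup G]
    [LocallyCompactSpace G] [MeasurableSpace G] [BorelSpace G] : Measure G :=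
  (Measure.haar (Set.univ : Set G))⁻¹ • Measure.haar

/-- The diagonal matrix `cos x`. -/
def cosDiag {q : ℕ} (x : Fin q → ℝ) : Matrix (Fin q) (Fin q) F :=
  Matrix.diagonal fun i => algebraMap ℝ F (Real.cos (x i))

/-- The diagonal matrix `sin x`. -/
def sinDiag {q : ℕ} (x : Fin q → ℝ) : Matrix (Fin q) (Fin q) F :=
  Matrix.diagonal fun i => algebraMap ℝ F (Real.sin (x i))

variable {F} in
/-- `d(x, y, v, w) = arccos (spec_s (- sin x w sin y + cos x v cos y))`. -/
def productAngles {q : ℕ} (x y : Fin q → ℝ) (v w : Matrix (Fin q) (Fin q) F) : alcove q :=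
  singularAngles (-(sinDiag F x * w * sinDiag F y) + cosDiag F x * v * cosDiag F y)

/-- The matrix ball `B_q = {w : w* w < I}`: the form `a ↦ |a|² - |w a|²` is positive definite. -/
def matrixBall (q : ℕ) : Set (Matrix (Fin q) (Fin q) F) :=
  {w | ∀ a : Fin q → F, a ≠ 0 → ∑ i, ‖(w *ᵥ a) i‖ ^ 2 < ∑ i, ‖a i‖ ^ 2}

/-- `γ = d (q - 1/2) + 1`, where `d` is the real dimension of `F`. -/
def gammaConst (q : ℕ) : ℝ := Module.finrank ℝ F * ((q : ℝ) - 1 / 2) + 1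

/-- The density `Δ(I - w* w) ^ (μ - γ)`. -/
def ballDensity (q : ℕ) (μ : ℂ) (w : Matrix (Fin q) (Fin q) F) : ℂ :=
  HasDet.det (Fin q) (1 - wᴴ * w) ^ (μ - gammaConst F q)

/-- The constant `κ_μ`. -/
def kappa (q : ℕ) (μ : ℂ) : ℂ := ∫ w in matrixBall F q, ballDensity F q μ w

/-- The functional `δ_x *_μ δ_y` on functions on the alcove. -/
def pointConv (q : ℕ) (μ : ℂ) (x y : alcove q) (f : alcove q → ℝ) : ℂ :=
  1 / kappa F q μ * ∫ w in matrixBall F q, ∫ v : unitaryComponent F q,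
    (f (productAngles x.1 y.1 (v : Matrix (Fin q) (Fin q) F) w) : ℂ) * ballDensity F q μ w
    ∂normalizedHaar (unitaryComponent F q)

/-! ## The compact Grassmannians -/

/-- The group `U = SU(p+q, F)`: unitary matrices of determinant one, in block notation. -/
abbrev grassmannU (p q : ℕ) : Subgroup (unitaryMatrices F (Fin p ⊕ Fin q)) :=
  ((HasDet.det (F := F) (Fin p ⊕ Fin q)).comp
    (unitary (Matrix (Fin p ⊕ Fin q) (Fin p ⊕ Fin q) F)).subtype).ker

/-- The subgroup `K = S(U(p, F) × U(q, F))` of block diagonal matrices in `U`. -/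
def grassmannK (p q : ℕ) : Subgroup (grassmannU F p q) where
  carrier := {u | (u : Matrix (Fin p ⊕ Fin q) (Fin p ⊕ Fin q) F).toBlocks₁₂ = 0 ∧
    (u : Matrix (Fin p ⊕ Fin q) (Fin p ⊕ Fin q) F).toBlocks₂₁ = 0}
  one_mem' := by
    constructor <;> ext i j <;> simp [Matrix.toBlocks₁₂, Matrix.toBlocks₂₁]
  mul_mem' := by
    rintro a b ⟨ha1, ha2⟩ ⟨hb1, hb2⟩
    have ea := Matrix.fromBlocks_toBlocks (a : Matrix (Fin p ⊕ Fin q) (Fin p ⊕ Fin q) F)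
    have eb := Matrix.fromBlocks_toBlocks (b : Matrix (Fin p ⊕ Fin q) (Fin p ⊕ Fin q) F)
    rw [ha1, ha2] at ea
    rw [hb1, hb2] at eb
    have hab : ((a * b : grassmannU F p q) : Matrix (Fin p ⊕ Fin q) (Fin p ⊕ Fin q) F) =
        (a : Matrix (Fin p ⊕ Fin q) (Fin p ⊕ Fin q) F) * b := rfl
    rw [← ea, ← eb, Matrix.fromBlocks_multiply] at hab
    simp only [Set.mem_ofPred_eq, hab, Matrix.toBlocks_fromBlocks₁₂,
      Matrix.toBlocks_fromBlocks₂₁]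
    simp
  inv_mem' := by
    rintro a ⟨ha1, ha2⟩
    have ha : ((a⁻¹ : grassmannU F p q) : Matrix (Fin p ⊕ Fin q) (Fin p ⊕ Fin q) F) =
        (a : Matrix (Fin p ⊕ Fin q) (Fin p ⊕ Fin q) F)ᴴ := rfl
    simp only [Set.mem_ofPred_eq, ha]
    constructor
    · ext i j
      have := congrFun (congrFun ha2 j) i
      simp only [Matrix.toBlocks₂₁, Matrix.of_apply, Matrix.zero_apply] at this
      simp [Matrix.toBlocks₁₂, this]
    · ext i j
      have := congrFun (congrFun ha1 j) i
      simp only [Matrix.toBlocks₁₂, Matrix.of_apply, Matrix.zero_apply] at this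
      simp [Matrix.toBlocks₂₁, this]

instance (p q : ℕ) : LocallyCompactSpace (grassmannU F p q) := by
  have h : IsClosed (grassmannU F p q : Set (unitaryMatrices F (Fin p ⊕ Fin q))) :=
    isClosed_singleton.preimage ((HasDet.continuous_det _).comp continuous_subtype_val)
  exact h.isClosedEmbedding_subtypeVal.locallyCompactSpace

instance (p q : ℕ) : LocallyCompactSpace (grassmannK F p q) := by
  have hc : Continuous fun u : grassmannU F p q =>
      (u : Matrix (Fin p ⊕ Fin q) (Fin p ⊕ Fin q) F) :=
    continuous_subtype_val.comp continuous_subtype_val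
  have h : IsClosed (grassmannK F p q : Set (grassmannU F p q)) :=
    (isClosed_singleton (x := (0 : Matrix (Fin p) (Fin q) F))).preimage
      (continuous_matrix fun i j => hc.matrix_elem (Sum.inl i) (Sum.inr j)) |>.inter
    ((isClosed_singleton (x := (0 : Matrix (Fin q) (Fin p) F))).preimage
      (continuous_matrix fun i j => hc.matrix_elem (Sum.inr i) (Sum.inl j)))
  exact h.isClosedEmbedding_subtypeVal.locallyCompactSpace

/-- The double coset space `U // K`. -/
abbrev GrassmannCosets (p q : ℕ) :=
  DoubleCoset.Quotient (grassmannK F p q : Set (grassmannU F p q))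
    (grassmannK F p q : Set (grassmannU F p q))

instance (p q : ℕ) : TopologicalSpace (GrassmannCosets F p q) :=
  inferInstanceAs (TopologicalSpace (Quotient (DoubleCoset.setoid
    (grassmannK F p q : Set (grassmannU F p q)) (grassmannK F p q : Set (grassmannU F p q)))))

variable {F} in
/-- The double coset `K g K`. -/
abbrev coset {p q : ℕ} (g : grassmannU F p q) : GrassmannCosets F p q :=
  DoubleCoset.mk (grassmannK F p q) (grassmannK F p q) g

/-- The double coset convolution `δ_{KgK} * δ_{KhK} = ∫_K δ_{KgkhK} dk` as a functional. -/
def cosetConv {p q : ℕ} (g h : grassmannU F p q) (f : GrassmannCosets F p q → ℝ) : ℝ :=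
  ∫ k : grassmannK F p q, f (coset (g * k * h)) ∂normalizedHaar (grassmannK F p q)

instance (p q : ℕ) : LocallyCompactSpace (Subgroup.connectedComponentOfOne (grassmannK F p q)) :=
  (isClosed_connectedComponent (x := (1 : grassmannK F p q))
    ).isClosedEmbedding_subtypeVal.locallyCompactSpace

/-- The same average over the identity component of `K`; over the real numbers this component is
`SO(p) × SO(q)`, over the complex numbers and the quaternions it is all of `K`. -/
def cosetConvComponent {p q : ℕ} (g h : grassmannU F p q) (f : GrassmannCosets F p q → ℝ) : ℝ :=
  ∫ k : Subgroup.connectedComponentOfOne (grassmannK F p q),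
    f (coset (g * (k : grassmannK F p q) * h))
    ∂normalizedHaar (Subgroup.connectedComponentOfOne (grassmannK F p q))

/-- The matrix `b_x`: the rotation by the angle `xⱼ` in the plane spanned by the `j`-th and the
`(p + j)`-th basis vector, for `j = 1, …, q`. -/
def rotationMatrix (p q : ℕ) (x : Fin q → ℝ) : Matrix (Fin p ⊕ Fin q) (Fin p ⊕ Fin q) F :=
  Matrix.fromBlocks
    (Matrix.diagonal fun i => algebraMap ℝ F (if h : (i : ℕ) < q then Real.cos (x ⟨i, h⟩) else 1))
    (Matrix.of fun i j => algebraMap ℝ F (if (i : ℕ) = j then -Real.sin (x j) else 0))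
    (Matrix.of fun i j => algebraMap ℝ F (if (i : ℕ) = j then Real.sin (x i) else 0))
    (cosDiag F x)

end

noncomputable section

set_option linter.unusedSectionVars false
set_option linter.unusedSimpArgs false

/-! For `μ = pd/2` the product formula is the double coset convolution of a Grassmannian. By the
Cartan decomposition every `u ∈ U` has the form `k b_x l` with `k, l ∈ K`, where the cosines of `x`
are the singular values of the lower right block of `u`. The lower right block of `b_x k b_y` is
`-sin x w sin y + cos x v cos y`, where `v` is the lower block of `k` and `w` is the `q × q` corner
of its upper block. For Haar distributed `k` this corner has a density proportional to `Δ(1 - w*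
w)^(μ-γ)`, so averaging over `K` gives the integral formula. Associativity is inherited from `U`.
Commutativity holds because inversion in `U` does not change the singular values of the block. All
other `μ` are reached by a moment argument. On a Borel set, both sides of the associative or
commutative law for positive measures are, up to a power of `κ_μ`, integrals of `t^s` with `s = μ -
γ`, where `t` is a product of determinants `Δ(1 - w* w)` with values in `(0, 1]`. The Grassmannians
give equality for the exponents `d/2 - 1 + n d/2`, `n = 0, 1, 2, …`. These integrals are the moments
of the image of `t^(d/2-1) dM` under `t ↦ t^(d/2)`, a finite measure on `[0, 1]`. By Weierstrass the
moments determine this measure, hence the integrals of `t^s` for every complex `s`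
(`integral_cpow_eq`). The analysis on the matrix ball peels off one row at a time. With `h = (1 - y*
y)^(1/2)`, the matrix with first row `y` and remaining rows `w h` satisfies `1 - (y; w h)* (y; w h)
= h (1 - w* w) h`. Hence integrals of powers of the determinant become products of radial beta
integrals, which yields integrability and `κ_μ ≠ 0` (`integral_gramDet_cpow_ne_zero`). The same
recursion gives the law of a corner of a Haar unitary matrix (`exists_lintegral_unitary_submatrix`).
The linear algebra is uniform in the scalars. Maximizing a weighted sum of squared column lengths
over a compact set stable under plane rotations produces orthogonal, sorted columns
(`exists_orthogonal_columns`). This replaces the spectral theorem over the quaternions, and applied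
to cosets of identity components it shows that `U(q)` and `K` are generated by their identity
components and diagonal matrices. For real `μ` the density is positive, so the support of `δ_x *
δ_y` is the image of the compact set `U₀ × {w* w ≤ 1}` under a continuous map. This gives the
Michael continuity. That `0` lies in the support only for `x = y` follows from an identity
expressing `1` as a sum of squares (`eq_of_productAngles_eq_zero`). -/

/-- The algebraic properties shared by the real numbers, the complex numbers and the quaternions. -/
class IsScalar (F : Type) [NormedRing F] [StarRing F] [NormedAlgebra ℝ F] : Prop where
  nontrivial : Nontrivial F
  star_mul_self' : ∀ a : F, star a * a = algebraMap ℝ F (‖a‖ ^ 2)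
  star_algebraMap' : ∀ r : ℝ, star (algebraMap ℝ F r) = algebraMap ℝ F r

/-! ### Scalars with a multiplicative norm, and unitary matrices over them. -/

namespace Grassmann

section Basic

variable {F : Type} [NormedRing F] [StarRing F] [NormedStarGroup F] [NormedAlgebra ℝ F]
  [IsScalar F]

instance : Nontrivial F := IsScalar.nontrivial

theorem star_mul_self_eq (a : F) : star a * a = algebraMap ℝ F (‖a‖ ^ 2) :=
  IsScalar.star_mul_self' a

theorem star_algebraMap_eq (r : ℝ) : star (algebraMap ℝ F r) = algebraMap ℝ F r :=
  IsScalar.star_algebraMap' r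

theorem mul_star_self_eq (a : F) : a * star a = algebraMap ℝ F (‖a‖ ^ 2) := by
  have := star_mul_self_eq (star a)
  rwa [star_star, _root_.norm_star] at this

theorem algebraMap_inj {r s : ℝ} : algebraMap ℝ F r = algebraMap ℝ F s ↔ r = s :=
  (algebraMap ℝ F).injective.eq_iff

/-- Real scalars are central, so `(ab)* ab = b* (a* a) b = |a|² |b|²`. A normed ring only supplies
the inequality. -/
instance : NormMulClass F where
  norm_mul a b := by
    have h : algebraMap ℝ F (‖a * b‖ ^ 2) = algebraMap ℝ F ((‖a‖ * ‖b‖) ^ 2) := by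
      rw [← star_mul_self_eq, star_mul, mul_assoc, ← mul_assoc (star a), star_mul_self_eq,
        Algebra.commutes (‖a‖ ^ 2) b, ← mul_assoc, star_mul_self_eq, ← map_mul]
      congr 1; ring
    exact (pow_left_inj₀ (norm_nonneg _) (by positivity) two_ne_zero).1 (algebraMap_inj.1 h)

instance : NormOneClass F where
  norm_one := by
    have h : ‖(1 : F)‖ * ‖(1 : F)‖ = ‖(1 : F)‖ := by rw [← norm_mul, one_mul]
    have h0 : ‖(1 : F)‖ ≠ 0 := norm_ne_zero_iff.2 one_ne_zero
    exact mul_left_cancel₀ h0 (by rw [h, mul_one])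

theorem norm_algebraMap_eq (r : ℝ) : ‖algebraMap ℝ F r‖ = |r| := by
  rw [norm_algebraMap', Real.norm_eq_abs]

instance : NoZeroDivisors F where
  eq_zero_or_eq_zero_of_mul_eq_zero {a b} h := by
    have : ‖a‖ * ‖b‖ = 0 := by rw [← norm_mul, h, norm_zero]
    simpa using this

/-- The squared Euclidean norm of a vector. -/
def normSq {n : Type*} [Fintype n] (a : n → F) : ℝ := ∑ i, ‖a i‖ ^ 2

theorem normSq_nonneg {n : Type*} [Fintype n] (a : n → F) : 0 ≤ normSq a :=
  Finset.sum_nonneg fun _ _ => by positivity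

theorem normSq_eq_zero {n : Type*} [Fintype n] {a : n → F} : normSq a = 0 ↔ a = 0 := by
  rw [normSq, Finset.sum_eq_zero_iff_of_nonneg fun _ _ => by positivity, funext_iff]
  simp

theorem star_dotProduct_self {n : Type*} [Fintype n] (a : n → F) :
    star a ⬝ᵥ a = algebraMap ℝ F (normSq a) := by
  simp [dotProduct, star_mul_self_eq, normSq, map_sum]

theorem dotProduct_star_self {n : Type*} [Fintype n] (a : n → F) :
    a ⬝ᵥ star a = algebraMap ℝ F (normSq a) := by
  simp [dotProduct, mul_star_self_eq, normSq, map_sum]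

theorem conjTranspose_mul_self_diag {m n : Type*} [Fintype m] (A : Matrix m n F) (j : n) :
    (Aᴴ * A) j j = algebraMap ℝ F (normSq fun i => A i j) := by
  rw [← star_dotProduct_self]; rfl

theorem mul_conjTranspose_self_diag {m n : Type*} [Fintype n] (A : Matrix m n F) (i : m) :
    (A * Aᴴ) i i = algebraMap ℝ F (normSq (A i)) := by
  rw [← dotProduct_star_self]; rfl

/-- The length of `A a` is the value at `a` of the form `A* A`, so only the Gram matrix matters. The
two matrices may have different numbers of rows. -/
theorem normSq_mulVec_of_conjTranspose_mul_eq {m m' n : Type*} [Fintype m] [Fintype m'] [Fintype n]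
    {A : Matrix m n F} {B : Matrix m' n F} (h : Aᴴ * A = Bᴴ * B) (a : n → F) :
    normSq (A *ᵥ a) = normSq (B *ᵥ a) := by
  apply algebraMap_inj (F := F).1
  rw [← star_dotProduct_self, ← star_dotProduct_self, star_mulVec, star_mulVec,
    ← dotProduct_mulVec, ← dotProduct_mulVec, mulVec_mulVec, mulVec_mulVec, h]

variable [ProperSpace F]

instance : FiniteDimensional ℝ F := FiniteDimensional.of_locallyCompactSpace ℝ

/-- Properness gives finite dimension over the reals, hence Noetherian scalars, and one-sided
inverses of square matrices are then two-sided. This serves in place of a determinant criterion over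
the quaternions. -/
theorem isStablyFiniteRing_of_proper : IsStablyFiniteRing F := by
  have : IsNoetherianRing F := isNoetherian_of_tower ℝ inferInstance
  infer_instance

theorem mem_unitary_of_conjTranspose_mul {n : Type*} [Fintype n] [DecidableEq n] {u : Matrix n n F}
    (h : uᴴ * u = 1) : u ∈ unitary (Matrix n n F) := by
  have := isStablyFiniteRing_of_proper (F := F)
  exact ⟨h, mul_eq_one_comm.1 h⟩

theorem normSq_unitary_col {n : Type*} [Fintype n] [DecidableEq n] {u : Matrix n n F}
    (hu : u ∈ unitary (Matrix n n F)) (j : n) : normSq (fun i => u i j) = 1 := by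
  apply algebraMap_inj (F := F).1
  rw [← conjTranspose_mul_self_diag, map_one]
  have := hu.1
  rw [star_eq_conjTranspose] at this
  simp [this]

theorem normSq_unitary_row {n : Type*} [Fintype n] [DecidableEq n] {u : Matrix n n F}
    (hu : u ∈ unitary (Matrix n n F)) (i : n) : normSq (u i) = 1 := by
  apply algebraMap_inj (F := F).1
  rw [← mul_conjTranspose_self_diag, map_one]
  have := hu.2
  rw [star_eq_conjTranspose] at this
  simp [this]

theorem normSq_unitary_mulVec {n : Type*} [Fintype n] [DecidableEq n] {u : Matrix n n F}
    (hu : u ∈ unitary (Matrix n n F)) (a : n → F) : normSq (u *ᵥ a) = normSq a := by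
  have := normSq_mulVec_of_conjTranspose_mul_eq (A := u) (B := (1 : Matrix n n F))
    (by have := hu.1; rw [star_eq_conjTranspose] at this; simp [this]) a
  rwa [one_mulVec] at this

theorem normSq_vecMul_unitary {n : Type*} [Fintype n] [DecidableEq n] {u : Matrix n n F}
    (hu : u ∈ unitary (Matrix n n F)) (a : n → F) : normSq (a ᵥ* u) = normSq a := by
  apply algebraMap_inj (F := F).1
  have h2 := hu.2
  rw [star_eq_conjTranspose] at h2
  rw [← dotProduct_star_self, ← dotProduct_star_self, star_vecMul, dotProduct_mulVec,
    vecMul_vecMul, h2, vecMul_one]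

theorem isCompact_unitary (n : Type*) [Fintype n] [DecidableEq n] :
    IsCompact (unitary (Matrix n n F) : Set (Matrix n n F)) := by
  have h1 : IsCompact (Set.univ.pi fun _ : n => Set.univ.pi fun _ : n =>
      Metric.closedBall (0 : F) 1) :=
    isCompact_univ_pi fun _ => isCompact_univ_pi fun _ => isCompact_closedBall _ _
  refine IsCompact.of_isClosed_subset h1 (isClosed_unitary (R := Matrix n n F)) ?_
  intro u hu i _ j _
  have h := normSq_unitary_col hu j
  have h2 : ‖u i j‖ ^ 2 ≤ 1 := by
    rw [← h]
    exact Finset.single_le_sum (f := fun i => ‖u i j‖ ^ 2) (fun _ _ => by positivity)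
      (Finset.mem_univ i)
  simpa using (sq_le_one_iff₀ (norm_nonneg _)).1 h2

instance (n : Type) [Fintype n] [DecidableEq n] : CompactSpace (unitaryMatrices F n) :=
  isCompact_iff_compactSpace.1 (isCompact_unitary n)

end Basic

/-! ### Plane rotations and orthogonalization of columns by maximization. -/

section Rotation

variable {F : Type} [NormedRing F] [StarRing F] [NormedStarGroup F] [NormedAlgebra ℝ F]
  [IsScalar F] {n : Type*} [Fintype n] [DecidableEq n]

/-- The rotation in the plane of the coordinates `i` and `j`, twisted by the unit `ε`. -/
def rotation (i j : n) (ε : F) (c s : ℝ) : Matrix n n F :=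
  1 + (c - 1) • (single i i 1 + single j j 1) + s • (single j i ε - single i j (star ε))

@[simp] theorem rotation_one_zero (i j : n) (ε : F) : rotation i j ε 1 0 = 1 := by
  simp [rotation]

instance : StarModule ℝ F where
  star_smul r a := by
    rw [Algebra.smul_def, Algebra.smul_def, star_mul, star_algebraMap_eq, Algebra.commutes]
    simp

theorem rotation_conjTranspose (i j : n) (ε : F) (c s : ℝ) :
    (rotation i j ε c s)ᴴ = rotation i j ε c (-s) := by
  simp only [rotation, conjTranspose_add, conjTranspose_sub, conjTranspose_smul, conjTranspose_one,
    conjTranspose_single, star_one, star_star, star_trivial]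
  rw [neg_smul, ← smul_neg, neg_sub]

theorem rotation_mul {i j : n} (hij : i ≠ j) {ε : F} (hε : ‖ε‖ = 1) (c s c' s' : ℝ) :
    rotation i j ε c s * rotation i j ε c' s' =
      rotation i j ε (c * c' - s * s') (c * s' + s * c') := by
  have h1 : ε * star ε = 1 := by rw [mul_star_self_eq, hε]; simp
  have h2 : star ε * ε = 1 := by rw [star_mul_self_eq, hε]; simp
  simp only [rotation]
  -- `P` projects onto the plane and `J` is a complex structure on it: `J² = -P`, `PJ = JP = J`.
  -- Hence `1 - P + cP + sJ` multiplies like the complex number `c + si`.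
  generalize hP : (single i i 1 + single j j 1 : Matrix n n F) = P
  generalize hJ : single j i ε - single i j (star ε) = J
  have hPP : P * P = P := by
    subst hP; simp [mul_add, add_mul, hij, hij.symm]
  have hPJ : P * J = J := by
    subst hP hJ; simp [mul_sub, add_mul, hij, hij.symm]
  have hJP : J * P = J := by
    subst hP hJ; simp [mul_add, sub_mul, hij, hij.symm]; abel
  have hJJ : J * J = -P := by
    subst hP hJ; simp [mul_sub, sub_mul, hij, hij.symm, h1, h2]; abel
  simp only [mul_add, add_mul, smul_mul_assoc, mul_smul_comm, one_mul, mul_one, hPP, hPJ, hJP, hJJ]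
  module

theorem rotation_mem_unitary {i j : n} (hij : i ≠ j) {ε : F} (hε : ‖ε‖ = 1) {c s : ℝ}
    (hcs : c ^ 2 + s ^ 2 = 1) : rotation i j ε c s ∈ unitary (Matrix n n F) := by
  constructor <;> rw [star_eq_conjTranspose, rotation_conjTranspose, rotation_mul hij hε,
    ← rotation_one_zero i j ε] <;> congr 1 <;> linarith

theorem mul_rotation_apply_left {m : Type*} {i j : n} (hij : i ≠ j) (ε : F) (c s : ℝ)
    (A : Matrix m n F) (k : m) :
    (A * rotation i j ε c s) k i = c • A k i + s • (A k j * ε) := by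
  simp only [rotation, mul_add, mul_sub, mul_one, Matrix.mul_smul, Matrix.add_apply, Matrix.sub_apply, Matrix.smul_apply,
    Matrix.mul_add, Matrix.mul_sub, Matrix.mul_one, mul_single_apply_same, mul_single_apply_of_ne _ _ _ _ _ hij]
  module

theorem mul_rotation_apply_of_ne {m : Type*} {i j l : n} (hi : l ≠ i) (hj : l ≠ j) (ε : F)
    (c s : ℝ) (A : Matrix m n F) (k : m) :
    (A * rotation i j ε c s) k l = A k l := by
  simp [rotation, Matrix.mul_add, Matrix.mul_sub, smul_add, -smul_single, mul_single_apply_of_ne _ _ _ _ _ hi,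
    mul_single_apply_of_ne _ _ _ _ _ hj]

theorem continuous_rotation (i j : n) (ε : F) :
    Continuous fun z : ℝ × ℝ => rotation i j ε z.1 z.2 := by
  unfold rotation; fun_prop

/-- The phase `ε` is used to make the inner product of the two columns real, so that the cross term
is an honest `2cst`. -/
theorem normSq_add_of_real_inner {m : Type*} [Fintype m] (a b : m → F) (ε : F) (hε : ‖ε‖ = 1)
    (c s t : ℝ) (h : (star a ⬝ᵥ b) * ε = algebraMap ℝ F t) :
    normSq (fun k => c • a k + s • (b k * ε)) = c ^ 2 * normSq a + s ^ 2 * normSq b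
      + 2 * c * s * t := by
  apply algebraMap_inj (F := F).1
  have hb : star (fun k => b k * ε) ⬝ᵥ (fun k => b k * ε) = algebraMap ℝ F (normSq b) := by
    rw [star_dotProduct_self]; simp [normSq, hε]
  have h1 : star a ⬝ᵥ (fun k => b k * ε) = algebraMap ℝ F t := by
    rw [← h, dotProduct, dotProduct, Finset.sum_mul]; simp [mul_assoc]
  have h2 : star (fun k => b k * ε) ⬝ᵥ a = algebraMap ℝ F t := by
    rw [← star_algebraMap_eq, ← h1, star_dotProduct]
  have e : (fun k => c • a k + s • (b k * ε)) = c • a + s • (fun k => b k * ε) := rfl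
  rw [← star_dotProduct_self, e]
  simp only [star_add, StarModule.star_smul, star_trivial, add_dotProduct, dotProduct_add, smul_dotProduct,
    dotProduct_smul, hb, h1, h2, star_dotProduct_self]
  simp only [Algebra.algebraMap_eq_smul_one]
  module

/-- A compact set of unitary matrices that is stable under rotations in the coordinate planes of a
relation contains an element which makes the corresponding columns of `X * v` orthogonal and sorted
by length. -/
theorem exists_orthogonal_columns {m : Type*} [Fintype m] (X : Matrix m n F)
    {S : Set (Matrix n n F)} (hS : IsCompact S) (hne : S.Nonempty) {c : n → ℝ}
    (hc : Function.Injective c) {r : n → n → Prop} (hsymm : ∀ i j, r i j → r j i)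
    (hr : ∀ v ∈ S, ∀ i j, r i j → i ≠ j → ∀ (ε : F) (a b : ℝ), ‖ε‖ = 1 → a ^ 2 + b ^ 2 = 1 →
      v * rotation i j ε a b ∈ S) :
    ∃ v ∈ S, (∀ i j, r i j → i ≠ j → ((X * v)ᴴ * (X * v)) i j = 0) ∧
      ∀ i j, r i j → c j < c i →
        normSq (fun k => (X * v) k j) ≤ normSq (fun k => (X * v) k i) := by
  -- The functional to be maximized: squared column lengths, weighted with the distinct numbers `c`.
  have hcont : Continuous fun v : Matrix n n F => ∑ l, c l * normSq fun k => (X * v) k l := by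
    unfold normSq
    have : ∀ k l, Continuous fun v : Matrix n n F => (X * v) k l := fun k l =>
      (continuous_const.matrix_mul continuous_id).matrix_elem k l
    fun_prop
  obtain ⟨v, hv, hmax⟩ := hS.exists_isMaxOn hne hcont.continuousOn
  -- A rotation of the columns `i` and `j` keeps the total squared length and all other columns. At
  -- a maximum it therefore cannot lengthen the column of larger weight.
  have key (i j : n) (hrij : r i j) (hij : i ≠ j) (hcij : c j < c i) (ε : F) (a b : ℝ)
      (hε : ‖ε‖ = 1) (hab : a ^ 2 + b ^ 2 = 1) :
      normSq (fun k => a • (X * v) k i + b • ((X * v) k j * ε)) ≤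
        normSq (fun k => (X * v) k i) := by
    set R : Matrix n n F := rotation i j ε a b
    have hmem := hr v hv i j hrij hij ε a b hε hab
    have h1 := hmax hmem
    simp only [Set.mem_ofPred_eq] at h1
    have hR := rotation_mem_unitary hij hε hab
    set N : n → ℝ := fun l => normSq fun k => (X * v) k l
    set N' : n → ℝ := fun l => normSq fun k => (X * (v * R)) k l
    have htot : ∑ l, N' l = ∑ l, N l := by
      simp only [N, N', normSq]
      rw [Finset.sum_comm, Finset.sum_comm (f := fun l k => ‖(X * v) k l‖ ^ 2)]
      refine Finset.sum_congr rfl fun k _ => ?_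
      have h3 := hR.2
      rw [star_eq_conjTranspose] at h3
      have h4 : algebraMap ℝ F (normSq ((X * (v * R)) k)) =
          algebraMap ℝ F (normSq ((X * v) k)) := by
        rw [← mul_conjTranspose_self_diag, ← mul_conjTranspose_self_diag, ← Matrix.mul_assoc,
          conjTranspose_mul, Matrix.mul_assoc (X * v), ← Matrix.mul_assoc R, h3, Matrix.one_mul]
      exact algebraMap_inj.1 h4
    have hNl (l : n) (hi : l ≠ i) (hj : l ≠ j) : N' l = N l := by
      simp only [N, N']
      congr 1; ext k
      rw [← Matrix.mul_assoc, mul_rotation_apply_of_ne hi hj]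
    have hNi : N' i = normSq (fun k => a • (X * v) k i + b • ((X * v) k j * ε)) := by
      simp only [N']
      congr 1; ext k
      rw [← Matrix.mul_assoc, mul_rotation_apply_left hij]
    have hsplit (g : n → ℝ) : ∑ l, g l = g i + g j + ∑ l ∈ (Finset.univ.erase i).erase j, g l := by
      rw [← Finset.add_sum_erase _ g (Finset.mem_univ i),
        ← Finset.add_sum_erase (Finset.univ.erase i) g (Finset.mem_erase.2 ⟨hij.symm, Finset.mem_univ j⟩), add_assoc]
    have hrest (g : n → ℝ) : ∑ l ∈ (Finset.univ.erase i).erase j, g l * N' l =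
        ∑ l ∈ (Finset.univ.erase i).erase j, g l * N l := by
      refine Finset.sum_congr rfl fun l hl => ?_
      simp only [Finset.mem_erase] at hl
      rw [hNl l hl.2.1 hl.1]
    have e1 := hrest (fun _ => 1)
    simp only [one_mul] at e1
    rw [hsplit N', hsplit N, e1] at htot
    change ∑ l, c l * N' l ≤ ∑ l, c l * N l at h1
    rw [hsplit fun l => c l * N' l, hsplit fun l => c l * N l, hrest] at h1
    rw [← hNi]
    change N' i ≤ N i
    have h5 : N' j = N i + N j - N' i := by linarith
    rw [h5] at h1
    have : (c i - c j) * (N' i - N i) ≤ 0 := by linarith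
    nlinarith
  have hself (i j : n) : star (fun k => (X * v) k i) ⬝ᵥ (fun k => (X * v) k j) =
    ((X * v)ᴴ * (X * v)) i j := rfl
  have horth (i j : n) (hrij : r i j) (hij : i ≠ j) (hcij : c j < c i) :
      ((X * v)ᴴ * (X * v)) i j = 0 := by
    by_contra hz
    set z := ((X * v)ᴴ * (X * v)) i j
    have hz' : 0 < ‖z‖ := norm_pos_iff.2 hz
    set ε : F := ‖z‖⁻¹ • star z
    have hε : ‖ε‖ = 1 := by
      simp only [ε, norm_smul, _root_.norm_star, norm_inv, norm_norm]
      exact inv_mul_cancel₀ hz'.ne'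
    have hzε : z * ε = algebraMap ℝ F ‖z‖ := by
      simp only [ε, mul_smul_comm, mul_star_self_eq]
      rw [Algebra.smul_def, ← map_mul]
      congr 1; field_simp
    set K := normSq (fun k => (X * v) k i) - normSq (fun k => (X * v) k j)
    -- This is the maximality inequality for the rotation with tangent `t`, multiplied by `1 + t²`
    -- and divided by `t`. For `t = 1` it forces `K > 0`, and then `t = ‖z‖ / K` gives `2‖z‖ ≤ ‖z‖`.
    have hK (t : ℝ) (ht : 0 < t) : 2 * ‖z‖ ≤ t * K := by
      have hp : 0 < 1 + t ^ 2 := by positivity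
      have h := key i j hrij hij hcij ε (1 / √(1 + t ^ 2)) (t / √(1 + t ^ 2)) hε (by
        rw [div_pow, div_pow, Real.sq_sqrt hp.le]; field_simp)
      rw [normSq_add_of_real_inner (F := F) _ _ ε hε _ _ ‖z‖ (by rw [hself, hzε]), div_pow, div_pow,
        Real.sq_sqrt hp.le] at h
      have h5 : 2 * (1 / √(1 + t ^ 2)) * (t / √(1 + t ^ 2)) * ‖z‖ = 2 * t * ‖z‖ / (1 + t ^ 2) := by
        nth_rewrite 3 [← Real.sq_sqrt hp.le]
        field_simp
      rw [h5] at h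
      have h6 := mul_le_mul_of_nonneg_right h hp.le
      field_simp at h6
      have : t * (2 * ‖z‖) ≤ t * (t * K) := by simp only [K]; nlinarith
      exact le_of_mul_le_mul_left this ht
    have hKpos : 0 < K := by have := hK 1 one_pos; linarith
    have := hK (‖z‖ / K) (by positivity)
    rw [div_mul_cancel₀ _ hKpos.ne'] at this
    linarith
  refine ⟨v, hv, fun i j hrij hij => ?_, fun i j hrij hcij => ?_⟩
  · rcases lt_or_gt_of_ne (hc.ne hij) with h | h
    · have := horth j i (hsymm _ _ hrij) hij.symm h
      have h2 : ((X * v)ᴴ * (X * v)) i j = star (((X * v)ᴴ * (X * v)) j i) := by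
        rw [← conjTranspose_apply, conjTranspose_mul (X * v)ᴴ, conjTranspose_conjTranspose]
      rw [h2, this, star_zero]
    · exact horth i j hrij hij h
  · have hij : i ≠ j := fun h => by simp [h] at hcij
    -- The quarter turn puts column `j` in the place of column `i`, which yields the ordering by
    -- length.
    have := key i j hrij hij hcij 1 0 1 norm_one (by norm_num)
    simpa using this

end Rotation
end Grassmann

/-! ### Singular value decomposition and continuity of the singular values. -/

namespace Grassmann

section Spectral

variable {F : Type} [NormedRing F] [StarRing F] [NormedStarGroup F] [NormedAlgebra ℝ F]
  [IsScalar F]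

/-- The diagonal matrix with given real entries. -/
def realDiag (F : Type) [NormedRing F] [NormedAlgebra ℝ F] {n : Type*} [DecidableEq n]
    (σ : n → ℝ) : Matrix n n F :=
  diagonal fun i => algebraMap ℝ F (σ i)

section realDiag

variable {n : Type*} [DecidableEq n]

@[simp] theorem realDiag_conjTranspose (σ : n → ℝ) : (realDiag F σ)ᴴ = realDiag F σ := by
  simp [realDiag, diagonal_conjTranspose, Pi.star_def, star_algebraMap_eq]

theorem realDiag_mul [Fintype n] (σ τ : n → ℝ) :
    realDiag F σ * realDiag F τ = realDiag F fun i => σ i * τ i := by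
  simp [realDiag]

@[simp] theorem realDiag_one : realDiag F (fun _ : n => 1) = 1 := by
  simp [realDiag]

@[simp] theorem realDiag_zero : realDiag F (fun _ : n => 0) = 0 := by
  simp [realDiag]

theorem realDiag_add (σ τ : n → ℝ) :
    realDiag F σ + realDiag F τ = realDiag F fun i => σ i + τ i := by
  simp [realDiag]

theorem mul_realDiag_apply [Fintype n] {m : Type*} (A : Matrix m n F) (σ : n → ℝ) (i : m) (j : n) :
    (A * realDiag F σ) i j = σ j • A i j := by
  rw [realDiag, mul_diagonal, ← Algebra.commutes, Algebra.smul_def]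

theorem realDiag_mul_apply [Fintype n] {m : Type*} (A : Matrix n m F) (σ : n → ℝ) (i : n) (j : m) :
    (realDiag F σ * A) i j = σ i • A i j := by
  rw [realDiag, diagonal_mul, Algebra.smul_def]

theorem continuous_realDiag : Continuous (realDiag F : (n → ℝ) → Matrix n n F) := by
  unfold realDiag
  refine Continuous.matrix_diagonal (continuous_pi fun i => ?_)
  exact (continuous_algebraMap ℝ F).comp (continuous_apply i)

end realDiag

/-- Gram matrices can be diagonalized. -/
theorem exists_gram_eq_realDiag [ProperSpace F] {m : Type*} [Fintype m] {q : ℕ}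
    (X : Matrix m (Fin q) F) :
    ∃ v ∈ unitary (Matrix (Fin q) (Fin q) F), ∃ σ : Fin q → ℝ, Antitone σ ∧ (∀ i, 0 ≤ σ i) ∧
      (X * v)ᴴ * (X * v) = realDiag F fun i => σ i ^ 2 := by
  -- The weights `-i` decrease with the index, so the longest column comes first.
  obtain ⟨v, hv, h1, h2⟩ := exists_orthogonal_columns X (isCompact_unitary (F := F) (Fin q))
    ⟨1, one_mem _⟩ (c := fun i : Fin q => -(i : ℝ))
    (fun i j h => by simpa [Fin.val_inj] using h) (r := fun _ _ => True) (fun _ _ _ => trivial)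
    (fun v hv i j _ hij ε a b hε hab => mul_mem hv (rotation_mem_unitary hij hε hab))
  refine ⟨v, hv, fun i => √(normSq fun k => (X * v) k i), fun i j hij => ?_,
    fun i => Real.sqrt_nonneg _, ?_⟩
  · rcases hij.eq_or_lt with rfl | h
    · exact le_rfl
    · exact Real.sqrt_le_sqrt (h2 i j trivial (by simpa using h))
  · ext i j
    by_cases hij : i = j
    · subst hij
      rw [conjTranspose_mul_self_diag]
      simp [realDiag, Real.sq_sqrt (normSq_nonneg _)]
    · rw [h1 i j trivial hij]
      simp [realDiag, hij]

/-- Comparing entries in `(Y Y*) Y = Y (Y* Y)` gives `τ i = σ j` wherever `Y i j ≠ 0`. The number of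
`j` with `σ j ≥ t` is the sum of `|Y i j|² / σ j²` over these `j` and all `i`, and similarly for
rows, so double counting gives equality. No characteristic polynomial is involved, which keeps the
argument valid over the quaternions. -/
theorem card_filter_le_eq {m n : Type*} [Fintype m] [Fintype n] [DecidableEq m] [DecidableEq n]
    {Y : Matrix m n F} {σ : n → ℝ} {τ : m → ℝ} (hσ : ∀ j, 0 ≤ σ j) (hτ : ∀ i, 0 ≤ τ i)
    (h1 : Yᴴ * Y = realDiag F fun j => σ j ^ 2) (h2 : Y * Yᴴ = realDiag F fun i => τ i ^ 2)
    {t : ℝ} (ht : 0 < t) :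
    (Finset.univ.filter fun j => t ≤ σ j).card = (Finset.univ.filter fun i => t ≤ τ i).card := by
  have hcol (j : n) : ∑ i, ‖Y i j‖ ^ 2 = σ j ^ 2 := by
    apply algebraMap_inj (F := F).1
    have := conjTranspose_mul_self_diag Y j
    rw [h1] at this
    simpa [realDiag, normSq] using this.symm
  have hrow (i : m) : ∑ j, ‖Y i j‖ ^ 2 = τ i ^ 2 := by
    apply algebraMap_inj (F := F).1
    have := mul_conjTranspose_self_diag Y i
    rw [h2] at this
    simpa [realDiag, normSq] using this.symm
  have heq (i : m) (j : n) (hY : Y i j ≠ 0) : τ i = σ j := by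
    have h3 : Y * (Yᴴ * Y) = (Y * Yᴴ) * Y := (Matrix.mul_assoc _ _ _).symm
    rw [h1, h2] at h3
    have h4 := congrFun (congrFun h3 i) j
    rw [mul_realDiag_apply, realDiag_mul_apply] at h4
    have h5 : σ j ^ 2 = τ i ^ 2 := smul_left_injective ℝ hY h4
    exact ((pow_left_inj₀ (hσ j) (hτ i) two_ne_zero).1 h5).symm
  have e1 : ((Finset.univ.filter fun j => t ≤ σ j).card : ℝ) =
      ∑ j, ∑ i, if t ≤ σ j then ‖Y i j‖ ^ 2 / σ j ^ 2 else 0 := by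
    rw [Finset.card_filter, Nat.cast_sum]
    refine Finset.sum_congr rfl fun j _ => ?_
    split_ifs with h
    · have : σ j ^ 2 ≠ 0 := by have := ht.trans_le h; positivity
      rw [← Finset.sum_div, hcol, div_self this]; simp
    · simp
  have e2 : ((Finset.univ.filter fun i => t ≤ τ i).card : ℝ) =
      ∑ i, ∑ j, if t ≤ τ i then ‖Y i j‖ ^ 2 / τ i ^ 2 else 0 := by
    rw [Finset.card_filter, Nat.cast_sum]
    refine Finset.sum_congr rfl fun i _ => ?_
    split_ifs with h
    · have : τ i ^ 2 ≠ 0 := by have := ht.trans_le h; positivity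
      rw [← Finset.sum_div, hrow, div_self this]; simp
    · simp
  have : ((Finset.univ.filter fun j => t ≤ σ j).card : ℝ) =
      (Finset.univ.filter fun i => t ≤ τ i).card := by
    rw [e1, e2, Finset.sum_comm]
    refine Finset.sum_congr rfl fun i _ => Finset.sum_congr rfl fun j _ => ?_
    by_cases hY : Y i j = 0
    · simp [hY]
    · rw [heq i j hY]
  exact_mod_cast this

theorem antitone_ext_of_card {q : ℕ} {σ τ : Fin q → ℝ} (hσ : Antitone σ) (hτ : Antitone τ)
    (hσ0 : ∀ i, 0 ≤ σ i) (hτ0 : ∀ i, 0 ≤ τ i)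
    (h : ∀ t, 0 < t → (Finset.univ.filter fun j => t ≤ σ j).card =
      (Finset.univ.filter fun i => t ≤ τ i).card) : σ = τ := by
  have key (σ τ : Fin q → ℝ) (hσ : Antitone σ) (hτ : Antitone τ) (hσ0 : ∀ i, 0 ≤ σ i)
      (h : ∀ t, 0 < t → (Finset.univ.filter fun j => t ≤ σ j).card =
      (Finset.univ.filter fun i => t ≤ τ i).card) (i : Fin q) : τ i ≤ σ i := by
    by_contra! hlt
    have ht := (hσ0 i).trans_lt hlt
    have h1 : Finset.Iic i ⊆ Finset.univ.filter fun j => τ i ≤ τ j := by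
      intro j hj
      simpa using hτ (Finset.mem_Iic.1 hj)
    have h2 : (Finset.univ.filter fun j => τ i ≤ σ j) ⊆ Finset.Iio i := by
      intro j hj
      simp only [Finset.mem_filter, Finset.mem_univ, true_and] at hj
      rw [Finset.mem_Iio]
      by_contra! hij
      linarith [hσ hij]
    have h3 := Finset.card_le_card h1
    have h4 := Finset.card_le_card h2
    rw [h _ ht] at h4
    simp at h3 h4
    omega
  ext i
  exact le_antisymm (key τ σ hτ hσ hτ0 (fun t ht => (h t ht).symm) i) (key σ τ hσ hτ hσ0 h i)

theorem gram_spectrum_unique {q : ℕ} {Y : Matrix (Fin q) (Fin q) F} {σ τ : Fin q → ℝ}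
    (hσ : Antitone σ) (hτ : Antitone τ) (hσ0 : ∀ i, 0 ≤ σ i) (hτ0 : ∀ i, 0 ≤ τ i)
    (h1 : Yᴴ * Y = realDiag F fun j => σ j ^ 2) (h2 : Y * Yᴴ = realDiag F fun i => τ i ^ 2) :
    σ = τ :=
  antitone_ext_of_card hσ hτ hσ0 hτ0 fun _ ht => card_filter_le_eq hσ0 hτ0 h1 h2 ht

variable [ProperSpace F]

theorem conjTranspose_mul_self_of_unitary {n : Type*} [Fintype n] [DecidableEq n]
    {u : Matrix n n F} (hu : u ∈ unitary (Matrix n n F)) : uᴴ * u = 1 := hu.1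

theorem mul_conjTranspose_self_of_unitary {n : Type*} [Fintype n] [DecidableEq n]
    {u : Matrix n n F} (hu : u ∈ unitary (Matrix n n F)) : u * uᴴ = 1 := hu.2

theorem conjTranspose_mem_unitary {n : Type*} [Fintype n] [DecidableEq n]
    {u : Matrix n n F} (hu : u ∈ unitary (Matrix n n F)) : uᴴ ∈ unitary (Matrix n n F) :=
  Unitary.star_mem hu

theorem exists_eq_unitary_mul_realDiag {q : ℕ} {B : Matrix (Fin q) (Fin q) F} {σ : Fin q → ℝ}
    (hσ : Antitone σ) (hσ0 : ∀ i, 0 ≤ σ i) (h : Bᴴ * B = realDiag F fun i => σ i ^ 2) :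
    ∃ u ∈ unitary (Matrix (Fin q) (Fin q) F), B = u * realDiag F σ := by
  -- Diagonalizing `B B*` as well makes both Gram matrices of `Y` equal to the same diagonal matrix,
  -- so the rows and the columns of `Y` vanish at the same indices.
  obtain ⟨u, hu, τ, hτ, hτ0, h2⟩ := exists_gram_eq_realDiag Bᴴ
  have hu2 := mul_conjTranspose_self_of_unitary hu
  set Y := uᴴ * B with hY
  have h3 : Yᴴ * Y = realDiag F fun i => σ i ^ 2 := by
    rw [hY, conjTranspose_mul, conjTranspose_conjTranspose, Matrix.mul_assoc, ← Matrix.mul_assoc u,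
      hu2, Matrix.one_mul, h]
  have h4 : Y * Yᴴ = realDiag F fun i => τ i ^ 2 := by
    rw [← h2, hY]; simp [conjTranspose_mul, Matrix.mul_assoc]
  obtain rfl := gram_spectrum_unique hσ hτ hσ0 hτ0 h3 h4
  -- `S` is the pseudoinverse, with `0⁻¹ = 0`, and `E` projects onto the coordinates where `σ`
  -- vanishes. `Y S` is a partial isometry and `Y S + E` extends it to a unitary matrix.
  set S : Matrix (Fin q) (Fin q) F := realDiag F fun i => (σ i)⁻¹
  set E : Matrix (Fin q) (Fin q) F := realDiag F fun i => if σ i = 0 then 1 else 0 with hE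
  have hEY : E * Y = 0 := by
    ext i j
    rw [realDiag_mul_apply, Matrix.zero_apply]
    split_ifs with hi
    · have h5 := mul_conjTranspose_self_diag Y i
      rw [h4] at h5
      simp only [realDiag, diagonal_apply_eq, hi] at h5
      have h6 := algebraMap_inj.1 h5
      have h7 := normSq_eq_zero.1 (h6.symm.trans (by norm_num))
      rw [one_smul, h7]; rfl
    · simp
  have hYE : Y * E = 0 := by
    ext i j
    rw [mul_realDiag_apply, Matrix.zero_apply]
    split_ifs with hj
    · have h5 := conjTranspose_mul_self_diag Y j
      rw [h3] at h5
      simp only [realDiag, diagonal_apply_eq, hj] at h5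
      have h6 := algebraMap_inj.1 h5
      have h7 := normSq_eq_zero.1 (h6.symm.trans (by norm_num))
      rw [one_smul, congrFun h7 i]; rfl
    · simp
  have hYE' : Yᴴ * E = 0 := by
    have := congrArg conjTranspose hEY
    rwa [conjTranspose_mul, realDiag_conjTranspose, conjTranspose_zero] at this
  have hW : (Y * S + E)ᴴ * (Y * S + E) = 1 := by
    rw [conjTranspose_add, conjTranspose_mul, realDiag_conjTranspose, realDiag_conjTranspose]
    rw [Matrix.add_mul, Matrix.mul_add, Matrix.mul_add, Matrix.mul_assoc, ← Matrix.mul_assoc Yᴴ, h3,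
      Matrix.mul_assoc, hYE', ← Matrix.mul_assoc E, hEY, Matrix.mul_zero, Matrix.zero_mul,
      realDiag_mul, realDiag_mul, realDiag_mul, add_zero, zero_add, realDiag_add, ← realDiag_one]
    congr 1; ext i
    by_cases hi : σ i = 0
    · simp [hi]
    · simp [hi]; field_simp
  refine ⟨u * (Y * S + E), mul_mem hu (mem_unitary_of_conjTranspose_mul hW), ?_⟩
  have h8 : (Y * S + E) * realDiag F σ = Y := by
    rw [Matrix.add_mul, Matrix.mul_assoc, realDiag_mul, realDiag_mul]
    have : (fun i => (if σ i = 0 then (1 : ℝ) else 0) * σ i) = fun _ => 0 := by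
      ext i; split_ifs with h <;> simp [h]
    rw [this, realDiag_zero, add_zero]
    have h9 : realDiag F (fun i => (σ i)⁻¹ * σ i) + E = 1 := by
      rw [hE, realDiag_add, ← realDiag_one]
      congr 1; ext i
      by_cases hi : σ i = 0 <;> simp [hi]
    have h10 : Y * (realDiag F (fun i => (σ i)⁻¹ * σ i) + E) = Y := by rw [h9, Matrix.mul_one]
    rwa [Matrix.mul_add, hYE, add_zero] at h10
  rw [Matrix.mul_assoc, h8, hY, ← Matrix.mul_assoc, hu2, Matrix.one_mul]

theorem exists_unitary_mul_eq_of_square {q : ℕ} {A B : Matrix (Fin q) (Fin q) F}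
    (h : Aᴴ * A = Bᴴ * B) : ∃ u ∈ unitary (Matrix (Fin q) (Fin q) F), A = u * B := by
  obtain ⟨v, hv, σ, hσ, hσ0, h1⟩ := exists_gram_eq_realDiag A
  have hv2 := mul_conjTranspose_self_of_unitary hv
  have h2 : (B * v)ᴴ * (B * v) = realDiag F fun i => σ i ^ 2 := by
    rw [← h1, conjTranspose_mul, conjTranspose_mul, Matrix.mul_assoc, Matrix.mul_assoc,
      ← Matrix.mul_assoc Bᴴ, ← Matrix.mul_assoc Aᴴ, h]
  obtain ⟨u1, hu1, e1⟩ := exists_eq_unitary_mul_realDiag hσ hσ0 h1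
  obtain ⟨u2, hu2, e2⟩ := exists_eq_unitary_mul_realDiag hσ hσ0 h2
  refine ⟨u1 * u2ᴴ, mul_mem hu1 (conjTranspose_mem_unitary hu2), ?_⟩
  have e3 : A * v = u1 * u2ᴴ * (B * v) := by
    rw [e2, Matrix.mul_assoc, ← Matrix.mul_assoc u2ᴴ, conjTranspose_mul_self_of_unitary hu2,
      Matrix.one_mul, e1]
  have e4 := congrArg (· * vᴴ) e3
  simpa only [Matrix.mul_assoc, hv2, Matrix.mul_one] using e4

/-- Two families of vectors with the same Gram matrix are related by a unitary matrix. -/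
theorem exists_unitary_mul_eq {m q : ℕ} (hqm : q ≤ m) {A B : Matrix (Fin m) (Fin q) F}
    (h : Aᴴ * A = Bᴴ * B) : ∃ u ∈ unitary (Matrix (Fin m) (Fin m) F), A = u * B := by
  -- Zero columns make the matrices square without changing the equality of the Gram matrices.
  let pad (A : Matrix (Fin m) (Fin q) F) : Matrix (Fin m) (Fin m) F :=
    of fun i j => if hj : (j : ℕ) < q then A i ⟨j, hj⟩ else 0
  have hpad (A : Matrix (Fin m) (Fin q) F) (i j : Fin m) : ((pad A)ᴴ * pad A) i j =
      if hij : (i : ℕ) < q ∧ (j : ℕ) < q then (Aᴴ * A) ⟨i, hij.1⟩ ⟨j, hij.2⟩ else 0 := by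
    simp only [mul_apply, conjTranspose_apply, pad, of_apply]
    by_cases hi : (i : ℕ) < q <;> by_cases hj : (j : ℕ) < q <;> simp [hi, hj]
  obtain ⟨u, hu, e⟩ := exists_unitary_mul_eq_of_square (A := pad A) (B := pad B) (by
    ext i j; rw [hpad, hpad, h])
  refine ⟨u, hu, ?_⟩
  ext i j
  have := congrFun (congrFun e i) (Fin.castLE hqm j)
  simpa [pad, mul_apply] using this

theorem exists_singular_value_decomposition {q : ℕ} (X : Matrix (Fin q) (Fin q) F) :
    ∃ u ∈ unitary (Matrix (Fin q) (Fin q) F), ∃ v ∈ unitary (Matrix (Fin q) (Fin q) F),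
      ∃ σ : Fin q → ℝ, Antitone σ ∧ (∀ i, 0 ≤ σ i) ∧ X = u * realDiag F σ * v := by
  obtain ⟨v, hv, σ, hσ, hσ0, h1⟩ := exists_gram_eq_realDiag X
  obtain ⟨u, hu, e⟩ := exists_eq_unitary_mul_realDiag hσ hσ0 h1
  refine ⟨u, hu, vᴴ, conjTranspose_mem_unitary hv, σ, hσ, hσ0, ?_⟩
  rw [← e, Matrix.mul_assoc, mul_conjTranspose_self_of_unitary hv, Matrix.mul_one]

/-- The definition chooses a spectrum, so uniqueness is needed. If `u` and `v` both diagonalize `X*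
X`, the two Gram matrices of `v* u S` are the two diagonal forms, and they have the same sorted
spectrum. -/
theorem singularSpectrum_eq_of_isSingularSpectrum {q : ℕ} {X : Matrix (Fin q) (Fin q) F}
    {σ : Fin q → ℝ} (h : IsSingularSpectrum X σ) : singularSpectrum X = σ := by
  have hex : ∃ σ, IsSingularSpectrum X σ := ⟨σ, h⟩
  have h1 : IsSingularSpectrum X (singularSpectrum X) := by
    rw [singularSpectrum, dif_pos hex]; exact hex.choose_spec
  obtain ⟨a1, a2, u, hu, e1⟩ := h1
  obtain ⟨b1, b2, v, hv, e2⟩ := h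
  change _ = u * realDiag F (fun i => singularSpectrum X i ^ 2) * uᴴ at e1
  change _ = v * realDiag F (fun i => σ i ^ 2) * vᴴ at e2
  have hu1 := conjTranspose_mul_self_of_unitary hu
  have hv1 := conjTranspose_mul_self_of_unitary hv
  set S := realDiag F (singularSpectrum X)
  have hSS : realDiag F (fun i => singularSpectrum X i ^ 2) = S * S := by
    rw [realDiag_mul]; simp [sq]
  refine gram_spectrum_unique (F := F) (Y := (vᴴ * u) * S) a1 b1 a2 b2 ?_ ?_
  · rw [hSS, conjTranspose_mul, realDiag_conjTranspose, conjTranspose_mul,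
      conjTranspose_conjTranspose, Matrix.mul_assoc, Matrix.mul_assoc, ← Matrix.mul_assoc v,
      ← Matrix.mul_assoc v, mul_conjTranspose_self_of_unitary hv, Matrix.one_mul,
      ← Matrix.mul_assoc uᴴ, hu1, Matrix.one_mul]
  · have e3 : vᴴ * (Xᴴ * X) * v = realDiag F (fun i => σ i ^ 2) := by
      rw [e2, Matrix.mul_assoc, Matrix.mul_assoc, Matrix.mul_assoc, hv1, Matrix.mul_one,
        ← Matrix.mul_assoc, hv1, Matrix.one_mul]
    rw [← e3, e1, hSS, conjTranspose_mul, realDiag_conjTranspose, conjTranspose_mul,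
      conjTranspose_conjTranspose]
    simp only [Matrix.mul_assoc]
    rfl

theorem isSingularSpectrum_of_eq {q : ℕ} {X : Matrix (Fin q) (Fin q) F} {σ : Fin q → ℝ}
    (hσ : Antitone σ) (hσ0 : ∀ i, 0 ≤ σ i) {u v : Matrix (Fin q) (Fin q) F}
    (hu : u ∈ unitary (Matrix (Fin q) (Fin q) F)) (hv : v ∈ unitary (Matrix (Fin q) (Fin q) F))
    (h : X = u * realDiag F σ * v) : IsSingularSpectrum X σ := by
  refine ⟨hσ, hσ0, vᴴ, conjTranspose_mem_unitary hv, ?_⟩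
  change _ = vᴴ * realDiag F (fun i => σ i ^ 2) * vᴴᴴ
  have hSS : realDiag F (fun i => σ i ^ 2) = realDiag F σ * realDiag F σ := by
    rw [realDiag_mul]; simp [sq]
  rw [h, hSS, conjTranspose_mul, conjTranspose_mul, realDiag_conjTranspose,
    conjTranspose_conjTranspose]
  simp only [Matrix.mul_assoc]
  rw [← Matrix.mul_assoc uᴴ, conjTranspose_mul_self_of_unitary hu, Matrix.one_mul]

theorem singularSpectrum_eq_of_eq {q : ℕ} {X : Matrix (Fin q) (Fin q) F} {σ : Fin q → ℝ}
    (hσ : Antitone σ) (hσ0 : ∀ i, 0 ≤ σ i) {u v : Matrix (Fin q) (Fin q) F}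
    (hu : u ∈ unitary (Matrix (Fin q) (Fin q) F)) (hv : v ∈ unitary (Matrix (Fin q) (Fin q) F))
    (h : X = u * realDiag F σ * v) : singularSpectrum X = σ :=
  singularSpectrum_eq_of_isSingularSpectrum (isSingularSpectrum_of_eq hσ hσ0 hu hv h)

/-- Singular value decomposition. -/
theorem exists_eq_mul_singularSpectrum_mul {q : ℕ} (X : Matrix (Fin q) (Fin q) F) :
    ∃ u ∈ unitary (Matrix (Fin q) (Fin q) F), ∃ v ∈ unitary (Matrix (Fin q) (Fin q) F),
      X = u * realDiag F (singularSpectrum X) * v := by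
  obtain ⟨u, hu, v, hv, σ, hσ, hσ0, h⟩ := exists_singular_value_decomposition X
  exact ⟨u, hu, v, hv, by rwa [singularSpectrum_eq_of_eq hσ hσ0 hu hv h]⟩

theorem singularSpectrum_mul_mul {q : ℕ} {u v : Matrix (Fin q) (Fin q) F}
    (hu : u ∈ unitary (Matrix (Fin q) (Fin q) F)) (hv : v ∈ unitary (Matrix (Fin q) (Fin q) F))
    (X : Matrix (Fin q) (Fin q) F) : singularSpectrum (u * X * v) = singularSpectrum X := by
  obtain ⟨a, ha, b, hb, h⟩ := exists_eq_mul_singularSpectrum_mul X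
  obtain ⟨h1, h2⟩ := singularSpectrum_antitone_nonneg X
  refine singularSpectrum_eq_of_eq h1 h2 (mul_mem hu ha) (mul_mem hb hv) ?_
  nth_rewrite 1 [h]
  simp only [Matrix.mul_assoc]

theorem singularSpectrum_conjTranspose {q : ℕ} (X : Matrix (Fin q) (Fin q) F) :
    singularSpectrum Xᴴ = singularSpectrum X := by
  obtain ⟨a, ha, b, hb, h⟩ := exists_eq_mul_singularSpectrum_mul X
  obtain ⟨h1, h2⟩ := singularSpectrum_antitone_nonneg X
  refine singularSpectrum_eq_of_eq h1 h2 (conjTranspose_mem_unitary hb)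
    (conjTranspose_mem_unitary ha) ?_
  nth_rewrite 1 [h]
  rw [conjTranspose_mul, conjTranspose_mul, realDiag_conjTranspose, Matrix.mul_assoc]

/-- Choose a singular value decomposition of every matrix. Near `X` all factors stay in a compact
set, so along an ultrafilter they converge. The limit is again a singular value decomposition, and
uniqueness identifies its spectrum with that of `X`. -/
theorem continuous_singularSpectrum {q : ℕ} :
    Continuous (singularSpectrum : Matrix (Fin q) (Fin q) F → Fin q → ℝ) := by
  rw [continuous_iff_ultrafilter]
  intro X g hg
  choose u hu v hv huv using fun X : Matrix (Fin q) (Fin q) F =>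
    exists_eq_mul_singularSpectrum_mul X
  let β : Matrix (Fin q) (Fin q) F → ℝ := fun X => ∑ k, ∑ l, ‖X k l‖
  have hβ : Continuous β := by
    have : ∀ k l, Continuous fun X : Matrix (Fin q) (Fin q) F => X k l := fun k l =>
      continuous_id.matrix_elem k l
    fun_prop
  have hentry (w : Matrix (Fin q) (Fin q) F) (hw : w ∈ unitary (Matrix (Fin q) (Fin q) F))
      (i j : Fin q) : ‖w i j‖ ≤ 1 := by
    refine (sq_le_one_iff₀ (norm_nonneg _)).1 ?_
    rw [← normSq_unitary_col hw j]
    exact Finset.single_le_sum (f := fun i => ‖w i j‖ ^ 2) (fun _ _ => by positivity)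
      (Finset.mem_univ i)
  have hbound (Y : Matrix (Fin q) (Fin q) F) (i : Fin q) : singularSpectrum Y i ≤ β Y := by
    have e : realDiag F (singularSpectrum Y) = (u Y)ᴴ * Y * (v Y)ᴴ := by
      nth_rewrite 3 [huv Y]
      simp only [Matrix.mul_assoc]
      rw [mul_conjTranspose_self_of_unitary (hv Y), Matrix.mul_one, ← Matrix.mul_assoc,
        conjTranspose_mul_self_of_unitary (hu Y), Matrix.one_mul]
    have e2 := congrArg norm (congrFun (congrFun e i) i)
    rw [realDiag, diagonal_apply_eq, norm_algebraMap_eq,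
      abs_of_nonneg ((singularSpectrum_antitone_nonneg Y).2 i)] at e2
    rw [e2, mul_apply]
    refine (norm_sum_le _ _).trans ?_
    simp only [β]
    rw [Finset.sum_comm]
    refine Finset.sum_le_sum fun l _ => ?_
    rw [norm_mul]
    refine (mul_le_of_le_one_right (norm_nonneg _)
      (hentry _ (conjTranspose_mem_unitary (hv Y)) _ _)).trans ?_
    rw [mul_apply]
    refine (norm_sum_le _ _).trans (Finset.sum_le_sum fun k _ => ?_)
    rw [norm_mul]
    exact mul_le_of_le_one_left (norm_nonneg _)
      (hentry _ (conjTranspose_mem_unitary (hu Y)) _ _)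
  let K : Set ((Fin q → ℝ) × Matrix (Fin q) (Fin q) F × Matrix (Fin q) (Fin q) F) :=
    (Set.univ.pi fun _ => Set.Icc 0 (β X + 1)) ×ˢ ((unitary (Matrix (Fin q) (Fin q) F) : Set _) ×ˢ
      (unitary (Matrix (Fin q) (Fin q) F) : Set _))
  have hK : IsCompact K := (isCompact_univ_pi fun _ => isCompact_Icc).prod
    ((isCompact_unitary _).prod (isCompact_unitary _))
  let φ : Matrix (Fin q) (Fin q) F →
      (Fin q → ℝ) × Matrix (Fin q) (Fin q) F × Matrix (Fin q) (Fin q) F :=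
    fun Y => (singularSpectrum Y, u Y, v Y)
  have hev : ∀ᶠ Y in (g : Filter _), φ Y ∈ K := by
    have : ∀ᶠ Y in nhds X, β Y < β X + 1 :=
      hβ.continuousAt.eventually_lt continuousAt_const (by linarith)
    filter_upwards [hg this] with Y hY
    exact ⟨fun i _ => ⟨(singularSpectrum_antitone_nonneg Y).2 i, (hbound Y i).trans hY.le⟩,
      hu Y, hv Y⟩
  obtain ⟨⟨s, a, b⟩, ⟨hs, ha, hb⟩, hlim⟩ := hK.ultrafilter_le_nhds (g.map φ)
    (Filter.le_principal_iff.2 hev)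
  have hlim' : Filter.Tendsto φ g (nhds (s, a, b)) := hlim
  have t1 : Filter.Tendsto (singularSpectrum (F := F) (q := q)) (g : Filter _) (nhds s) :=
    (continuous_fst.tendsto _).comp hlim'
  have t2 : Filter.Tendsto u (g : Filter _) (nhds a) :=
    ((continuous_fst.comp continuous_snd).tendsto _).comp hlim'
  have t3 : Filter.Tendsto v (g : Filter _) (nhds b) :=
    ((continuous_snd.comp continuous_snd).tendsto _).comp hlim'
  have hmul : Continuous fun z : (Fin q → ℝ) × Matrix (Fin q) (Fin q) F × Matrix (Fin q) (Fin q) F =>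
      z.2.1 * realDiag F z.1 * z.2.2 :=
    ((continuous_fst.comp continuous_snd).matrix_mul
      (continuous_realDiag.comp continuous_fst)).matrix_mul (continuous_snd.comp continuous_snd)
  have t4 : Filter.Tendsto (fun Y => Y) (g : Filter _) (nhds (a * realDiag F s * b)) := by
    have := (hmul.tendsto (s, a, b)).comp hlim'
    refine this.congr fun Y => (huv Y).symm
  have hX : X = a * realDiag F s * b := tendsto_nhds_unique hg t4
  have hanti : Antitone s := by
    intro i j hij
    exact le_of_tendsto_of_tendsto' ((continuous_apply j).tendsto _ |>.comp t1)
      ((continuous_apply i).tendsto _ |>.comp t1)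
      fun Y => (singularSpectrum_antitone_nonneg Y).1 hij
  rw [singularSpectrum_eq_of_eq hanti (fun i => (hs i trivial).1) ha hb hX]
  exact t1

theorem continuous_singularAngles {q : ℕ} :
    Continuous (singularAngles : Matrix (Fin q) (Fin q) F → alcove q) := by
  refine Continuous.subtype_mk (continuous_pi fun i => ?_) _
  exact Real.continuous_arccos.comp ((continuous_apply _).comp continuous_singularSpectrum)

theorem singularAngles_mul_mul {q : ℕ} {u v : Matrix (Fin q) (Fin q) F}
    (hu : u ∈ unitary (Matrix (Fin q) (Fin q) F)) (hv : v ∈ unitary (Matrix (Fin q) (Fin q) F))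
    (X : Matrix (Fin q) (Fin q) F) : singularAngles (u * X * v) = singularAngles X := by
  apply Subtype.ext
  simp only [singularAngles, singularSpectrum_mul_mul hu hv]

theorem singularAngles_conjTranspose {q : ℕ} (X : Matrix (Fin q) (Fin q) F) :
    singularAngles Xᴴ = singularAngles X := by
  apply Subtype.ext
  simp only [singularAngles, singularSpectrum_conjTranspose]

end Spectral
end Grassmann

/-! ### Radial integrals over the unit ball of a normed space. -/

namespace Grassmann

section Radial

open Set Metric ENNReal

/-- Substitute `r = t / √(1 - t²)`, with `dr = (1 - t²)^(-3/2) dt`. Together with the factor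
`r^(n-1)` this gives the exponent `-(n/2 + 1)`. -/
theorem lintegral_Ioi_eq_lintegral_Ioo (n : ℕ) (hn : 0 < n) (g : ℝ → ℝ≥0∞) :
    ∫⁻ r in Ioi (0 : ℝ), ENNReal.ofReal (r ^ (n - 1)) * g r =
      ∫⁻ t in Ioo (0 : ℝ) 1, ENNReal.ofReal (t ^ (n - 1)) *
        (g (t * (√(1 - t ^ 2))⁻¹) * ENNReal.ofReal ((1 - t ^ 2) ^ (-((n : ℝ) / 2 + 1)))) := by
  have hs (t : ℝ) (ht : t ∈ Ioo (0 : ℝ) 1) : 0 < 1 - t ^ 2 := by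
    have := ht.1; have := ht.2; nlinarith
  have hderiv (t : ℝ) (ht : t ∈ Ioo (0 : ℝ) 1) :
      HasDerivWithinAt (fun t => t * (√(1 - t ^ 2))⁻¹) ((√(1 - t ^ 2) ^ 3)⁻¹) (Ioo 0 1) t := by
    have h0 := hs t ht
    have h1 : HasDerivAt (fun t : ℝ => 1 - t ^ 2) (-(2 * t)) t := by
      simpa using (hasDerivAt_pow 2 t).const_sub 1
    have h2 := h1.sqrt h0.ne'
    have h3 := h2.inv (Real.sqrt_pos.2 h0).ne'
    have h4 := (hasDerivAt_id t).mul h3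
    refine HasDerivAt.hasDerivWithinAt (h4.congr_deriv ?_)
    have hp := Real.sqrt_pos.2 h0
    have hsq := Real.sq_sqrt h0.le
    have e : (fun y : ℝ => √(1 - y ^ 2))⁻¹ t = (√(1 - t ^ 2))⁻¹ := rfl
    rw [e]
    simp only [id]
    field_simp
    nlinarith
  have hinj : InjOn (fun t : ℝ => t * (√(1 - t ^ 2))⁻¹) (Ioo 0 1) := by
    have : StrictMonoOn (fun t : ℝ => t * (√(1 - t ^ 2))⁻¹) (Ioo 0 1) := by
      intro a ha b hb hab
      have h1 : √(1 - b ^ 2) < √(1 - a ^ 2) :=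
        Real.sqrt_lt_sqrt (hs b hb).le (by have := ha.1; nlinarith)
      have h2 := Real.sqrt_pos.2 (hs b hb)
      have h3 := ha.1
      change a * (√(1 - a ^ 2))⁻¹ < b * (√(1 - b ^ 2))⁻¹
      have h4 : (√(1 - a ^ 2))⁻¹ < (√(1 - b ^ 2))⁻¹ := (inv_lt_inv₀ (h2.trans h1) h2).2 h1
      have h5 : 0 < (√(1 - a ^ 2))⁻¹ := inv_pos.2 (h2.trans h1)
      nlinarith
    exact this.injOn
  have himg : (fun t : ℝ => t * (√(1 - t ^ 2))⁻¹) '' Ioo 0 1 = Ioi 0 := by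
    ext r
    constructor
    · rintro ⟨t, ht, rfl⟩
      exact mul_pos ht.1 (inv_pos.2 (Real.sqrt_pos.2 (hs t ht)))
    · intro hr
      have hr' : (0 : ℝ) < r := hr
      have h1 : 0 < 1 + r ^ 2 := by positivity
      have h2 := Real.sqrt_pos.2 h1
      have h3 := Real.sq_sqrt h1.le
      refine ⟨r / √(1 + r ^ 2), ⟨by positivity, ?_⟩, ?_⟩
      · rw [div_lt_one h2]
        exact Real.lt_sqrt_of_sq_lt (by linarith)
      · have h4 : 1 - (r / √(1 + r ^ 2)) ^ 2 = (√(1 + r ^ 2))⁻¹ ^ 2 := by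
          rw [div_pow, inv_pow, h3]; field_simp; ring
        simp only [h4]
        rw [Real.sqrt_sq (by positivity)]
        field_simp
  rw [← himg, lintegral_image_eq_lintegral_abs_deriv_mul measurableSet_Ioo hderiv hinj]
  refine setLIntegral_congr_fun measurableSet_Ioo fun t ht => ?_
  have h0 := hs t ht
  have hp := Real.sqrt_pos.2 h0
  rw [abs_of_pos (by positivity), ← mul_assoc, mul_comm (g _), ← mul_assoc,
    ← ENNReal.ofReal_mul (by positivity), ← ENNReal.ofReal_mul (pow_nonneg ht.1.le _)]
  congr 2
  have e : (1 - t ^ 2) ^ (-((n : ℝ) / 2 + 1)) = (√(1 - t ^ 2) ^ (n + 2))⁻¹ := by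
    rw [Real.rpow_neg h0.le, Real.sqrt_eq_rpow, ← Real.rpow_natCast (_ ^ (1 / 2 : ℝ)), ← Real.rpow_mul h0.le]
    congr 2; push_cast; ring
  rw [e]
  obtain ⟨k, rfl⟩ : ∃ k, n = k + 1 := ⟨n - 1, by omega⟩
  simp only [Nat.add_sub_cancel, mul_pow, inv_pow]
  field_simp
  ring

variable {E : Type*} [NormedAddCommGroup E] [NormedSpace ℝ E] [FiniteDimensional ℝ E]
  [MeasurableSpace E] [BorelSpace E] (μ : Measure E) [μ.IsAddHaarMeasure]

theorem lintegral_eq_lintegral_toSphere [Nontrivial E] {f : E → ℝ≥0∞} (hf : Measurable f) :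
    ∫⁻ x, f x ∂μ = ∫⁻ ω : sphere (0 : E) 1, ∫⁻ r in Ioi (0 : ℝ),
      ENNReal.ofReal (r ^ (Module.finrank ℝ E - 1)) * f (r • (ω : E)) ∂volume ∂μ.toSphere := by
  have hmeas : Measurable fun z : sphere (0 : E) 1 × Ioi (0 : ℝ) => f ((z.2 : ℝ) • (z.1 : E)) :=
    hf.comp (by fun_prop)
  calc ∫⁻ x, f x ∂μ = ∫⁻ x : ({(0)}ᶜ : Set E), f x ∂(μ.comap (↑)) := by
        rw [lintegral_subtype_comap (measurableSet_singleton _).compl, restrict_compl_singleton]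
    _ = ∫⁻ x : ({(0)}ᶜ : Set E), (fun z : sphere (0 : E) 1 × Ioi (0 : ℝ) =>
          f ((z.2 : ℝ) • (z.1 : E))) (homeomorphUnitSphereProd E x) ∂(μ.comap (↑)) := by
        refine lintegral_congr fun x => ?_
        have hx : ‖(x : E)‖ ≠ 0 := norm_ne_zero_iff.2 x.2
        simp [smul_smul, hx]
    _ = ∫⁻ z, f ((z.2 : ℝ) • (z.1 : E)) ∂(μ.toSphere.prod (.volumeIoiPow (Module.finrank ℝ E - 1))) :=
        μ.measurePreserving_homeomorphUnitSphereProd.lintegral_comp hmeas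
    _ = _ := by
        rw [lintegral_prod _ hmeas.aemeasurable]
        refine lintegral_congr fun ω => ?_
        have hm : Measurable fun r : ℝ => f (r • (ω : E)) := hf.comp (by fun_prop)
        rw [← lintegral_subtype_comap measurableSet_Ioi]
        exact lintegral_withDensity_eq_lintegral_mul _ (by fun_prop)
          (hm.comp measurable_subtype_coe)

/-- The substitution `y ↦ y / √(1 - ‖y‖²)` of the unit ball onto the whole space. -/
theorem lintegral_eq_lintegral_ball [Nontrivial E] {f : E → ℝ≥0∞} (hf : Measurable f) :
    ∫⁻ x, f x ∂μ = ∫⁻ y in ball (0 : E) 1, f ((√(1 - ‖y‖ ^ 2))⁻¹ • y) *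
      ENNReal.ofReal ((1 - ‖y‖ ^ 2) ^ (-((Module.finrank ℝ E : ℝ) / 2 + 1))) ∂μ := by
  rw [← lintegral_indicator measurableSet_ball, lintegral_eq_lintegral_toSphere μ hf,
    lintegral_eq_lintegral_toSphere μ ?_]
  · refine lintegral_congr fun ω => ?_
    rw [lintegral_Ioi_eq_lintegral_Ioo _ Module.finrank_pos,
      ← lintegral_indicator measurableSet_Ioo, ← lintegral_indicator measurableSet_Ioi]
    refine lintegral_congr fun t => ?_
    have hω : ‖(ω : E)‖ = 1 := norm_eq_of_mem_sphere ω
    by_cases h0 : 0 < t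
    · by_cases h1 : t < 1
      · rw [indicator_of_mem (by exact ⟨h0, h1⟩), indicator_of_mem (by exact h0),
          indicator_of_mem (by simp [norm_smul, hω, abs_of_pos h0, h1])]
        simp only [norm_smul, hω, Real.norm_eq_abs, mul_one, sq_abs, smul_smul]
        rw [mul_comm t]
      · rw [indicator_of_notMem (by simp [h0, h1]), indicator_of_mem (by exact h0),
          indicator_of_notMem (by simpa [norm_smul, hω, abs_of_pos h0] using h1), mul_zero]
    · rw [indicator_of_notMem (by simp [h0]), indicator_of_notMem (by simp [h0])]
  · refine Measurable.indicator ?_ measurableSet_ball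
    refine Measurable.mul (hf.comp ?_) (by fun_prop)
    have : Measurable fun y : E => (√(1 - ‖y‖ ^ 2))⁻¹ := by fun_prop
    fun_prop

/-- Radial beta integrals over the unit ball do not vanish. -/
theorem integral_ball_one_sub_norm_sq_cpow_ne_zero [Nontrivial E] {s : ℂ} (hs : -1 < s.re) :
    ∫ y in ball (0 : E) 1, ((1 - ‖y‖ ^ 2 : ℝ) : ℂ) ^ s ∂μ ≠ 0 := by
  set n := Module.finrank ℝ E
  have hn : 0 < n := Module.finrank_pos
  rw [← integral_indicator measurableSet_ball]
  have e1 (y : E) : (ball (0 : E) 1).indicator (fun y => ((1 - ‖y‖ ^ 2 : ℝ) : ℂ) ^ s) y =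
      (Iio (1 : ℝ)).indicator (fun r : ℝ => ((1 - r ^ 2 : ℝ) : ℂ) ^ s) ‖y‖ := by
    by_cases h : ‖y‖ < 1
    · rw [indicator_of_mem (by simpa using h), indicator_of_mem (by exact h)]
    · rw [indicator_of_notMem (by simpa using h), indicator_of_notMem (by exact h)]
  simp_rw [e1]
  rw [integral_fun_norm_addHaar]
  have hvol : μ.real (ball (0 : E) 1) ≠ 0 := by
    rw [measureReal_def]
    exact (ENNReal.toReal_pos (measure_ball_pos μ _ one_pos).ne' measure_ball_lt_top.ne).ne'
  refine smul_ne_zero hn.ne' (smul_ne_zero hvol ?_)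
  -- With `x = r²` the radial integral becomes half of `B(n/2, s + 1)`. It cannot vanish because its
  -- product with a value of `Γ` is the nonzero number `Γ(n/2) Γ(s + 1)`.
  have e2 : ∫ y in Ioi (0 : ℝ), y ^ (n - 1) •
      (Iio (1 : ℝ)).indicator (fun r : ℝ => ((1 - r ^ 2 : ℝ) : ℂ) ^ s) y =
      (1 / 2 : ℂ) * Complex.betaIntegral ((n : ℂ) / 2) (s + 1) := by
    have h1 := integral_comp_rpow_Ioi (fun x : ℝ => (Ioo (0 : ℝ) 1).indicator
      (fun x : ℝ => (x : ℂ) ^ ((n : ℂ) / 2 - 1) * (1 - (x : ℂ)) ^ (s + 1 - 1)) x)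
      (p := 2) two_ne_zero
    have h2 : Complex.betaIntegral ((n : ℂ) / 2) (s + 1) =
        ∫ x in Ioi (0 : ℝ), (Ioo (0 : ℝ) 1).indicator
          (fun x : ℝ => (x : ℂ) ^ ((n : ℂ) / 2 - 1) * (1 - (x : ℂ)) ^ (s + 1 - 1)) x := by
      rw [Complex.betaIntegral, intervalIntegral.integral_of_le zero_le_one,
        integral_Ioc_eq_integral_Ioo, setIntegral_indicator measurableSet_Ioo,
        inter_eq_self_of_subset_right Ioo_subset_Ioi_self]
    rw [h2, ← h1, ← integral_const_mul]
    refine setIntegral_congr_fun measurableSet_Ioi fun x hx => ?_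
    have hx0 : 0 < x := hx
    have hpow : x ^ (2 : ℝ) = x ^ 2 := by norm_cast
    simp only [hpow]
    by_cases h : x < 1
    · have h3 : x ^ 2 < 1 := by nlinarith
      rw [indicator_of_mem (by exact h), indicator_of_mem (by exact ⟨by positivity, h3⟩)]
      have h4 : ((x ^ 2 : ℝ) : ℂ) ^ ((n : ℂ) / 2 - 1) * x = (x : ℂ) ^ (n - 1) := by
        have hxc : (x : ℂ) ≠ 0 := by exact_mod_cast hx0.ne'
        have h5 : ((x ^ 2 : ℝ) : ℂ) = (x : ℂ) * (x : ℂ) := by push_cast; ring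
        rw [h5, ← Complex.ofReal_mul, Complex.ofReal_mul,
          Complex.mul_cpow_ofReal_nonneg hx0.le hx0.le, ← Complex.cpow_add _ _ hxc]
        nth_rewrite 2 [← Complex.cpow_one (x : ℂ)]
        rw [← Complex.cpow_add _ _ hxc, ← Complex.cpow_natCast, Nat.cast_sub hn]
        congr 1; push_cast; ring
      have h6 : (1 : ℂ) - ((x ^ 2 : ℝ) : ℂ) = ((1 - x ^ 2 : ℝ) : ℂ) := by push_cast; ring
      rw [h6, add_sub_cancel_right, Complex.real_smul, Complex.real_smul]
      have h7 : (x : ℝ) ^ ((2 : ℝ) - 1) = x := by norm_num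
      rw [h7, Complex.ofReal_pow, ← h4]
      push_cast
      rw [abs_of_pos (by norm_num : (0 : ℝ) < 2)]
      push_cast
      ring
    · have h3 : ¬ x ^ 2 < 1 := by nlinarith
      rw [indicator_of_notMem (by exact h), indicator_of_notMem (by exact fun hh => h3 hh.2)]
      simp
  rw [e2]
  have h2 : 0 < (s + 1).re := by simp; linarith
  have h3 : 0 < ((n : ℂ) / 2).re := by
    have : (n : ℂ) / 2 = ((n / 2 : ℝ) : ℂ) := by push_cast; rfl
    rw [this, Complex.ofReal_re]; positivity
  have h4 := Complex.Gamma_mul_Gamma_eq_betaIntegral h3 h2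
  have h5 := mul_ne_zero (Complex.Gamma_ne_zero_of_re_pos h3) (Complex.Gamma_ne_zero_of_re_pos h2)
  rw [h4] at h5
  exact mul_ne_zero (by norm_num) (right_ne_zero_of_mul h5)

theorem lintegral_ball_one_sub_norm_sq_rpow_lt_top [Nontrivial E] {s : ℝ} (hs : -1 < s) :
    ∫⁻ y in ball (0 : E) 1, ENNReal.ofReal ((1 - ‖y‖ ^ 2) ^ s) ∂μ < ∞ := by
  -- A function that is not integrable has Bochner integral zero, so the nonvanishing already proved
  -- contains integrability.
  have h : Integrable (fun y => ((1 - ‖y‖ ^ 2 : ℝ) : ℂ) ^ (s : ℂ)) (μ.restrict (ball (0 : E) 1)) :=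
    not_imp_comm.1 integral_undef
      (integral_ball_one_sub_norm_sq_cpow_ne_zero μ (s := s) (by simpa using hs))
  refine lt_of_eq_of_lt (setLIntegral_congr_fun measurableSet_ball fun y hy => ?_) h.2
  have hy1 : ‖y‖ < 1 := by simpa using hy
  have h0 : 0 < 1 - ‖y‖ ^ 2 := by nlinarith [norm_nonneg y]
  simp only
  rw [← ofReal_norm, Complex.norm_cpow_eq_rpow_re_of_pos h0, Complex.ofReal_re]

end Radial
end Grassmann

/-! ### Normalized Haar measure on compact groups. -/

namespace Grassmann

section CompactGroup

variable {G : Type*} [TopologicalSpace G] [Group G] [IsTopologicalGroup G] [CompactSpace G]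
  [MeasurableSpace G] [BorelSpace G]

instance : IsProbabilityMeasure (normalizedHaar G) where
  measure_univ := by
    rw [normalizedHaar, Measure.smul_apply, smul_eq_mul]
    refine ENNReal.inv_mul_cancel ?_ (measure_ne_top _ _)
    exact (isOpen_univ.measure_pos _ ⟨1, trivial⟩).ne'

instance : (normalizedHaar G).IsHaarMeasure :=
  Measure.IsHaarMeasure.smul _ (ENNReal.inv_ne_zero.2 (measure_ne_top _ _))
    (ENNReal.inv_ne_top.2 (isOpen_univ.measure_pos _ ⟨1, trivial⟩).ne')

/-- A right translate is again a Haar probability measure, and there is only one. -/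
instance : (normalizedHaar G).IsMulRightInvariant where
  map_mul_right_eq_self g := by
    have : IsProbabilityMeasure (Measure.map (· * g) (normalizedHaar G)) :=
      Measure.isProbabilityMeasure_map (measurable_mul_const g).aemeasurable
    exact Measure.isHaarMeasure_eq_of_isProbabilityMeasure _ _

instance : (normalizedHaar G).IsInvInvariant where
  inv_eq_self := by
    have h := Measure.isMulInvariant_eq_smul_of_compactSpace (normalizedHaar G).inv
      (normalizedHaar G)
    have h1 : (normalizedHaar G).inv Set.univ = 1 := by
      rw [Measure.inv_apply]; simp
    have h2 := h1
    rw [h, Measure.smul_apply, measure_univ] at h2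
    have h3 : Measure.haarScalarFactor (normalizedHaar G).inv (normalizedHaar G) = 1 := by
      simpa [ENNReal.smul_def] using h2
    rw [h, h3, one_smul]

theorem lintegral_mul_left_normalizedHaar (f : G → ENNReal) (g : G) :
    ∫⁻ x, f (g * x) ∂normalizedHaar G = ∫⁻ x, f x ∂normalizedHaar G :=
  lintegral_mul_left_eq_self f g

theorem lintegral_mul_right_normalizedHaar (f : G → ENNReal) (g : G) :
    ∫⁻ x, f (x * g) ∂normalizedHaar G = ∫⁻ x, f x ∂normalizedHaar G :=
  lintegral_mul_right_eq_self f g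

end CompactGroup

/-! ### Integration over vectors with entries in the scalars. -/

section Vectors

open Set ENNReal

variable {F : Type} [NormedRing F] [StarRing F] [NormedStarGroup F] [NormedAlgebra ℝ F]
  [IsScalar F]

theorem continuous_normSq {ι : Type*} [Fintype ι] : Continuous (normSq : (ι → F) → ℝ) := by
  unfold normSq; fun_prop

theorem normSq_smul {ι : Type*} [Fintype ι] (c : ℝ) (y : ι → F) :
    normSq (c • y) = c ^ 2 * normSq y := by
  simp [normSq, norm_smul, mul_pow, Finset.mul_sum]

variable [ProperSpace F] [MeasureSpace F] [BorelSpace F]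
  [Measure.IsAddHaarMeasure (volume : Measure F)]

variable {ι : Type*} [Fintype ι]

instance : Measure.IsAddHaarMeasure (volume : Measure (ι → F)) :=
  inferInstanceAs (Measure.IsAddHaarMeasure (Measure.pi fun _ : ι => (volume : Measure F)))

/-- The open unit ball for the Euclidean norm. -/
def unitBall (F : Type) [NormedRing F] (ι : Type*) [Fintype ι] : Set (ι → F) :=
  {y | normSq y < 1}

@[fun_prop]
theorem measurable_normSq : Measurable (normSq : (ι → F) → ℝ) := continuous_normSq.measurable

theorem isOpen_unitBall : IsOpen (unitBall F ι) := isOpen_lt continuous_normSq continuous_const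

theorem measurableSet_unitBall : MeasurableSet (unitBall F ι) := isOpen_unitBall.measurableSet

theorem normSq_toLp (y : ι → F) : ‖WithLp.toLp 2 y‖ ^ 2 = normSq y := by
  rw [PiLp.norm_sq_eq_of_L2]; rfl

/-- Function spaces carry the supremum norm. The radial formulas are transported from `PiLp 2`,
whose squared norm is `normSq`, with the image of the product measure as Haar measure. -/
theorem measurePreserving_toLp : MeasurePreserving (WithLp.toLp 2 : (ι → F) → PiLp 2 fun _ : ι => F)
    volume (Measure.map (WithLp.toLp 2) volume) :=
  ⟨WithLp.measurable_toLp _ _, rfl⟩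

instance : Measure.IsAddHaarMeasure
    (Measure.map (WithLp.toLp 2 : (ι → F) → PiLp 2 fun _ : ι => F) volume) :=
  (PiLp.continuousLinearEquiv 2 ℝ fun _ : ι => F).symm.isAddHaarMeasure_map volume

theorem toLp_preimage_ball :
    (WithLp.toLp 2 : (ι → F) → PiLp 2 fun _ : ι => F) ⁻¹' Metric.ball 0 1 = unitBall F ι := by
  ext y
  rw [mem_preimage, mem_ball_zero_iff, unitBall, mem_ofPred_eq, ← normSq_toLp,
    sq_lt_one_iff₀ (norm_nonneg _)]

theorem finrank_toLp : Module.finrank ℝ (PiLp 2 fun _ : ι => F) = Module.finrank ℝ (ι → F) :=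
  (PiLp.continuousLinearEquiv 2 ℝ fun _ : ι => F).toLinearEquiv.finrank_eq

theorem volume_unitBall_ne_zero : volume (unitBall F ι) ≠ 0 :=
  (isOpen_unitBall.measure_pos _ ⟨0, by simp [unitBall, normSq]⟩).ne'

theorem volume_unitBall_ne_top : volume (unitBall F ι) ≠ ∞ := by
  rw [← toLp_preimage_ball, measurePreserving_toLp.measure_preimage
    Metric.isOpen_ball.measurableSet.nullMeasurableSet]
  exact measure_ball_lt_top.ne

/-- The substitution `y ↦ y / √(1 - |y|²)` of the Euclidean unit ball onto the whole space. -/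
theorem lintegral_eq_lintegral_unitBall [Nonempty ι] {f : (ι → F) → ℝ≥0∞} (hf : Measurable f) :
    ∫⁻ x, f x = ∫⁻ y in unitBall F ι, f ((√(1 - normSq y))⁻¹ • y) *
      ENNReal.ofReal ((1 - normSq y) ^ (-((Module.finrank ℝ (ι → F) : ℝ) / 2 + 1))) := by
  have hf' : Measurable fun x : PiLp 2 fun _ : ι => F => f (WithLp.ofLp x) :=
    hf.comp (WithLp.measurable_ofLp _ _)
  have h := lintegral_eq_lintegral_ball
    (Measure.map (WithLp.toLp 2 : (ι → F) → PiLp 2 fun _ : ι => F) volume) hf'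
  rw [lintegral_map hf' (WithLp.measurable_toLp _ _),
    ← measurePreserving_toLp.setLIntegral_comp_preimage_emb
      (MeasurableEquiv.toLp 2 (ι → F)).measurableEmbedding, toLp_preimage_ball, finrank_toLp] at h
  simpa only [normSq_toLp, WithLp.ofLp_smul] using h

theorem lintegral_unitBall_one_sub_normSq_rpow_lt_top [Nonempty ι] {s : ℝ} (hs : -1 < s) :
    ∫⁻ y in unitBall F ι, ENNReal.ofReal ((1 - normSq y) ^ s) < ∞ := by
  have h := lintegral_ball_one_sub_norm_sq_rpow_lt_top
    (Measure.map (WithLp.toLp 2 : (ι → F) → PiLp 2 fun _ : ι => F) volume) hs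
  rw [← measurePreserving_toLp.setLIntegral_comp_preimage_emb
      (MeasurableEquiv.toLp 2 (ι → F)).measurableEmbedding, toLp_preimage_ball] at h
  simpa only [normSq_toLp] using h

theorem integral_unitBall_one_sub_normSq_cpow_ne_zero [Nonempty ι] {s : ℂ} (hs : -1 < s.re) :
    ∫ y in unitBall F ι, ((1 - normSq y : ℝ) : ℂ) ^ s ≠ 0 := by
  have h := integral_ball_one_sub_norm_sq_cpow_ne_zero
    (Measure.map (WithLp.toLp 2 : (ι → F) → PiLp 2 fun _ : ι => F) volume) hs
  rw [← measurePreserving_toLp.setIntegral_preimage_emb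
      (MeasurableEquiv.toLp 2 (ι → F)).measurableEmbedding, toLp_preimage_ball] at h
  simpa only [normSq_toLp] using h

theorem lintegral_eq_mul_lintegral_smul {f : (ι → F) → ℝ≥0∞} (hf : Measurable f) {c : ℝ}
    (hc : 0 < c) : ∫⁻ x, f x =
      ENNReal.ofReal (c ^ Module.finrank ℝ (ι → F)) * ∫⁻ x, f (c • x) := by
  have h := Measure.map_addHaar_smul (volume : Measure (ι → F)) hc.ne'
  rw [← lintegral_map hf (measurable_const_smul c), h, lintegral_smul_measure, smul_eq_mul,
    ← mul_assoc, ← ENNReal.ofReal_mul (by positivity), abs_of_pos (by positivity),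
    mul_inv_cancel₀ (by positivity), ENNReal.ofReal_one, one_mul]

/-- Multiplication of row vectors by a matrix, as a real linear map. -/
def vecMulLinear [DecidableEq ι] (u : Matrix ι ι F) : (ι → F) →ₗ[ℝ] ι → F where
  toFun x := x ᵥ* u
  map_add' x y := add_vecMul u x y
  map_smul' c x := by simp [smul_vecMul]

theorem det_vecMulLinear_ne_zero [DecidableEq ι] {u v : Matrix ι ι F} (h : u * v = 1) :
    LinearMap.det (vecMulLinear u) ≠ 0 := by
  have : vecMulLinear v ∘ₗ vecMulLinear u = LinearMap.id := by
    refine LinearMap.ext fun x => ?_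
    change (x ᵥ* u) ᵥ* v = x
    rw [vecMul_vecMul, h, vecMul_one]
  intro h0
  have h1 := congrArg LinearMap.det this
  rw [LinearMap.det_comp, h0, mul_zero, LinearMap.det_id] at h1
  exact zero_ne_one h1

/-- An invertible linear map multiplies Haar measure by a constant. Here it maps the Euclidean unit
ball onto itself, and that ball has finite positive volume, so the constant is one. -/
theorem measurePreserving_vecMul [DecidableEq ι] {u : Matrix ι ι F}
    (hu : u ∈ unitary (Matrix ι ι F)) :
    MeasurePreserving (fun x : ι → F => x ᵥ* u) volume volume := by
  have hdet := det_vecMulLinear_ne_zero (mul_conjTranspose_self_of_unitary hu)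
  have hcont : Continuous (vecMulLinear u) := LinearMap.continuous_of_finiteDimensional _
  have h := Measure.map_linearMap_addHaar_eq_smul_addHaar (volume : Measure (ι → F)) hdet
  refine ⟨hcont.measurable, ?_⟩
  change Measure.map (vecMulLinear u) volume = volume
  have hB := congrArg (fun μ : Measure (ι → F) => μ (unitBall F ι)) h
  simp only [Measure.smul_apply, smul_eq_mul] at hB
  rw [Measure.map_apply hcont.measurable measurableSet_unitBall] at hB
  have hpre : vecMulLinear u ⁻¹' unitBall F ι = unitBall F ι := by
    ext x
    have := normSq_vecMul_unitary hu x
    simp only [unitBall, mem_preimage, mem_ofPred_eq]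
    change normSq (x ᵥ* u) < 1 ↔ _
    rw [this]
  rw [hpre] at hB
  have h1 := (ENNReal.mul_eq_right volume_unitBall_ne_zero volume_unitBall_ne_top).1 hB.symm
  rw [h, h1, one_smul]

end Vectors
end Grassmann

/-! ### The real, complex and quaternionic determinants. -/

/-- The properties of the determinant on which the constructions rest. -/
class IsScalarDet (F : Type) [NormedRing F] [StarRing F] [NormedAlgebra ℝ F] [HasDet F] :
    Prop where
  det_realDiag : ∀ (n : Type) [Fintype n] [DecidableEq n] (r : n → ℝ), (∀ i, 0 ≤ r i) →
    HasDet.det n (Grassmann.realDiag F r) = ((∏ i, r i : ℝ) : ℂ)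
  exists_det_mul_eq_one : ∀ (n : Type) [Fintype n] [DecidableEq n] (u : Matrix n n F)
    (_ : u ∈ unitary (Matrix n n F)) (i : n), ∃ s : F, ‖s‖ = 1 ∧
      HasDet.det n (diagonal (Function.update 1 i s)) * HasDet.det n u = 1

namespace Grassmann

section Instances

instance : IsScalar ℝ := ⟨inferInstance, by intro a; simp [sq], by simp⟩

instance : IsScalar ℂ := ⟨inferInstance, by intro a; simp [Complex.conj_mul'], by intro a; simp⟩

instance : IsScalar ℍ[ℝ] :=
  ⟨inferInstance, by
    intro a
    rw [Quaternion.star_mul_self, Quaternion.normSq_eq_norm_mul_self, sq]; rfl,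
    fun a => Quaternion.star_coe a⟩

theorem prod_update_one {n R : Type*} [Fintype n] [DecidableEq n] [CommMonoid R] (i : n) (s : R) :
    ∏ j, Function.update (1 : n → R) i s j = s := by
  rw [Finset.prod_update_of_mem (Finset.mem_univ i)]
  simp

instance : IsScalarDet ℝ where
  det_realDiag n _ _ r hr := by
    change Complex.ofReal (Matrix.det (realDiag ℝ r)) = _
    simp [realDiag, det_diagonal]
  exists_det_mul_eq_one n _ _ u hu i := by
    have h : u.det * u.det = 1 := by
      have := congrArg Matrix.det (conjTranspose_mul_self_of_unitary hu)
      rwa [det_mul, det_conjTranspose, det_one, star_trivial] at this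
    refine ⟨u.det, ?_, ?_⟩
    · rw [← pow_eq_one_iff_of_nonneg (norm_nonneg _) two_ne_zero, Real.norm_eq_abs, sq_abs, sq, h]
    · change Complex.ofReal (Matrix.det _) * Complex.ofReal u.det = _
      rw [det_diagonal, prod_update_one, ← Complex.ofReal_mul, h, Complex.ofReal_one]

instance : IsScalarDet ℂ where
  det_realDiag n _ _ r hr := by
    change Matrix.det (realDiag ℂ r) = _
    simp [realDiag, det_diagonal]
  exists_det_mul_eq_one n _ _ u hu i := by
    have h : star u.det * u.det = 1 := by
      have := congrArg Matrix.det (conjTranspose_mul_self_of_unitary hu)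
      rwa [det_mul, det_conjTranspose, det_one] at this
    refine ⟨star u.det, ?_, ?_⟩
    · have h2 := congrArg norm h
      rw [norm_mul, _root_.norm_star, norm_one, ← sq] at h2
      rw [_root_.norm_star]
      exact (pow_eq_one_iff_of_nonneg (norm_nonneg _) two_ne_zero).1 h2
    · change Matrix.det _ * u.det = _
      rw [det_diagonal, prod_update_one, h]

theorem quaternionToComplex_conjTranspose {n : Type} [Fintype n] [DecidableEq n]
    (A : Matrix n n ℍ[ℝ]) : quaternionToComplex n Aᴴ = (quaternionToComplex n A)ᴴ := by
  change fromBlocks _ _ _ _ = (fromBlocks _ _ _ _)ᴴ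
  rw [fromBlocks_conjTranspose]
  congr 1 <;> ext i j <;> simp [Complex.ext_iff]

theorem quaternionToComplex_realDiag {n : Type} [Fintype n] [DecidableEq n] (r : n → ℝ) :
    quaternionToComplex n (realDiag ℍ[ℝ] r) =
      fromBlocks (diagonal fun i => (r i : ℂ)) 0 0 (diagonal fun i => (r i : ℂ)) := by
  change fromBlocks _ _ _ _ = _
  congr 1 <;> ext i j <;> by_cases h : i = j <;>
    simp [realDiag, diagonal_apply, h, Complex.ext_iff]

instance : IsScalarDet ℍ[ℝ] where
  det_realDiag n _ _ r hr := by
    change Complex.ofReal (√‖(quaternionToComplex n (realDiag ℍ[ℝ] r)).det‖) = _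
    rw [quaternionToComplex_realDiag, det_fromBlocks_zero₂₁, det_diagonal, ← Complex.ofReal_prod,
      norm_mul, Real.sqrt_mul_self (norm_nonneg _), Complex.norm_real, Real.norm_eq_abs,
      abs_of_nonneg (Finset.prod_nonneg fun i _ => hr i)]
  exists_det_mul_eq_one n _ _ u hu i := by
    have h : star (quaternionToComplex n u).det * (quaternionToComplex n u).det = 1 := by
      have := congrArg (fun A => (quaternionToComplex n A).det)
        (conjTranspose_mul_self_of_unitary hu)
      simpa only [map_mul, det_mul, quaternionToComplex_conjTranspose, det_conjTranspose, map_one,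
        det_one] using this
    have h2 := congrArg norm h
    rw [norm_mul, _root_.norm_star, norm_one, ← sq] at h2
    have h3 := (pow_eq_one_iff_of_nonneg (norm_nonneg _) two_ne_zero).1 h2
    -- The Dieudonné determinant of a unitary matrix is already one, so no phase is needed.
    refine ⟨1, norm_one, ?_⟩
    have h4 : diagonal (Function.update (1 : n → ℍ[ℝ]) i 1) = 1 := by simp
    rw [h4, map_one, one_mul]
    change Complex.ofReal (√‖(quaternionToComplex n u).det‖) = 1
    rw [h3, Real.sqrt_one, Complex.ofReal_one]

end Instances

/-! ### Rotations have determinant one. -/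

section Determinant

variable {F : Type} [NormedRing F] [StarRing F] [NormedStarGroup F] [NormedAlgebra ℝ F]
  [IsScalar F] [HasDet F] [IsScalarDet F]

/-- A one-parameter family of matrices whose elements are conjugate to their inverses by an
involution has determinant one. -/
theorem det_eq_one_of_conj {n : Type} [Fintype n] [DecidableEq n] {A H D : Matrix n n F}
    (hH : H * H = A) (hD : D * D = 1) {H' : Matrix n n F} (hinv : H * H' = 1)
    (hconj : D * H * D = H') : HasDet.det n A = 1 := by
  have h1 := congrArg (HasDet.det (F := F) n) hD
  have h2 := congrArg (HasDet.det (F := F) n) hinv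
  have h3 := congrArg (HasDet.det (F := F) n) hconj
  have h4 := congrArg (HasDet.det (F := F) n) hH
  simp only [map_mul, map_one] at h1 h2 h3 h4
  rw [← h4]
  calc HasDet.det n H * HasDet.det n H
      = HasDet.det n H * (HasDet.det n D * HasDet.det n H * HasDet.det n D) := by
        linear_combination (-HasDet.det n H * HasDet.det n H) * h1
    _ = 1 := by rw [h3, h2]

/-- The reflection in coordinate `j` conjugates the half-angle rotation to its inverse, and the
square of that rotation is the given one. This uses only multiplicativity of the determinant. -/
theorem det_rotation {n : Type} [Fintype n] [DecidableEq n] {i j : n} (hij : i ≠ j) {ε : F}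
    (hε : ‖ε‖ = 1) (θ : ℝ) : HasDet.det n (rotation i j ε (Real.cos θ) (Real.sin θ)) = 1 := by
  refine det_eq_one_of_conj (H := rotation i j ε (Real.cos (θ / 2)) (Real.sin (θ / 2)))
    (H' := rotation i j ε (Real.cos (θ / 2)) (-Real.sin (θ / 2)))
    (D := diagonal (Function.update 1 j (-1))) ?_ ?_ ?_ ?_
  · rw [rotation_mul hij hε]
    have h : θ = θ / 2 + θ / 2 := by ring
    conv_rhs => rw [h, Real.cos_add, Real.sin_add]
    congr 1; ring
  · rw [diagonal_mul_diagonal, ← diagonal_one]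
    congr 1; ext k
    by_cases h : k = j
    · subst h; simp
    · simp [h]
  · rw [rotation_mul hij hε]
    rw [← rotation_one_zero i j ε]
    congr 1
    · nlinarith [Real.sin_sq_add_cos_sq (θ / 2)]
    · ring
  · ext a b
    rw [mul_diagonal, diagonal_mul]
    simp only [rotation, Matrix.add_apply, Matrix.smul_apply, single_apply, one_apply,
      Matrix.sub_apply]
    by_cases ha : a = j <;> by_cases hb : b = j
    · simp [ha, hb, hij]
    · by_cases hi : i = b <;> simp [ha, hb, hij, Ne.symm hb, hi]
    · by_cases hi : i = a <;> simp [ha, hb, hij, Ne.symm ha, hi]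
    · simp [ha, hb, Ne.symm ha, Ne.symm hb]

end Determinant
end Grassmann

/-! ### The law of a row of a Haar distributed unitary matrix. -/

namespace Grassmann
open Set ENNReal

section RowLaw

variable {F : Type} [NormedRing F] [StarRing F] [NormedStarGroup F] [NormedAlgebra ℝ F]
  [IsScalar F] [ProperSpace F]

/-- Every vector is a multiple of a row of a unitary matrix. -/
theorem exists_unitary_row {p : ℕ} (i : Fin p) (a : Fin p → F) :
    ∃ u ∈ unitary (Matrix (Fin p) (Fin p) F), a = √(normSq a) • u i := by
  have key : ∀ b : Fin p → F, normSq b = 1 → ∃ u ∈ unitary (Matrix (Fin p) (Fin p) F), u i = b := by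
    intro b hb
    obtain ⟨u, hu, h⟩ := exists_unitary_mul_eq (F := F) (m := p) (q := 1)
      (A := of fun k _ => star (b k)) (B := of fun k _ => if k = i then 1 else 0)
      (Nat.one_le_iff_ne_zero.2 (Fin.pos i).ne') (by
        ext k l
        have h1 := star_dotProduct_self (star b)
        have h2 : normSq (star b) = 1 := by rw [← hb]; simp [normSq]
        rw [h2] at h1
        simp only [dotProduct, Pi.star_apply, star_star, map_one] at h1
        simp [mul_apply, h1])
    refine ⟨uᴴ, conjTranspose_mem_unitary hu, ?_⟩
    ext k
    have h3 := congrFun (congrFun h k) 0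
    simp only [of_apply, mul_apply, mul_ite, mul_one, mul_zero, Finset.sum_ite_eq',
      Finset.mem_univ, if_true] at h3
    rw [conjTranspose_apply, ← h3, star_star]
  by_cases ha : normSq a = 0
  · exact ⟨1, one_mem _, by rw [normSq_eq_zero.1 ha]; simp [normSq]⟩
  have hpos : 0 < normSq a := lt_of_le_of_ne (normSq_nonneg a) (Ne.symm ha)
  obtain ⟨u, hu, h⟩ := key ((√(normSq a))⁻¹ • a) (by
    rw [normSq_smul, inv_pow, Real.sq_sqrt hpos.le, inv_mul_cancel₀ ha])
  refine ⟨u, hu, ?_⟩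
  rw [h, smul_inv_smul₀ (Real.sqrt_ne_zero'.2 hpos)]

variable [MeasureSpace F] [BorelSpace F] [Measure.IsAddHaarMeasure (volume : Measure F)]

instance {m n : Type*} [Finite m] [Finite n] : SecondCountableTopology (Matrix m n F) :=
  inferInstanceAs (SecondCountableTopology (m → n → F))

instance (n : Type) [Fintype n] [DecidableEq n] :
    SecondCountableTopology (unitaryMatrices F n) :=
  TopologicalSpace.Subtype.secondCountableTopology _

theorem measurable_vecMul {m n : Type*} [Fintype m] [Fintype n] :
    Measurable fun z : (m → F) × Matrix m n F => z.1 ᵥ* z.2 :=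
  (Continuous.matrix_vecMul continuous_fst continuous_snd).measurable

/-- A row of a Haar distributed unitary matrix is uniformly distributed on the unit sphere. -/
theorem lintegral_unitary_row {p : ℕ} (i : Fin p) {φ : (Fin p → F) → ℝ≥0∞} (hφ : Measurable φ) :
    volume (unitBall F (Fin p)) *
      ∫⁻ u : unitaryMatrices F (Fin p), φ ((u : Matrix (Fin p) (Fin p) F) i)
        ∂normalizedHaar (unitaryMatrices F (Fin p)) =
      ∫⁻ x in unitBall F (Fin p), φ ((√(normSq x))⁻¹ • x) := by
  have : Nonempty (Fin p) := ⟨i⟩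
  set H := normalizedHaar (unitaryMatrices F (Fin p))
  have h1 : ∀ u : unitaryMatrices F (Fin p),
      ∫⁻ x in unitBall F (Fin p), φ ((√(normSq x))⁻¹ • (x ᵥ* (u : Matrix (Fin p) (Fin p) F))) =
        ∫⁻ x in unitBall F (Fin p), φ ((√(normSq x))⁻¹ • x) := by
    intro u
    rw [← lintegral_indicator measurableSet_unitBall, ← lintegral_indicator measurableSet_unitBall,
      ← (measurePreserving_vecMul u.2).lintegral_comp (f := (unitBall F (Fin p)).indicator
        fun x => φ ((√(normSq x))⁻¹ • x))
        ((hφ.comp (((measurable_normSq.sqrt).inv).smul measurable_id)).indicator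
          measurableSet_unitBall)]
    refine lintegral_congr fun x => ?_
    simp only [indicator, unitBall, mem_ofPred_eq, normSq_vecMul_unitary u.2]
    rfl
  have hm : Measurable fun z : (Fin p → F) × unitaryMatrices F (Fin p) =>
      φ ((√(normSq z.1))⁻¹ • (z.1 ᵥ* (z.2 : Matrix (Fin p) (Fin p) F))) := by
    have e1 : Measurable fun z : (Fin p → F) × unitaryMatrices F (Fin p) => (√(normSq z.1))⁻¹ :=
      ((measurable_normSq.comp measurable_fst).sqrt).inv
    have e2 : Measurable fun z : (Fin p → F) × unitaryMatrices F (Fin p) =>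
        z.1 ᵥ* (z.2 : Matrix (Fin p) (Fin p) F) :=
      measurable_vecMul.comp (measurable_fst.prodMk (measurable_subtype_coe.comp measurable_snd))
    exact hφ.comp (e1.smul e2)
  -- The average of `φ(x / |x|)` over the ball is unchanged by `x ↦ x u`, so it may also be averaged
  -- over `u`. For fixed `x ≠ 0`, `x u / |x|` is row `i` of `v u` for a fixed unitary `v`, and `v u`
  -- is again Haar distributed.
  have h2 : ∫⁻ x in unitBall F (Fin p), φ ((√(normSq x))⁻¹ • x) =
      ∫⁻ x in unitBall F (Fin p), ∫⁻ u : unitaryMatrices F (Fin p),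
        φ ((√(normSq x))⁻¹ • (x ᵥ* (u : Matrix (Fin p) (Fin p) F))) ∂H := by
    rw [lintegral_lintegral_swap hm.aemeasurable, lintegral_congr h1, lintegral_const,
      measure_univ, mul_one]
  rw [h2]
  have h3 : ∀ᵐ x ∂(volume.restrict (unitBall F (Fin p))),
      ∫⁻ u : unitaryMatrices F (Fin p),
        φ ((√(normSq x))⁻¹ • (x ᵥ* (u : Matrix (Fin p) (Fin p) F))) ∂H =
      ∫⁻ u : unitaryMatrices F (Fin p), φ ((u : Matrix (Fin p) (Fin p) F) i) ∂H := by
    refine ae_restrict_of_ae ?_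
    have h0 : ∀ᵐ x : Fin p → F, x ≠ 0 := by
      simp [ae_iff, measure_singleton]
    filter_upwards [h0] with x hx
    obtain ⟨v, hv, h⟩ := exists_unitary_row i x
    have hpos : √(normSq x) ≠ 0 := Real.sqrt_ne_zero'.2
      (lt_of_le_of_ne (normSq_nonneg x) fun h => hx (normSq_eq_zero.1 h.symm))
    have h4 : ∀ u : Matrix (Fin p) (Fin p) F, (√(normSq x))⁻¹ • (x ᵥ* u) = (v * u) i := by
      intro u
      conv_lhs => rw [← smul_vecMul]; enter [1, 2]; rw [h]
      rw [inv_smul_smul₀ hpos]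
      rfl
    simp only [h4]
    exact lintegral_mul_left_normalizedHaar
      (fun u : unitaryMatrices F (Fin p) => φ ((u : Matrix (Fin p) (Fin p) F) i)) ⟨v, hv⟩
  rw [lintegral_congr_ae h3, lintegral_const, Measure.restrict_apply_univ, mul_comm]

theorem lintegral_normSq_lt {ι : Type*} [Fintype ι] {t : ℝ} (ht : 0 < t) (n : ℕ) :
    ∫⁻ z : ι → F, (if normSq z < t then ENNReal.ofReal (√(normSq z) ^ n) else 0) =
      ENNReal.ofReal (t ^ (((Module.finrank ℝ (ι → F) : ℝ) + n) / 2)) *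
        ∫⁻ z : ι → F, if normSq z < 1 then ENNReal.ofReal (√(normSq z) ^ n) else 0 := by
  have hs := Real.sqrt_pos.2 ht
  have hm : ∀ t : ℝ, Measurable fun z : ι → F =>
      (if normSq z < t then ENNReal.ofReal (√(normSq z) ^ n) else 0 : ℝ≥0∞) := fun t =>
    Measurable.ite (measurableSet_lt measurable_normSq measurable_const) (by fun_prop)
      measurable_const
  rw [lintegral_eq_mul_lintegral_smul (hm t) hs]
  have h : ∀ z : ι → F, (if normSq (√t • z) < t then ENNReal.ofReal (√(normSq (√t • z)) ^ n) else 0)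
      = ENNReal.ofReal (√t ^ n) *
        (if normSq z < 1 then ENNReal.ofReal (√(normSq z) ^ n) else 0 : ℝ≥0∞) := by
    intro z
    rw [normSq_smul, Real.sq_sqrt ht.le, Real.sqrt_mul ht.le, mul_pow,
      ENNReal.ofReal_mul (by positivity)]
    have : t * normSq z < t ↔ normSq z < 1 := by
      constructor <;> intro h <;> nlinarith
    simp only [this, mul_ite, mul_zero]
  simp only [h]
  rw [lintegral_const_mul _ (hm 1), ← mul_assoc, ← ENNReal.ofReal_mul (by positivity), ← pow_add]
  congr 2
  rw [← Real.rpow_natCast, Real.sqrt_eq_rpow, ← Real.rpow_mul ht.le]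
  congr 1
  push_cast; ring

theorem lintegral_fin_add {q k : ℕ} {g : (Fin (q + k) → F) → ℝ≥0∞} (hg : Measurable g) :
    ∫⁻ x, g x = ∫⁻ z : Fin k → F, ∫⁻ y : Fin q → F, g (Fin.append y z) := by
  have h1 := (volume_measurePreserving_piCongrLeft (fun _ : Fin (q + k) => F)
    (finSumFinEquiv (m := q) (n := k)))
  have h2 := (volume_measurePreserving_sumPiEquivProdPi_symm
    (fun _ : Fin q ⊕ Fin k => F))
  have h3 := h1.comp h2
  rw [← h3.lintegral_comp hg]
  refine (lintegral_prod_symm' _ (hg.comp h3.measurable)).trans ?_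
  refine lintegral_congr fun z => lintegral_congr fun y => ?_
  refine congrArg g (funext fun i => ?_)
  refine Fin.addCases (fun j => ?_) (fun j => ?_) i
  · rw [Fin.append_left]
    have := Equiv.piCongrLeft_apply_apply (fun _ : Fin (q + k) => F) finSumFinEquiv
      ((MeasurableEquiv.sumPiEquivProdPi (fun _ : Fin q ⊕ Fin k => F)).symm (y, z)) (Sum.inl j)
    exact this
  · rw [Fin.append_right]
    have := Equiv.piCongrLeft_apply_apply (fun _ : Fin (q + k) => F) finSumFinEquiv
      ((MeasurableEquiv.sumPiEquivProdPi (fun _ : Fin q ⊕ Fin k => F)).symm (y, z)) (Sum.inr j)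
    exact this

theorem normSq_append {q k : ℕ} (y : Fin q → F) (z : Fin k → F) :
    normSq (Fin.append y z) = normSq y + normSq z := by
  simp [normSq, Fin.sum_univ_add]

theorem one_add_normSq_smul {ι : Type*} [Fintype ι] {w : ι → F} (hw : normSq w < 1) :
    1 + normSq ((√(1 - normSq w))⁻¹ • w) = (1 - normSq w)⁻¹ := by
  have h : 0 < 1 - normSq w := by linarith
  rw [normSq_smul, inv_pow, Real.sq_sqrt h.le]
  field_simp; ring

/-- The law of the first `q` coordinates of a row of a Haar distributed unitary matrix. -/
theorem exists_lintegral_unitary_row_append {q k : ℕ} (hq : 0 < q) (hk : 0 < k)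
    (i : Fin (q + k)) :
    ∃ C : ℝ≥0∞, ∀ g : (Fin q → F) → ℝ≥0∞, Measurable g →
      ∫⁻ u : unitaryMatrices F (Fin (q + k)),
        g (fun j => (u : Matrix (Fin (q + k)) (Fin (q + k)) F) i (Fin.castAdd k j))
        ∂normalizedHaar (unitaryMatrices F (Fin (q + k))) =
      C * ∫⁻ y in unitBall F (Fin q), g y *
        ENNReal.ofReal ((1 - normSq y) ^ ((Module.finrank ℝ F * k : ℝ) / 2 - 1)) := by
  have : Nonempty (Fin q) := ⟨⟨0, hq⟩⟩
  have : Nonempty (Fin k) := ⟨⟨0, hk⟩⟩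
  set n := Module.finrank ℝ (Fin q → F) with hn
  set J := ∫⁻ z : Fin k → F, if normSq z < 1 then ENNReal.ofReal (√(normSq z) ^ n) else 0 with hJ
  refine ⟨(volume (unitBall F (Fin (q + k))))⁻¹ * J, fun g hg => ?_⟩
  have hrow := lintegral_unitary_row i (φ := fun x => g fun j => x (Fin.castAdd k j))
    (hg.comp (by fun_prop))
  set G : (Fin (q + k) → F) → ℝ≥0∞ := (unitBall F (Fin (q + k))).indicator
    fun x => g fun j => ((√(normSq x))⁻¹ • x) (Fin.castAdd k j) with hG
  have hGm : Measurable G := by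
    refine Measurable.indicator (hg.comp ?_) measurableSet_unitBall
    exact measurable_pi_lambda _ fun j => (measurable_pi_apply (Fin.castAdd k j)).comp
      ((measurable_normSq.sqrt.inv).smul measurable_id)
  rw [mul_assoc, ← (ENNReal.mul_right_inj volume_unitBall_ne_zero volume_unitBall_ne_top :
    volume (unitBall F (Fin (q + k))) * _ = volume (unitBall F (Fin (q + k))) * _ ↔ _), hrow,
    ← mul_assoc, ENNReal.mul_inv_cancel volume_unitBall_ne_zero volume_unitBall_ne_top, one_mul,
    ← lintegral_indicator measurableSet_unitBall, ← hG, lintegral_fin_add hGm]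
  have hz : ∀ᵐ z : Fin k → F, z ≠ 0 := by simp [ae_iff, measure_singleton]
  have hite : Measurable fun z : (Fin q → F) × (Fin k → F) =>
      (if normSq z.2 < 1 - normSq z.1 then ENNReal.ofReal (√(normSq z.2) ^ n) else 0 : ℝ≥0∞) := by
    refine Measurable.ite (measurableSet_lt ?_ ?_) ?_ measurable_const
    · exact measurable_normSq.comp measurable_snd
    · exact measurable_const.sub (measurable_normSq.comp measurable_fst)
    · exact ((measurable_normSq.comp measurable_snd).sqrt.pow_const n).ennreal_ofReal
  have hgw : Measurable fun w : Fin q → F =>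
      g w * ENNReal.ofReal ((1 - normSq w) ^ (-((n : ℝ) / 2 + 1))) :=
    hg.mul ((measurable_const.sub measurable_normSq).pow_const _).ennreal_ofReal
  -- For fixed `z` substitute `y = |z| w / √(1 - |w|²)`. The vector `(y, z)` then has squared length
  -- `|z|² / (1 - |w|²)`, its normalized first coordinates are `w`, and membership in the unit ball
  -- becomes `|z|² < 1 - |w|²`.
  have h1 : ∀ᵐ z : Fin k → F, ∫⁻ y : Fin q → F, G (Fin.append y z) =
      ∫⁻ w in unitBall F (Fin q), g w * ENNReal.ofReal ((1 - normSq w) ^ (-((n : ℝ) / 2 + 1))) *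
        (if normSq z < 1 - normSq w then ENNReal.ofReal (√(normSq z) ^ n) else 0) := by
    filter_upwards [hz] with z hz
    have hpos : 0 < normSq z := lt_of_le_of_ne (normSq_nonneg z) fun h => hz (normSq_eq_zero.1 h.symm)
    have hr := Real.sqrt_pos.2 hpos
    have hmeas : Measurable fun y : Fin q → F => G (Fin.append y z) := by
      refine hGm.comp (measurable_pi_lambda _ fun i => ?_)
      refine Fin.addCases (fun j => ?_) (fun j => ?_) i
      · simp only [Fin.append_left]; fun_prop
      · simp only [Fin.append_right]; fun_prop
    rw [lintegral_eq_mul_lintegral_smul hmeas hr, lintegral_eq_lintegral_unitBall,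
      ← lintegral_const_mul]
    · refine setLIntegral_congr_fun measurableSet_unitBall fun w hw => ?_
      have hw' : 0 < 1 - normSq w := sub_pos.2 hw
      have e1 := one_add_normSq_smul hw
      set y := (√(1 - normSq w))⁻¹ • w with hy
      have e2 : normSq (Fin.append (√(normSq z) • y) z) = normSq z * (1 - normSq w)⁻¹ := by
        rw [normSq_append, normSq_smul, Real.sq_sqrt hpos.le, ← e1]; ring
      have e3 : normSq z * (1 - normSq w)⁻¹ < 1 ↔ normSq z < 1 - normSq w := by
        rw [mul_inv_lt_iff₀ hw', one_mul]
      have e4 : (fun j => ((√(normSq (Fin.append (√(normSq z) • y) z)))⁻¹ •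
          Fin.append (√(normSq z) • y) z) (Fin.castAdd k j)) = w := by
        ext j
        rw [Pi.smul_apply, Fin.append_left, e2, Real.sqrt_mul hpos.le, Real.sqrt_inv, hy,
          Pi.smul_apply, Pi.smul_apply, smul_smul, smul_smul]
        convert one_smul ℝ (w j)
        have := Real.sqrt_pos.2 hw'
        field_simp
      classical
      rw [hG, indicator_apply, e4]
      simp only [unitBall, mem_ofPred_eq, e2, e3]
      split_ifs
      · rw [← hn]; ring
      · simp
    · refine (hmeas.comp (measurable_const_smul (√(normSq z)))).comp ?_ |>.mul ?_
      · exact ((measurable_const.sub measurable_normSq).sqrt.inv).smul measurable_id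
      · exact ((measurable_const.sub measurable_normSq).pow_const _).ennreal_ofReal
    · exact hmeas.comp (measurable_const_smul (√(normSq z)))
  -- With `n = dq`, the integral over `z` scales like `(1 - |w|²)^((dk + n)/2)`. The Jacobian
  -- exponent `-(n/2 + 1)` leaves `dk/2 - 1`.
  rw [lintegral_congr_ae h1, lintegral_lintegral_swap, ← lintegral_const_mul]
  · refine setLIntegral_congr_fun measurableSet_unitBall fun w hw => ?_
    have hw' : 0 < 1 - normSq w := sub_pos.2 hw
    have hJw : Measurable fun z : Fin k → F =>
        (if normSq z < 1 - normSq w then ENNReal.ofReal (√(normSq z) ^ n) else 0 : ℝ≥0∞) :=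
      hite.comp measurable_prodMk_left
    rw [lintegral_const_mul _ hJw, lintegral_normSq_lt hw', ← hJ, mul_comm J, mul_assoc, mul_assoc,
      ← mul_assoc (ENNReal.ofReal _) (ENNReal.ofReal _), ← ENNReal.ofReal_mul (by positivity),
      ← Real.rpow_add hw', hn, Module.finrank_pi_fintype, Module.finrank_pi_fintype]
    congr 4
    simp; ring
  · exact hg.mul ((measurable_const.sub measurable_normSq).pow_const _).ennreal_ofReal
  · refine Measurable.aemeasurable ?_
    exact (hgw.comp measurable_snd).mul (hite.comp measurable_swap)

end RowLaw
end Grassmann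

/-! ### The matrix ball and its decomposition by the first row. -/

namespace Grassmann
open Set ENNReal

section RectBall

variable {F : Type} [NormedRing F] [StarRing F] [NormedStarGroup F] [NormedAlgebra ℝ F]
  [IsScalar F]

/-- The ball of rectangular matrices `w` with `w* w < 1`. -/
def rectBall (F : Type) [NormedRing F] (m q : ℕ) : Set (Matrix (Fin m) (Fin q) F) :=
  {w | ∀ a : Fin q → F, a ≠ 0 → normSq (w *ᵥ a) < normSq a}

/-- The determinant of `1 - w* w`. -/
def gramDet [HasDet F] {m q : ℕ} (w : Matrix (Fin m) (Fin q) F) : ℝ :=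
  (HasDet.det (Fin q) (1 - wᴴ * w)).re

theorem matrixBall_eq (q : ℕ) : matrixBall F q = rectBall F q q := rfl

/-- Put a row on top of a matrix. -/
def consRow {m q : ℕ} (y : Fin q → F) (w : Matrix (Fin m) (Fin q) F) :
    Matrix (Fin (m + 1)) (Fin q) F := of (Fin.cons y w)

@[simp] theorem consRow_zero {m q : ℕ} (y : Fin q → F) (w : Matrix (Fin m) (Fin q) F) :
    consRow y w 0 = y := rfl

@[simp] theorem consRow_succ {m q : ℕ} (y : Fin q → F) (w : Matrix (Fin m) (Fin q) F)
    (i : Fin m) : consRow y w i.succ = w i := rfl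

theorem consRow_gram {m q : ℕ} (y : Fin q → F) (w : Matrix (Fin m) (Fin q) F) :
    (consRow y w)ᴴ * consRow y w = vecMulVec (star y) y + wᴴ * w := by
  ext i j
  simp [mul_apply, Fin.sum_univ_succ, vecMulVec_apply]

theorem normSq_consRow_mulVec {m q : ℕ} (y : Fin q → F) (w : Matrix (Fin m) (Fin q) F)
    (a : Fin q → F) :
    normSq (consRow y w *ᵥ a) = ‖y ⬝ᵥ a‖ ^ 2 + normSq (w *ᵥ a) := by
  simp only [normSq, Fin.sum_univ_succ, mulVec, consRow_zero, consRow_succ]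

/-- The positive square root of `1 - y* y`. -/
def fiberRoot {q : ℕ} (y : Fin q → F) : Matrix (Fin q) (Fin q) F :=
  -- With `s = √(1 - |y|²)` the eigenvalue along `y*` is `1 - |y|² / (1 + s) = s`. Written in this
  -- way the root involves no division by `|y|` and is continuous at zero.
  1 - (1 + √(1 - normSq y))⁻¹ • vecMulVec (star y) y

variable [ProperSpace F]

theorem conjTranspose_mul_realDiag_update_mul {q : ℕ} {v : Matrix (Fin q) (Fin q) F}
    (hv : v ∈ unitary (Matrix (Fin q) (Fin q) F)) (i : Fin q) (r : ℝ) :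
    vᴴ * realDiag F (Function.update 1 i r) * v = 1 + (r - 1) • vecMulVec (star (v i)) (v i) := by
  have h : realDiag F (Function.update 1 i r) = 1 + (r - 1) • single i i (1 : F) := by
    ext a b
    by_cases hab : a = b
    · subst hab
      by_cases ha : a = i
      · subst ha; simp [realDiag, Algebra.algebraMap_eq_smul_one, sub_smul]
      · simp [realDiag, ha, Ne.symm ha]
    · by_cases ha : a = i
      · subst ha; simp [realDiag, hab]
      · simp [realDiag, hab, Ne.symm ha]
  rw [h, mul_add, add_mul, mul_one, conjTranspose_mul_self_of_unitary hv, Matrix.mul_smul,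
    Matrix.smul_mul]
  congr 2
  ext a b
  simp [mul_apply, single_apply, vecMulVec_apply, Finset.sum_ite_eq', ite_and]

/-- In an orthonormal basis containing the direction of `y`, both matrices are diagonal and differ
from the identity in one entry only. -/
theorem exists_fiberRoot_eq {q : ℕ} (i : Fin q) {y : Fin q → F} (hy : normSq y ≤ 1) :
    ∃ v ∈ unitary (Matrix (Fin q) (Fin q) F),
      1 - vecMulVec (star y) y = vᴴ * realDiag F (Function.update 1 i (1 - normSq y)) * v ∧
      fiberRoot y = vᴴ * realDiag F (Function.update 1 i (√(1 - normSq y))) * v := by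
  obtain ⟨v, hv, h⟩ := exists_unitary_row i y
  have hP : vecMulVec (star y) y = normSq y • vecMulVec (star (v i)) (v i) := by
    conv_lhs => rw [h]
    ext a b
    simp only [vecMulVec_apply, Pi.star_apply, Pi.smul_apply, StarModule.star_smul, star_trivial,
      Matrix.smul_apply, smul_mul_smul_comm, Real.mul_self_sqrt (normSq_nonneg y)]
  have hs : √(1 - normSq y) ^ 2 = 1 - normSq y := Real.sq_sqrt (by linarith)
  have hs0 := Real.sqrt_nonneg (1 - normSq y)
  refine ⟨v, hv, ?_, ?_⟩
  · rw [conjTranspose_mul_realDiag_update_mul hv, hP]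
    module
  · rw [conjTranspose_mul_realDiag_update_mul hv, fiberRoot, hP, smul_smul, sub_eq_add_neg,
      ← neg_smul]
    congr 2
    have : (1 + √(1 - normSq y)) ≠ 0 := by positivity
    field_simp
    linarith

theorem fiberRoot_mul_self {q : ℕ} {y : Fin q → F} (hy : normSq y ≤ 1) :
    fiberRoot y * fiberRoot y = 1 - vecMulVec (star y) y := by
  rcases Nat.eq_zero_or_pos q with rfl | hq
  · exact Subsingleton.elim _ _
  obtain ⟨v, hv, h1, h2⟩ := exists_fiberRoot_eq ⟨0, hq⟩ hy
  rw [h1, h2]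
  set D := realDiag F (Function.update 1 (⟨0, hq⟩ : Fin q) (√(1 - normSq y))) with hD
  calc _ = vᴴ * D * (v * vᴴ) * D * v := by simp only [mul_assoc]
    _ = _ := by
      rw [hD, mul_conjTranspose_self_of_unitary hv, mul_one, mul_assoc vᴴ, realDiag_mul]
      congr 3
      ext k
      by_cases hk : k = ⟨0, hq⟩
      · subst hk; simp [Real.mul_self_sqrt (sub_nonneg.2 hy)]
      · simp [hk]

theorem fiberRoot_conjTranspose {q : ℕ} {y : Fin q → F} (hy : normSq y ≤ 1) :
    (fiberRoot y)ᴴ = fiberRoot y := by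
  rcases Nat.eq_zero_or_pos q with rfl | hq
  · exact Subsingleton.elim _ _
  obtain ⟨v, hv, h1, h2⟩ := exists_fiberRoot_eq ⟨0, hq⟩ hy
  rw [h2]
  simp [mul_assoc]

theorem continuous_fiberRoot {q : ℕ} : Continuous (fiberRoot : (Fin q → F) → _) := by
  unfold fiberRoot
  have h1 : Continuous fun y : Fin q → F => (1 + √(1 - normSq y))⁻¹ :=
    Continuous.inv₀ (continuous_const.add (continuous_const.sub continuous_normSq).sqrt)
      fun y => by positivity
  have h2 : Continuous fun y : Fin q → F => vecMulVec (star y) y :=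
    Continuous.matrix_vecMulVec continuous_star continuous_id
  exact continuous_const.sub (h1.smul h2)

theorem fiberRoot_mulVec {q : ℕ} {y : Fin q → F} (hy : normSq y ≤ 1) (a : Fin q → F) :
    ‖y ⬝ᵥ a‖ ^ 2 + normSq (fiberRoot y *ᵥ a) = normSq a := by
  rw [← normSq_consRow_mulVec]
  have := normSq_mulVec_of_conjTranspose_mul_eq (A := consRow y (fiberRoot y))
    (B := (1 : Matrix (Fin q) (Fin q) F)) (by
      rw [consRow_gram, fiberRoot_conjTranspose hy, fiberRoot_mul_self hy]; simp) a
  rwa [one_mulVec] at this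

/-- This identity drives the recursion over the rows: it makes determinants factor when a first row
`y` is split off. -/
theorem one_sub_consRow_gram {m q : ℕ} {y : Fin q → F} (hy : normSq y ≤ 1)
    (w : Matrix (Fin m) (Fin q) F) :
    1 - (consRow y (w * fiberRoot y))ᴴ * consRow y (w * fiberRoot y) =
      fiberRoot y * (1 - wᴴ * w) * fiberRoot y := by
  rw [consRow_gram, mul_sub, sub_mul, mul_one, fiberRoot_mul_self hy, conjTranspose_mul,
    fiberRoot_conjTranspose hy, ← sub_sub]
  simp only [Matrix.mul_assoc]

theorem exists_fiberRoot_inv {q : ℕ} {y : Fin q → F} (hy : normSq y < 1) :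
    ∃ h : Matrix (Fin q) (Fin q) F, fiberRoot y * h = 1 ∧ h * fiberRoot y = 1 := by
  rcases Nat.eq_zero_or_pos q with rfl | hq
  · exact ⟨1, Subsingleton.elim _ _, Subsingleton.elim _ _⟩
  obtain ⟨v, hv, h1, h2⟩ := exists_fiberRoot_eq ⟨0, hq⟩ hy.le
  have hs : √(1 - normSq y) ≠ 0 := Real.sqrt_ne_zero'.2 (by linarith)
  have key : ∀ r s : ℝ, r * s = 1 →
      (vᴴ * realDiag F (Function.update 1 ⟨0, hq⟩ r) * v) *
        (vᴴ * realDiag F (Function.update 1 ⟨0, hq⟩ s) * v) = 1 := by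
    intro r s hrs
    calc _ = vᴴ * (realDiag F (Function.update 1 ⟨0, hq⟩ r) * (v * vᴴ) *
          realDiag F (Function.update 1 ⟨0, hq⟩ s)) * v := by simp only [mul_assoc]
      _ = vᴴ * 1 * v := by
        rw [mul_conjTranspose_self_of_unitary hv, mul_one, realDiag_mul, ← realDiag_one]
        congr 3
        ext k
        by_cases hk : k = ⟨0, hq⟩
        · subst hk; simp [hrs]
        · simp [hk]
      _ = 1 := by rw [mul_one, conjTranspose_mul_self_of_unitary hv]
  refine ⟨vᴴ * realDiag F (Function.update 1 ⟨0, hq⟩ (√(1 - normSq y))⁻¹) * v, ?_, ?_⟩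
  · rw [h2]; exact key _ _ (mul_inv_cancel₀ hs)
  · rw [h2]; exact key _ _ (inv_mul_cancel₀ hs)

/-- By `fiberRoot_mulVec` the term `|y a|²` cancels on both sides and leaves the condition on `w` at
the vector `h a`, with `h` the root. Since `|y| < 1`, `h` is invertible and every vector arises in
this way. -/
theorem consRow_mem_rectBall_iff {m q : ℕ} {y : Fin q → F} (hy : normSq y < 1)
    (w : Matrix (Fin m) (Fin q) F) :
    consRow y (w * fiberRoot y) ∈ rectBall F (m + 1) q ↔ w ∈ rectBall F m q := by
  obtain ⟨h, h1, h2⟩ := exists_fiberRoot_inv hy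
  simp only [rectBall, mem_ofPred_eq, normSq_consRow_mulVec]
  have e : ∀ a, ‖y ⬝ᵥ a‖ ^ 2 + normSq ((w * fiberRoot y) *ᵥ a) < normSq a ↔
      normSq (w *ᵥ (fiberRoot y *ᵥ a)) < normSq (fiberRoot y *ᵥ a) := by
    intro a
    rw [← fiberRoot_mulVec hy.le a, mulVec_mulVec]
    exact add_lt_add_iff_left _
  simp only [e]
  constructor
  · intro H a ha
    have := H (h *ᵥ a) fun h0 => ha (by
      have := congrArg (fiberRoot y *ᵥ ·) h0
      simpa [h1] using this)
    rwa [mulVec_mulVec _ (fiberRoot y), h1, one_mulVec] at this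
  · intro H a ha
    exact H _ fun h0 => ha (by
      have := congrArg (h *ᵥ ·) h0
      simpa [h2] using this)

theorem normSq_lt_one_of_consRow_mem {m q : ℕ} {y : Fin q → F} {w : Matrix (Fin m) (Fin q) F}
    (h : consRow y w ∈ rectBall F (m + 1) q) : normSq y < 1 := by
  by_cases hy : y = 0
  · subst hy; simp [normSq]
  -- The test vector `y*` turns the ball condition into `|y|⁴ < |y|²`, up to a nonnegative term on
  -- the left.
  have h1 := h (star y) (by simpa using hy)
  rw [normSq_consRow_mulVec, dotProduct_star_self, norm_algebraMap_eq, sq_abs] at h1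
  have h2 : normSq (star y) = normSq y := by simp [normSq]
  have h3 := normSq_nonneg (w *ᵥ star y)
  have h4 : 0 < normSq y := lt_of_le_of_ne (normSq_nonneg y) fun h => hy (normSq_eq_zero.1 h.symm)
  rw [h2] at h1
  nlinarith

/-- By homogeneity it suffices to test unit vectors. They form a compact set, so a strict inequality
persists for nearby matrices. -/
theorem isOpen_rectBall (m q : ℕ) : IsOpen (rectBall F m q) := by
  have hS : IsCompact {a : Fin q → F | normSq a = 1} := by
    refine (isCompact_univ_pi fun _ : Fin q => isCompact_closedBall (0 : F) 1).of_isClosed_subset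
      (isClosed_eq (by unfold normSq; fun_prop) continuous_const) fun a ha i _ => ?_
    rw [mem_closedBall_zero_iff]
    have h1 : ‖a i‖ ^ 2 ≤ normSq a :=
      Finset.single_le_sum (f := fun i => ‖a i‖ ^ 2) (fun _ _ => by positivity) (Finset.mem_univ i)
    rw [mem_ofPred_eq] at ha
    rw [ha] at h1
    exact (sq_le_one_iff₀ (norm_nonneg _)).1 h1
  have e : rectBall F m q = {w | ∀ a ∈ {a : Fin q → F | normSq a = 1}, normSq (w *ᵥ a) < 1} := by
    ext w
    refine ⟨fun h a (ha : normSq a = 1) => ?_, fun h a ha => ?_⟩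
    · have := h a fun h0 => by simp [h0, normSq] at ha
      rwa [ha] at this
    · have hpos : 0 < normSq a :=
        lt_of_le_of_ne (normSq_nonneg a) fun h => ha (normSq_eq_zero.1 h.symm)
      have h1 := h ((√(normSq a))⁻¹ • a) (by
        rw [mem_ofPred_eq, normSq_smul, inv_pow, Real.sq_sqrt hpos.le, inv_mul_cancel₀ hpos.ne'])
      rw [mulVec_smul, normSq_smul, inv_pow, Real.sq_sqrt hpos.le, inv_mul_lt_iff₀ hpos,
        mul_one] at h1
      exact h1
  rw [e, isOpen_iff_mem_nhds]
  intro w hw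
  refine hS.eventually_forall_of_forall_eventually (P := fun w a => normSq (w *ᵥ a) < 1) ?_
  intro a ha
  have hc : Continuous fun z : Matrix (Fin m) (Fin q) F × (Fin q → F) => normSq (z.1 *ᵥ z.2) := by
    have : Continuous fun z : Matrix (Fin m) (Fin q) F × (Fin q → F) => z.1 *ᵥ z.2 :=
      continuous_fst.matrix_mulVec continuous_snd
    unfold normSq
    fun_prop
  exact hc.continuousAt.eventually_lt continuousAt_const (hw a ha)

/-- Contractive matrices: the closure of the ball. -/
def closedRectBall (F : Type) [NormedRing F] (m q : ℕ) : Set (Matrix (Fin m) (Fin q) F) :=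
  {w | ∀ a : Fin q → F, normSq (w *ᵥ a) ≤ normSq a}

theorem rectBall_subset_closedRectBall (m q : ℕ) : rectBall F m q ⊆ closedRectBall F m q := by
  intro w hw a
  by_cases ha : a = 0
  · simp [ha, normSq]
  · exact (hw a ha).le

theorem exists_one_sub_gram_eq {m q : ℕ} {w : Matrix (Fin m) (Fin q) F}
    (hw : w ∈ closedRectBall F m q) :
    ∃ v ∈ unitary (Matrix (Fin q) (Fin q) F), ∃ r : Fin q → ℝ, (∀ i, 0 ≤ r i ∧ r i ≤ 1) ∧
      (w ∈ rectBall F m q → ∀ i, 0 < r i) ∧ 1 - wᴴ * w = v * realDiag F r * vᴴ := by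
  obtain ⟨v, hv, σ, -, -, h⟩ := exists_gram_eq_realDiag w
  have h1 : ∀ i, normSq (w *ᵥ (v *ᵥ Pi.single i 1)) = σ i ^ 2 := by
    intro i
    have := conjTranspose_mul_self_diag (w * v) i
    rw [h, realDiag, diagonal_apply_eq] at this
    rw [(algebraMap_inj (F := F)).1 this, mulVec_mulVec]
    congr 1; ext k; simp
  have h2 : ∀ i, normSq (v *ᵥ Pi.single i 1) = 1 := by
    intro i
    rw [normSq_unitary_mulVec hv, normSq, Finset.sum_eq_single i]
    · simp
    · intro j _ hj; simp [hj]
    · simp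
  refine ⟨v, hv, fun i => 1 - σ i ^ 2, fun i => ⟨?_, ?_⟩, fun hw i => ?_, ?_⟩
  · have := hw (v *ᵥ Pi.single i 1)
    rw [h1, h2] at this
    linarith
  · nlinarith [sq_nonneg (σ i)]
  · have := hw (v *ᵥ Pi.single i 1) fun h0 => by
      have := h2 i
      simp [h0, normSq] at this
    rw [h1, h2] at this
    linarith
  · have e1 : realDiag F (fun i => 1 - σ i ^ 2) = 1 - realDiag F fun i => σ i ^ 2 := by
      rw [eq_sub_iff_add_eq, realDiag_add]
      simp
    have h3 := mul_conjTranspose_self_of_unitary hv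
    rw [e1, ← h, mul_sub, sub_mul, mul_one, h3, conjTranspose_mul]
    congr 1
    calc wᴴ * w = (v * vᴴ) * (wᴴ * w) * (v * vᴴ) := by rw [h3, one_mul, mul_one]
      _ = _ := by simp only [Matrix.mul_assoc]

variable [HasDet F] [IsScalarDet F]

/-- The matrix `1 - w* w` is unitarily conjugate to a real diagonal matrix with entries in `[0, 1]`,
and the determinants of `v` and `v*` cancel. So on contractions `gramDet` loses nothing by taking
the real part. -/
theorem det_one_sub_gram {m q : ℕ} {w : Matrix (Fin m) (Fin q) F}
    (hw : w ∈ closedRectBall F m q) :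
    HasDet.det (Fin q) (1 - wᴴ * w) = (gramDet w : ℂ) ∧ 0 ≤ gramDet w ∧ gramDet w ≤ 1 ∧
      (w ∈ rectBall F m q → 0 < gramDet w) := by
  obtain ⟨v, hv, r, hr, hr', h⟩ := exists_one_sub_gram_eq hw
  have h1 : HasDet.det (Fin q) (1 - wᴴ * w) = ((∏ i, r i : ℝ) : ℂ) := by
    have h2 := congrArg (HasDet.det (F := F) (Fin q)) (conjTranspose_mul_self_of_unitary hv)
    rw [map_mul, map_one] at h2
    rw [h, map_mul, map_mul, IsScalarDet.det_realDiag _ _ fun i => (hr i).1]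
    linear_combination (((∏ i, r i : ℝ) : ℂ)) * h2
  have h3 : gramDet w = ∏ i, r i := by rw [gramDet, h1, Complex.ofReal_re]
  rw [h1, h3]
  exact ⟨rfl, Finset.prod_nonneg fun i _ => (hr i).1,
    Finset.prod_le_one (fun i _ => (hr i).1) fun i _ => (hr i).2,
    fun hw => Finset.prod_pos fun i _ => hr' hw i⟩

theorem gramDet_pos {m q : ℕ} {w : Matrix (Fin m) (Fin q) F} (hw : w ∈ rectBall F m q) :
    0 < gramDet w :=
  (det_one_sub_gram (rectBall_subset_closedRectBall m q hw)).2.2.2 hw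

theorem gramDet_le_one {m q : ℕ} {w : Matrix (Fin m) (Fin q) F} (hw : w ∈ rectBall F m q) :
    gramDet w ≤ 1 :=
  (det_one_sub_gram (rectBall_subset_closedRectBall m q hw)).2.2.1

theorem continuous_gramDet {m q : ℕ} :
    Continuous (gramDet : Matrix (Fin m) (Fin q) F → ℝ) := by
  refine Complex.continuous_re.comp ((HasDet.continuous_det (F := F) (Fin q)).comp ?_)
  exact continuous_const.sub
    ((continuous_id.matrix_conjTranspose).matrix_mul continuous_id)

/-- The root enters twice, and the square of its determinant is `1 - |y|²`. -/
theorem gramDet_consRow {m q : ℕ} (hq : 0 < q) {y : Fin q → F} (hy : normSq y < 1)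
    {w : Matrix (Fin m) (Fin q) F} (hw : w ∈ rectBall F m q) :
    gramDet (consRow y (w * fiberRoot y)) = (1 - normSq y) * gramDet w := by
  have h1 : HasDet.det (Fin q) (fiberRoot y) * HasDet.det (Fin q) (fiberRoot y) =
      ((1 - normSq y : ℝ) : ℂ) := by
    obtain ⟨v, hv, h, -⟩ := exists_fiberRoot_eq ⟨0, hq⟩ hy.le
    have h2 := congrArg (HasDet.det (F := F) (Fin q)) (conjTranspose_mul_self_of_unitary hv)
    rw [map_mul, map_one] at h2
    rw [← map_mul, fiberRoot_mul_self hy.le, h, map_mul, map_mul,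
      IsScalarDet.det_realDiag, prod_update_one]
    · linear_combination (((1 - normSq y : ℝ) : ℂ)) * h2
    · intro i
      by_cases hi : i = ⟨0, hq⟩
      · subst hi; simp [hy.le]
      · simp [hi]
  rw [gramDet, one_sub_consRow_gram hy.le, map_mul, map_mul,
    (det_one_sub_gram (rectBall_subset_closedRectBall m q hw)).1, mul_right_comm, h1,
    ← Complex.ofReal_mul, Complex.ofReal_re]

end RectBall

end Grassmann

/-! ### Integrals of determinant powers over the matrix ball. -/

namespace Grassmann
open Set ENNReal

section BallMeasure

variable {F : Type} [NormedRing F] [StarRing F] [NormedStarGroup F] [NormedAlgebra ℝ F]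
  [IsScalar F] [ProperSpace F] [MeasureSpace F] [BorelSpace F]
  [Measure.IsAddHaarMeasure (volume : Measure F)]

instance {m n : Type*} [Fintype m] [Fintype n] : SigmaFinite (volume : Measure (Matrix m n F)) :=
  inferInstanceAs (SigmaFinite (volume : Measure (m → n → F)))

theorem vecMulLinear_mul {n : Type*} [Fintype n] [DecidableEq n] (A B : Matrix n n F) :
    vecMulLinear (A * B) = vecMulLinear B ∘ₗ vecMulLinear A := by
  refine LinearMap.ext fun x => ?_
  change x ᵥ* (A * B) = (x ᵥ* A) ᵥ* B
  rw [vecMul_vecMul]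

theorem det_vecMulLinear_realDiag {n : Type*} [Fintype n] [DecidableEq n] (r : n → ℝ) :
    LinearMap.det (vecMulLinear (realDiag F r)) = (∏ i, r i) ^ Module.finrank ℝ F := by
  have h : vecMulLinear (realDiag F r) =
      LinearMap.pi fun i => (r i • LinearMap.id (R := ℝ) (M := F)) ∘ₗ LinearMap.proj i := by
    refine LinearMap.ext fun x => ?_
    ext i
    change (x ᵥ* realDiag F r) i = r i • x i
    rw [realDiag, vecMul_diagonal, ← Algebra.commutes, Algebra.smul_def]
  rw [h, LinearMap.det_pi]
  simp [Finset.prod_pow]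

theorem det_vecMulLinear_fiberRoot {q : ℕ} (hq : 0 < q) {y : Fin q → F} (hy : normSq y ≤ 1) :
    LinearMap.det (vecMulLinear (fiberRoot y)) = √(1 - normSq y) ^ Module.finrank ℝ F := by
  obtain ⟨v, hv, -, h⟩ := exists_fiberRoot_eq ⟨0, hq⟩ hy
  have h1 : LinearMap.det (vecMulLinear v) * LinearMap.det (vecMulLinear vᴴ) = 1 := by
    rw [← LinearMap.det_comp, ← vecMulLinear_mul, conjTranspose_mul_self_of_unitary hv,
      ← LinearMap.det_id (A := ℝ) (M := Fin q → F)]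
    congr 1
    refine LinearMap.ext fun x => ?_
    exact vecMul_one x
  rw [h, vecMulLinear_mul, vecMulLinear_mul, LinearMap.det_comp, LinearMap.det_comp,
    det_vecMulLinear_realDiag, prod_update_one]
  linear_combination (√(1 - normSq y) ^ Module.finrank ℝ F) * h1

/-- The change of variables `w ↦ w h` for `h` the square root of `1 - y* y`. -/
theorem lintegral_eq_lintegral_mul_fiberRoot {m q : ℕ} (hq : 0 < q) {y : Fin q → F}
    (hy : normSq y < 1) {g : Matrix (Fin m) (Fin q) F → ℝ≥0∞} (hg : Measurable g) :
    ∫⁻ w, g w = ENNReal.ofReal ((1 - normSq y) ^ ((Module.finrank ℝ F * m : ℝ) / 2)) *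
      ∫⁻ w : Matrix (Fin m) (Fin q) F, g (w * fiberRoot y) := by
  have hpos : 0 < 1 - normSq y := sub_pos.2 hy
  set L : (Fin m → Fin q → F) →ₗ[ℝ] (Fin m → Fin q → F) :=
    LinearMap.pi fun i => vecMulLinear (fiberRoot y) ∘ₗ LinearMap.proj i with hL
  have hLw : ∀ w : Matrix (Fin m) (Fin q) F, L w = w * fiberRoot y := fun w => rfl
  have hdet : LinearMap.det L = (1 - normSq y) ^ ((Module.finrank ℝ F * m : ℝ) / 2) := by
    rw [hL, LinearMap.det_pi, Finset.prod_const, det_vecMulLinear_fiberRoot hq hy.le, ← pow_mul,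
      Real.sqrt_eq_rpow, ← Real.rpow_natCast, ← Real.rpow_mul hpos.le]
    congr 1
    simp; ring
  have hdpos : 0 < LinearMap.det L := by rw [hdet]; positivity
  have hc : Continuous L := LinearMap.continuous_of_finiteDimensional _
  have h := Measure.map_linearMap_addHaar_eq_smul_addHaar
    (volume : Measure (Fin m → Fin q → F)) hdpos.ne'
  have h2 : ∫⁻ w : Matrix (Fin m) (Fin q) F, g (w * fiberRoot y) =
      ENNReal.ofReal (LinearMap.det L)⁻¹ * ∫⁻ w, g w := by
    have h3 := lintegral_map (μ := (volume : Measure (Fin m → Fin q → F)))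
      (f := fun w : Fin m → Fin q → F => g (of w)) hg hc.measurable
    rw [h, lintegral_smul_measure, smul_eq_mul, abs_of_pos (inv_pos.2 hdpos)] at h3
    exact h3.symm
  rw [h2, ← mul_assoc, ← hdet, ← ENNReal.ofReal_mul hdpos.le, mul_inv_cancel₀ hdpos.ne',
    ENNReal.ofReal_one, one_mul]

theorem continuous_consRow_mul_fiberRoot {m q : ℕ} :
    Continuous fun z : (Fin q → F) × Matrix (Fin m) (Fin q) F =>
      consRow z.1 (z.2 * fiberRoot z.1) := by
  refine continuous_matrix fun i j => ?_
  refine Fin.cases ?_ (fun i => ?_) i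
  · exact (continuous_apply j).comp continuous_fst
  · have h : Continuous fun z : (Fin q → F) × Matrix (Fin m) (Fin q) F =>
      z.2 * fiberRoot z.1 := continuous_snd.matrix_mul (continuous_fiberRoot.comp continuous_fst)
    exact h.matrix_elem i j

theorem measurable_consRow {m q : ℕ} :
    Measurable fun z : (Fin q → F) × Matrix (Fin m) (Fin q) F => consRow z.1 z.2 := by
  refine Continuous.measurable (continuous_matrix fun i j => ?_)
  refine Fin.cases ?_ (fun i => ?_) i
  · exact (continuous_apply j).comp continuous_fst
  · exact continuous_snd.matrix_elem i j

theorem measurableSet_rectBall (m q : ℕ) : MeasurableSet (rectBall F m q) :=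
  (isOpen_rectBall m q).measurableSet

theorem measurable_ofReal_one_sub_normSq_rpow {ι : Type*} [Fintype ι] (e : ℝ) :
    Measurable fun y : ι → F => ENNReal.ofReal ((1 - normSq y) ^ e) :=
  ((measurable_const.sub measurable_normSq).pow_const e).ennreal_ofReal

theorem indicator_rectBall_consRow {m q : ℕ} (g : Matrix (Fin (m + 1)) (Fin q) F → ℝ≥0∞)
    {y : Fin q → F} (hy : normSq y < 1) (w : Matrix (Fin m) (Fin q) F) :
    (rectBall F (m + 1) q).indicator g (consRow y (w * fiberRoot y)) =
      (rectBall F m q).indicator (fun w => g (consRow y (w * fiberRoot y))) w := by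
  by_cases hw : w ∈ rectBall F m q
  · rw [indicator_of_mem hw, indicator_of_mem ((consRow_mem_rectBall_iff hy w).2 hw)]
  · rw [indicator_of_notMem hw, indicator_of_notMem (mt (consRow_mem_rectBall_iff hy w).1 hw)]

/-- Decomposition of the matrix ball with respect to the first row. -/
theorem lintegral_rectBall_succ {m q : ℕ} (hq : 0 < q)
    {g : Matrix (Fin (m + 1)) (Fin q) F → ℝ≥0∞} (hg : Measurable g) :
    ∫⁻ w in rectBall F (m + 1) q, g w =
      ∫⁻ y in unitBall F (Fin q), ENNReal.ofReal ((1 - normSq y) ^ ((Module.finrank ℝ F * m : ℝ) / 2)) *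
        ∫⁻ w in rectBall F m q, g (consRow y (w * fiberRoot y)) := by
  obtain ⟨G, hG⟩ : ∃ G, G = (rectBall F (m + 1) q).indicator g := ⟨_, rfl⟩
  have hGm : Measurable G := hG ▸ hg.indicator (measurableSet_rectBall _ _)
  have h1 := (volume_preserving_piFinSuccAbove (fun _ : Fin (m + 1) => Fin q → F) 0).symm
  rw [← lintegral_indicator (measurableSet_rectBall _ _), ← hG,
    ← lintegral_indicator measurableSet_unitBall]
  have h2 : ∫⁻ w, G w = ∫⁻ z : (Fin q → F) × Matrix (Fin m) (Fin q) F, G (consRow z.1 z.2)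
      ∂(volume.prod volume) := by
    refine (h1.lintegral_comp (f := fun w : Fin (m + 1) → Fin q → F => G (of w)) hGm).symm.trans ?_
    refine lintegral_congr fun z => congrArg G ?_
    refine funext fun i => ?_
    refine Fin.cases ?_ (fun i => ?_) i
    · exact Fin.insertNth_apply_same (α := fun _ => Fin q → F) 0 z.1 z.2
    · exact Fin.insertNth_apply_succAbove (α := fun _ => Fin q → F) 0 z.1 z.2 i
  have hGc : Measurable fun z : (Fin q → F) × Matrix (Fin m) (Fin q) F => G (consRow z.1 z.2) :=
    hGm.comp measurable_consRow
  rw [h2, lintegral_prod _ hGc.aemeasurable]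
  refine lintegral_congr fun y => ?_
  by_cases hy : y ∈ unitBall F (Fin q)
  · have hyc : Measurable fun w : Matrix (Fin m) (Fin q) F => G (consRow y w) :=
      hGm.comp (measurable_consRow.comp (measurable_const.prodMk measurable_id))
    have h3 : ∫⁻ w : Matrix (Fin m) (Fin q) F, G (consRow y (w * fiberRoot y)) =
        ∫⁻ w in rectBall F m q, g (consRow y (w * fiberRoot y)) := by
      rw [← lintegral_indicator (measurableSet_rectBall _ _), hG]
      exact lintegral_congr fun w => indicator_rectBall_consRow g hy w
    rw [indicator_of_mem hy, lintegral_eq_lintegral_mul_fiberRoot hq hy hyc, h3]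
  · rw [indicator_of_notMem hy]
    refine (lintegral_congr fun w => ?_).trans lintegral_zero
    rw [hG]
    exact indicator_of_notMem (fun h => hy (normSq_lt_one_of_consRow_mem h)) _

variable [HasDet F] [IsScalarDet F]

theorem volume_rectBall_zero (q : ℕ) : rectBall F 0 q = univ := by
  ext w
  simp only [rectBall, mem_ofPred_eq, mem_univ, iff_true]
  intro a ha
  have h1 : normSq (w *ᵥ a) = 0 := by simp [normSq]
  rw [h1]
  exact lt_of_le_of_ne (normSq_nonneg a) fun h => ha (normSq_eq_zero.1 h.symm)

/-- Matrices without rows form a single point of mass one, which starts the induction over the rows.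
-/
theorem lintegral_zero_rows {q : ℕ} (g : Matrix (Fin 0) (Fin q) F → ℝ≥0∞) :
    ∫⁻ w, g w = g 0 := by
  have h : (volume : Measure (Matrix (Fin 0) (Fin q) F)) = Measure.dirac 0 :=
    Measure.pi_of_empty _ _
  rw [h, lintegral_dirac]

theorem gramDet_zero_rows {q : ℕ} (w : Matrix (Fin 0) (Fin q) F) : gramDet w = 1 := by
  have : wᴴ * w = 0 := by ext i j; simp [mul_apply]
  rw [gramDet, this, sub_zero, map_one, Complex.one_re]

/-- Row by row the integral is a product of integrals of `(1 - |y|²)^(dj/2 + s)`, with `j` below the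
number of rows. Each exponent is at least `s > -1`. -/
theorem lintegral_rectBall_gramDet_rpow_lt_top {m q : ℕ} (hq : 0 < q) {s : ℝ} (hs : -1 < s) :
    ∫⁻ w in rectBall F m q, ENNReal.ofReal (gramDet w ^ s) < ∞ := by
  have : Nonempty (Fin q) := ⟨⟨0, hq⟩⟩
  induction m with
  | zero =>
    rw [volume_rectBall_zero, Measure.restrict_univ, lintegral_zero_rows]
    exact ENNReal.ofReal_lt_top
  | succ m ih =>
    rw [lintegral_rectBall_succ hq (continuous_gramDet.measurable.pow_const s).ennreal_ofReal]
    have h : ∀ y ∈ unitBall F (Fin q),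
        ENNReal.ofReal ((1 - normSq y) ^ ((Module.finrank ℝ F * m : ℝ) / 2)) *
        ∫⁻ w in rectBall F m q, ENNReal.ofReal (gramDet (consRow y (w * fiberRoot y)) ^ s) =
        ENNReal.ofReal ((1 - normSq y) ^ ((Module.finrank ℝ F * m : ℝ) / 2 + s)) *
          ∫⁻ w in rectBall F m q, ENNReal.ofReal (gramDet w ^ s) := by
      intro y hy
      have hy' : 0 < 1 - normSq y := sub_pos.2 hy
      rw [Real.rpow_add hy', ENNReal.ofReal_mul (by positivity), mul_assoc]
      congr 1
      rw [← lintegral_const_mul _ (continuous_gramDet.measurable.pow_const s).ennreal_ofReal]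
      refine setLIntegral_congr_fun (measurableSet_rectBall _ _) fun w hw => ?_
      rw [gramDet_consRow hq hy hw, Real.mul_rpow hy'.le (gramDet_pos hw).le,
        ENNReal.ofReal_mul (by positivity)]
    rw [setLIntegral_congr_fun measurableSet_unitBall h, lintegral_mul_const _
      (measurable_ofReal_one_sub_normSq_rpow _)]
    refine ENNReal.mul_lt_top (lintegral_unitBall_one_sub_normSq_rpow_lt_top ?_) ih
    have : 0 ≤ (Module.finrank ℝ F * m : ℝ) / 2 := by positivity
    linarith

theorem norm_gramDet_cpow {m q : ℕ} {w : Matrix (Fin m) (Fin q) F} (hw : w ∈ rectBall F m q)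
    (s : ℂ) : ‖(gramDet w : ℂ) ^ s‖ = gramDet w ^ s.re :=
  Complex.norm_cpow_eq_rpow_re_of_pos (gramDet_pos hw) s

theorem measurable_gramDet_cpow {m q : ℕ} (s : ℂ) :
    Measurable fun w : Matrix (Fin m) (Fin q) F => (gramDet w : ℂ) ^ s :=
  (Complex.measurable_ofReal.comp continuous_gramDet.measurable).pow_const s

theorem integrableOn_gramDet_cpow {m q : ℕ} (hq : 0 < q) {s : ℂ} (hs : -1 < s.re) :
    IntegrableOn (fun w : Matrix (Fin m) (Fin q) F => (gramDet w : ℂ) ^ s) (rectBall F m q) := by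
  refine ⟨(measurable_gramDet_cpow s).aestronglyMeasurable, ?_⟩
  rw [HasFiniteIntegral, setLIntegral_congr_fun (g := fun w => ENNReal.ofReal (gramDet w ^ s.re))
    (measurableSet_rectBall _ _)]
  · exact lintegral_rectBall_gramDet_rpow_lt_top hq hs
  · intro w hw
    beta_reduce
    rw [← norm_gramDet_cpow hw, ofReal_norm]

/-- The row decomposition as an identity of measures, which applies to Bochner integrals of complex
functions. -/
theorem restrict_rectBall_succ {m q : ℕ} (hq : 0 < q) :
    (volume : Measure (Matrix (Fin (m + 1)) (Fin q) F)).restrict (rectBall F (m + 1) q) =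
      (((volume.restrict (unitBall F (Fin q))).withDensity fun y =>
        ENNReal.ofReal ((1 - normSq y) ^ ((Module.finrank ℝ F * m : ℝ) / 2))).prod
        (volume.restrict (rectBall F m q))).map
      fun z : (Fin q → F) × Matrix (Fin m) (Fin q) F => consRow z.1 (z.2 * fiberRoot z.1) := by
  have hd : Measurable fun y : Fin q → F =>
      ENNReal.ofReal ((1 - normSq y) ^ ((Module.finrank ℝ F * m : ℝ) / 2)) :=
    measurable_ofReal_one_sub_normSq_rpow _
  refine Measure.ext_of_lintegral _ fun g hg => ?_
  have hgc : Measurable fun z : (Fin q → F) × Matrix (Fin m) (Fin q) F =>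
      g (consRow z.1 (z.2 * fiberRoot z.1)) :=
    hg.comp continuous_consRow_mul_fiberRoot.measurable
  rw [lintegral_rectBall_succ hq hg, lintegral_map hg continuous_consRow_mul_fiberRoot.measurable,
    lintegral_prod _ hgc.aemeasurable,
    lintegral_withDensity_eq_lintegral_mul _ hd (Measurable.lintegral_prod_right' hgc)]
  rfl

/-- Induction over the rows: complex powers of positive reals are multiplicative, so each row
contributes a nonvanishing beta integral as a factor. -/
theorem integral_gramDet_cpow_ne_zero {m q : ℕ} (hq : 0 < q) {s : ℂ} (hs : -1 < s.re) :
    ∫ w in rectBall F m q, (gramDet w : ℂ) ^ s ≠ 0 := by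
  have : Nonempty (Fin q) := ⟨⟨0, hq⟩⟩
  induction m with
  | zero =>
    have h : (volume : Measure (Matrix (Fin 0) (Fin q) F)) = Measure.dirac 0 :=
      Measure.pi_of_empty _ _
    rw [volume_rectBall_zero, Measure.restrict_univ, h, integral_dirac, gramDet_zero_rows]
    simp
  | succ m ih =>
    have hd' : Measurable fun y : Fin q → F =>
        Real.toNNReal ((1 - normSq y) ^ ((Module.finrank ℝ F * m : ℝ) / 2)) :=
      ((measurable_const.sub measurable_normSq).pow_const _).real_toNNReal
    rw [restrict_rectBall_succ hq, integral_map
      continuous_consRow_mul_fiberRoot.measurable.aemeasurable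
      (measurable_gramDet_cpow s).aestronglyMeasurable]
    have hae : ∀ᵐ z ∂((volume.restrict (unitBall F (Fin q))).withDensity fun y =>
        ENNReal.ofReal ((1 - normSq y) ^ ((Module.finrank ℝ F * m : ℝ) / 2))).prod
        (volume.restrict (rectBall F m q)),
        ((gramDet (consRow z.1 (z.2 * fiberRoot z.1)) : ℝ) : ℂ) ^ s =
          ((1 - normSq z.1 : ℝ) : ℂ) ^ s * (gramDet z.2 : ℂ) ^ s := by
      rw [Measure.ae_prod_iff_ae_ae]
      · have h1 : ∀ᵐ y ∂((volume.restrict (unitBall F (Fin q))).withDensity fun y =>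
            ENNReal.ofReal ((1 - normSq y) ^ ((Module.finrank ℝ F * m : ℝ) / 2))),
            y ∈ unitBall F (Fin q) :=
          (withDensity_absolutelyContinuous _ _).ae_le (ae_restrict_mem measurableSet_unitBall)
        filter_upwards [h1] with y hy
        filter_upwards [ae_restrict_mem (measurableSet_rectBall m q)] with w hw
        have hy' : 0 < 1 - normSq y := sub_pos.2 hy
        rw [gramDet_consRow hq hy hw, Complex.ofReal_mul,
          Complex.mul_cpow_ofReal_nonneg hy'.le (gramDet_pos hw).le]
      · refine measurableSet_eq_fun ?_ ?_
        · exact (measurable_gramDet_cpow s).comp continuous_consRow_mul_fiberRoot.measurable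
        · refine Measurable.mul ?_ ((measurable_gramDet_cpow s).comp measurable_snd)
          exact (Complex.measurable_ofReal.comp (measurable_const.sub
            (measurable_normSq.comp measurable_fst))).pow_const s
    rw [integral_congr_ae hae, integral_prod_mul (fun y : Fin q → F => ((1 - normSq y : ℝ) : ℂ) ^ s)
      fun w : Matrix (Fin m) (Fin q) F => (gramDet w : ℂ) ^ s]
    refine mul_ne_zero ?_ ih
    have h2 : (fun y : Fin q → F =>
        ENNReal.ofReal ((1 - normSq y) ^ ((Module.finrank ℝ F * m : ℝ) / 2))) = fun y =>
        ((Real.toNNReal ((1 - normSq y) ^ ((Module.finrank ℝ F * m : ℝ) / 2)) : NNReal) : ℝ≥0∞) :=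
      rfl
    rw [h2, integral_withDensity_eq_integral_smul hd']
    have h3 := integral_unitBall_one_sub_normSq_cpow_ne_zero (F := F) (ι := Fin q)
      (s := ((Module.finrank ℝ F * m : ℝ) / 2 : ℝ) + s) (by
        rw [Complex.add_re, Complex.ofReal_re]
        have : 0 ≤ (Module.finrank ℝ F * m : ℝ) / 2 := by positivity
        linarith)
    convert h3 using 1
    refine setIntegral_congr_fun measurableSet_unitBall fun y hy => ?_
    have hy' : 0 < 1 - normSq y := sub_pos.2 hy
    rw [Complex.cpow_add _ _ (Complex.ofReal_ne_zero.2 hy'.ne'), NNReal.smul_def,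
      Real.coe_toNNReal _ (by positivity), Complex.real_smul, Complex.ofReal_cpow hy'.le]

end BallMeasure

end Grassmann

/-! ### The law of a corner of a Haar distributed unitary matrix. -/

namespace Grassmann
open Set ENNReal

section Truncation

variable {F : Type} [NormedRing F] [StarRing F] [NormedStarGroup F] [NormedAlgebra ℝ F]
  [IsScalar F] [ProperSpace F]

/-- The block matrix `1 ⊕ u`. -/
def oneBlock {p : ℕ} (u : Matrix (Fin p) (Fin p) F) : Matrix (Fin (p + 1)) (Fin (p + 1)) F :=
  consRow (Fin.cons 1 0) (of fun i => Fin.cons 0 (u i))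

theorem oneBlock_mul_zero {p q : ℕ} (u : Matrix (Fin p) (Fin p) F)
    (A : Matrix (Fin (p + 1)) (Fin q) F) : (oneBlock u * A) 0 = A 0 := by
  ext j
  simp [oneBlock, mul_apply, Fin.sum_univ_succ]

theorem oneBlock_mul_succ {p q : ℕ} (u : Matrix (Fin p) (Fin p) F)
    (A : Matrix (Fin (p + 1)) (Fin q) F) (i : Fin p) :
    (oneBlock u * A) i.succ = (u * A.submatrix Fin.succ id) i := by
  ext j
  simp [oneBlock, mul_apply, Fin.sum_univ_succ]

theorem oneBlock_conjTranspose {p : ℕ} (u : Matrix (Fin p) (Fin p) F) :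
    (oneBlock u)ᴴ = oneBlock uᴴ := by
  ext i j
  refine Fin.cases ?_ (fun i => ?_) i <;> refine Fin.cases ?_ (fun j => ?_) j <;>
    simp [oneBlock]

theorem oneBlock_mem_unitary {p : ℕ} {u : Matrix (Fin p) (Fin p) F}
    (hu : u ∈ unitary (Matrix (Fin p) (Fin p) F)) :
    oneBlock u ∈ unitary (Matrix (Fin (p + 1)) (Fin (p + 1)) F) := by
  refine mem_unitary_of_conjTranspose_mul ?_
  rw [oneBlock_conjTranspose]
  ext i j
  refine Fin.cases ?_ (fun i => ?_) i
  · rw [oneBlock_mul_zero]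
    refine Fin.cases ?_ (fun j => ?_) j <;> simp [oneBlock, one_apply, (Fin.succ_ne_zero _).symm]
  · rw [oneBlock_mul_succ]
    refine Fin.cases ?_ (fun j => ?_) j
    · simp [oneBlock, mul_apply, one_apply]
    · have := congrFun (congrFun (conjTranspose_mul_self_of_unitary hu) i) j
      rw [one_apply] at this ⊢
      simp only [Fin.succ_inj]
      rw [← this]
      simp [oneBlock, mul_apply]

theorem continuous_oneBlock {p : ℕ} : Continuous (oneBlock : Matrix (Fin p) (Fin p) F → _) := by
  refine continuous_matrix fun i j => ?_
  refine Fin.cases ?_ (fun i => ?_) i <;> refine Fin.cases ?_ (fun j => ?_) j <;>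
    simp only [oneBlock, consRow_zero, consRow_succ, Fin.cons_zero, Fin.cons_succ, of_apply]
  · exact continuous_const
  · exact continuous_const
  · exact continuous_const
  · exact continuous_id.matrix_elem i j

/-- The embedding of the standard basis of `Fᵠ` into `Fᵖ`. -/
def coordEmbedding (F : Type) [NormedRing F] {p q : ℕ} (h : q ≤ p) : Matrix (Fin p) (Fin q) F :=
  (1 : Matrix (Fin p) (Fin p) F).submatrix id (Fin.castLE h)

theorem mul_coordEmbedding {m : Type*} {p q : ℕ} (h : q ≤ p) (A : Matrix m (Fin p) F) :
    A * coordEmbedding F h = A.submatrix id (Fin.castLE h) := by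
  ext i j
  simp [coordEmbedding, mul_apply, one_apply]

theorem coordEmbedding_conjTranspose_mul {m : Type*} {p q : ℕ} (h : q ≤ p)
    (A : Matrix (Fin p) m F) :
    (coordEmbedding F h)ᴴ * A = A.submatrix (Fin.castLE h) id := by
  ext i j
  simp [coordEmbedding, mul_apply, one_apply, apply_ite star]

theorem coordEmbedding_gram {p q : ℕ} (h : q ≤ p) :
    (coordEmbedding F h)ᴴ * coordEmbedding F h = 1 := by
  rw [mul_coordEmbedding, coordEmbedding]
  ext i j
  simp [one_apply]

theorem normSq_castLE_le {p q : ℕ} (h : q ≤ p) (y : Fin p → F) :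
    normSq (fun j => y (Fin.castLE h j)) ≤ normSq y := by
  have := Finset.sum_map Finset.univ (Fin.castLEEmb h) fun i => ‖y i‖ ^ 2
  refine (le_of_eq this.symm).trans ?_
  exact Finset.sum_le_sum_of_subset_of_nonneg (Finset.subset_univ _) fun _ _ _ => by positivity

/-- The lower left part of a unitary matrix is determined by the first row, up to a rotation. -/
theorem exists_submatrix_succ_eq {p q : ℕ} (hqp : q ≤ p)
    {u : Matrix (Fin (p + 1)) (Fin (p + 1)) F}
    (hu : u ∈ unitary (Matrix (Fin (p + 1)) (Fin (p + 1)) F)) :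
    ∃ u₀ ∈ unitary (Matrix (Fin p) (Fin p) F),
      u.submatrix Fin.succ (Fin.castLE (hqp.trans p.le_succ)) =
        u₀ * (coordEmbedding F hqp * fiberRoot fun j => u 0 (Fin.castLE (hqp.trans p.le_succ) j)) := by
  set y : Fin q → F := fun j => u 0 (Fin.castLE (hqp.trans p.le_succ) j) with hy
  have hy1 : normSq y ≤ 1 := by
    rw [← normSq_unitary_row hu 0]
    exact normSq_castLE_le _ _
  -- The chosen columns of `u` are orthonormal, so below the first row `y` their Gram matrix is `1 -
  -- y* y`. That is also the Gram matrix of the coordinate embedding times the root.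
  refine exists_unitary_mul_eq hqp ?_
  rw [conjTranspose_mul, Matrix.mul_assoc, ← Matrix.mul_assoc (coordEmbedding F hqp)ᴴ,
    coordEmbedding_gram, Matrix.one_mul, fiberRoot_conjTranspose hy1, fiberRoot_mul_self hy1,
    eq_sub_iff_add_eq, add_comm, ← consRow_gram]
  have h1 : consRow y (u.submatrix Fin.succ (Fin.castLE (hqp.trans p.le_succ))) =
      u * coordEmbedding F (hqp.trans p.le_succ) := by
    rw [mul_coordEmbedding]
    ext i j
    refine Fin.cases ?_ (fun i => ?_) i <;> rfl
  rw [h1, conjTranspose_mul, Matrix.mul_assoc, ← Matrix.mul_assoc uᴴ,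
    conjTranspose_mul_self_of_unitary hu, Matrix.one_mul, coordEmbedding_gram]

theorem submatrix_oneBlock_mul {p q m : ℕ} (hqp : q ≤ p) (hmp : m ≤ p)
    {u : Matrix (Fin (p + 1)) (Fin (p + 1)) F} {u₀ : Matrix (Fin p) (Fin p) F}
    {h : Matrix (Fin q) (Fin q) F}
    (hu : u.submatrix Fin.succ (Fin.castLE (hqp.trans p.le_succ)) =
        u₀ * (coordEmbedding F hqp * h)) (u' : Matrix (Fin p) (Fin p) F) :
    (oneBlock u' * u).submatrix (Fin.castLE (Nat.succ_le_succ hmp))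
        (Fin.castLE (hqp.trans p.le_succ)) =
      consRow (fun j => u 0 (Fin.castLE (hqp.trans p.le_succ) j))
        ((u' * u₀).submatrix (Fin.castLE hmp) (Fin.castLE hqp) * h) := by
  ext i j
  refine Fin.cases ?_ (fun i => ?_) i
  · exact congrFun (oneBlock_mul_zero u' u) _
  · have h1 : (oneBlock u' * u) (Fin.castLE hmp i).succ (Fin.castLE (hqp.trans p.le_succ) j) =
        (u' * u.submatrix Fin.succ (Fin.castLE (hqp.trans p.le_succ))) (Fin.castLE hmp i) j := by
      rw [oneBlock_mul_succ]
      rfl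
    change (oneBlock u' * u) (Fin.castLE hmp i).succ (Fin.castLE (hqp.trans p.le_succ) j) = _
    rw [h1, hu, ← Matrix.mul_assoc, ← Matrix.mul_assoc, mul_coordEmbedding, consRow_succ]
    rfl

variable [MeasureSpace F] [BorelSpace F] [Measure.IsAddHaarMeasure (volume : Measure F)]

theorem exists_lintegral_unitary_row {p q : ℕ} (hq : 0 < q) (hqp : q < p) (i : Fin p) :
    ∃ C : ℝ≥0∞, ∀ g : (Fin q → F) → ℝ≥0∞, Measurable g →
      ∫⁻ u : unitaryMatrices F (Fin p),
        g (fun j => (u : Matrix (Fin p) (Fin p) F) i (Fin.castLE hqp.le j))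
        ∂normalizedHaar (unitaryMatrices F (Fin p)) =
      C * ∫⁻ y in unitBall F (Fin q), g y *
        ENNReal.ofReal ((1 - normSq y) ^ ((Module.finrank ℝ F * ((p : ℝ) - q)) / 2 - 1)) := by
  obtain ⟨k, rfl⟩ := Nat.exists_eq_add_of_lt hqp
  obtain ⟨C, hC⟩ := exists_lintegral_unitary_row_append (F := F) hq (Nat.succ_pos k) i
  refine ⟨C, fun g hg => (hC g hg).trans ?_⟩
  congr! 6
  push_cast; ring

/-- Averaging over the action of a group. -/
theorem lintegral_eq_of_lintegral_smul {Ω H : Type*} [MeasurableSpace Ω] [MeasurableSpace H]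
    {ν : Measure Ω} {η : Measure H} [SFinite ν] [IsProbabilityMeasure η]
    (a : H → Ω → Ω) (ha : Measurable fun z : Ω × H => a z.2 z.1)
    (hν : ∀ h, MeasurePreserving (a h) ν ν) {Ψ : Ω → ℝ≥0∞} (hΨ : Measurable Ψ) :
    ∫⁻ ω, Ψ ω ∂ν = ∫⁻ ω, ∫⁻ h, Ψ (a h ω) ∂η ∂ν := by
  have h1 : AEMeasurable (Function.uncurry fun (ω : Ω) (h : H) => Ψ (a h ω)) (ν.prod η) :=
    (hΨ.comp ha).aemeasurable
  rw [lintegral_lintegral_swap h1]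
  simp only [fun h => (hν h).lintegral_comp hΨ, lintegral_const, measure_univ, mul_one]

variable [HasDet F] [IsScalarDet F]

/-- The law of the upper left corner of a Haar distributed unitary matrix. -/
theorem exists_lintegral_unitary_submatrix {q : ℕ} (hq : 0 < q) (m : ℕ) :
    ∀ (p : ℕ) (hm : m + q ≤ p), ∃ C : ℝ≥0∞, ∀ φ : Matrix (Fin m) (Fin q) F → ℝ≥0∞,
      Measurable φ →
      ∫⁻ u : unitaryMatrices F (Fin p), φ ((u : Matrix (Fin p) (Fin p) F).submatrix
          (Fin.castLE (le_of_add_le_left hm)) (Fin.castLE (le_of_add_le_right hm)))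
        ∂normalizedHaar (unitaryMatrices F (Fin p)) =
      C * ∫⁻ w in rectBall F m q, φ w *
        ENNReal.ofReal (gramDet w ^ (Module.finrank ℝ F * ((p : ℝ) - m - q + 1) / 2 - 1)) := by
  induction m with
  | zero =>
    intro p hm
    refine ⟨1, fun φ hφ => ?_⟩
    rw [volume_rectBall_zero, Measure.restrict_univ, lintegral_zero_rows, gramDet_zero_rows]
    have : ∀ A : Matrix (Fin 0) (Fin q) F, A = 0 := fun A => Subsingleton.elim _ _
    simp only [this ((_ : Matrix (Fin p) (Fin p) F).submatrix _ _)]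
    simp
  | succ m ih =>
    intro p hm
    obtain ⟨p, rfl⟩ : ∃ p', p = p' + 1 := Nat.exists_eq_succ_of_ne_zero (by omega)
    have hm' : m + q ≤ p := by omega
    have hqp : q ≤ p := by omega
    have hmp : m ≤ p := by omega
    obtain ⟨C, hC⟩ := ih p hm'
    obtain ⟨C', hC'⟩ := exists_lintegral_unitary_row (F := F) hq (show q < p + 1 by omega) 0
    refine ⟨C' * C, fun φ hφ => ?_⟩
    set e : ℝ := Module.finrank ℝ F * ((p : ℝ) - m - q + 1) / 2 - 1 with he
    -- The exponent depends on `p - m` only, so it is the same at every stage of the induction.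
    have he' : Module.finrank ℝ F * (((p + 1 : ℕ) : ℝ) - (m + 1 : ℕ) - q + 1) / 2 - 1 = e := by
      rw [he]; push_cast; ring
    rw [he']
    have hDe : ∀ k, Measurable fun w : Matrix (Fin k) (Fin q) F => ENNReal.ofReal (gramDet w ^ e) :=
      fun k => (continuous_gramDet.measurable.pow_const e).ennreal_ofReal
    have hsub : Measurable fun u : Matrix (Fin (p + 1)) (Fin (p + 1)) F =>
        u.submatrix (Fin.castLE (le_of_add_le_left hm)) (Fin.castLE (le_of_add_le_right hm)) :=
      (continuous_id.matrix_submatrix _ _).measurable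
    have hmul : Measurable fun z : unitaryMatrices F (Fin (p + 1)) × unitaryMatrices F (Fin p) =>
        (⟨oneBlock (z.2 : Matrix (Fin p) (Fin p) F), oneBlock_mem_unitary z.2.2⟩ :
          unitaryMatrices F (Fin (p + 1))) * z.1 := by
      have h1 : Continuous fun z : unitaryMatrices F (Fin (p + 1)) × unitaryMatrices F (Fin p) =>
          (⟨oneBlock (z.2 : Matrix (Fin p) (Fin p) F), oneBlock_mem_unitary z.2.2⟩ :
            unitaryMatrices F (Fin (p + 1))) :=
        (continuous_oneBlock.comp (continuous_subtype_val.comp continuous_snd)).subtype_mk _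
      exact (h1.mul continuous_fst).measurable
    refine (lintegral_eq_of_lintegral_smul (η := normalizedHaar (unitaryMatrices F (Fin p)))
      (Ψ := fun u : unitaryMatrices F (Fin (p + 1)) =>
        φ ((u : Matrix (Fin (p + 1)) (Fin (p + 1)) F).submatrix
          (Fin.castLE (le_of_add_le_left hm)) (Fin.castLE (le_of_add_le_right hm))))
      (fun (v : unitaryMatrices F (Fin p)) (u : unitaryMatrices F (Fin (p + 1))) =>
        ⟨oneBlock (v : Matrix (Fin p) (Fin p) F), oneBlock_mem_unitary v.2⟩ * u) hmul
      (fun v => measurePreserving_mul_left _ _)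
      (hφ.comp (hsub.comp measurable_subtype_coe))).trans ?_
    -- Multiplication by `1 ⊕ v` keeps the first row `y` and turns the remaining part of the corner
    -- into a corner of `v u₀` times the root. Right invariance of Haar measure removes `u₀`, and
    -- the induction hypothesis in dimension `p` applies.
    have hinner : ∀ u : unitaryMatrices F (Fin (p + 1)),
        ∫⁻ v : unitaryMatrices F (Fin p), φ (((oneBlock (v : Matrix (Fin p) (Fin p) F)) *
          (u : Matrix (Fin (p + 1)) (Fin (p + 1)) F)).submatrix
            (Fin.castLE (le_of_add_le_left hm)) (Fin.castLE (le_of_add_le_right hm)))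
          ∂normalizedHaar (unitaryMatrices F (Fin p)) =
        (fun y => C * ∫⁻ w in rectBall F m q, φ (consRow y (w * fiberRoot y)) *
          ENNReal.ofReal (gramDet w ^ e)) fun j =>
            (u : Matrix (Fin (p + 1)) (Fin (p + 1)) F) 0
              (Fin.castLE (show q < p + 1 by omega).le j) := by
      intro u
      obtain ⟨u₀, hu₀, h⟩ := exists_submatrix_succ_eq hqp u.2
      simp only [submatrix_oneBlock_mul hqp hmp h]
      have hφy : ∀ y : Fin q → F, Measurable fun w : Matrix (Fin m) (Fin q) F =>
          φ (consRow y (w * fiberRoot y)) := fun y =>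
        (hφ.comp continuous_consRow_mul_fiberRoot.measurable).comp (measurable_prodMk_left (x := y))
      rw [← hC _ (hφy _)]
      exact lintegral_mul_right_normalizedHaar (fun v : unitaryMatrices F (Fin p) =>
        φ (consRow _ ((v : Matrix (Fin p) (Fin p) F).submatrix (Fin.castLE hmp)
          (Fin.castLE hqp) * _))) ⟨u₀, hu₀⟩
    refine (lintegral_congr hinner).trans ?_
    have hprod : Measurable fun z : (Fin q → F) × Matrix (Fin m) (Fin q) F =>
        φ (consRow z.1 (z.2 * fiberRoot z.1)) * ENNReal.ofReal (gramDet z.2 ^ e) :=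
      (hφ.comp continuous_consRow_mul_fiberRoot.measurable).mul ((hDe m).comp measurable_snd)
    have hint : Measurable fun y : Fin q → F => ∫⁻ w in rectBall F m q,
        φ (consRow y (w * fiberRoot y)) * ENNReal.ofReal (gramDet w ^ e) :=
      hprod.lintegral_prod_right'
    have hφD : Measurable fun w : Matrix (Fin (m + 1)) (Fin q) F =>
        φ w * ENNReal.ofReal (gramDet w ^ e) := hφ.mul (hDe _)
    have hint2 : Measurable fun y : Fin q → F =>
        ENNReal.ofReal ((1 - normSq y) ^ ((Module.finrank ℝ F * m : ℝ) / 2)) *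
        ∫⁻ w in rectBall F m q, φ (consRow y (w * fiberRoot y)) *
          ENNReal.ofReal (gramDet (consRow y (w * fiberRoot y)) ^ e) :=
      (measurable_ofReal_one_sub_normSq_rpow _).mul
        (hφD.comp continuous_consRow_mul_fiberRoot.measurable).lintegral_prod_right'
    have hprod1 : ∀ y : Fin q → F, Measurable fun w : Matrix (Fin m) (Fin q) F =>
        φ (consRow y (w * fiberRoot y)) * ENNReal.ofReal (gramDet w ^ e) := fun y =>
      hprod.comp (measurable_prodMk_left (x := y))
    have hprod2 : ∀ y : Fin q → F, Measurable fun w : Matrix (Fin m) (Fin q) F =>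
        φ (consRow y (w * fiberRoot y)) *
          ENNReal.ofReal (gramDet (consRow y (w * fiberRoot y)) ^ e) := fun y =>
      (hφD.comp continuous_consRow_mul_fiberRoot.measurable).comp (measurable_prodMk_left (x := y))
    rw [hC' _ (hint.const_mul C), mul_assoc, lintegral_rectBall_succ hq hφD, ← lintegral_const_mul _ hint2]
    congr 1
    refine setLIntegral_congr_fun measurableSet_unitBall fun y hy => ?_
    have hy' : 0 < 1 - normSq y := sub_pos.2 hy
    rw [mul_assoc]
    congr 1
    rw [← lintegral_mul_const _ (hprod1 y), ← lintegral_const_mul _ (hprod2 y)]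
    refine setLIntegral_congr_fun (measurableSet_rectBall _ _) fun w hw => ?_
    rw [gramDet_consRow hq hy hw, Real.mul_rpow hy'.le (gramDet_pos hw).le,
      ENNReal.ofReal_mul (by positivity)]
    -- The row density splits into the Jacobian `dm/2` of the row decomposition and the common power
    -- `e`, because `d(p + 1 - q)/2 - 1 = dm/2 + e`.
    have h3 : ENNReal.ofReal ((1 - normSq y) ^
        ((Module.finrank ℝ F * (((p + 1 : ℕ) : ℝ) - q)) / 2 - 1)) =
        ENNReal.ofReal ((1 - normSq y) ^ ((Module.finrank ℝ F * m : ℝ) / 2)) *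
        ENNReal.ofReal ((1 - normSq y) ^ e) := by
      rw [← ENNReal.ofReal_mul (by positivity), ← Real.rpow_add hy']
      congr 2
      rw [he]; push_cast; ring
    rw [h3]
    ring

end Truncation

end Grassmann

/-! ### Identity components and diagonal matrices. -/

namespace Grassmann
open Set

section Component

theorem mem_connectedComponentOfOne_of_continuous {G : Type*} [TopologicalSpace G] [Group G]
    [IsTopologicalGroup G] {γ : ℝ → G} (hγ : Continuous γ) (h0 : γ 0 = 1) (t : ℝ) :
    γ t ∈ Subgroup.connectedComponentOfOne G := by
  have h1 : IsPreconnected (range γ) := isPreconnected_range hγ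
  exact h1.subset_connectedComponent ⟨0, h0⟩ ⟨t, rfl⟩

theorem conj_mem_connectedComponentOfOne {G : Type*} [TopologicalSpace G] [Group G]
    [IsTopologicalGroup G] {g : G} (hg : g ∈ Subgroup.connectedComponentOfOne G) (h : G) :
    h * g * h⁻¹ ∈ Subgroup.connectedComponentOfOne G := by
  have hc : Continuous fun g : G => h * g * h⁻¹ := by fun_prop
  have := hc.image_connectedComponent_subset 1 ⟨g, hg, rfl⟩
  change h * g * h⁻¹ ∈ connectedComponent 1
  simpa using this

variable {F : Type} [NormedRing F] [StarRing F] [NormedStarGroup F] [NormedAlgebra ℝ F]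
  [IsScalar F] [ProperSpace F]

theorem realDiag_apply_self {n : Type*} [DecidableEq n] (σ : n → ℝ) (i : n) :
    realDiag F σ i i = algebraMap ℝ F (σ i) := diagonal_apply_eq _ _

/-- A unitary matrix that diagonalizes a diagonal matrix with simple spectrum, in order, is
diagonal. -/
theorem apply_eq_zero_of_gram_eq_realDiag {n : ℕ} {a : Matrix (Fin n) (Fin n) F}
    (ha : a ∈ unitary (Matrix (Fin n) (Fin n) F)) {c σ : Fin n → ℝ} (hc : StrictAnti c)
    (hc0 : ∀ i, 0 ≤ c i) (hσ : Antitone σ) (hσ0 : ∀ i, 0 ≤ σ i)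
    (h : (realDiag F c * a)ᴴ * (realDiag F c * a) = realDiag F fun i => σ i ^ 2) {i j : Fin n}
    (hij : i ≠ j) : a i j = 0 := by
  -- Whatever the unitary `a` is, `(c a)(c a)* = c²`. Uniqueness of the sorted spectrum forces `σ =
  -- c`, so `a` commutes with `c²`, whose diagonal entries are distinct.
  have h2 : (realDiag F c * a) * (realDiag F c * a)ᴴ = realDiag F fun i => c i ^ 2 := by
    rw [conjTranspose_mul, realDiag_conjTranspose, mul_assoc, ← mul_assoc a,
      mul_conjTranspose_self_of_unitary ha, one_mul, realDiag_mul]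
    simp only [sq]
  have hs := gram_spectrum_unique hσ hc.antitone hσ0 hc0 h h2
  subst hs
  have h3 : realDiag F (fun i => σ i ^ 2) * a = a * realDiag F fun i => σ i ^ 2 := by
    conv_rhs => rw [← h, conjTranspose_mul, realDiag_conjTranspose]
    have : a * (aᴴ * realDiag F σ * (realDiag F σ * a)) =
        (a * aᴴ) * (realDiag F σ * realDiag F σ) * a := by simp only [mul_assoc]
    rw [this, mul_conjTranspose_self_of_unitary ha, one_mul, realDiag_mul]
    simp only [sq]
  have h4 := congrFun (congrFun h3 i) j
  rw [realDiag_mul_apply, mul_realDiag_apply] at h4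
  have h5 : (σ i ^ 2 - σ j ^ 2) • a i j = 0 := by rw [sub_smul, h4, sub_self]
  refine (smul_eq_zero.1 h5).resolve_left ?_
  have h6 : σ i ≠ σ j := fun h => hij (hc.injective h)
  intro h7
  have : (σ i - σ j) * (σ i + σ j) = 0 := by linear_combination h7
  rcases mul_eq_zero.1 this with h | h
  · exact h6 (sub_eq_zero.1 h)
  · have := hc0 i; have := hc0 j
    exact h6 (by linarith)

/-- The rotations form a path. -/
theorem rotation_mem_component {n : Type} [Fintype n] [DecidableEq n] {G : Type*}
    [TopologicalSpace G] [Group G] [IsTopologicalGroup G] (ι : G → Matrix n n F)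
    (hι : Topology.IsInducing ι) (hι1 : ∀ g, ι g = 1 → g = 1) {i j : n} {ε : F}
    (h : ∀ θ : ℝ, ∃ g : G, ι g = rotation i j ε (Real.cos θ) (Real.sin θ)) {c s : ℝ}
    (hcs : c ^ 2 + s ^ 2 = 1) :
    ∃ g ∈ Subgroup.connectedComponentOfOne G, ι g = rotation i j ε c s := by
  choose γ hγ using h
  obtain ⟨θ, hθ1, hθ2⟩ : ∃ θ : ℝ, Real.cos θ = c ∧ Real.sin θ = s := by
    refine ⟨Complex.arg ⟨c, s⟩, ?_, ?_⟩
    all_goals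
      have hn : ‖(⟨c, s⟩ : ℂ)‖ = 1 := by
        rw [Complex.norm_def, Complex.normSq_mk, ← sq, ← sq, hcs, Real.sqrt_one]
    · rw [Complex.cos_arg (by intro h0; rw [h0] at hn; simp at hn), hn, div_one]
    · rw [Complex.sin_arg, hn, div_one]
  refine ⟨γ θ, mem_connectedComponentOfOne_of_continuous (hι.continuous_iff.2 ?_)
    (hι1 _ (by rw [hγ]; simp)) θ, by rw [hγ, hθ1, hθ2]⟩
  have : ι ∘ γ = fun θ => rotation i j ε (Real.cos θ) (Real.sin θ) := funext hγ
  rw [this]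
  exact (continuous_rotation i j ε).comp (Real.continuous_cos.prodMk Real.continuous_sin)

theorem strictAnti_reversed (n : ℕ) : StrictAnti fun i : Fin n => ((n : ℝ) - (i : ℕ)) := by
  intro i j h
  have : ((i : ℕ) : ℝ) < (j : ℕ) := by exact_mod_cast h
  change (n : ℝ) - (j : ℕ) < n - (i : ℕ)
  linarith

theorem reversed_nonneg {n : ℕ} (i : Fin n) : 0 ≤ (n : ℝ) - (i : ℕ) := by
  have : ((i : ℕ) : ℝ) ≤ n := by exact_mod_cast i.2.le
  linarith

instance (q : ℕ) : CompactSpace (unitaryComponent F q) :=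
  isCompact_iff_compactSpace.1 (isClosed_connectedComponent
    (x := (1 : unitaryMatrices F (Fin q)))).isCompact

/-- The unitary group is generated by its identity component and the diagonal matrices. -/
theorem exists_component_mul_diagonal {q : ℕ} (u : unitaryMatrices F (Fin q)) :
    ∃ v ∈ unitaryComponent F q, ∃ t : unitaryMatrices F (Fin q), u = v * t ∧
      ∀ i j, i ≠ j → (t : Matrix (Fin q) (Fin q) F) i j = 0 := by
  set c : Fin q → ℝ := fun i => (q : ℝ) - (i : ℕ) with hc
  set S : Set (Matrix (Fin q) (Fin q) F) :=
    (fun w : unitaryMatrices F (Fin q) => ((w * u : unitaryMatrices F (Fin q)) :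
      Matrix (Fin q) (Fin q) F)) '' (unitaryComponent F q : Set (unitaryMatrices F (Fin q)))
    with hS
  have hScomp : IsCompact S := by
    refine (isClosed_connectedComponent.isCompact).image ?_
    exact continuous_subtype_val.comp (continuous_mul_const u)
  -- The maximization runs over the coset `U₀ u`. It is stable under right multiplication by
  -- rotations `g` because `w u g = w (u g u⁻¹) u` and `U₀` is normal. For a diagonal matrix with
  -- simple spectrum the maximizer has to be diagonal.
  obtain ⟨v', ⟨w, hw, rfl⟩, h1, h2⟩ := exists_orthogonal_columns (realDiag F c) hScomp
    ⟨_, 1, one_mem _, rfl⟩ (c := fun i : Fin q => -(i : ℝ))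
    (fun i j h => by simpa [Fin.val_inj] using h) (r := fun _ _ => True) (fun _ _ _ => trivial) (by
      rintro _ ⟨w, hw, rfl⟩ i j - hij ε a b hε hab
      obtain ⟨g, hg, hgr⟩ := rotation_mem_component (G := unitaryMatrices F (Fin q)) (F := F)
        Subtype.val Topology.IsInducing.subtypeVal (fun g h => Subtype.ext h) (i := i) (j := j)
        (ε := ε) (fun θ => ⟨⟨_, rotation_mem_unitary hij hε (Real.cos_sq_add_sin_sq θ)⟩, rfl⟩) hab
      refine ⟨w * (u * g * u⁻¹), mul_mem hw ?_, ?_⟩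
      · exact conj_mem_connectedComponentOfOne hg u
      · rw [← hgr]
        simp [mul_assoc])
  refine ⟨w⁻¹, inv_mem hw, w * u, by simp, fun i j hij => ?_⟩
  refine apply_eq_zero_of_gram_eq_realDiag (w * u).2 (strictAnti_reversed q) reversed_nonneg
    (σ := fun i => √(normSq fun k => (realDiag F c * (w * u : unitaryMatrices F (Fin q))) k i))
    (fun i j hij => ?_) (fun i => Real.sqrt_nonneg _) ?_ hij
  · rcases hij.eq_or_lt with rfl | h
    · exact le_rfl
    · exact Real.sqrt_le_sqrt (h2 i j trivial (by simpa using h))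
  · ext i j
    by_cases hij : i = j
    · subst hij
      rw [conjTranspose_mul_self_diag, realDiag_apply_self, Real.sq_sqrt (normSq_nonneg _)]
    · rw [h1 i j trivial hij]
      simp [realDiag, hij]

end Component

end Grassmann

/-! ### Contractions and their angles. -/

namespace Grassmann
open Set

section Angles

variable {F : Type} [NormedRing F] [StarRing F] [NormedStarGroup F] [NormedAlgebra ℝ F]
  [IsScalar F] [ProperSpace F]

theorem submatrix_one_mem_unitary {n : Type*} [Fintype n] [DecidableEq n] (e : n ≃ n) :
    (1 : Matrix n n F).submatrix e id ∈ unitary (Matrix n n F) := by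
  refine mem_unitary_of_conjTranspose_mul ?_
  rw [conjTranspose_submatrix, conjTranspose_one, submatrix_mul_equiv]
  simp

/-- The arccosine reverses order, so the angles list the singular values backwards; a permutation
matrix repairs this. -/
theorem realDiag_rev_eq {q : ℕ} (σ : Fin q → ℝ) :
    ∃ u ∈ unitary (Matrix (Fin q) (Fin q) F),
      realDiag F σ = u * realDiag F (fun i => σ i.rev) * uᴴ := by
  refine ⟨_, submatrix_one_mem_unitary Fin.revPerm, ?_⟩
  ext i j
  rw [conjTranspose_submatrix, conjTranspose_one]
  by_cases h : i = j
  · subst h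
    simp [realDiag, mul_apply, one_apply, diagonal_apply]
  · have : ¬ (Fin.rev i = Fin.rev j) := fun h' => h (Fin.rev_injective h')
    simp [realDiag, mul_apply, one_apply, diagonal_apply, h, this]

theorem cosDiag_eq {q : ℕ} (x : Fin q → ℝ) : cosDiag F x = realDiag F fun i => Real.cos (x i) := rfl

theorem sinDiag_eq {q : ℕ} (x : Fin q → ℝ) : sinDiag F x = realDiag F fun i => Real.sin (x i) := rfl

theorem singularAngles_cosDiag {q : ℕ} (x : alcove q) : singularAngles (cosDiag F x.1) = x := by
  obtain ⟨hx, hx2⟩ := x.2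
  obtain ⟨u, hu, h⟩ := realDiag_rev_eq (F := F) fun i => Real.cos (x.1 i)
  have hs : singularSpectrum (cosDiag F x.1) = fun i => Real.cos (x.1 i.rev) := by
    refine singularSpectrum_eq_of_eq ?_ ?_ hu (conjTranspose_mem_unitary hu) h
    · intro i j hij
      refine Real.cos_le_cos_of_nonneg_of_le_pi (hx2 _).1 ?_ (hx (Fin.rev_le_rev.2 hij))
      linarith [(hx2 i.rev).2, (hx2 j.rev).2, Real.pi_pos]
    · intro i
      exact Real.cos_nonneg_of_neg_pi_div_two_le_of_le (by linarith [(hx2 i.rev).1, Real.pi_pos])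
        (hx2 _).2
  apply Subtype.ext
  funext i
  simp only [singularAngles, hs, Fin.rev_rev]
  exact Real.arccos_cos (hx2 i).1 (by linarith [(hx2 i).2, Real.pi_pos])

theorem normSq_single {q : ℕ} (i : Fin q) : normSq (Pi.single i 1 : Fin q → F) = 1 := by
  rw [normSq, Finset.sum_eq_single i]
  · simp
  · intro j _ hj; simp [hj]
  · simp

/-- For a contraction all singular values are at most one, so they are recovered as cosines of the
angles. Beyond one the arccosine would lose information. -/
theorem exists_eq_mul_cosDiag_mul {q : ℕ} {X : Matrix (Fin q) (Fin q) F}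
    (hX : X ∈ closedRectBall F q q) :
    ∃ a ∈ unitary (Matrix (Fin q) (Fin q) F), ∃ b ∈ unitary (Matrix (Fin q) (Fin q) F),
      X = a * cosDiag F (singularAngles X).1 * b := by
  obtain ⟨u, hu, v, hv, h⟩ := exists_eq_mul_singularSpectrum_mul X
  obtain ⟨h1, h2⟩ := singularSpectrum_antitone_nonneg X
  have h3 : ∀ i, singularSpectrum X i ≤ 1 := by
    intro i
    have e1 := hX (vᴴ *ᵥ Pi.single i 1)
    rw [normSq_unitary_mulVec (conjTranspose_mem_unitary hv), normSq_single] at e1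
    have e2 : X *ᵥ (vᴴ *ᵥ Pi.single i 1) = u *ᵥ (singularSpectrum X i • Pi.single i 1) := by
      conv_lhs => rw [h, mulVec_mulVec, Matrix.mul_assoc, mul_conjTranspose_self_of_unitary hv,
        Matrix.mul_one, ← mulVec_mulVec]
      congr 1
      ext k
      by_cases hk : k = i
      · subst hk; simp [realDiag, mulVec_diagonal, Algebra.smul_def]
      · simp [realDiag, mulVec_diagonal, hk]
    rw [e2, normSq_unitary_mulVec hu, normSq_smul, normSq_single, mul_one] at e1
    exact (sq_le_one_iff₀ (h2 i)).1 e1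
  obtain ⟨w, hw, hw2⟩ := realDiag_rev_eq (F := F) fun i => singularSpectrum X i.rev
  have h4 : cosDiag F (singularAngles X).1 = realDiag F fun i => singularSpectrum X i.rev := by
    rw [cosDiag_eq]
    congr 1
    ext i
    exact Real.cos_arccos (by linarith [h2 i.rev]) (h3 _)
  simp only [Fin.rev_rev] at hw2
  refine ⟨u * wᴴ, mul_mem hu (conjTranspose_mem_unitary hw), w * v, mul_mem hw hv, ?_⟩
  have hww := conjTranspose_mul_self_of_unitary hw
  calc X = u * (wᴴ * w) * realDiag F (singularSpectrum X) * (wᴴ * w) * v := by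
        rw [hww, mul_one, mul_one]; exact h
    _ = _ := by
        rw [h4, hw2]; simp only [mul_assoc]

end Angles

/-! ### The torus of the matrices `b_x`. -/

section RotationMatrix

variable {F : Type} [NormedRing F] [StarRing F] [NormedStarGroup F] [NormedAlgebra ℝ F]
  [IsScalar F] [ProperSpace F] {p q : ℕ}

/-- In terms of the coordinate embedding `E`, the block calculations below need only the relation
`E* E = 1`. -/
theorem rotationMatrix_eq (hqp : q ≤ p) (x : Fin q → ℝ) :
    rotationMatrix F p q x = fromBlocks
      (1 + coordEmbedding F hqp * (cosDiag F x - 1) * (coordEmbedding F hqp)ᴴ)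
      (-(coordEmbedding F hqp * sinDiag F x)) (sinDiag F x * (coordEmbedding F hqp)ᴴ)
      (cosDiag F x) := by
  have hE : ∀ (i : Fin p) (j : Fin q), coordEmbedding F hqp i j = if (i : ℕ) = j then 1 else 0 := by
    intro i j
    simp [coordEmbedding, one_apply, Fin.ext_iff]
  rw [rotationMatrix]
  congr 1
  · ext i j
    have h1 : (coordEmbedding F hqp * (cosDiag F x - 1) * (coordEmbedding F hqp)ᴴ :
        Matrix (Fin p) (Fin p) F) i j =
        ∑ k : Fin q, (if (i : ℕ) = k then 1 else 0) * (algebraMap ℝ F (Real.cos (x k)) - 1) *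
          (if (j : ℕ) = k then 1 else 0) := by
      rw [mul_apply]
      refine Finset.sum_congr rfl fun k _ => ?_
      have : cosDiag F x - 1 = Matrix.diagonal fun i => algebraMap ℝ F (Real.cos (x i)) - 1 := by
        rw [cosDiag, ← diagonal_one, diagonal_sub]
      rw [this, mul_diagonal, conjTranspose_apply, hE, hE, apply_ite star, star_one, star_zero]
    rw [Matrix.add_apply, h1]
    by_cases hi : (i : ℕ) < q
    · rw [Finset.sum_eq_single ⟨i, hi⟩]
      · by_cases hij : i = j
        · subst hij; simp [hi]
        · have : ¬ (j : ℕ) = i := fun h => hij (Fin.ext h.symm)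
          simp [hij, this]
      · intro k _ hk
        have : ¬ (i : ℕ) = k := fun h => hk (Fin.ext h.symm)
        simp [this]
      · simp
    · rw [Finset.sum_eq_zero]
      · by_cases hij : i = j
        · subst hij; simp [hi]
        · simp [hij]
      · intro k _
        have : ¬ (i : ℕ) = k := fun h => hi (h ▸ k.2)
        simp [this]
  · ext i j
    rw [Matrix.neg_apply, sinDiag, mul_diagonal, hE]
    by_cases h : (i : ℕ) = j <;> simp [h]
  · ext i j
    rw [sinDiag, diagonal_mul, conjTranspose_apply, hE]
    by_cases h : (i : ℕ) = j
    · simp [h]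
    · simp [h, Ne.symm h]

theorem cosDiag_add (x y : Fin q → ℝ) :
    cosDiag F (x + y) = cosDiag F x * cosDiag F y - sinDiag F x * sinDiag F y := by
  rw [eq_sub_iff_add_eq]
  simp only [cosDiag_eq, sinDiag_eq, realDiag_mul, realDiag_add]
  congr 1
  ext i
  simp [Real.cos_add]

theorem sinDiag_add (x y : Fin q → ℝ) :
    sinDiag F (x + y) = sinDiag F x * cosDiag F y + cosDiag F x * sinDiag F y := by
  simp only [cosDiag_eq, sinDiag_eq, realDiag_mul, realDiag_add]
  congr 1
  ext i
  simp [Real.sin_add]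

@[simp] theorem cosDiag_zero : cosDiag F (0 : Fin q → ℝ) = 1 := by simp [cosDiag_eq]

@[simp] theorem sinDiag_zero : sinDiag F (0 : Fin q → ℝ) = 0 := by simp [sinDiag_eq]

@[simp] theorem cosDiag_neg (x : Fin q → ℝ) : cosDiag F (-x) = cosDiag F x := by
  simp [cosDiag_eq]

@[simp] theorem sinDiag_neg (x : Fin q → ℝ) : sinDiag F (-x) = -sinDiag F x := by
  rw [eq_neg_iff_add_eq_zero, sinDiag_eq, sinDiag_eq, realDiag_add]
  simp

theorem rotationMatrix_add (hqp : q ≤ p) (x y : Fin q → ℝ) :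
    rotationMatrix F p q (x + y) = rotationMatrix F p q x * rotationMatrix F p q y := by
  have hE : ∀ {n : Type} (A : Matrix (Fin q) n F),
      (coordEmbedding F hqp)ᴴ * (coordEmbedding F hqp * A) = A := by
    intro n A
    rw [← Matrix.mul_assoc, coordEmbedding_gram, Matrix.one_mul]
  rw [rotationMatrix_eq hqp, rotationMatrix_eq hqp, rotationMatrix_eq hqp, fromBlocks_multiply,
    cosDiag_add, sinDiag_add]
  generalize coordEmbedding F hqp = E at hE
  generalize cosDiag F x = c
  generalize sinDiag F x = s
  generalize cosDiag F y = c'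
  generalize sinDiag F y = s'
  congr 1 <;>
    simp only [Matrix.mul_assoc, Matrix.add_mul, Matrix.mul_add, Matrix.sub_mul, Matrix.mul_sub,
      Matrix.one_mul, Matrix.mul_one, Matrix.neg_mul, Matrix.mul_neg, hE, neg_neg] <;> abel

theorem rotationMatrix_zero (hqp : q ≤ p) : rotationMatrix F p q 0 = 1 := by
  rw [rotationMatrix_eq hqp]
  simp

theorem rotationMatrix_conjTranspose (hqp : q ≤ p) (x : Fin q → ℝ) :
    (rotationMatrix F p q x)ᴴ = rotationMatrix F p q (-x) := by
  have hc : (cosDiag F x)ᴴ = cosDiag F x := by rw [cosDiag_eq, realDiag_conjTranspose]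
  have hs : (sinDiag F x)ᴴ = sinDiag F x := by rw [sinDiag_eq, realDiag_conjTranspose]
  rw [rotationMatrix_eq hqp, rotationMatrix_eq hqp, fromBlocks_conjTranspose]
  simp [hc, hs, Matrix.mul_assoc]

theorem rotationMatrix_mem_unitary (hqp : q ≤ p) (x : Fin q → ℝ) :
    rotationMatrix F p q x ∈ unitary (Matrix (Fin p ⊕ Fin q) (Fin p ⊕ Fin q) F) := by
  refine mem_unitary_of_conjTranspose_mul ?_
  rw [rotationMatrix_conjTranspose hqp, ← rotationMatrix_add hqp, neg_add_cancel,
    rotationMatrix_zero hqp]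

/-- As for plane rotations: `diag(1, -1)` conjugates the half-angle matrix to its inverse. -/
theorem det_rotationMatrix [HasDet F] [IsScalarDet F] (hqp : q ≤ p) (x : Fin q → ℝ) :
    HasDet.det (Fin p ⊕ Fin q) (rotationMatrix F p q x) = 1 := by
  refine det_eq_one_of_conj (H := rotationMatrix F p q ((1 / 2 : ℝ) • x))
    (H' := rotationMatrix F p q (-((1 / 2 : ℝ) • x))) (D := fromBlocks 1 0 0 (-1)) ?_ ?_ ?_ ?_
  · rw [← rotationMatrix_add hqp, ← add_smul]
    norm_num
  · rw [fromBlocks_multiply, ← fromBlocks_one]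
    simp
  · rw [← rotationMatrix_add hqp, add_neg_cancel, rotationMatrix_zero hqp]
  · rw [rotationMatrix_eq hqp, rotationMatrix_eq hqp, fromBlocks_multiply, fromBlocks_multiply]
    simp

end RotationMatrix

/-! ### The group, its block diagonal subgroup, and the Cartan decomposition. -/

section Grassmannian

variable {F : Type} [NormedRing F] [StarRing F] [NormedStarGroup F] [NormedAlgebra ℝ F]
  [IsScalar F] [ProperSpace F] [HasDet F] [IsScalarDet F] {p q : ℕ}

variable [MeasureSpace F] [BorelSpace F]

/-- The matrix of an element of the group. -/
abbrev toMat (u : grassmannU F p q) : Matrix (Fin p ⊕ Fin q) (Fin p ⊕ Fin q) F :=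
  ((u : unitaryMatrices F (Fin p ⊕ Fin q)) : Matrix (Fin p ⊕ Fin q) (Fin p ⊕ Fin q) F)

theorem toMat_mem (u : grassmannU F p q) :
    toMat u ∈ unitary (Matrix (Fin p ⊕ Fin q) (Fin p ⊕ Fin q) F) := u.1.2

theorem toMat_mul (u v : grassmannU F p q) : toMat (u * v) = toMat u * toMat v := rfl

theorem toMat_inv (u : grassmannU F p q) : toMat u⁻¹ = (toMat u)ᴴ := rfl

theorem toMat_injective : Function.Injective (toMat : grassmannU F p q → _) :=
  Subtype.val_injective.comp Subtype.val_injective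

theorem continuous_toMat : Continuous (toMat : grassmannU F p q → _) :=
  continuous_subtype_val.comp continuous_subtype_val

theorem isInducing_toMat : Topology.IsInducing (toMat : grassmannU F p q → _) :=
  Topology.IsInducing.subtypeVal.comp Topology.IsInducing.subtypeVal

/-- The element of the group with a given matrix. -/
def ofMat (A : Matrix (Fin p ⊕ Fin q) (Fin p ⊕ Fin q) F)
    (hA : A ∈ unitary (Matrix (Fin p ⊕ Fin q) (Fin p ⊕ Fin q) F))
    (hdet : HasDet.det (Fin p ⊕ Fin q) A = 1) : grassmannU F p q := ⟨⟨A, hA⟩, hdet⟩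

instance : CompactSpace (grassmannU F p q) := by
  have h : IsClosed (grassmannU F p q : Set (unitaryMatrices F (Fin p ⊕ Fin q))) :=
    isClosed_singleton.preimage ((HasDet.continuous_det _).comp continuous_subtype_val)
  exact isCompact_iff_compactSpace.1 h.isCompact

instance : CompactSpace (grassmannK F p q) := by
  have hc := continuous_toMat (F := F) (p := p) (q := q)
  have h : IsClosed (grassmannK F p q : Set (grassmannU F p q)) :=
    (isClosed_singleton (x := (0 : Matrix (Fin p) (Fin q) F))).preimage
      (continuous_matrix fun i j => hc.matrix_elem (Sum.inl i) (Sum.inr j)) |>.inter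
    ((isClosed_singleton (x := (0 : Matrix (Fin q) (Fin p) F))).preimage
      (continuous_matrix fun i j => hc.matrix_elem (Sum.inr i) (Sum.inl j)))
  exact isCompact_iff_compactSpace.1 h.isCompact

instance : CompactSpace (Subgroup.connectedComponentOfOne (grassmannK F p q)) :=
  isCompact_iff_compactSpace.1 (isClosed_connectedComponent
    (x := (1 : grassmannK F p q))).isCompact

theorem fromBlocks_mem_unitary_iff {a : Matrix (Fin p) (Fin p) F} {b : Matrix (Fin q) (Fin q) F} :
    fromBlocks a 0 0 b ∈ unitary (Matrix (Fin p ⊕ Fin q) (Fin p ⊕ Fin q) F) ↔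
      a ∈ unitary (Matrix (Fin p) (Fin p) F) ∧ b ∈ unitary (Matrix (Fin q) (Fin q) F) := by
  constructor
  · intro h
    have h1 := conjTranspose_mul_self_of_unitary h
    rw [fromBlocks_conjTranspose, fromBlocks_multiply, ← fromBlocks_one, fromBlocks_inj] at h1
    exact ⟨mem_unitary_of_conjTranspose_mul (by simpa using h1.1),
      mem_unitary_of_conjTranspose_mul (by simpa using h1.2.2.2)⟩
  · rintro ⟨ha, hb⟩
    refine mem_unitary_of_conjTranspose_mul ?_
    rw [fromBlocks_conjTranspose, fromBlocks_multiply, ← fromBlocks_one]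
    simp [conjTranspose_mul_self_of_unitary ha, conjTranspose_mul_self_of_unitary hb]

/-- The block diagonal element with given blocks. -/
def ofBlocks (a : Matrix (Fin p) (Fin p) F) (b : Matrix (Fin q) (Fin q) F)
    (ha : a ∈ unitary (Matrix (Fin p) (Fin p) F)) (hb : b ∈ unitary (Matrix (Fin q) (Fin q) F))
    (hdet : HasDet.det (Fin p ⊕ Fin q) (fromBlocks a 0 0 b) = 1) : grassmannK F p q :=
  ⟨ofMat (fromBlocks a 0 0 b) (fromBlocks_mem_unitary_iff.2 ⟨ha, hb⟩) hdet,
    toBlocks_fromBlocks₁₂ _ _ _ _, toBlocks_fromBlocks₂₁ _ _ _ _⟩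

/-- The upper left block. -/
def blockOne (k : grassmannK F p q) : Matrix (Fin p) (Fin p) F := (toMat k.1).toBlocks₁₁

/-- The lower right block. -/
def blockTwo (k : grassmannK F p q) : Matrix (Fin q) (Fin q) F := (toMat k.1).toBlocks₂₂

theorem toMat_coe (k : grassmannK F p q) :
    toMat k.1 = fromBlocks (blockOne k) 0 0 (blockTwo k) := by
  have h := fromBlocks_toBlocks (toMat k.1)
  have h1 : (toMat k.1).toBlocks₁₂ = 0 := k.2.1
  have h2 : (toMat k.1).toBlocks₂₁ = 0 := k.2.2
  rw [h1, h2] at h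
  exact h.symm

theorem blockOne_mul (k l : grassmannK F p q) : blockOne (k * l) = blockOne k * blockOne l := by
  have h : toMat (k * l).1 = toMat k.1 * toMat l.1 := rfl
  rw [toMat_coe, toMat_coe k, toMat_coe l, fromBlocks_multiply, fromBlocks_inj] at h
  simpa using h.1

theorem blockTwo_mul (k l : grassmannK F p q) : blockTwo (k * l) = blockTwo k * blockTwo l := by
  have h : toMat (k * l).1 = toMat k.1 * toMat l.1 := rfl
  rw [toMat_coe, toMat_coe k, toMat_coe l, fromBlocks_multiply, fromBlocks_inj] at h
  simpa using h.2.2.2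

theorem blockOne_mem (k : grassmannK F p q) :
    blockOne k ∈ unitary (Matrix (Fin p) (Fin p) F) :=
  (fromBlocks_mem_unitary_iff.1 (toMat_coe k ▸ toMat_mem k.1)).1

theorem blockTwo_mem (k : grassmannK F p q) :
    blockTwo k ∈ unitary (Matrix (Fin q) (Fin q) F) :=
  (fromBlocks_mem_unitary_iff.1 (toMat_coe k ▸ toMat_mem k.1)).2

theorem continuous_blockOne : Continuous (blockOne : grassmannK F p q → _) :=
  continuous_matrix fun i j =>
    (continuous_toMat.comp continuous_subtype_val).matrix_elem (Sum.inl i) (Sum.inl j)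

theorem continuous_blockTwo : Continuous (blockTwo : grassmannK F p q → _) :=
  continuous_matrix fun i j =>
    (continuous_toMat.comp continuous_subtype_val).matrix_elem (Sum.inr i) (Sum.inr j)

theorem diagonal_update_mem_unitary {n : Type*} [Fintype n] [DecidableEq n] (i : n) {s : F}
    (hs : ‖s‖ = 1) : diagonal (Function.update 1 i s) ∈ unitary (Matrix n n F) := by
  refine mem_unitary_of_conjTranspose_mul ?_
  rw [diagonal_conjTranspose, diagonal_mul_diagonal, ← diagonal_one]
  congr 1
  ext j
  by_cases h : j = i
  · subst h; simp [star_mul_self_eq, hs]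
  · simp [h]

/-- Every pair of unitary matrices becomes block diagonal in the group after scaling one
coordinate. -/
theorem exists_blocks_eq (i : Fin p) {a : Matrix (Fin p) (Fin p) F}
    {b : Matrix (Fin q) (Fin q) F} (ha : a ∈ unitary (Matrix (Fin p) (Fin p) F))
    (hb : b ∈ unitary (Matrix (Fin q) (Fin q) F)) :
    ∃ s : F, ‖s‖ = 1 ∧ ∃ k : grassmannK F p q,
      blockOne k = a * diagonal (Function.update 1 i s) ∧ blockTwo k = b := by
  obtain ⟨s, hs, h⟩ := IsScalarDet.exists_det_mul_eq_one (Fin p ⊕ Fin q) (fromBlocks a 0 0 b)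
    (fromBlocks_mem_unitary_iff.2 ⟨ha, hb⟩) (Sum.inl i)
  have h1 : diagonal (Function.update (1 : Fin p ⊕ Fin q → F) (Sum.inl i) s) =
      fromBlocks (diagonal (Function.update 1 i s)) 0 0 1 := by
    rw [← diagonal_one, fromBlocks_diagonal]
    congr 1
    ext j
    rcases j with j | j
    · by_cases hj : j = i <;> simp [hj]
    · simp
  rw [mul_comm, ← map_mul, h1, fromBlocks_multiply] at h
  simp only [Matrix.mul_zero, Matrix.zero_mul, add_zero, zero_add, Matrix.mul_one] at h
  exact ⟨s, hs, ofBlocks _ _ (mul_mem ha (diagonal_update_mem_unitary i hs)) hb h,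
    toBlocks_fromBlocks₁₁ _ _ _ _, toBlocks_fromBlocks₂₂ _ _ _ _⟩

/-- The parameter in the alcove of an element of the group. -/
def angles (u : grassmannU F p q) : alcove q := singularAngles (toMat u).toBlocks₂₂

theorem continuous_angles : Continuous (angles : grassmannU F p q → alcove q) :=
  continuous_singularAngles.comp (continuous_matrix fun i j =>
    continuous_toMat.matrix_elem (Sum.inr i) (Sum.inr j))

theorem angles_inv (u : grassmannU F p q) : angles u⁻¹ = angles u := by
  rw [angles, toMat_inv, angles]
  exact singularAngles_conjTranspose (toMat u).toBlocks₂₂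

theorem angles_mul_mul (k l : grassmannK F p q) (u : grassmannU F p q) :
    angles (k.1 * u * l.1) = angles u := by
  have h : (toMat (k.1 * u * l.1)).toBlocks₂₂ =
      blockTwo k * (toMat u).toBlocks₂₂ * blockTwo l := by
    rw [toMat_mul, toMat_mul, toMat_coe, toMat_coe l, ← fromBlocks_toBlocks (toMat u),
      fromBlocks_multiply, fromBlocks_multiply]
    simp
  rw [angles, h, singularAngles_mul_mul (blockTwo_mem k) (blockTwo_mem l), angles]

/-- The rotations `b_x` as elements of the group. -/
def torus (hqp : q ≤ p) (x : Fin q → ℝ) : grassmannU F p q :=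
  ofMat (rotationMatrix F p q x) (rotationMatrix_mem_unitary hqp x) (det_rotationMatrix hqp x)

theorem angles_torus (hqp : q ≤ p) (x : alcove q) : angles (torus (F := F) hqp x.1) = x := by
  have h : (toMat (torus (F := F) hqp x.1)).toBlocks₂₂ = cosDiag F x.1 := rfl
  rw [angles, h, singularAngles_cosDiag]

/-- This is where the product formula originates: the lower right block of `b_x k b_y` is its matrix
argument, with `v` the lower block of `k` and `w` the `q × q` corner of the upper block. -/
theorem angles_torus_mul_mul (hqp : q ≤ p) (x y : Fin q → ℝ) (k : grassmannK F p q) :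
    angles (torus hqp x * k.1 * torus hqp y) =
      productAngles x y (blockTwo k) ((coordEmbedding F hqp)ᴴ * blockOne k *
        coordEmbedding F hqp) := by
  have h : (toMat (torus hqp x * k.1 * torus hqp y)).toBlocks₂₂ =
      -(sinDiag F x * ((coordEmbedding F hqp)ᴴ * blockOne k * coordEmbedding F hqp) *
        sinDiag F y) + cosDiag F x * blockTwo k * cosDiag F y := by
    rw [toMat_mul, toMat_mul, toMat_coe]
    change (rotationMatrix F p q x * _ * rotationMatrix F p q y).toBlocks₂₂ = _
    rw [rotationMatrix_eq hqp, rotationMatrix_eq hqp, fromBlocks_multiply, fromBlocks_multiply]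
    simp [Matrix.mul_assoc]
  rw [angles, h, productAngles]

/-- An index `i ≥ q` lies outside the embedded coordinates, so a phase placed there can correct a
determinant without being seen by the `q × q` corner. -/
theorem coordEmbedding_mul_diagonal_update {hqp : q ≤ p} {i : Fin p} (hi : q ≤ i) (s : F) :
    diagonal (Function.update 1 i s) * coordEmbedding F hqp = coordEmbedding F hqp := by
  ext a b
  rw [diagonal_mul]
  by_cases h : a = i
  · subst h
    have : ¬ a = Fin.castLE hqp b := fun h => by
      have := congrArg Fin.val h
      simp at this
      omega
    simp [coordEmbedding, one_apply, this]
  · simp [h]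

/-- The Cartan decomposition. -/
theorem exists_eq_mul_torus_mul (hqp : q < p) (u : grassmannU F p q) :
    ∃ k l : grassmannK F p q, u = k.1 * torus hqp.le (angles u).1 * l.1 := by
  set E := coordEmbedding F hqp.le with hE
  set x := (angles u).1 with hx
  set A := (toMat u).toBlocks₁₂ with hA
  set B := (toMat u).toBlocks₂₂ with hB
  have hcols : Aᴴ * A + Bᴴ * B = 1 := by
    have h := conjTranspose_mul_self_of_unitary (toMat_mem u)
    rw [← fromBlocks_toBlocks (toMat u), fromBlocks_conjTranspose, fromBlocks_multiply,
      ← fromBlocks_one, fromBlocks_inj] at h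
    exact h.2.2.2
  have hBc : B ∈ closedRectBall F q q := by
    intro v
    have h1 := normSq_mulVec_of_conjTranspose_mul_eq (A := fromRows A B)
      (B := (1 : Matrix (Fin q) (Fin q) F)) (by
        rw [conjTranspose_fromRows_eq_fromCols_conjTranspose, fromCols_mul_fromRows, hcols]; simp) v
    rw [one_mulVec, fromRows_mulVec] at h1
    rw [← h1, normSq, normSq, Fintype.sum_sum_type]
    simp only [Sum.elim_inl, Sum.elim_inr]
    exact le_add_of_nonneg_left (Finset.sum_nonneg fun _ _ => by positivity)
  -- With `B = a cos x b`, orthonormality of the columns gives `A* A = 1 - B* B = b* sin² x b`. This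
  -- is the Gram matrix of `-E sin x b`, so `A` is a unitary multiple of that matrix.
  obtain ⟨a, ha, b, hb, hab⟩ := exists_eq_mul_cosDiag_mul hBc
  change B = a * cosDiag F x * b at hab
  have hcs : sinDiag F x * sinDiag F x = 1 - cosDiag F x * cosDiag F x := by
    rw [eq_sub_iff_add_eq, sinDiag_eq, cosDiag_eq, realDiag_mul, realDiag_mul, realDiag_add,
      ← realDiag_one]
    congr 1
    ext i
    simpa [sq] using Real.sin_sq_add_cos_sq (x i)
  have hcH : (cosDiag F x)ᴴ = cosDiag F x := realDiag_conjTranspose _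
  have hsH : (sinDiag F x)ᴴ = sinDiag F x := realDiag_conjTranspose _
  have hgram : Aᴴ * A = (-(E * sinDiag F x) * b)ᴴ * (-(E * sinDiag F x) * b) := by
    have h1 : (-(E * sinDiag F x) * b)ᴴ * (-(E * sinDiag F x) * b) =
        bᴴ * (sinDiag F x * (Eᴴ * E) * sinDiag F x) * b := by
      simp [conjTranspose_mul, hsH, Matrix.mul_assoc]
    have h2 : Bᴴ * B = bᴴ * (cosDiag F x * cosDiag F x) * b := by
      rw [hab]
      simp only [conjTranspose_mul, hcH, Matrix.mul_assoc]
      rw [← Matrix.mul_assoc aᴴ, conjTranspose_mul_self_of_unitary ha, Matrix.one_mul]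
    rw [h1, hE, coordEmbedding_gram, Matrix.mul_one, hcs, eq_sub_of_add_eq hcols, h2,
      Matrix.mul_sub, Matrix.sub_mul, Matrix.mul_one, conjTranspose_mul_self_of_unitary hb]
  obtain ⟨g, hg, hgA⟩ := exists_unitary_mul_eq hqp.le hgram
  -- The last coordinate is not among the first `q` because `q < p`, so adjusting the determinant
  -- there does not change `g E`.
  set i : Fin p := ⟨p - 1, by omega⟩ with hi
  obtain ⟨s, hs, k, hk1, hk2⟩ := exists_blocks_eq i hg ha
  have hkE : blockOne k * E = g * E := by
    rw [hk1, Matrix.mul_assoc, hE, coordEmbedding_mul_diagonal_update (by rw [hi]; simp; omega)]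
  set v : grassmannU F p q := (torus hqp.le x)⁻¹ * k.1⁻¹ * u with hv
  have huv : u = k.1 * torus hqp.le x * v := by rw [hv]; group
  have hcol : toMat u * (fromRows 0 1 : Matrix (Fin p ⊕ Fin q) (Fin q) F) =
      toMat (k.1 * torus hqp.le x) * (fromRows 0 b : Matrix (Fin p ⊕ Fin q) (Fin q) F) := by
    rw [toMat_mul, toMat_coe]
    have ht : toMat (torus (F := F) hqp.le x) = rotationMatrix F p q x := rfl
    rw [ht]
    rw [rotationMatrix_eq hqp.le, fromBlocks_multiply, ← fromBlocks_toBlocks (toMat u)]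
    refine (fromBlocks_mul_fromRows _ _ _ _ _ _).trans
      (Eq.trans ?_ (fromBlocks_mul_fromRows _ _ _ _ _ _).symm)
    simp only [Matrix.mul_zero, Matrix.mul_one, zero_add, Matrix.zero_mul, add_zero, ← hA, ← hB]
    congr 1
    · rw [hgA, ← hE, Matrix.mul_neg (blockOne k), ← Matrix.mul_assoc (blockOne k), hkE]
      simp only [Matrix.mul_neg, Matrix.neg_mul, Matrix.mul_assoc]
    · rw [hk2, hab]
  -- The last block column of `v` is `(0; b)`. Since `b` is unitary, the normalization of the lower
  -- rows makes the other off-diagonal block vanish too, and `v` lies in `K`.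
  have hvcol : toMat v * (fromRows 0 1 : Matrix (Fin p ⊕ Fin q) (Fin q) F) = fromRows 0 b := by
    have h1 := conjTranspose_mul_self_of_unitary (toMat_mem (k.1 * torus hqp.le x))
    have h2 := congrArg (fun C : Matrix (Fin p ⊕ Fin q) (Fin q) F => (toMat (k.1 * torus hqp.le x))ᴴ * C) hcol
    simp only [← Matrix.mul_assoc] at h2
    rw [h1, Matrix.one_mul] at h2
    rw [← h2, hv]
    congr 1
    rw [← toMat_inv, ← toMat_mul, _root_.mul_inv_rev]
  have hv12 : (toMat v).toBlocks₁₂ = 0 ∧ (toMat v).toBlocks₂₂ = b := by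
    have h1 := (fromBlocks_mul_fromRows _ _ _ _ _ _).symm.trans
      ((congrArg (· * (fromRows 0 1 : Matrix (Fin p ⊕ Fin q) (Fin q) F))
        (fromBlocks_toBlocks (toMat v))).trans hvcol)
    simpa using fromRows_inj h1
  have hv21 : (toMat v).toBlocks₂₁ = 0 := by
    have h := mul_conjTranspose_self_of_unitary (toMat_mem v)
    rw [← fromBlocks_toBlocks (toMat v), fromBlocks_conjTranspose, fromBlocks_multiply,
      ← fromBlocks_one, fromBlocks_inj] at h
    have h2 := h.2.2.2
    rw [hv12.2, mul_conjTranspose_self_of_unitary hb, add_eq_right] at h2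
    ext r t
    have h3 := mul_conjTranspose_self_diag (toMat v).toBlocks₂₁ r
    rw [h2, Matrix.zero_apply, eq_comm, ← map_zero (algebraMap ℝ F), algebraMap_inj,
      normSq_eq_zero] at h3
    exact congrFun h3 t
  exact ⟨k, ⟨v, hv12.1, hv21⟩, huv⟩

end Grassmannian

end Grassmann

/-! ### Continuity and invariance of the product formula. -/

namespace Grassmann
open Set ENNReal

section ProductAngles

variable {F : Type} [NormedRing F] [StarRing F] [NormedStarGroup F] [NormedAlgebra ℝ F]
  [IsScalar F] [ProperSpace F] {q : ℕ}

theorem continuous_productAngles :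
    Continuous fun z : ((Fin q → ℝ) × (Fin q → ℝ)) × (Matrix (Fin q) (Fin q) F ×
      Matrix (Fin q) (Fin q) F) => productAngles z.1.1 z.1.2 z.2.1 z.2.2 := by
  have hc : Continuous fun x : Fin q → ℝ => cosDiag F x :=
    continuous_realDiag.comp (continuous_pi fun i => Real.continuous_cos.comp (continuous_apply i))
  have hs : Continuous fun x : Fin q → ℝ => sinDiag F x :=
    continuous_realDiag.comp (continuous_pi fun i => Real.continuous_sin.comp (continuous_apply i))
  refine continuous_singularAngles.comp ?_
  have h1 := hs.comp (continuous_fst.comp continuous_fst (X := ((Fin q → ℝ) × (Fin q → ℝ)) ×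
    (Matrix (Fin q) (Fin q) F × Matrix (Fin q) (Fin q) F)))
  have h2 := hs.comp (continuous_snd.comp continuous_fst (X := ((Fin q → ℝ) × (Fin q → ℝ)) ×
    (Matrix (Fin q) (Fin q) F × Matrix (Fin q) (Fin q) F)))
  have h3 := hc.comp (continuous_fst.comp continuous_fst (X := ((Fin q → ℝ) × (Fin q → ℝ)) ×
    (Matrix (Fin q) (Fin q) F × Matrix (Fin q) (Fin q) F)))
  have h4 := hc.comp (continuous_snd.comp continuous_fst (X := ((Fin q → ℝ) × (Fin q → ℝ)) ×
    (Matrix (Fin q) (Fin q) F × Matrix (Fin q) (Fin q) F)))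
  have h5 := continuous_fst.comp continuous_snd (X := ((Fin q → ℝ) × (Fin q → ℝ)) ×
    (Matrix (Fin q) (Fin q) F × Matrix (Fin q) (Fin q) F))
  have h6 := continuous_snd.comp continuous_snd (X := ((Fin q → ℝ) × (Fin q → ℝ)) ×
    (Matrix (Fin q) (Fin q) F × Matrix (Fin q) (Fin q) F))
  exact (((h1.mul h6).mul h2).neg).add ((h3.mul h5).mul h4)

theorem productAngles_neg_neg (x y : Fin q → ℝ) (v w : Matrix (Fin q) (Fin q) F) :
    productAngles (-x) (-y) v w = productAngles x y v w := by
  simp [productAngles]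

/-- Diagonal unitary matrices commute with real diagonal matrices. -/
theorem commute_realDiag {t : Matrix (Fin q) (Fin q) F} (ht : ∀ i j, i ≠ j → t i j = 0)
    (σ : Fin q → ℝ) : t * realDiag F σ = realDiag F σ * t := by
  ext i j
  rw [mul_realDiag_apply, realDiag_mul_apply]
  by_cases h : i = j
  · rw [h]
  · rw [ht i j h, smul_zero, smul_zero]

/-- Diagonal unitary matrices commute with real diagonal ones, so `t` moves to the far right, where
singular values ignore it. This invariance allows passing from `U(q)` to its identity component. -/
theorem productAngles_mul_diagonal {t : Matrix (Fin q) (Fin q) F}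
    (htu : t ∈ unitary (Matrix (Fin q) (Fin q) F)) (ht : ∀ i j, i ≠ j → t i j = 0)
    (x y : Fin q → ℝ) (v w : Matrix (Fin q) (Fin q) F) :
    productAngles x y (v * t) (w * t) = productAngles x y v w := by
  have h : ∀ (a w : Matrix (Fin q) (Fin q) F) (σ : Fin q → ℝ),
      a * (w * t) * realDiag F σ = a * w * realDiag F σ * t := by
    intro a w σ
    rw [← mul_assoc a w t, mul_assoc (a * w) t, commute_realDiag ht, ← mul_assoc]
  rw [productAngles, productAngles, sinDiag_eq y, cosDiag_eq y, h, h, ← neg_mul, ← add_mul]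
  simpa using singularAngles_mul_mul (one_mem _) htu
    (-(sinDiag F x * w * realDiag F fun i => Real.sin (y i)) +
      cosDiag F x * v * realDiag F fun i => Real.cos (y i))

theorem measurable_comp_productAngles {X : Type*} [TopologicalSpace X] [MeasurableSpace X]
    [OpensMeasurableSpace X] {f : alcove q → ℝ≥0∞} (hf : Measurable f) (x y : Fin q → ℝ)
    {v w : X → Matrix (Fin q) (Fin q) F} (hv : Continuous v) (hw : Continuous w) :
    Measurable fun z => f (productAngles x y (v z) (w z)) := by
  have key : ∀ P : (Fin q → ℝ) → (Fin q → ℝ) → Matrix (Fin q) (Fin q) F →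
      Matrix (Fin q) (Fin q) F → alcove q,
      (Continuous fun z : ((Fin q → ℝ) × (Fin q → ℝ)) × (Matrix (Fin q) (Fin q) F ×
        Matrix (Fin q) (Fin q) F) => P z.1.1 z.1.2 z.2.1 z.2.2) →
      Continuous fun z => P x y (v z) (w z) := fun P hP =>
    hP.comp ((continuous_const (y := (x, y))).prodMk (hv.prodMk hw))
  have h : Continuous fun z => productAngles x y (v z) (w z) :=
    key productAngles continuous_productAngles
  have h' := h.measurable
  exact hf.comp h'

end ProductAngles

/-! ### The double coset convolution and its expression on the matrix ball. -/

section DoubleCoset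

variable {F : Type} [NormedRing F] [StarRing F] [NormedStarGroup F] [NormedAlgebra ℝ F]
  [IsScalar F] [ProperSpace F] [HasDet F] [IsScalarDet F] {p q : ℕ}
  [MeasureSpace F] [BorelSpace F]

instance : SecondCountableTopology (grassmannU F p q) :=
  TopologicalSpace.Subtype.secondCountableTopology _

instance : SecondCountableTopology (grassmannK F p q) :=
  TopologicalSpace.Subtype.secondCountableTopology _

instance : SecondCountableTopology (unitaryComponent F q) :=
  TopologicalSpace.Subtype.secondCountableTopology _

/-- The average depends on the double cosets of `g` and `h` only: the inner `K` factors of their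
Cartan decompositions are absorbed by Haar measure, the outer ones by the invariance of the angles.
-/
theorem lintegral_angles_eq (hqp : q < p) (g h : grassmannU F p q) (f : alcove q → ℝ≥0∞) :
    ∫⁻ k : grassmannK F p q, f (angles (g * k.1 * h)) ∂normalizedHaar (grassmannK F p q) =
      ∫⁻ k : grassmannK F p q, f (angles (torus hqp.le (angles g).1 * k.1 *
        torus hqp.le (angles h).1)) ∂normalizedHaar (grassmannK F p q) := by
  obtain ⟨a, b, hg⟩ := exists_eq_mul_torus_mul hqp g
  obtain ⟨c, d, hh⟩ := exists_eq_mul_torus_mul hqp h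
  have e : ∀ k : grassmannK F p q, angles (g * k.1 * h) =
      angles (torus hqp.le (angles g).1 * (b * k * c).1 * torus hqp.le (angles h).1) := by
    intro k
    have e1 : g * k.1 * h = a.1 * (torus hqp.le (angles g).1 * (b * k * c).1 *
        torus hqp.le (angles h).1) * d.1 := by
      generalize torus (F := F) hqp.le (angles g).1 = A at hg
      generalize torus (F := F) hqp.le (angles h).1 = B at hh
      rw [hg, hh]
      simp only [Subgroup.coe_mul, mul_assoc]
    rw [e1, angles_mul_mul]
  simp only [e]
  rw [lintegral_mul_right_normalizedHaar (fun k : grassmannK F p q =>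
      f (angles (torus hqp.le (angles g).1 * k.1 * torus hqp.le (angles h).1))) c |>.symm,
    lintegral_mul_left_normalizedHaar (fun k : grassmannK F p q =>
      f (angles (torus hqp.le (angles g).1 * (k * c).1 * torus hqp.le (angles h).1))) b |>.symm]

/-- Associativity of the double coset convolution. -/
theorem lintegral_angles_assoc (hqp : q < p) (x y z : alcove q) {f : alcove q → ℝ≥0∞}
    (hf : Measurable f) :
    ∫⁻ k : grassmannK F p q, ∫⁻ l : grassmannK F p q,
      f (angles (torus hqp.le (angles (torus hqp.le x.1 * k.1 * torus hqp.le y.1)).1 * l.1 *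
        torus hqp.le z.1)) ∂normalizedHaar (grassmannK F p q) ∂normalizedHaar (grassmannK F p q) =
    ∫⁻ l : grassmannK F p q, ∫⁻ k : grassmannK F p q,
      f (angles (torus hqp.le x.1 * k.1 * torus hqp.le
        (angles (torus hqp.le y.1 * l.1 * torus hqp.le z.1)).1))
      ∂normalizedHaar (grassmannK F p q) ∂normalizedHaar (grassmannK F p q) := by
  have h1 : ∀ k : grassmannK F p q, ∫⁻ l : grassmannK F p q,
      f (angles (torus hqp.le (angles (torus hqp.le x.1 * k.1 * torus hqp.le y.1)).1 * l.1 *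
        torus hqp.le z.1)) ∂normalizedHaar (grassmannK F p q) =
      ∫⁻ l : grassmannK F p q, f (angles (torus hqp.le x.1 * k.1 * torus hqp.le y.1 * l.1 *
        torus hqp.le z.1)) ∂normalizedHaar (grassmannK F p q) := by
    intro k
    rw [lintegral_angles_eq hqp (torus hqp.le x.1 * k.1 * torus hqp.le y.1), angles_torus]
  have h2 : ∀ l : grassmannK F p q, ∫⁻ k : grassmannK F p q,
      f (angles (torus hqp.le x.1 * k.1 * torus hqp.le
        (angles (torus hqp.le y.1 * l.1 * torus hqp.le z.1)).1))
        ∂normalizedHaar (grassmannK F p q) =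
      ∫⁻ k : grassmannK F p q, f (angles (torus hqp.le x.1 * k.1 * torus hqp.le y.1 * l.1 *
        torus hqp.le z.1)) ∂normalizedHaar (grassmannK F p q) := by
    intro l
    rw [← angles_torus (F := F) hqp.le x, ← lintegral_angles_eq hqp (torus hqp.le x.1)
      (torus hqp.le y.1 * l.1 * torus hqp.le z.1)]
    simp only [angles_torus, mul_assoc]
  -- Both sides are now the double average of `f` at the angles of `b_x k b_y l b_z`, in the two
  -- orders of integration.
  simp only [h1, h2]
  refine lintegral_lintegral_swap (Measurable.aemeasurable (hf.comp ?_))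
  refine (continuous_angles.comp ?_).measurable
  fun_prop

/-- Commutativity of the double coset convolution. -/
theorem lintegral_angles_comm (hqp : q < p) (x y : alcove q) (f : alcove q → ℝ≥0∞) :
    ∫⁻ k : grassmannK F p q, f (angles (torus hqp.le x.1 * k.1 * torus hqp.le y.1))
      ∂normalizedHaar (grassmannK F p q) =
    ∫⁻ k : grassmannK F p q, f (angles (torus hqp.le y.1 * k.1 * torus hqp.le x.1))
      ∂normalizedHaar (grassmannK F p q) := by
  have h : ∀ x : Fin q → ℝ, (torus (F := F) hqp.le x)⁻¹ = torus hqp.le (-x) := fun x =>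
    toMat_injective (rotationMatrix_conjTranspose hqp.le x)
  -- Inversion preserves the angles, reverses the product and sends `b_x` to `b_{-x}`. Changing the
  -- signs of both arguments does not affect the product formula.
  have h2 : ∀ k : grassmannK F p q, angles (torus hqp.le x.1 * k.1 * torus hqp.le y.1) =
      angles (torus hqp.le y.1 * k⁻¹.1 * torus hqp.le x.1) := by
    intro k
    rw [← angles_inv, _root_.mul_inv_rev, _root_.mul_inv_rev, h, h, ← mul_assoc]
    change angles (torus hqp.le (-y.1) * (k⁻¹ : grassmannK F p q).1 * torus hqp.le (-x.1)) = _
    rw [angles_torus_mul_mul, angles_torus_mul_mul, productAngles_neg_neg]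
  simp only [h2]
  exact lintegral_inv_eq_self (fun k : grassmannK F p q =>
    f (angles (torus hqp.le y.1 * k.1 * torus hqp.le x.1)))

/-- Averages over `K` of functions which are invariant under diagonal unitary matrices. -/
theorem lintegral_blocks_eq (hq : 0 < q) (hqp : q + q ≤ p)
    {G : Matrix (Fin q) (Fin q) F → Matrix (Fin q) (Fin q) F → ℝ≥0∞}
    (hG : Measurable fun z : Matrix (Fin q) (Fin q) F × Matrix (Fin q) (Fin q) F => G z.1 z.2)
    (hGt : ∀ t : Matrix (Fin q) (Fin q) F, t ∈ unitary (Matrix (Fin q) (Fin q) F) →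
      (∀ i j, i ≠ j → t i j = 0) → ∀ v w, G (v * t) (w * t) = G v w) :
    ∫⁻ k : grassmannK F p q, G (blockTwo k)
      ((coordEmbedding F (le_of_add_le_left hqp))ᴴ * blockOne k *
        coordEmbedding F (le_of_add_le_left hqp)) ∂normalizedHaar (grassmannK F p q) =
      ∫⁻ v : unitaryComponent F q, ∫⁻ u : unitaryMatrices F (Fin p),
        G (v : Matrix (Fin q) (Fin q) F)
          ((coordEmbedding F (le_of_add_le_left hqp))ᴴ * (u : Matrix (Fin p) (Fin p) F) *
            coordEmbedding F (le_of_add_le_left hqp)) ∂normalizedHaar (unitaryMatrices F (Fin p))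
        ∂normalizedHaar (unitaryComponent F q) := by
  have hq' : q ≤ p := le_of_add_le_left hqp
  obtain ⟨E, hE⟩ : ∃ E, E = coordEmbedding F hq' := ⟨_, rfl⟩
  rw [← hE]
  set HP := normalizedHaar (unitaryMatrices F (Fin p)) with hHP
  set HQ := normalizedHaar (unitaryMatrices F (Fin q)) with hHQ
  set H0 := normalizedHaar (unitaryComponent F q) with hH0
  set T : Matrix (Fin p) (Fin p) F → Matrix (Fin q) (Fin q) F → ℝ≥0∞ :=
    fun u v => G v (Eᴴ * u * E) with hT
  have hTc : Measurable fun z : Matrix (Fin p) (Fin p) F × Matrix (Fin q) (Fin q) F =>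
      T z.1 z.2 := by
    refine hG.comp (measurable_snd.prodMk (Continuous.measurable ?_))
    exact (continuous_const.matrix_mul continuous_fst).matrix_mul continuous_const
  set Ψ : unitaryMatrices F (Fin p) × unitaryMatrices F (Fin q) → ℝ≥0∞ := fun ω =>
    T ω.1 ω.2 with hΨ
  have hΨm : Measurable Ψ := hTc.comp
    ((measurable_subtype_coe.comp measurable_fst).prodMk
      (measurable_subtype_coe.comp measurable_snd))
  let i : Fin p := ⟨p - 1, by omega⟩
  have hi : q ≤ (i : ℕ) := by simp only [i]; omega
  -- Haar measure on `U(p) × U(q)` is averaged over `K`. Each pair is the pair of blocks of an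
  -- element of `K` up to a phase in the coordinate `p - 1 ≥ q`, which the corner does not see.
  have e1 : ∫⁻ ω, Ψ ω ∂(HP.prod HQ) = ∫⁻ k : grassmannK F p q, T (blockOne k) (blockTwo k)
      ∂normalizedHaar (grassmannK F p q) := by
    let b1 : grassmannK F p q → unitaryMatrices F (Fin p) := fun k => ⟨blockOne k, blockOne_mem k⟩
    let b2 : grassmannK F p q → unitaryMatrices F (Fin q) := fun k => ⟨blockTwo k, blockTwo_mem k⟩
    have hb1 : Continuous b1 := continuous_blockOne.subtype_mk _
    have hb2 : Continuous b2 := continuous_blockTwo.subtype_mk _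
    rw [lintegral_eq_of_lintegral_smul (η := normalizedHaar (grassmannK F p q))
      (fun (k : grassmannK F p q) (ω : unitaryMatrices F (Fin p) × unitaryMatrices F (Fin q)) =>
        (b1 k * ω.1, b2 k * ω.2)) ?_
      (fun k => (measurePreserving_mul_left HP (b1 k)).prod (measurePreserving_mul_left HQ (b2 k)))
      hΨm]
    · have : ∀ ω : unitaryMatrices F (Fin p) × unitaryMatrices F (Fin q),
          ∫⁻ k : grassmannK F p q, Ψ (b1 k * ω.1, b2 k * ω.2)
            ∂normalizedHaar (grassmannK F p q) =
          ∫⁻ k : grassmannK F p q, T (blockOne k) (blockTwo k)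
            ∂normalizedHaar (grassmannK F p q) := by
        intro ω
        obtain ⟨s, hs, k₀, h1, h2⟩ := exists_blocks_eq i ω.1.2 ω.2.2
        rw [← lintegral_mul_right_normalizedHaar (fun k : grassmannK F p q =>
          T (blockOne k) (blockTwo k)) k₀]
        refine lintegral_congr fun k => ?_
        change T (blockOne k * (ω.1 : Matrix (Fin p) (Fin p) F))
          (blockTwo k * (ω.2 : Matrix (Fin q) (Fin q) F)) = _
        simp only [hT]
        have hX : Eᴴ * (blockOne k * ((ω.1 : Matrix (Fin p) (Fin p) F) *
            Matrix.diagonal (Function.update 1 i s))) * E =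
            Eᴴ * (blockOne k * (ω.1 : Matrix (Fin p) (Fin p) F)) * E := by
          have hE' := coordEmbedding_mul_diagonal_update (F := F) (hqp := hq') hi s
          rw [← hE] at hE'
          simp only [Matrix.mul_assoc, hE']
        rw [blockOne_mul, blockTwo_mul, h1, h2, hX]
      simp only [this, lintegral_const, measure_univ, mul_one]
    · refine Continuous.measurable ?_
      exact ((hb1.comp continuous_snd).mul (continuous_fst.comp continuous_fst)).prodMk
        ((hb2.comp continuous_snd).mul (continuous_snd.comp continuous_fst))
  -- The same measure is averaged over `U₀(q) × U(p)` instead.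
  have e2 : ∫⁻ ω, Ψ ω ∂(HP.prod HQ) = ∫⁻ v : unitaryComponent F q,
      ∫⁻ u : unitaryMatrices F (Fin p), T u (v : Matrix (Fin q) (Fin q) F) ∂HP ∂H0 := by
    rw [lintegral_eq_of_lintegral_smul (η := H0.prod HP)
      (fun (h : unitaryComponent F q × unitaryMatrices F (Fin p))
        (ω : unitaryMatrices F (Fin p) × unitaryMatrices F (Fin q)) =>
        (h.2 * ω.1, h.1.1 * ω.2)) ?_
      (fun h => (measurePreserving_mul_left HP h.2).prod (measurePreserving_mul_left HQ h.1.1))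
      hΨm]
    · have : ∀ ω : unitaryMatrices F (Fin p) × unitaryMatrices F (Fin q),
          ∫⁻ h : unitaryComponent F q × unitaryMatrices F (Fin p), Ψ (h.2 * ω.1, h.1.1 * ω.2)
            ∂(H0.prod HP) =
          ∫⁻ v : unitaryComponent F q,
            ∫⁻ u : unitaryMatrices F (Fin p), T u (v : Matrix (Fin q) (Fin q) F) ∂HP ∂H0 := by
        intro ω
        obtain ⟨v₀, hv₀, t, hvt, ht⟩ := exists_component_mul_diagonal ω.2
        -- Since `E t*` has orthonormal columns, it equals `r E` with `r` unitary. Absorbing `r`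
        -- into `u` leaves the corner multiplied by `t` on the right, like the other argument, and
        -- the invariance of `G` removes `t`.
        obtain ⟨r, hr, hrE⟩ := exists_unitary_mul_eq (F := F) hq'
          (A := E * (t : Matrix (Fin q) (Fin q) F)ᴴ) (B := E) (by
            rw [conjTranspose_mul, conjTranspose_conjTranspose, Matrix.mul_assoc,
              ← Matrix.mul_assoc Eᴴ, hE, coordEmbedding_gram, Matrix.one_mul,
              mul_conjTranspose_self_of_unitary t.2])
        have hm : Measurable fun h : unitaryComponent F q × unitaryMatrices F (Fin p) =>
            Ψ (h.2 * ω.1, h.1.1 * ω.2) := by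
          refine hΨm.comp (Continuous.measurable ?_)
          fun_prop
        rw [lintegral_prod _ hm.aemeasurable,
          ← lintegral_mul_right_normalizedHaar (fun v : unitaryComponent F q =>
            ∫⁻ u : unitaryMatrices F (Fin p), T u (v : Matrix (Fin q) (Fin q) F) ∂HP) ⟨v₀, hv₀⟩]
        refine lintegral_congr fun v => ?_
        rw [← lintegral_mul_right_normalizedHaar (fun u : unitaryMatrices F (Fin p) =>
          T u ((v * ⟨v₀, hv₀⟩ : unitaryComponent F q) : Matrix (Fin q) (Fin q) F))
          (ω.1 * ⟨r, hr⟩)]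
        refine lintegral_congr fun u => ?_
        change G ((v : Matrix (Fin q) (Fin q) F) * (ω.2 : Matrix _ _ F))
          (Eᴴ * ((u : Matrix (Fin p) (Fin p) F) * (ω.1 : Matrix _ _ F)) * E) =
          G ((v : Matrix (Fin q) (Fin q) F) * (v₀ : Matrix _ _ F))
          (Eᴴ * ((u : Matrix (Fin p) (Fin p) F) * ((ω.1 : Matrix _ _ F) * r)) * E)
        have hω : (ω.2 : Matrix (Fin q) (Fin q) F) = (v₀ : Matrix _ _ F) * (t : Matrix _ _ F) := by
          rw [hvt]; rfl
        have hEt : r * E * (t : Matrix (Fin q) (Fin q) F) = E := by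
          rw [← hrE, Matrix.mul_assoc, conjTranspose_mul_self_of_unitary t.2, Matrix.mul_one]
        have h1 : Eᴴ * ((u : Matrix (Fin p) (Fin p) F) * (ω.1 : Matrix _ _ F)) * E =
            Eᴴ * ((u : Matrix (Fin p) (Fin p) F) * ((ω.1 : Matrix _ _ F) * r)) * E *
              (t : Matrix (Fin q) (Fin q) F) := by
          rw [Matrix.mul_assoc r] at hEt
          simp only [Matrix.mul_assoc, hEt]
        rw [hω, ← mul_assoc (v : Matrix (Fin q) (Fin q) F), h1,
          hGt _ t.2 ht]
      simp only [this, lintegral_const, measure_univ, mul_one]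
    · refine Continuous.measurable ?_
      fun_prop
  exact e1.symm.trans e2

variable [Measure.IsAddHaarMeasure (volume : Measure F)]

/-- The exponent which belongs to the Grassmannian of `q`-dimensional subspaces of `Fᵖ⁺ᵠ`. -/
def grassmannExponent (F : Type) [NormedRing F] [NormedAlgebra ℝ F] (p q : ℕ) : ℝ :=
  Module.finrank ℝ F * ((p : ℝ) - q - q + 1) / 2 - 1

/-- The double coset convolution in terms of the matrix ball. -/
theorem exists_lintegral_angles_eq (hq : 0 < q) (hqp : q + q ≤ p) :
    ∃ C : ℝ≥0∞, ∀ (x y : alcove q) (f : alcove q → ℝ≥0∞), Measurable f →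
      ∫⁻ k : grassmannK F p q, f (angles (torus (le_of_add_le_left hqp) x.1 * k.1 *
        torus (le_of_add_le_left hqp) y.1)) ∂normalizedHaar (grassmannK F p q) =
      C * ∫⁻ v : unitaryComponent F q, (∫⁻ w in rectBall F q q,
        f (productAngles x.1 y.1 (v : Matrix (Fin q) (Fin q) F) w) *
          ENNReal.ofReal (gramDet w ^ grassmannExponent F p q))
        ∂normalizedHaar (unitaryComponent F q) := by
  obtain ⟨C, hC⟩ := exists_lintegral_unitary_submatrix (F := F) hq q p hqp
  refine ⟨C, fun x y f hf => ?_⟩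
  obtain ⟨G, hG⟩ : ∃ G : Matrix (Fin q) (Fin q) F → Matrix (Fin q) (Fin q) F → ℝ≥0∞,
    G = fun v w => f (productAngles x.1 y.1 v w) := ⟨_, rfl⟩
  have hGm : Measurable fun z : Matrix (Fin q) (Fin q) F × Matrix (Fin q) (Fin q) F =>
      G z.1 z.2 := by
    rw [hG]
    exact measurable_comp_productAngles hf x.1 y.1 continuous_fst continuous_snd
  have hGt : ∀ t : Matrix (Fin q) (Fin q) F, t ∈ unitary (Matrix (Fin q) (Fin q) F) →
      (∀ i j, i ≠ j → t i j = 0) → ∀ v w, G (v * t) (w * t) = G v w := by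
    intro t h1 h2 v w
    rw [hG]
    exact congrArg f (productAngles_mul_diagonal h1 h2 x.1 y.1 v w)
  have hG' : ∀ v w, f (productAngles x.1 y.1 v w) = G v w := fun v w => by rw [hG]
  simp only [angles_torus_mul_mul, hG']
  have hmeas : Measurable fun v : unitaryComponent F q => ∫⁻ w in rectBall F q q,
      G (v : Matrix (Fin q) (Fin q) F) w *
        ENNReal.ofReal (gramDet w ^ grassmannExponent F p q) := by
    have h1 : Measurable fun z : unitaryComponent F q × Matrix (Fin q) (Fin q) F =>
        G (z.1 : Matrix (Fin q) (Fin q) F) z.2 *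
          ENNReal.ofReal (gramDet z.2 ^ grassmannExponent F p q) := by
      refine (hGm.comp (Measurable.prodMk (Continuous.measurable ?_) measurable_snd)).mul
        ((((continuous_gramDet (F := F)).measurable.comp measurable_snd).pow_const _).ennreal_ofReal)
      fun_prop
    exact h1.lintegral_prod_right'
  rw [lintegral_blocks_eq hq hqp hGm hGt, ← lintegral_const_mul _ hmeas]
  refine lintegral_congr fun v => ?_
  refine Eq.trans ?_ (hC (fun w => G (v : Matrix (Fin q) (Fin q) F) w)
    (hGm.comp measurable_prodMk_left))
  refine lintegral_congr fun u => ?_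
  rw [mul_coordEmbedding, coordEmbedding_conjTranspose_mul]
  rfl

end DoubleCoset

end Grassmann

/-! ### From moments to complex powers. -/

namespace Grassmann
open Set ENNReal

section Moments

theorem integrable_of_ae_mem_Icc {M : Measure ℝ} [IsFiniteMeasure M]
    (h : ∀ᵐ r ∂M, r ∈ Icc (0 : ℝ) 1) {g : ℝ → ℝ} (hg : Continuous g) : Integrable g M := by
  obtain ⟨C, hC⟩ := isCompact_Icc.exists_bound_of_continuousOn (hg.continuousOn (s := Icc (0 : ℝ) 1))
  exact Integrable.of_bound hg.aestronglyMeasurable C (h.mono fun r hr => hC r hr)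

/-- A finite measure on the unit interval is determined by its moments. -/
theorem ext_of_moments {M M' : Measure ℝ} [IsFiniteMeasure M] [IsFiniteMeasure M']
    (h : ∀ᵐ r ∂M, r ∈ Icc (0 : ℝ) 1) (h' : ∀ᵐ r ∂M', r ∈ Icc (0 : ℝ) 1)
    (hm : ∀ n : ℕ, ∫ r, r ^ n ∂M = ∫ r, r ^ n ∂M') : M = M' := by
  refine ext_of_forall_integral_eq_of_IsFiniteMeasure fun f => ?_
  have hpoly : ∀ P : Polynomial ℝ, ∫ r, P.eval r ∂M = ∫ r, P.eval r ∂M' := by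
    intro P
    simp only [Polynomial.eval_eq_sum_range]
    rw [integral_finsetSum _ fun i _ => (integrable_of_ae_mem_Icc h (continuous_pow i)).const_mul _,
      integral_finsetSum _ fun i _ => (integrable_of_ae_mem_Icc h' (continuous_pow i)).const_mul _]
    simp only [integral_const_mul, hm]
  have key : ∀ {N : Measure ℝ} [IsFiniteMeasure N], (∀ᵐ r ∂N, r ∈ Icc (0 : ℝ) 1) →
      ∀ ε : ℝ, ∀ P : Polynomial ℝ, (∀ x ∈ Icc (0 : ℝ) 1, |P.eval x - f x| < ε) →
      |∫ r, P.eval r ∂N - ∫ r, f r ∂N| ≤ ε * N.real univ := by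
    intro N _ hN ε P hP
    rw [← integral_sub (integrable_of_ae_mem_Icc hN P.continuous)
      (integrable_of_ae_mem_Icc hN f.continuous), ← Real.norm_eq_abs]
    exact norm_integral_le_of_norm_le_const (hN.mono fun r hr => (hP r hr).le)
  refine eq_of_abs_sub_le_all fun ε hε => ?_
  set c := M.real univ + M'.real univ + 1
  have hc : 0 < c := by positivity
  -- Weierstrass approximation on `[0, 1]`, with an accuracy that allows for both total masses.
  obtain ⟨P, hP⟩ := exists_polynomial_near_of_continuousOn 0 1 f f.continuous.continuousOn
    (ε / c) (by positivity)
  have h1 := key h _ P hP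
  have h2 := key h' _ P hP
  rw [hpoly P] at h1
  have h3 : ε / c * M.real univ + ε / c * M'.real univ ≤ ε := by
    rw [← mul_add, div_mul_eq_mul_div, div_le_iff₀ hc]
    exact mul_le_mul_of_nonneg_left (by simp [c]) hε.le
  calc |∫ r, f r ∂M - ∫ r, f r ∂M'|
      = |(∫ r, P.eval r ∂M' - ∫ r, f r ∂M') - (∫ r, P.eval r ∂M' - ∫ r, f r ∂M)| := by
        congr 1; ring
    _ ≤ _ := (abs_sub _ _)
    _ ≤ ε := by linarith

/-- The image of a measure with density a power of `t` under another power of `t`. -/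
theorem exists_map_withDensity_rpow {Ω : Type*} [MeasurableSpace Ω] {M : Measure Ω} {t : Ω → ℝ}
    (ht : Measurable t) (h01 : ∀ᵐ ω ∂M, t ω ∈ Ioc (0 : ℝ) 1) {e h : ℝ} (hh : 0 < h)
    (hfin : ∫⁻ ω, ENNReal.ofReal (t ω ^ e) ∂M ≠ ⊤) (s : ℂ) :
    ∃ N : Measure ℝ, IsFiniteMeasure N ∧ (∀ᵐ r ∂N, r ∈ Icc (0 : ℝ) 1) ∧
      (∀ n : ℕ, ∫⁻ r, ENNReal.ofReal (r ^ n) ∂N = ∫⁻ ω, ENNReal.ofReal (t ω ^ (e + n * h)) ∂M) ∧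
      ∫ r, (r : ℂ) ^ ((s - e) / h) ∂N = ∫ ω, (t ω : ℂ) ^ s ∂M := by
  have hte : Measurable fun ω => ENNReal.ofReal (t ω ^ e) := (ht.pow_const e).ennreal_ofReal
  have hth : Measurable fun ω => t ω ^ h := ht.pow_const h
  -- `N` is the image of `t^e M` under `r = t^h`. Then `r^n t^e = t^(e + nh)` and `r^((s-e)/h) t^e =
  -- t^s`.
  refine ⟨(M.withDensity fun ω => ENNReal.ofReal (t ω ^ e)).map fun ω => t ω ^ h, ?_, ?_, ?_, ?_⟩
  · have := isFiniteMeasure_withDensity (μ := M) hfin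
    infer_instance
  · refine (ae_map_iff hth.aemeasurable measurableSet_Icc).2 ?_
    refine (withDensity_absolutelyContinuous M _).ae_le (h01.mono fun ω hω => ?_)
    exact ⟨Real.rpow_nonneg hω.1.le _, Real.rpow_le_one hω.1.le hω.2 hh.le⟩
  · intro n
    rw [lintegral_map (by fun_prop) hth, lintegral_withDensity_eq_lintegral_mul _ hte (by fun_prop)]
    refine lintegral_congr_ae (h01.mono fun ω hω => ?_)
    simp only [Pi.mul_apply]
    rw [← ENNReal.ofReal_mul (Real.rpow_nonneg hω.1.le _), ← Real.rpow_natCast,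
      ← Real.rpow_mul hω.1.le, ← Real.rpow_add hω.1, mul_comm h]
  · rw [integral_map hth.aemeasurable (Measurable.aestronglyMeasurable
        (Complex.measurable_ofReal.pow_const _)),
      integral_withDensity_eq_integral_toReal_smul hte
        (Filter.Eventually.of_forall fun _ => ENNReal.ofReal_lt_top)]
    refine integral_congr_ae (h01.mono fun ω hω => ?_)
    have h0 : (t ω : ℂ) ≠ 0 := Complex.ofReal_ne_zero.2 hω.1.ne'
    simp only
    have h1 : ((t ω ^ h : ℝ) : ℂ) ≠ 0 := Complex.ofReal_ne_zero.2 (Real.rpow_pos_of_pos hω.1 h).ne'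
    have h2 : (h : ℂ) ≠ 0 := Complex.ofReal_ne_zero.2 hh.ne'
    rw [ENNReal.toReal_ofReal (Real.rpow_nonneg hω.1.le _), Complex.real_smul,
      Complex.ofReal_cpow hω.1.le, Complex.cpow_def_of_ne_zero h0, Complex.cpow_def_of_ne_zero h0,
      Complex.cpow_def_of_ne_zero h1, ← Complex.ofReal_log (Real.rpow_nonneg hω.1.le _),
      Real.log_rpow hω.1, ← Complex.exp_add, ← Complex.ofReal_log hω.1.le]
    congr 1
    push_cast
    field_simp
    ring

/-- Integrals of complex powers are determined by the integrals of the powers along an arithmetic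
progression. -/
theorem integral_cpow_eq {Ω Ω' : Type*} [MeasurableSpace Ω] [MeasurableSpace Ω'] {M : Measure Ω}
    {M' : Measure Ω'} {t : Ω → ℝ} {t' : Ω' → ℝ} (ht : Measurable t) (ht' : Measurable t')
    (h01 : ∀ᵐ ω ∂M, t ω ∈ Ioc (0 : ℝ) 1) (h01' : ∀ᵐ ω ∂M', t' ω ∈ Ioc (0 : ℝ) 1) {e h : ℝ}
    (hh : 0 < h) (hfin : ∫⁻ ω, ENNReal.ofReal (t ω ^ e) ∂M ≠ ⊤)
    (heq : ∀ n : ℕ, ∫⁻ ω, ENNReal.ofReal (t ω ^ (e + n * h)) ∂M =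
      ∫⁻ ω, ENNReal.ofReal (t' ω ^ (e + n * h)) ∂M') (s : ℂ) :
    ∫ ω, (t ω : ℂ) ^ s ∂M = ∫ ω, (t' ω : ℂ) ^ s ∂M' := by
  have hfin' : ∫⁻ ω, ENNReal.ofReal (t' ω ^ e) ∂M' ≠ ⊤ := by
    have := heq 0
    simp only [Nat.cast_zero, zero_mul, add_zero] at this
    rwa [← this]
  obtain ⟨N, hN, hN1, hN2, hN3⟩ := exists_map_withDensity_rpow ht h01 hh hfin s
  obtain ⟨N', hN', hN1', hN2', hN3'⟩ := exists_map_withDensity_rpow ht' h01' hh hfin' s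
  -- Both integrals are integrals of one function of `r`, so equality of the measures `N` and `N'`
  -- suffices. Integrability of `t^s` plays no role.
  rw [← hN3, ← hN3']
  congr 1
  refine ext_of_moments hN1 hN1' fun n => ?_
  rw [integral_eq_lintegral_of_nonneg_ae (hN1.mono fun r hr => pow_nonneg hr.1 n) (by fun_prop),
    integral_eq_lintegral_of_nonneg_ae (hN1'.mono fun r hr => pow_nonneg hr.1 n) (by fun_prop),
    hN2, hN2', heq]

end Moments

/-! ### Associativity and commutativity for the exponents of the Grassmannians. -/

section Associativity

variable (F : Type) [NormedRing F] [StarRing F] [NormedStarGroup F] [NormedAlgebra ℝ F]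
  [IsScalar F] [ProperSpace F] [HasDet F] [IsScalarDet F] {q : ℕ}
  [MeasureSpace F] [BorelSpace F] [Measure.IsAddHaarMeasure (volume : Measure F)]

/-- The parameter space of the convolution of two point measures. -/
abbrev BallParam (q : ℕ) := unitaryComponent F q × Matrix (Fin q) (Fin q) F

/-- The measure `dv dw` on the parameter space. -/
def paramMeasure (q : ℕ) : Measure (BallParam F q) :=
  (normalizedHaar (unitaryComponent F q)).prod (volume.restrict (matrixBall F q))

instance : SFinite (paramMeasure F q) := by unfold paramMeasure; infer_instance

variable {F}

/-- The determinant of `1 - w* w` at the parameter `(v, w)`. -/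
def paramDet (ω : BallParam F q) : ℝ := gramDet ω.2

/-- The point of the alcove which belongs to a pair of points and a parameter. -/
def paramProduct (x y : alcove q) (ω : BallParam F q) : alcove q :=
  productAngles x.1 y.1 (ω.1 : Matrix (Fin q) (Fin q) F) ω.2

theorem continuous_paramDet : Continuous (paramDet : BallParam F q → ℝ) :=
  continuous_gramDet.comp continuous_snd

theorem continuous_paramProduct {X : Type*} [TopologicalSpace X] {x y : X → alcove q}
    {ω : X → BallParam F q} (hx : Continuous x) (hy : Continuous y) (hω : Continuous ω) :
    Continuous fun z => paramProduct (x z) (y z) (ω z) := by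
  have h : Continuous fun z => (((x z).1, (y z).1), (((ω z).1 : Matrix (Fin q) (Fin q) F), (ω z).2)) := by
    fun_prop
  have key : ∀ P : (Fin q → ℝ) → (Fin q → ℝ) → Matrix (Fin q) (Fin q) F →
      Matrix (Fin q) (Fin q) F → alcove q,
      (Continuous fun z : ((Fin q → ℝ) × (Fin q → ℝ)) × (Matrix (Fin q) (Fin q) F ×
        Matrix (Fin q) (Fin q) F) => P z.1.1 z.1.2 z.2.1 z.2.2) →
      Continuous fun z => P (x z).1 (y z).1 ((ω z).1 : Matrix (Fin q) (Fin q) F) (ω z).2 :=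
    fun P hP => hP.comp h
  exact key productAngles continuous_productAngles

theorem measurable_paramProduct {X : Type*} [MeasurableSpace X] {x y : X → alcove q}
    {ω : X → BallParam F q} (hx : Measurable x) (hy : Measurable y) (hω : Measurable ω) :
    Measurable fun z => paramProduct (x z) (y z) (ω z) := by
  have h : Continuous fun z : (alcove q × alcove q) × BallParam F q =>
      paramProduct z.1.1 z.1.2 z.2 :=
    continuous_paramProduct (by fun_prop) (by fun_prop) (by fun_prop)
  have key : ∀ P : alcove q → alcove q → BallParam F q → alcove q,
      (Continuous fun z : (alcove q × alcove q) × BallParam F q => P z.1.1 z.1.2 z.2) →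
      Measurable fun z => P (x z) (y z) (ω z) :=
    fun P hP => hP.measurable.comp ((hx.prodMk hy).prodMk hω)
  exact key paramProduct h

theorem paramDet_mem : ∀ᵐ ω ∂paramMeasure F q, paramDet ω ∈ Ioc (0 : ℝ) 1 := by
  have h : ∀ᵐ w ∂(volume.restrict (matrixBall F q)), gramDet w ∈ Ioc (0 : ℝ) 1 := by
    rw [matrixBall_eq]
    refine (ae_restrict_mem (measurableSet_rectBall q q)).mono fun w hw => ?_
    exact ⟨gramDet_pos hw, gramDet_le_one hw⟩
  exact Measure.quasiMeasurePreserving_snd.ae h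

/-- The weights which belong to the Grassmannians. -/
def paramWeight (n : ℕ) (ω : BallParam F q) : ℝ≥0∞ :=
  ENNReal.ofReal (paramDet ω ^ ((Module.finrank ℝ F / 2 - 1 : ℝ) + n * (Module.finrank ℝ F / 2 : ℝ)))

theorem measurable_paramWeight (n : ℕ) : Measurable (paramWeight n : BallParam F q → ℝ≥0∞) :=
  (continuous_paramDet.measurable.pow_const _).ennreal_ofReal

/-- For `p = 2q + n` the exponent is `d/2 - 1 + n d/2`, so varying `n` runs through an arithmetic
progression. The constant is neither zero nor infinite because the `K`-average of one is one. -/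
theorem exists_lintegral_angles_eq_param (hq : 0 < q) {n p : ℕ} (hp : p = q + q + n)
    (hqp : q ≤ p) :
    ∃ C : ℝ≥0∞, C ≠ 0 ∧ C ≠ ⊤ ∧ ∀ (x y : alcove q) (f : alcove q → ℝ≥0∞), Measurable f →
      ∫⁻ k : grassmannK F p q, f (angles (torus hqp x.1 * k.1 * torus hqp y.1))
        ∂normalizedHaar (grassmannK F p q) =
      C * ∫⁻ ω, f (paramProduct x y ω) * paramWeight n ω ∂paramMeasure F q := by
  obtain ⟨C, hC⟩ := exists_lintegral_angles_eq (F := F) (p := p) hq (by omega)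
  have h : ∀ (x y : alcove q) (f : alcove q → ℝ≥0∞), Measurable f →
      ∫⁻ k : grassmannK F p q, f (angles (torus hqp x.1 * k.1 * torus hqp y.1))
        ∂normalizedHaar (grassmannK F p q) =
      C * ∫⁻ ω, f (paramProduct x y ω) * paramWeight n ω ∂paramMeasure F q := by
    intro x y f hf
    rw [hC x y f hf, paramMeasure, lintegral_prod]
    · have he : grassmannExponent F p q =
          (Module.finrank ℝ F / 2 - 1 : ℝ) + n * (Module.finrank ℝ F / 2 : ℝ) := by
        rw [grassmannExponent, hp]
        push_cast
        ring
      rw [he]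
      rfl
    · exact ((hf.comp (measurable_paramProduct measurable_const measurable_const
        measurable_id)).mul (measurable_paramWeight n)).aemeasurable
  have h1 := h 0 0 (fun _ => 1) measurable_const
  simp only [lintegral_const, measure_univ, mul_one, one_mul] at h1
  refine ⟨C, ?_, ?_, h⟩
  · rintro rfl
    simp at h1
  · rintro rfl
    rcases eq_or_ne (∫⁻ ω, paramWeight n ω ∂paramMeasure F q) 0 with h0 | h0
    · simp [h0] at h1
    · rw [ENNReal.top_mul h0] at h1
      simp at h1

/-- Each side equals the corresponding double average over `K` up to the factor `C²`, which cancels.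
-/
theorem lintegral_paramProduct_assoc (hq : 0 < q) (n : ℕ) (x y z : alcove q) {f : alcove q → ℝ≥0∞}
    (hf : Measurable f) :
    ∫⁻ ω, (∫⁻ ω', f (paramProduct (paramProduct x y ω) z ω') * paramWeight n ω'
      ∂paramMeasure F q) * paramWeight n ω ∂paramMeasure F q =
    ∫⁻ ω', (∫⁻ ω, f (paramProduct x (paramProduct y z ω') ω) * paramWeight n ω
      ∂paramMeasure F q) * paramWeight n ω' ∂paramMeasure F q := by
  have hqp : q ≤ q + q + n := by omega
  obtain ⟨C, h0, ht, hC⟩ := exists_lintegral_angles_eq_param (F := F) hq rfl hqp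
  have h := lintegral_angles_assoc (F := F) (by omega : q < q + q + n) x y z hf
  simp only [hC _ _ f hf] at h
  rw [hC x y (fun u => C * ∫⁻ ω, f (paramProduct u z ω) * paramWeight n ω ∂paramMeasure F q),
    hC y z (fun u => C * ∫⁻ ω, f (paramProduct x u ω) * paramWeight n ω ∂paramMeasure F q)] at h
  · simp only [mul_assoc C] at h
    rw [lintegral_const_mul' _ _ ht, lintegral_const_mul' _ _ ht,
      ENNReal.mul_right_inj h0 ht, ENNReal.mul_right_inj h0 ht] at h
    exact h
  · refine Measurable.const_mul (Measurable.lintegral_prod_right' (f := fun z' :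
      alcove q × BallParam F q => f (paramProduct x z'.1 z'.2) * paramWeight n z'.2) ?_) _
    exact (hf.comp (measurable_paramProduct measurable_const measurable_fst measurable_snd)).mul
      ((measurable_paramWeight n).comp measurable_snd)
  · refine Measurable.const_mul (Measurable.lintegral_prod_right' (f := fun z' :
      alcove q × BallParam F q => f (paramProduct z'.1 z z'.2) * paramWeight n z'.2) ?_) _
    exact (hf.comp (measurable_paramProduct measurable_fst measurable_const measurable_snd)).mul
      ((measurable_paramWeight n).comp measurable_snd)

theorem lintegral_paramProduct_comm (hq : 0 < q) (n : ℕ) (x y : alcove q) {f : alcove q → ℝ≥0∞}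
    (hf : Measurable f) :
    ∫⁻ ω, f (paramProduct x y ω) * paramWeight n ω ∂paramMeasure F q =
    ∫⁻ ω, f (paramProduct y x ω) * paramWeight n ω ∂paramMeasure F q := by
  have hqp : q ≤ q + q + n := by omega
  obtain ⟨C, h0, ht, hC⟩ := exists_lintegral_angles_eq_param (F := F) hq rfl hqp
  have h := lintegral_angles_comm (F := F) (by omega : q < q + q + n) x y f
  rwa [hC _ _ f hf, hC _ _ f hf, ENNReal.mul_right_inj h0 ht] at h

theorem lintegral_paramWeight_ne_top (hq : 0 < q) (n : ℕ) :
    ∫⁻ ω, paramWeight n ω ∂paramMeasure F q ≠ ⊤ := by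
  have hqp : q ≤ q + q + n := by omega
  obtain ⟨C, h0, ht, hC⟩ := exists_lintegral_angles_eq_param (F := F) hq rfl hqp
  have h := hC 0 0 (fun _ => 1) measurable_const
  simp only [lintegral_const, measure_univ, mul_one, one_mul] at h
  intro h'
  rw [h', ENNReal.mul_top h0] at h
  simp at h

end Associativity

end Grassmann

/-! ### Complex measures, their products and integrals. -/

namespace Grassmann
open Set ENNReal

section ComplexMeasures

variable {X Y Z W Ω : Type*} [MeasurableSpace X] [MeasurableSpace Y] [MeasurableSpace Z]
  [MeasurableSpace W] [MeasurableSpace Ω]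

instance (c : ComplexMeasure X) : IsFiniteMeasure c.variation := by
  refine isFiniteMeasure_of_le ((ComplexMeasure.re c).totalVariation +
    (ComplexMeasure.im c).totalVariation) (VectorMeasure.variation_le_of_forall_enorm_le ?_)
  intro E hE
  have h : c E = ((ComplexMeasure.re c E : ℝ) : ℂ) + ((ComplexMeasure.im c E : ℝ) : ℂ) * Complex.I :=
    (Complex.re_add_im _).symm
  rw [h, Measure.add_apply]
  refine (enorm_add_le _ _).trans (add_le_add ?_ ?_)
  · refine le_trans (le_of_eq ?_) (SignedMeasure.enorm_le_totalVariation _ E)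
    simp [enorm_eq_nnnorm]
  · refine le_trans (le_of_eq ?_) (SignedMeasure.enorm_le_totalVariation _ E)
    simp [enorm_eq_nnnorm]

theorem finiteToComplex_apply (m : FiniteMeasure X) {E : Set X} (hE : MeasurableSet E) :
    finiteToComplex m E = ((m : Measure X).real E : ℂ) := by
  change (⟨(m : Measure X).toSignedMeasure E, 0⟩ : ℂ) = _
  rw [Measure.toSignedMeasure_apply_measurable hE]
  rfl

theorem finiteToComplex_eq (m : FiniteMeasure X) :
    finiteToComplex m = (m : Measure X).withDensityᵥ (fun _ => (1 : ℂ)) := by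
  ext E hE
  rw [finiteToComplex_apply m hE, withDensityᵥ_apply (integrable_const _) hE]
  simp

/-- Split into real and imaginary part and apply the Jordan decomposition to each. Linear identities
thus need checking on positive measures only. -/
theorem span_finiteToComplex :
    Submodule.span ℂ (Set.range (finiteToComplex : FiniteMeasure X → ComplexMeasure X)) = ⊤ := by
  rw [eq_top_iff]
  rintro c -
  have key : ∀ s : SignedMeasure X, s.toComplexMeasure 0 ∈
      Submodule.span ℂ (Set.range (finiteToComplex : FiniteMeasure X → ComplexMeasure X)) := by
    intro s
    have h : s.toComplexMeasure 0 =
        finiteToComplex (⟨s.toJordanDecomposition.posPart, inferInstance⟩ : FiniteMeasure X) -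
        finiteToComplex (⟨s.toJordanDecomposition.negPart, inferInstance⟩ : FiniteMeasure X) := by
      ext E hE
      refine Eq.trans ?_ (congrArg₂ (· - ·) (finiteToComplex_apply _ hE)
        (finiteToComplex_apply _ hE)).symm
      conv_lhs => rw [← s.toSignedMeasure_toJordanDecomposition]
      rw [SignedMeasure.toComplexMeasure_apply, JordanDecomposition.toSignedMeasure,
        _root_.sub_apply, Measure.toSignedMeasure_apply_measurable hE,
        Measure.toSignedMeasure_apply_measurable hE]
      apply Complex.ext <;> simp
    rw [h]
    exact Submodule.sub_mem _ (Submodule.subset_span ⟨_, rfl⟩) (Submodule.subset_span ⟨_, rfl⟩)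
  have h : c = (ComplexMeasure.re c).toComplexMeasure 0 +
      Complex.I • (ComplexMeasure.im c).toComplexMeasure 0 := by
    ext E hE
    rw [_root_.add_apply, _root_.smul_apply, SignedMeasure.toComplexMeasure_apply,
      SignedMeasure.toComplexMeasure_apply]
    apply Complex.ext <;> simp <;> rfl
  rw [h]
  exact Submodule.add_mem _ (key _) (Submodule.smul_mem _ _ (key _))

theorem linearMap_ext_finiteToComplex {V : Type*} [AddCommMonoid V] [Module ℂ V]
    {L L' : ComplexMeasure X →ₗ[ℂ] V}
    (h : ∀ m : FiniteMeasure X, L (finiteToComplex m) = L' (finiteToComplex m)) : L = L' :=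
  LinearMap.ext_on span_finiteToComplex (by rintro _ ⟨m, rfl⟩; exact h m)

/-- The product of complex measures. -/
abbrev cprod (a : ComplexMeasure X) (b : ComplexMeasure Y) : ComplexMeasure (X × Y) :=
  VectorMeasure.prod a b (ContinuousLinearMap.mul ℝ ℂ)

theorem cprod_eq {a : ComplexMeasure X} {b : ComplexMeasure Y} {c : ComplexMeasure (X × Y)}
    (h : ∀ (s : Set X) (t : Set Y), MeasurableSet s → MeasurableSet t → c (s ×ˢ t) = a s * b t) :
    cprod a b = c := VectorMeasure.prod_eq_of_forall_apply_prod h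

theorem cprod_apply (a : ComplexMeasure X) (b : ComplexMeasure Y) (s : Set X) (t : Set Y) :
    cprod a b (s ×ˢ t) = a s * b t := by
  rw [cprod, VectorMeasure.prod_apply]
  rfl

theorem cprod_add_left (a a' : ComplexMeasure X) (b : ComplexMeasure Y) :
    cprod (a + a') b = cprod a b + cprod a' b :=
  cprod_eq fun s t _ _ => by
    rw [_root_.add_apply, _root_.add_apply, cprod_apply, cprod_apply, add_mul]

theorem cprod_add_right (a : ComplexMeasure X) (b b' : ComplexMeasure Y) :
    cprod a (b + b') = cprod a b + cprod a b' :=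
  cprod_eq fun s t _ _ => by
    rw [_root_.add_apply, _root_.add_apply, cprod_apply, cprod_apply, mul_add]

theorem cprod_smul_left (r : ℂ) (a : ComplexMeasure X) (b : ComplexMeasure Y) :
    cprod (r • a) b = r • cprod a b :=
  cprod_eq fun s t _ _ => by
    rw [_root_.smul_apply, _root_.smul_apply, cprod_apply, smul_eq_mul, smul_eq_mul,
      mul_assoc]

theorem cprod_smul_right (r : ℂ) (a : ComplexMeasure X) (b : ComplexMeasure Y) :
    cprod a (r • b) = r • cprod a b :=
  cprod_eq fun s t _ _ => by
    rw [_root_.smul_apply, _root_.smul_apply, cprod_apply, smul_eq_mul, smul_eq_mul,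
      mul_left_comm]

theorem cprod_map (a : ComplexMeasure Z) (b : ComplexMeasure W) {S : Z → X} {R : W → Y}
    (hS : Measurable S) (hR : Measurable R) :
    cprod (a.map S) (b.map R) = (cprod a b).map (Prod.map S R) :=
  cprod_eq fun s t hs ht => by
    rw [VectorMeasure.map_apply _ (hS.prodMap hR) (hs.prod ht), VectorMeasure.map_apply _ hS hs,
      VectorMeasure.map_apply _ hR ht, ← cprod_apply]
    rfl

theorem cprod_withDensity {M : Measure X} {N : Measure Y} [SFinite M] [SFinite N] {g : X → ℂ}
    {h : Y → ℂ} (hg : Integrable g M) (hh : Integrable h N) :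
    cprod (M.withDensityᵥ g) (N.withDensityᵥ h) =
      (M.prod N).withDensityᵥ fun z => g z.1 * h z.2 :=
  cprod_eq fun s t hs ht => by
    rw [withDensityᵥ_apply (hg.mul_prod hh) (hs.prod ht), withDensityᵥ_apply hg hs,
      withDensityᵥ_apply hh ht, setIntegral_prod_mul]

/-- The bilinear product of measures which is obtained from a map `(X × X) × Ω → X` and a complex
measure on `Ω`. -/
def paramConv (ρ : ComplexMeasure Ω) (T : (X × X) × Ω → X) : MeasureProduct X :=
  LinearMap.mk₂ ℂ (fun a b => (cprod (cprod a b) ρ).map T)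
    (fun a a' b => by rw [cprod_add_left, cprod_add_left, VectorMeasure.map_add])
    (fun r a b => by rw [cprod_smul_left, cprod_smul_left, VectorMeasure.map_smul])
    (fun a b b' => by rw [cprod_add_right, cprod_add_left, VectorMeasure.map_add])
    (fun r a b => by rw [cprod_smul_right, cprod_smul_left, VectorMeasure.map_smul])

/-- The factors are allowed to be images of measures with density because products of measures have
this form; the formula can therefore be applied to a product of products. -/
theorem paramConv_withDensity {M : Measure Z} {N : Measure W} {ρ : Measure Ω} [SFinite M]
    [SFinite N] [SFinite ρ] {g : Z → ℂ} {h : W → ℂ} {k : Ω → ℂ} (hg : Integrable g M)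
    (hh : Integrable h N) (hk : Integrable k ρ) {S : Z → X} {R : W → X} (hS : Measurable S)
    (hR : Measurable R) {T : (X × X) × Ω → X} (hT : Measurable T) :
    paramConv (ρ.withDensityᵥ k) T ((M.withDensityᵥ g).map S) ((N.withDensityᵥ h).map R) =
      (((M.prod N).prod ρ).withDensityᵥ fun z => g z.1.1 * h z.1.2 * k z.2).map
        fun z => T ((S z.1.1, R z.1.2), z.2) := by
  have h1 : ρ.withDensityᵥ k = (ρ.withDensityᵥ k).map id := (VectorMeasure.map_id _).symm
  change (cprod (cprod ((M.withDensityᵥ g).map S) ((N.withDensityᵥ h).map R))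
    (ρ.withDensityᵥ k)).map T = _
  rw [cprod_map _ _ hS hR, cprod_withDensity hg hh, h1, cprod_map _ _ (hS.prodMap hR) measurable_id,
    cprod_withDensity (hg.mul_prod hh) hk]
  ext E hE
  have hm : Measurable fun z : (Z × W) × Ω => T ((S z.1.1, R z.1.2), z.2) := by
    refine hT.comp (Measurable.prodMk (Measurable.prodMk ?_ ?_) measurable_snd)
    · exact hS.comp (measurable_fst.comp measurable_fst)
    · exact hR.comp (measurable_snd.comp measurable_fst)
  rw [VectorMeasure.map_apply _ hT hE, VectorMeasure.map_apply _ hm hE,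
    VectorMeasure.map_apply _ ((hS.prodMap hR).prodMap measurable_id) (hT hE)]
  rfl

theorem finiteToComplex_eq_map (m : FiniteMeasure X) :
    finiteToComplex m = ((m : Measure X).withDensityᵥ fun _ => (1 : ℂ)).map id := by
  rw [VectorMeasure.map_id, finiteToComplex_eq]

theorem paramConv_finiteToComplex {ρ : Measure Ω} [SFinite ρ] {k : Ω → ℂ} (hk : Integrable k ρ)
    {T : (X × X) × Ω → X} (hT : Measurable T) (m n : FiniteMeasure X) :
    paramConv (ρ.withDensityᵥ k) T (finiteToComplex m) (finiteToComplex n) =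
      ((((m : Measure X).prod (n : Measure X)).prod ρ).withDensityᵥ fun z => k z.2).map T := by
  rw [finiteToComplex_eq_map, finiteToComplex_eq_map, paramConv_withDensity (integrable_const _)
    (integrable_const _) hk measurable_id measurable_id hT]
  simp

/-- Additivity reduces simple functions to indicators, and dominated convergence on both sides
passes to bounded measurable functions. -/
theorem cintegral_withDensity {M : Measure X} {g : X → ℂ} (hg : Integrable g M) {f : X → ℝ}
    (hf : Measurable f) {C : ℝ} (hC : ∀ x, ‖f x‖ ≤ C) :
    cintegral (M.withDensityᵥ g) f = ∫ x, (f x : ℂ) * g x ∂M := by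
  have h1 : ∀ s : SimpleFunc X ℝ, cintegral (M.withDensityᵥ g) s = ∫ x, (s x : ℂ) * g x ∂M := by
    intro s
    induction s using SimpleFunc.induction with
    | const c hs =>
      rename_i E
      have h : ⇑(SimpleFunc.piecewise E hs (SimpleFunc.const X c) (SimpleFunc.const X 0)) =
          E.indicator fun _ => c := by
        classical
        rw [SimpleFunc.coe_piecewise]
        exact Set.piecewise_eq_indicator
      rw [cintegral, h, VectorMeasure.integral_indicator_const c hs, withDensityᵥ_apply hg hs,
        ← integral_indicator hs]
      have h2 : ∀ x, ((E.indicator (fun _ => c) x : ℝ) : ℂ) * g x =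
          c * E.indicator g x := by
        intro x
        by_cases hx : x ∈ E <;> simp [hx]
      simp only [h2, integral_const_mul]
      simp
    | add hd hf hg' =>
      rename_i s₁ s₂
      have h1 : ∀ s : SimpleFunc X ℝ, (M.withDensityᵥ g).Integrable s := fun s =>
        SimpleFunc.integrable_of_isFiniteMeasure s
      have h2 : ∀ s : SimpleFunc X ℝ, Integrable (fun x => (s x : ℂ) * g x) M := by
        intro s
        obtain ⟨C, hC⟩ := s.exists_forall_norm_le
        refine hg.bdd_mul (c := C) (Complex.measurable_ofReal.comp s.measurable).aestronglyMeasurable ?_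
        exact Filter.Eventually.of_forall fun x => by simpa using hC x
      rw [cintegral, SimpleFunc.coe_add, VectorMeasure.integral_add (h1 _) (h1 _)]
      refine (congrArg₂ (· + ·) hf hg').trans ?_
      rw [← integral_add (h2 _) (h2 _)]
      refine integral_congr_ae (Filter.Eventually.of_forall fun x => ?_)
      simp only [Pi.add_apply, Complex.ofReal_add, add_mul]
  rcases isEmpty_or_nonempty X with h | ⟨⟨x₀⟩⟩
  · rw [cintegral, VectorMeasure.integral_of_isEmpty, integral_of_isEmpty]
  have hC0 : 0 ≤ C := (norm_nonneg _).trans (hC x₀)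
  have h2 := fun n => h1 (hf.stronglyMeasurable.approxBounded C n)
  have h3 := VectorMeasure.tendsto_integral_of_dominated_convergence (μ := M.withDensityᵥ g)
    (B := ContinuousLinearMap.lsmul ℝ ℝ)
    (f := f) (fun _ => C) (fun n => (SimpleFunc.stronglyMeasurable _).aestronglyMeasurable)
    (integrable_const C) (fun n => Filter.Eventually.of_forall fun x =>
      hf.stronglyMeasurable.norm_approxBounded_le hC0 n x)
    (Filter.Eventually.of_forall fun x =>
      hf.stronglyMeasurable.tendsto_approxBounded_of_norm_le (hC x))
  refine tendsto_nhds_unique h3 ?_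
  refine Filter.Tendsto.congr (fun n => (h2 n).symm) ?_
  refine tendsto_integral_of_dominated_convergence (fun x => C * ‖g x‖) (fun n => ?_)
    (hg.norm.const_mul C) (fun n => Filter.Eventually.of_forall fun x => ?_)
    (Filter.Eventually.of_forall fun x => ?_)
  · exact (Complex.measurable_ofReal.comp
      (SimpleFunc.measurable _)).aestronglyMeasurable.mul hg.aestronglyMeasurable
  · rw [norm_mul, Complex.norm_real]
    exact mul_le_mul_of_nonneg_right (hf.stronglyMeasurable.norm_approxBounded_le hC0 n x)
      (norm_nonneg _)
  · exact ((Complex.continuous_ofReal.tendsto _).comp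
      (hf.stronglyMeasurable.tendsto_approxBounded_of_norm_le (hC x))).mul_const _

theorem cintegral_map_withDensity {M : Measure Z} {g : Z → ℂ} (hg : Integrable g M) {S : Z → X}
    (hS : Measurable S) {f : X → ℝ} (hf : Measurable f) {C : ℝ} (hC : ∀ x, ‖f x‖ ≤ C) :
    cintegral ((M.withDensityᵥ g).map S) f = ∫ z, (f (S z) : ℂ) * g z ∂M := by
  rw [cintegral, VectorMeasure.integral_map hS hf.aestronglyMeasurable]
  · exact cintegral_withDensity hg (hf.comp hS) fun z => hC _
  · exact Integrable.of_bound (hf.comp hS).aestronglyMeasurable C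
      (Filter.Eventually.of_forall fun z => hC _)

end ComplexMeasures

end Grassmann

/-! ### Joint weak continuity of products of positive measures. -/

namespace Grassmann
open Set ENNReal

section WeakContinuity

open Filter Topology

/-- Write each measure as mass times a probability measure; products of probability measures are
weakly continuous. Normalization is not continuous at zero, but there the integral is squeezed by
the product of the masses and the norm of `Φ`. -/
theorem continuous_integral_prod {X : Type*} [TopologicalSpace X] [CompactSpace X]
    [SecondCountableTopology X] [MeasurableSpace X] [BorelSpace X] [TopologicalSpace.PseudoMetrizableSpace X]
    (Φ : C(X × X, ℝ)) :
    Continuous fun m : FiniteMeasure X × FiniteMeasure X =>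
      ∫ z, Φ z ∂((m.1 : Measure X).prod (m.2 : Measure X)) := by
  rcases isEmpty_or_nonempty X with h | h
  · have : ∀ m : FiniteMeasure X × FiniteMeasure X,
        ∫ z, Φ z ∂((m.1 : Measure X).prod (m.2 : Measure X)) = 0 := fun m => integral_of_isEmpty
    simp only [this]
    exact continuous_const
  set G : ProbabilityMeasure X × ProbabilityMeasure X → ℝ := fun p =>
    ∫ z, Φ z ∂((p.1 : Measure X).prod (p.2 : Measure X)) with hG
  have hGc : Continuous G := by
    have h1 := ProbabilityMeasure.continuous_integral_boundedContinuousFunction (X := X × X)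
      (BoundedContinuousFunction.mkOfCompact Φ)
    exact h1.comp ProbabilityMeasure.continuous_prod
  have hGb : ∀ p, ‖G p‖ ≤ ‖Φ‖ := by
    intro p
    refine (norm_integral_le_of_norm_le_const (Eventually.of_forall Φ.norm_coe_le_norm)).trans ?_
    simp
  have e : ∀ m : FiniteMeasure X × FiniteMeasure X,
      ∫ z, Φ z ∂((m.1 : Measure X).prod (m.2 : Measure X)) =
        ((m.1.mass : ℝ) * m.2.mass) * G (m.1.normalize, m.2.normalize) := by
    intro m
    have h1 : (m.1 : Measure X) = m.1.mass • (m.1.normalize : Measure X) := by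
      conv_lhs => rw [m.1.self_eq_mass_smul_normalize]
      rfl
    have h2 : (m.2 : Measure X) = m.2.mass • (m.2.normalize : Measure X) := by
      conv_lhs => rw [m.2.self_eq_mass_smul_normalize]
      rfl
    conv_lhs => rw [h1, h2]
    rw [Measure.prod_smul_left, Measure.prod_smul_right, integral_smul_nnreal_measure,
      integral_smul_nnreal_measure, NNReal.smul_def, NNReal.smul_def, smul_eq_mul, smul_eq_mul,
      mul_assoc]
  simp only [e]
  have hmass : Continuous fun m : FiniteMeasure X × FiniteMeasure X =>
      ((m.1.mass : ℝ) * m.2.mass) := by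
    have h1 : Continuous fun m : FiniteMeasure X => (m.mass : ℝ) :=
      NNReal.continuous_coe.comp FiniteMeasure.continuous_mass
    exact (h1.comp continuous_fst).mul (h1.comp continuous_snd)
  refine continuous_iff_continuousAt.2 fun m₀ => ?_
  by_cases h0 : m₀.1 ≠ 0 ∧ m₀.2 ≠ 0
  · refine hmass.continuousAt.mul ?_
    have h1 : Tendsto (fun m : FiniteMeasure X × FiniteMeasure X => m.1.normalize) (𝓝 m₀)
        (𝓝 m₀.1.normalize) :=
      FiniteMeasure.tendsto_normalize_of_tendsto (continuous_fst.tendsto m₀) h0.1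
    have h2 : Tendsto (fun m : FiniteMeasure X × FiniteMeasure X => m.2.normalize) (𝓝 m₀)
        (𝓝 m₀.2.normalize) :=
      FiniteMeasure.tendsto_normalize_of_tendsto (continuous_snd.tendsto m₀) h0.2
    exact (hGc.tendsto _).comp (h1.prodMk_nhds h2)
  · have hz : ((m₀.1.mass : ℝ) * m₀.2.mass) = 0 := by
      rw [not_and_or, not_not, not_not] at h0
      rcases h0 with h0 | h0 <;> simp [h0]
    rw [ContinuousAt, hz, zero_mul]
    have h1 : Tendsto (fun m : FiniteMeasure X × FiniteMeasure X =>
        ((m.1.mass : ℝ) * m.2.mass) * ‖Φ‖) (𝓝 m₀) (𝓝 0) := by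
      have := (hmass.tendsto m₀).mul_const ‖Φ‖
      rwa [hz, zero_mul] at this
    refine squeeze_zero_norm (fun m => ?_) h1
    rw [norm_mul, Real.norm_of_nonneg (by positivity)]
    exact mul_le_mul_of_nonneg_left (hGb _) (by positivity)

end WeakContinuity

section PointMass

variable {X : Type*} [MeasurableSpace X]

/-- The point measure at `x` as a finite measure. -/
def diracFinite (x : X) : FiniteMeasure X := ⟨Measure.dirac x, inferInstance⟩

theorem coe_diracFinite (x : X) : (diracFinite x : Measure X) = Measure.dirac x := rfl

theorem pointMass_eq (x : X) : pointMass x = finiteToComplex (diracFinite x) := rfl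

end PointMass

/-! ### The convolution on the alcove for complex parameters. -/

section Convolution

variable (F : Type) [NormedRing F] [StarRing F] [NormedStarGroup F] [NormedAlgebra ℝ F]
  [IsScalar F] [ProperSpace F] [HasDet F] [IsScalarDet F] {q : ℕ}
  [MeasureSpace F] [BorelSpace F] [Measure.IsAddHaarMeasure (volume : Measure F)]

/-- The normalized density on the parameter space. -/
def paramDensity (q : ℕ) (μ : ℂ) (ω : BallParam F q) : ℂ :=
  (kappa F q μ)⁻¹ * (paramDet ω : ℂ) ^ (μ - gammaConst F q)

/-- The convolution on the bounded measures on the alcove. -/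
def alcoveConv (q : ℕ) (μ : ℂ) : MeasureProduct (alcove q) :=
  paramConv ((paramMeasure F q).withDensityᵥ (paramDensity F q μ))
    fun z => paramProduct z.1.1 z.1.2 z.2

variable {F} {μ : ℂ}

theorem ballDensity_eq {w : Matrix (Fin q) (Fin q) F} (hw : w ∈ matrixBall F q) :
    ballDensity F q μ w = (gramDet w : ℂ) ^ (μ - gammaConst F q) := by
  rw [matrixBall_eq] at hw
  rw [ballDensity, (det_one_sub_gram (rectBall_subset_closedRectBall _ _ hw)).1]

theorem integrableOn_ballDensity (hq : 0 < q) (hμ : gammaConst F q - 1 < μ.re) :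
    IntegrableOn (ballDensity F q μ) (matrixBall F q) := by
  refine IntegrableOn.congr_fun (integrableOn_gramDet_cpow (F := F) (m := q) hq
    (s := μ - gammaConst F q) ?_) (fun w hw => (ballDensity_eq hw).symm) (measurableSet_rectBall q q)
  rw [Complex.sub_re, Complex.ofReal_re]
  linarith

theorem kappa_eq : kappa F q μ = ∫ w in matrixBall F q, (gramDet w : ℂ) ^ (μ - gammaConst F q) :=
  setIntegral_congr_fun (measurableSet_rectBall q q) fun _ hw => ballDensity_eq hw

theorem kappa_ne_zero (hq : 0 < q) (hμ : gammaConst F q - 1 < μ.re) : kappa F q μ ≠ 0 := by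
  rw [kappa_eq]
  refine integral_gramDet_cpow_ne_zero hq ?_
  rw [Complex.sub_re, Complex.ofReal_re]
  linarith

theorem integrable_paramDensity (hq : 0 < q) (hμ : gammaConst F q - 1 < μ.re) :
    Integrable (paramDensity F q μ) (paramMeasure F q) := by
  refine Integrable.const_mul ?_ _
  have h : Integrable (fun w : Matrix (Fin q) (Fin q) F => (gramDet w : ℂ) ^ (μ - gammaConst F q))
      (volume.restrict (matrixBall F q)) := integrableOn_gramDet_cpow (F := F) (m := q) hq (by
        rw [Complex.sub_re, Complex.ofReal_re]
        linarith)
  exact h.comp_snd _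

theorem integral_paramDensity (hq : 0 < q) (hμ : gammaConst F q - 1 < μ.re) :
    ∫ ω, paramDensity F q μ ω ∂paramMeasure F q = 1 := by
  have h := integral_fun_snd (μ := normalizedHaar (unitaryComponent F q))
    (ν := volume.restrict (matrixBall F q))
    (fun w : Matrix (Fin q) (Fin q) F => (kappa F q μ)⁻¹ * (gramDet w : ℂ) ^ (μ - gammaConst F q))
  refine h.trans ?_
  rw [integral_const_mul, ← kappa_eq, inv_mul_cancel₀ (kappa_ne_zero hq hμ)]
  simp

theorem measurable_paramProduct_uncurry :
    Measurable fun z : (alcove q × alcove q) × BallParam F q => paramProduct z.1.1 z.1.2 z.2 :=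
  measurable_paramProduct (measurable_fst.comp measurable_fst) (measurable_snd.comp measurable_fst)
    measurable_snd

theorem alcoveConv_finiteToComplex (hq : 0 < q) (hμ : gammaConst F q - 1 < μ.re)
    (m n : FiniteMeasure (alcove q)) :
    alcoveConv F q μ (finiteToComplex m) (finiteToComplex n) =
      ((((m : Measure (alcove q)).prod (n : Measure (alcove q))).prod
        (paramMeasure F q)).withDensityᵥ fun z => paramDensity F q μ z.2).map
        fun z => paramProduct z.1.1 z.1.2 z.2 :=
  paramConv_finiteToComplex (integrable_paramDensity hq hμ) measurable_paramProduct_uncurry m n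

theorem integrable_paramDensity_snd (hq : 0 < q) (hμ : gammaConst F q - 1 < μ.re) {Z : Type*}
    [MeasurableSpace Z] (M : Measure Z) [IsFiniteMeasure M] :
    Integrable (fun z : Z × BallParam F q => paramDensity F q μ z.2) (M.prod (paramMeasure F q)) :=
  (integrable_paramDensity hq hμ).comp_snd _

theorem cintegral_alcoveConv_pointMass (hq : 0 < q) (hμ : gammaConst F q - 1 < μ.re)
    (x y : alcove q) {f : alcove q → ℝ} (hf : Measurable f) {C : ℝ} (hC : ∀ x, ‖f x‖ ≤ C) :
    cintegral (alcoveConv F q μ (pointMass x) (pointMass y)) f =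
      ∫ ω, (f (paramProduct x y ω) : ℂ) * paramDensity F q μ ω ∂paramMeasure F q := by
  rw [pointMass_eq, pointMass_eq, alcoveConv_finiteToComplex hq hμ, cintegral_map_withDensity
    (integrable_paramDensity_snd hq hμ _) measurable_paramProduct_uncurry hf hC]
  rw [coe_diracFinite, coe_diracFinite, Measure.dirac_prod_dirac, Measure.dirac_prod,
    integral_map measurable_prodMk_left.aemeasurable]
  refine Measurable.aestronglyMeasurable ?_
  refine (Complex.measurable_ofReal.comp (hf.comp measurable_paramProduct_uncurry)).mul ?_
  exact (((Complex.measurable_ofReal.comp continuous_paramDet.measurable).pow_const _).const_mul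
    _).comp measurable_snd

theorem cintegral_alcoveConv_pointMass_eq_pointConv (hq : 0 < q) (hμ : gammaConst F q - 1 < μ.re)
    (x y : alcove q) (f : C(alcove q, ℝ)) :
    cintegral (alcoveConv F q μ (pointMass x) (pointMass y)) f = pointConv F q μ x y f := by
  rw [cintegral_alcoveConv_pointMass hq hμ x y f.continuous.measurable f.norm_coe_le_norm]
  have hint : Integrable (fun ω => (f (paramProduct x y ω) : ℂ) * paramDensity F q μ ω)
      (paramMeasure F q) := by
    refine (integrable_paramDensity hq hμ).bdd_mul (c := ‖f‖) (Measurable.aestronglyMeasurable ?_) ?_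
    · exact Complex.measurable_ofReal.comp (f.continuous.measurable.comp
        (measurable_paramProduct measurable_const measurable_const measurable_id))
    · exact Filter.Eventually.of_forall fun ω => by
        simpa using f.norm_coe_le_norm (paramProduct x y ω)
  refine (integral_prod_symm _ hint).trans ?_
  rw [pointConv, ← integral_const_mul]
  refine setIntegral_congr_fun (measurableSet_rectBall q q) fun w hw => ?_
  rw [← integral_const_mul]
  refine integral_congr_ae (Filter.Eventually.of_forall fun v => ?_)
  simp only
  rw [ballDensity_eq hw, paramDensity, paramDet, paramProduct]
  ring

theorem alcoveConv_univ (hq : 0 < q) (hμ : gammaConst F q - 1 < μ.re) (x y : alcove q) :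
    alcoveConv F q μ (pointMass x) (pointMass y) Set.univ = 1 := by
  rw [pointMass_eq, pointMass_eq, alcoveConv_finiteToComplex hq hμ, VectorMeasure.map_apply _
    measurable_paramProduct_uncurry MeasurableSet.univ, preimage_univ, withDensityᵥ_apply
    (integrable_paramDensity_snd hq hμ _) MeasurableSet.univ, Measure.restrict_univ,
    integral_fun_snd, integral_paramDensity hq hμ, coe_diracFinite, coe_diracFinite,
    Measure.dirac_prod_dirac]
  simp

/-- Integrating out the parameter turns `f` into a function `Ψ` of `(x, y)`, continuous by dominated
convergence. Its real and imaginary parts are then integrated against the product of the two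
measures. -/
theorem weaklyContinuous_alcoveConv (hq : 0 < q) (hμ : gammaConst F q - 1 < μ.re) :
    WeaklyContinuous (alcoveConv F q μ) := by
  intro f
  set Ψ : alcove q × alcove q → ℂ := fun z =>
    ∫ ω, (f (paramProduct z.1 z.2 ω) : ℂ) * paramDensity F q μ ω ∂paramMeasure F q with hΨ
  have hb : ∀ (z : alcove q × alcove q) (ω : BallParam F q),
      ‖(f (paramProduct z.1 z.2 ω) : ℂ) * paramDensity F q μ ω‖ ≤
        ‖f‖ * ‖paramDensity F q μ ω‖ := by
    intro z ω
    rw [norm_mul, Complex.norm_real]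
    exact mul_le_mul_of_nonneg_right (f.norm_coe_le_norm _) (norm_nonneg _)
  have hΨc : Continuous Ψ := by
    refine continuous_of_dominated (bound := fun ω => ‖f‖ * ‖paramDensity F q μ ω‖) ?_
      (fun z => Filter.Eventually.of_forall (hb z))
      ((integrable_paramDensity hq hμ).norm.const_mul _) (Filter.Eventually.of_forall fun ω => ?_)
    · intro z
      refine AEStronglyMeasurable.mul (Measurable.aestronglyMeasurable ?_)
        (integrable_paramDensity hq hμ).aestronglyMeasurable
      exact Complex.measurable_ofReal.comp (f.continuous.measurable.comp
        (measurable_paramProduct measurable_const measurable_const measurable_id))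
    · exact (Complex.continuous_ofReal.comp (f.continuous.comp (continuous_paramProduct
        continuous_fst continuous_snd continuous_const))).mul continuous_const
  have e : ∀ m : FiniteMeasure (alcove q) × FiniteMeasure (alcove q),
      cintegral (alcoveConv F q μ (finiteToComplex m.1) (finiteToComplex m.2)) f =
      ((∫ z, (Ψ z).re ∂((m.1 : Measure (alcove q)).prod (m.2 : Measure (alcove q))) : ℝ) : ℂ) +
      ((∫ z, (Ψ z).im ∂((m.1 : Measure (alcove q)).prod (m.2 : Measure (alcove q))) : ℝ) : ℂ) *
        Complex.I := by
    intro m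
    rw [alcoveConv_finiteToComplex hq hμ, cintegral_map_withDensity
      (integrable_paramDensity_snd hq hμ _) measurable_paramProduct_uncurry f.continuous.measurable
      f.norm_coe_le_norm, integral_prod]
    · have hΨi : Integrable Ψ ((m.1 : Measure (alcove q)).prod (m.2 : Measure (alcove q))) :=
        hΨc.integrable_of_hasCompactSupport (HasCompactSupport.of_compactSpace _)
      exact (integral_re_add_im (𝕜 := ℂ) hΨi).symm
    · refine (integrable_paramDensity_snd hq hμ _).bdd_mul (c := ‖f‖)
        (Measurable.aestronglyMeasurable ?_) ?_
      · exact Complex.measurable_ofReal.comp (f.continuous.measurable.comp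
          measurable_paramProduct_uncurry)
      · exact Filter.Eventually.of_forall fun ω => by
          simpa using f.norm_coe_le_norm _
  simp only [e]
  have h1 := continuous_integral_prod ⟨fun z => (Ψ z).re, Complex.continuous_re.comp hΨc⟩
  have h2 := continuous_integral_prod ⟨fun z => (Ψ z).im, Complex.continuous_im.comp hΨc⟩
  exact (Complex.continuous_ofReal.comp h1).add ((Complex.continuous_ofReal.comp h2).mul
    continuous_const)

/-- As `sin 0 = 0` and `cos 0 = 1`, the matrix reduces to `v cos y`, whose angles are `y` for every
`v` and `w`. -/
theorem paramProduct_zero_left (y : alcove q) (ω : BallParam F q) : paramProduct 0 y ω = y := by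
  have h1 : sinDiag F ((0 : alcove q) : Fin q → ℝ) = 0 := by
    change sinDiag F (0 : Fin q → ℝ) = 0
    ext i j
    simp [sinDiag, Matrix.diagonal_apply]
  have h2 : cosDiag F ((0 : alcove q) : Fin q → ℝ) = 1 := by
    change cosDiag F (0 : Fin q → ℝ) = 1
    simp [cosDiag]
  rw [paramProduct, productAngles, h1, h2, zero_mul, zero_mul, neg_zero, zero_add, one_mul]
  have := singularAngles_mul_mul ω.1.1.2 (one_mem _) (cosDiag F y.1)
  rw [mul_one, singularAngles_cosDiag] at this
  exact this

theorem alcoveConv_zero_left (hq : 0 < q) (hμ : gammaConst F q - 1 < μ.re)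
    (a : ComplexMeasure (alcove q)) : alcoveConv F q μ (pointMass 0) a = a := by
  have h : alcoveConv F q μ (pointMass 0) = LinearMap.id := by
    refine linearMap_ext_finiteToComplex fun m => ?_
    ext A hA
    rw [LinearMap.id_apply, pointMass_eq, alcoveConv_finiteToComplex hq hμ, VectorMeasure.map_apply _
      measurable_paramProduct_uncurry hA, withDensityᵥ_apply (integrable_paramDensity_snd hq hμ _)
      (measurable_paramProduct_uncurry hA), finiteToComplex_apply _ hA]
    rw [coe_diracFinite]
    have hae : ∀ᵐ z ∂((Measure.dirac (0 : alcove q)).prod (m : Measure (alcove q))).prod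
        (paramMeasure F q), z.1.1 = 0 :=
      Measure.quasiMeasurePreserving_fst.ae (Measure.quasiMeasurePreserving_fst.ae
        ((ae_dirac_iff (measurableSet_singleton _)).2 rfl))
    have hset : ((fun z : (alcove q × alcove q) × BallParam F q =>
        paramProduct z.1.1 z.1.2 z.2) ⁻¹' A : Set _) =ᵐ[((Measure.dirac (0 : alcove q)).prod
          (m : Measure (alcove q))).prod (paramMeasure F q)]
          (((univ : Set (alcove q)) ×ˢ A) ×ˢ (univ : Set (BallParam F q)) : Set _) := by
      filter_upwards [hae] with z hz
      refine propext ?_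
      change paramProduct z.1.1 z.1.2 z.2 ∈ A ↔ (z.1.1 ∈ univ ∧ z.1.2 ∈ A) ∧ z.2 ∈ univ
      rw [hz, paramProduct_zero_left]
      simp
    have hp := setIntegral_prod_mul (μ := (Measure.dirac (0 : alcove q)).prod
      (m : Measure (alcove q))) (ν := paramMeasure F q) (fun _ => (1 : ℂ)) (paramDensity F q μ)
      ((univ : Set (alcove q)) ×ˢ A) univ
    rw [setIntegral_congr_set hset]
    simp only [one_mul, Measure.restrict_univ] at hp
    rw [hp, integral_paramDensity hq hμ]
    simp [Measure.real]
  rw [h, LinearMap.id_apply]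

end Convolution

end Grassmann

/-! ### Commutativity and associativity for all parameters. -/

namespace Grassmann
open Set ENNReal

theorem complexMeasure_induction {X : Type*} [MeasurableSpace X] {P : ComplexMeasure X → Prop}
    (zero : P 0) (add : ∀ a b, P a → P b → P (a + b)) (smul : ∀ (t : ℂ) a, P a → P (t • a))
    (finite : ∀ m : FiniteMeasure X, P (finiteToComplex m)) (c : ComplexMeasure X) : P c := by
  have hc : c ∈ Submodule.span ℂ (Set.range (finiteToComplex : FiniteMeasure X → ComplexMeasure X)) :=
    span_finiteToComplex (X := X) ▸ Submodule.mem_top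
  induction hc using Submodule.span_induction with
  | mem x hx =>
    obtain ⟨m, rfl⟩ := hx
    exact finite m
  | zero => exact zero
  | add a b _ _ ha hb => exact add a b ha hb
  | smul t a _ ha => exact smul t a ha

section Algebra

variable {F : Type} [NormedRing F] [StarRing F] [NormedStarGroup F] [NormedAlgebra ℝ F]
  [IsScalar F] [ProperSpace F] [HasDet F] [IsScalarDet F] {q : ℕ}
  [MeasureSpace F] [BorelSpace F] [Measure.IsAddHaarMeasure (volume : Measure F)] {μ : ℂ}

theorem setLIntegral_preimage_eq {Z X : Type*} [MeasurableSpace Z] [MeasurableSpace X]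
    (M : Measure Z) {S : Z → X} (hS : Measurable S) {A : Set X} (hA : MeasurableSet A)
    (g : Z → ℝ≥0∞) :
    ∫⁻ z in S ⁻¹' A, g z ∂M = ∫⁻ z, A.indicator (fun _ => 1) (S z) * g z ∂M := by
  rw [← lintegral_indicator (hS hA)]
  refine lintegral_congr fun z => ?_
  by_cases h : S z ∈ A
  · rw [indicator_of_mem h, one_mul, indicator_of_mem (mem_preimage.2 h)]
  · rw [indicator_of_notMem h, zero_mul, indicator_of_notMem (by simpa using h)]

theorem finrank_pos_real : 0 < (Module.finrank ℝ F / 2 : ℝ) := by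
  have : 0 < Module.finrank ℝ F := Module.finrank_pos
  positivity

/-- The weights `paramWeight n` are powers of the determinant along an arithmetic progression, and
for these the claim is commutativity on the Grassmannians. `integral_cpow_eq`, applied on the
preimage of `A`, extends it to every exponent `s`. -/
theorem paramDensity_integral_comm (hq : 0 < q) (m n : FiniteMeasure (alcove q))
    {A : Set (alcove q)} (hA : MeasurableSet A) (s : ℂ) :
    ∫ z in (fun z : (alcove q × alcove q) × BallParam F q => paramProduct z.1.1 z.1.2 z.2) ⁻¹' A,
      (paramDet z.2 : ℂ) ^ s ∂(((m : Measure (alcove q)).prod (n : Measure (alcove q))).prod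
        (paramMeasure F q)) =
    ∫ z in (fun z : (alcove q × alcove q) × BallParam F q => paramProduct z.1.1 z.1.2 z.2) ⁻¹' A,
      (paramDet z.2 : ℂ) ^ s ∂(((n : Measure (alcove q)).prod (m : Measure (alcove q))).prod
        (paramMeasure F q)) := by
  have hD : Measurable fun z : (alcove q × alcove q) × BallParam F q => paramDet z.2 :=
    continuous_paramDet.measurable.comp measurable_snd
  have h01 : ∀ M : Measure (alcove q × alcove q), ∀ᵐ z ∂(M.prod (paramMeasure F q)),
      paramDet z.2 ∈ Ioc (0 : ℝ) 1 := fun M => Measure.quasiMeasurePreserving_snd.ae paramDet_mem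
  have hI : Measurable (A.indicator fun _ => (1 : ℝ≥0∞)) := measurable_const.indicator hA
  have hw : ∀ (n' : ℕ) (z : (alcove q × alcove q) × BallParam F q), ENNReal.ofReal (paramDet z.2 ^
      ((Module.finrank ℝ F / 2 - 1 : ℝ) + n' * (Module.finrank ℝ F / 2 : ℝ))) =
      paramWeight n' z.2 := fun _ _ => rfl
  have key : ∀ (n' : ℕ) (m n : FiniteMeasure (alcove q)),
      ∫⁻ z, A.indicator (fun _ => 1) (paramProduct z.1.1 z.1.2 z.2) * paramWeight n' z.2
        ∂(((m : Measure (alcove q)).prod (n : Measure (alcove q))).prod (paramMeasure F q)) =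
      ∫⁻ x, ∫⁻ y, ∫⁻ ω, A.indicator (fun _ => 1) (paramProduct x y ω) * paramWeight n' ω
        ∂(paramMeasure F q) ∂(n : Measure (alcove q)) ∂(m : Measure (alcove q)) := by
    intro n' m n
    have hm : Measurable fun z : (alcove q × alcove q) × BallParam F q =>
        A.indicator (fun _ => (1 : ℝ≥0∞)) (paramProduct z.1.1 z.1.2 z.2) * paramWeight n' z.2 :=
      (hI.comp measurable_paramProduct_uncurry).mul
        ((measurable_paramWeight n').comp measurable_snd)
    rw [lintegral_prod _ hm.aemeasurable, lintegral_prod _ hm.lintegral_prod_right'.aemeasurable]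
  refine integral_cpow_eq hD hD (ae_restrict_of_ae (h01 _)) (ae_restrict_of_ae (h01 _))
    (finrank_pos_real (F := F)) (e := (Module.finrank ℝ F / 2 - 1 : ℝ)) ?_ ?_ s
  · refine ne_of_lt (lt_of_le_of_lt (setLIntegral_le_lintegral _ _) ?_)
    have := hw 0
    simp only [Nat.cast_zero, zero_mul, add_zero] at this
    simp only [this]
    have hm : Measurable fun z : (alcove q × alcove q) × BallParam F q => paramWeight 0 z.2 :=
      (measurable_paramWeight 0).comp measurable_snd
    rw [lintegral_prod _ hm.aemeasurable]
    simp only [lintegral_const]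
    exact ENNReal.mul_lt_top (lintegral_paramWeight_ne_top hq 0).lt_top (measure_lt_top _ _)
  · intro n'
    simp only [hw]
    rw [setLIntegral_preimage_eq _ measurable_paramProduct_uncurry hA,
      setLIntegral_preimage_eq _ measurable_paramProduct_uncurry hA, key, key,
      lintegral_lintegral_swap]
    · simp only [lintegral_paramProduct_comm hq n' _ _ hI]
    · have hm : Measurable fun z : (alcove q × alcove q) × BallParam F q =>
          A.indicator (fun _ => (1 : ℝ≥0∞)) (paramProduct z.1.1 z.1.2 z.2) * paramWeight n' z.2 :=
        (hI.comp measurable_paramProduct_uncurry).mul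
          ((measurable_paramWeight n').comp measurable_snd)
      exact hm.lintegral_prod_right'.aemeasurable

theorem alcoveConv_comm (hq : 0 < q) (hμ : gammaConst F q - 1 < μ.re)
    (a b : ComplexMeasure (alcove q)) : alcoveConv F q μ a b = alcoveConv F q μ b a := by
  have h : alcoveConv F q μ = (alcoveConv F q μ).flip := by
    refine linearMap_ext_finiteToComplex fun m => linearMap_ext_finiteToComplex fun n => ?_
    ext A hA
    rw [LinearMap.flip_apply, alcoveConv_finiteToComplex hq hμ, alcoveConv_finiteToComplex hq hμ,
      VectorMeasure.map_apply _ measurable_paramProduct_uncurry hA,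
      VectorMeasure.map_apply _ measurable_paramProduct_uncurry hA,
      withDensityᵥ_apply (integrable_paramDensity_snd hq hμ _)
        (measurable_paramProduct_uncurry hA),
      withDensityᵥ_apply (integrable_paramDensity_snd hq hμ _)
        (measurable_paramProduct_uncurry hA)]
    simp only [paramDensity, integral_const_mul, paramDensity_integral_comm hq m n hA]
  exact LinearMap.congr_fun₂ h a b

variable (F) in
/-- The parameter space of a product of three measures, bracketed from the left. -/
abbrev LeftParam (q : ℕ) :=
  (((alcove q × alcove q) × BallParam F q) × alcove q) × BallParam F q

variable (F) in
/-- The parameter space of a product of three measures, bracketed from the right. -/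
abbrev RightParam (q : ℕ) :=
  (alcove q × ((alcove q × alcove q) × BallParam F q)) × BallParam F q

/-- The product of three points, bracketed from the left. -/
def leftProduct (z : LeftParam F q) : alcove q :=
  paramProduct (paramProduct z.1.1.1.1 z.1.1.1.2 z.1.1.2) z.1.2 z.2

/-- The product of three points, bracketed from the right. -/
def rightProduct (z : RightParam F q) : alcove q :=
  paramProduct z.1.1 (paramProduct z.1.2.1.1 z.1.2.1.2 z.1.2.2) z.2

theorem measurable_leftProduct : Measurable (leftProduct : LeftParam F q → alcove q) :=
  measurable_paramProduct (measurable_paramProduct (by fun_prop) (by fun_prop) (by fun_prop))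
    (by fun_prop) (by fun_prop)

theorem measurable_rightProduct : Measurable (rightProduct : RightParam F q → alcove q) :=
  measurable_paramProduct (by fun_prop)
    (measurable_paramProduct (by fun_prop) (by fun_prop) (by fun_prop)) (by fun_prop)

variable (F) in
/-- The measure on the parameter space of a product, bracketed from the left. -/
def leftMeasure (m n r : FiniteMeasure (alcove q)) : Measure (LeftParam F q) :=
  ((((m : Measure (alcove q)).prod (n : Measure (alcove q))).prod (paramMeasure F q)).prod
    (r : Measure (alcove q))).prod (paramMeasure F q)

variable (F) in
/-- The measure on the parameter space of a product, bracketed from the right. -/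
def rightMeasure (m n r : FiniteMeasure (alcove q)) : Measure (RightParam F q) :=
  ((m : Measure (alcove q)).prod (((n : Measure (alcove q)).prod (r : Measure (alcove q))).prod
    (paramMeasure F q))).prod (paramMeasure F q)

/-- Integration over the three points is put outside the two parameters. In this common order
`lintegral_paramProduct_assoc` can be applied to fixed `x`, `y`, `z`. -/
theorem lintegral_leftMeasure (m n r : FiniteMeasure (alcove q)) (i : ℕ) {f : alcove q → ℝ≥0∞}
    (hf : Measurable f) :
    ∫⁻ z, f (leftProduct z) * (paramWeight i z.1.1.2 * paramWeight i z.2) ∂leftMeasure F m n r =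
    ∫⁻ x, ∫⁻ y, ∫⁻ z, ∫⁻ ω, (∫⁻ ω', f (paramProduct (paramProduct x y ω) z ω') *
      paramWeight i ω' ∂paramMeasure F q) * paramWeight i ω ∂paramMeasure F q
      ∂(r : Measure (alcove q)) ∂(n : Measure (alcove q)) ∂(m : Measure (alcove q)) := by
  have h1 : Measurable fun z : LeftParam F q => f (leftProduct z) * paramWeight i z.2 :=
    (hf.comp measurable_leftProduct).mul ((measurable_paramWeight i).comp measurable_snd)
  have h2 : Measurable fun z : LeftParam F q =>
      f (leftProduct z) * (paramWeight i z.1.1.2 * paramWeight i z.2) :=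
    (hf.comp measurable_leftProduct).mul (((measurable_paramWeight i).comp (by fun_prop)).mul
      ((measurable_paramWeight i).comp measurable_snd))
  have h3 : Measurable fun z : ((alcove q × alcove q) × BallParam F q) × alcove q =>
      (∫⁻ ω', f (leftProduct (z, ω')) * paramWeight i ω' ∂paramMeasure F q) *
        paramWeight i z.1.2 :=
    h1.lintegral_prod_right'.mul ((measurable_paramWeight i).comp (by fun_prop))
  rw [leftMeasure, lintegral_prod _ h2.aemeasurable]
  have e : ∀ z : ((alcove q × alcove q) × BallParam F q) × alcove q,
      ∫⁻ ω', f (leftProduct (z, ω')) * (paramWeight i z.1.2 * paramWeight i ω')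
        ∂paramMeasure F q =
      (∫⁻ ω', f (leftProduct (z, ω')) * paramWeight i ω' ∂paramMeasure F q) *
        paramWeight i z.1.2 := by
    intro z
    have h : Measurable fun ω => f (leftProduct (z, ω)) * paramWeight i ω :=
      h1.comp measurable_prodMk_left
    rw [← lintegral_mul_const _ h]
    refine lintegral_congr fun ω' => ?_
    ring
  simp only [e]
  rw [lintegral_prod _ h3.aemeasurable, lintegral_prod _ h3.lintegral_prod_right'.aemeasurable,
    lintegral_prod _ h3.lintegral_prod_right'.lintegral_prod_right'.aemeasurable]
  refine lintegral_congr fun x => lintegral_congr fun y => ?_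
  refine lintegral_lintegral_swap (Measurable.aemeasurable ?_)
  have hm : Measurable fun z : BallParam F q × alcove q => (((x, y), z.1), z.2) := by fun_prop
  exact h3.comp hm

theorem lintegral_rightMeasure (m n r : FiniteMeasure (alcove q)) (i : ℕ) {f : alcove q → ℝ≥0∞}
    (hf : Measurable f) :
    ∫⁻ z, f (rightProduct z) * (paramWeight i z.1.2.2 * paramWeight i z.2) ∂rightMeasure F m n r =
    ∫⁻ x, ∫⁻ y, ∫⁻ z, ∫⁻ ω', (∫⁻ ω, f (paramProduct x (paramProduct y z ω') ω) *
      paramWeight i ω ∂paramMeasure F q) * paramWeight i ω' ∂paramMeasure F q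
      ∂(r : Measure (alcove q)) ∂(n : Measure (alcove q)) ∂(m : Measure (alcove q)) := by
  have h1 : Measurable fun z : RightParam F q => f (rightProduct z) * paramWeight i z.2 :=
    (hf.comp measurable_rightProduct).mul ((measurable_paramWeight i).comp measurable_snd)
  have h2 : Measurable fun z : RightParam F q =>
      f (rightProduct z) * (paramWeight i z.1.2.2 * paramWeight i z.2) :=
    (hf.comp measurable_rightProduct).mul (((measurable_paramWeight i).comp (by fun_prop)).mul
      ((measurable_paramWeight i).comp measurable_snd))
  have h3 : Measurable fun z : alcove q × ((alcove q × alcove q) × BallParam F q) =>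
      (∫⁻ ω, f (rightProduct (z, ω)) * paramWeight i ω ∂paramMeasure F q) *
        paramWeight i z.2.2 :=
    h1.lintegral_prod_right'.mul ((measurable_paramWeight i).comp (by fun_prop))
  rw [rightMeasure, lintegral_prod _ h2.aemeasurable]
  have e : ∀ z : alcove q × ((alcove q × alcove q) × BallParam F q),
      ∫⁻ ω, f (rightProduct (z, ω)) * (paramWeight i z.2.2 * paramWeight i ω)
        ∂paramMeasure F q =
      (∫⁻ ω, f (rightProduct (z, ω)) * paramWeight i ω ∂paramMeasure F q) *
        paramWeight i z.2.2 := by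
    intro z
    have h : Measurable fun ω => f (rightProduct (z, ω)) * paramWeight i ω :=
      h1.comp measurable_prodMk_left
    rw [← lintegral_mul_const _ h]
    refine lintegral_congr fun ω' => ?_
    ring
  simp only [e]
  rw [lintegral_prod _ h3.aemeasurable]
  refine lintegral_congr fun x => ?_
  have h4 := h3.comp (measurable_prodMk_left (x := x))
  refine (lintegral_prod _ h4.aemeasurable).trans ?_
  exact lintegral_prod _ h4.lintegral_prod_right'.aemeasurable

theorem ae_leftMeasure (m n r : FiniteMeasure (alcove q)) :
    ∀ᵐ z ∂leftMeasure F m n r, paramDet z.1.1.2 ∈ Ioc (0 : ℝ) 1 ∧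
      paramDet z.2 ∈ Ioc (0 : ℝ) 1 :=
    (Measure.quasiMeasurePreserving_fst.ae (Measure.quasiMeasurePreserving_fst.ae
      (Measure.quasiMeasurePreserving_snd.ae paramDet_mem))).and
      (Measure.quasiMeasurePreserving_snd.ae paramDet_mem)

theorem ae_rightMeasure (m n r : FiniteMeasure (alcove q)) :
    ∀ᵐ z ∂rightMeasure F m n r, paramDet z.1.2.2 ∈ Ioc (0 : ℝ) 1 ∧
      paramDet z.2 ∈ Ioc (0 : ℝ) 1 :=
    (Measure.quasiMeasurePreserving_fst.ae (Measure.quasiMeasurePreserving_snd.ae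
      (Measure.quasiMeasurePreserving_snd.ae paramDet_mem))).and
      (Measure.quasiMeasurePreserving_snd.ae paramDet_mem)

/-- As for commutativity, now with `t` the product of the determinants of the two parameters, so
that a single power of `t` carries both densities. -/
theorem paramDensity_integral_assoc (hq : 0 < q) (m n r : FiniteMeasure (alcove q))
    {A : Set (alcove q)} (hA : MeasurableSet A) (s : ℂ) :
    ∫ z in leftProduct ⁻¹' A, ((paramDet z.1.1.2 * paramDet z.2 : ℝ) : ℂ) ^ s
      ∂leftMeasure F m n r =
    ∫ z in rightProduct ⁻¹' A, ((paramDet z.1.2.2 * paramDet z.2 : ℝ) : ℂ) ^ s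
      ∂rightMeasure F m n r := by
  have hDl : Measurable fun z : LeftParam F q => paramDet z.1.1.2 * paramDet z.2 :=
    (continuous_paramDet.measurable.comp (by fun_prop)).mul
      (continuous_paramDet.measurable.comp (by fun_prop))
  have hDr : Measurable fun z : RightParam F q => paramDet z.1.2.2 * paramDet z.2 :=
    (continuous_paramDet.measurable.comp (by fun_prop)).mul
      (continuous_paramDet.measurable.comp (by fun_prop))
  have hl := ae_leftMeasure (F := F) m n r
  have hr := ae_rightMeasure (F := F) m n r
  have hmul : ∀ a b : ℝ, a ∈ Ioc (0 : ℝ) 1 ∧ b ∈ Ioc (0 : ℝ) 1 → a * b ∈ Ioc (0 : ℝ) 1 :=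
    fun a b h => ⟨mul_pos h.1.1 h.2.1, mul_le_one₀ h.1.2 h.2.1.le h.2.2⟩
  have hw : ∀ (i : ℕ) (ω ω' : BallParam F q), paramDet ω ∈ Ioc (0 : ℝ) 1 ∧
      paramDet ω' ∈ Ioc (0 : ℝ) 1 → ENNReal.ofReal ((paramDet ω * paramDet ω') ^
      ((Module.finrank ℝ F / 2 - 1 : ℝ) + i * (Module.finrank ℝ F / 2 : ℝ))) =
      paramWeight i ω * paramWeight i ω' := by
    intro i ω ω' h
    rw [Real.mul_rpow h.1.1.le h.2.1.le, ENNReal.ofReal_mul (Real.rpow_nonneg h.1.1.le _)]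
    rfl
  have el : ∀ (i : ℕ), ∫⁻ z in leftProduct ⁻¹' A, ENNReal.ofReal ((paramDet z.1.1.2 *
      paramDet z.2) ^ ((Module.finrank ℝ F / 2 - 1 : ℝ) + i * (Module.finrank ℝ F / 2 : ℝ)))
      ∂leftMeasure F m n r = ∫⁻ z, A.indicator (fun _ => 1) (leftProduct z) *
        (paramWeight i z.1.1.2 * paramWeight i z.2) ∂leftMeasure F m n r := by
    intro i
    rw [setLIntegral_preimage_eq _ measurable_leftProduct hA]
    exact lintegral_congr_ae (hl.mono fun z hz => by simp only [hw i _ _ hz])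
  have er : ∀ (i : ℕ), ∫⁻ z in rightProduct ⁻¹' A, ENNReal.ofReal ((paramDet z.1.2.2 *
      paramDet z.2) ^ ((Module.finrank ℝ F / 2 - 1 : ℝ) + i * (Module.finrank ℝ F / 2 : ℝ)))
      ∂rightMeasure F m n r = ∫⁻ z, A.indicator (fun _ => 1) (rightProduct z) *
        (paramWeight i z.1.2.2 * paramWeight i z.2) ∂rightMeasure F m n r := by
    intro i
    rw [setLIntegral_preimage_eq _ measurable_rightProduct hA]
    exact lintegral_congr_ae (hr.mono fun z hz => by simp only [hw i _ _ hz])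
  have hI : Measurable (A.indicator fun _ => (1 : ℝ≥0∞)) := measurable_const.indicator hA
  refine integral_cpow_eq hDl hDr (ae_restrict_of_ae (hl.mono fun z => hmul _ _))
    (ae_restrict_of_ae (hr.mono fun z => hmul _ _))
    (finrank_pos_real (F := F)) (e := (Module.finrank ℝ F / 2 - 1 : ℝ)) ?_ ?_ s
  · have := el 0
    simp only [Nat.cast_zero, zero_mul, add_zero] at this
    rw [this]
    refine ne_of_lt (lt_of_le_of_lt (lintegral_mono (g := fun z => (fun _ => (1 : ℝ≥0∞))
      (leftProduct z) * (paramWeight 0 z.1.1.2 * paramWeight 0 z.2)) fun z => ?_) ?_)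
    · refine mul_le_mul_left (indicator_le_self' (fun _ _ => zero_le) _) _
    · rw [lintegral_leftMeasure m n r 0 measurable_const]
      simp only [one_mul, lintegral_const]
      rw [lintegral_const_mul _ (measurable_paramWeight 0)]
      have := (lintegral_paramWeight_ne_top (F := F) hq 0).lt_top
      exact ENNReal.mul_lt_top (ENNReal.mul_lt_top (ENNReal.mul_lt_top (ENNReal.mul_lt_top this this)
        (measure_lt_top _ _)) (measure_lt_top _ _)) (measure_lt_top _ _)
  · intro i
    rw [el, er, lintegral_leftMeasure m n r i hI, lintegral_rightMeasure m n r i hI]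
    simp only [lintegral_paramProduct_assoc hq i _ _ _ hI]

theorem alcoveConv_assoc (hq : 0 < q) (hμ : gammaConst F q - 1 < μ.re)
    (a b c : ComplexMeasure (alcove q)) :
    alcoveConv F q μ (alcoveConv F q μ a b) c = alcoveConv F q μ a (alcoveConv F q μ b c) := by
  induction a using complexMeasure_induction with
  | zero => simp
  | add a a' h h' => simp only [map_add, LinearMap.add_apply, h, h']
  | smul t a h => simp only [map_smul, LinearMap.smul_apply, h]
  | finite m =>
  induction b using complexMeasure_induction with
  | zero => simp
  | add a a' h h' => simp only [map_add, LinearMap.add_apply, h, h']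
  | smul t a h => simp only [map_smul, LinearMap.smul_apply, h]
  | finite n =>
  induction c using complexMeasure_induction with
  | zero => simp
  | add a a' h h' => simp only [map_add, LinearMap.add_apply, h, h']
  | smul t a h => simp only [map_smul, LinearMap.smul_apply, h]
  | finite r =>
  ext A hA
  have hi := integrable_paramDensity (F := F) hq hμ
  rw [alcoveConv_finiteToComplex hq hμ m n, alcoveConv_finiteToComplex hq hμ n r,
    finiteToComplex_eq_map r, finiteToComplex_eq_map m, alcoveConv,
    paramConv_withDensity (integrable_paramDensity_snd hq hμ _) (integrable_const _) hi
      measurable_paramProduct_uncurry measurable_id measurable_paramProduct_uncurry,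
    paramConv_withDensity (integrable_const _) (integrable_paramDensity_snd hq hμ _) hi
      measurable_id measurable_paramProduct_uncurry measurable_paramProduct_uncurry]
  have hl : Integrable (fun z : LeftParam F q =>
      paramDensity F q μ z.1.1.2 * 1 * paramDensity F q μ z.2) (leftMeasure F m n r) := by
    have h1 := integrable_paramDensity_snd (F := F) hq hμ
      ((m : Measure (alcove q)).prod (n : Measure (alcove q)))
    have h2 := h1.mul_prod (integrable_const (μ := (r : Measure (alcove q))) (1 : ℂ))
    exact h2.mul_prod hi
  have hr : Integrable (fun z : RightParam F q =>
      1 * paramDensity F q μ z.1.2.2 * paramDensity F q μ z.2) (rightMeasure F m n r) := by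
    have h1 := integrable_paramDensity_snd (F := F) hq hμ
      ((n : Measure (alcove q)).prod (r : Measure (alcove q)))
    have h2 := (integrable_const (μ := (m : Measure (alcove q))) (1 : ℂ)).mul_prod h1
    exact h2.mul_prod hi
  refine (VectorMeasure.map_apply _ measurable_leftProduct hA).trans
    (Eq.trans ?_ (VectorMeasure.map_apply _ measurable_rightProduct hA).symm)
  refine (withDensityᵥ_apply hl (measurable_leftProduct hA)).trans
    (Eq.trans ?_ (withDensityᵥ_apply hr (measurable_rightProduct hA)).symm)
  -- Either bracketing carries the factor `κ⁻²`. The two density powers combine into a power of the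
  -- product because the determinants are positive almost everywhere.
  have h := congrArg (((kappa F q μ)⁻¹ * (kappa F q μ)⁻¹) * ·)
    (paramDensity_integral_assoc (F := F) hq m n r hA (μ - gammaConst F q))
  simp only [← integral_const_mul] at h
  refine Eq.trans (integral_congr_ae (ae_restrict_of_ae ?_)) (h.trans
    (integral_congr_ae (ae_restrict_of_ae ?_)))
  · filter_upwards [ae_leftMeasure m n r] with z hz
    rw [paramDensity, paramDensity, Complex.ofReal_mul,
      Complex.mul_cpow_ofReal_nonneg hz.1.1.le hz.2.1.le]
    ring
  · filter_upwards [ae_rightMeasure m n r] with z hz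
    rw [paramDensity, paramDensity, Complex.ofReal_mul,
      Complex.mul_cpow_ofReal_nonneg hz.1.1.le hz.2.1.le]
    ring

end Algebra

end Grassmann

/-! ### The closed ball and the condition for `0` to be attained. -/

namespace Grassmann
open Set ENNReal

section Ball

variable {F : Type} [NormedRing F] [StarRing F] [NormedStarGroup F] [NormedAlgebra ℝ F]
  [IsScalar F] [ProperSpace F] {m q : ℕ}

theorem isClosed_closedRectBall : IsClosed (closedRectBall F m q) := by
  have h : closedRectBall F m q = ⋂ a : Fin q → F, {w | normSq (w *ᵥ a) ≤ normSq a} := by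
    ext w
    simp [closedRectBall]
  rw [h]
  refine isClosed_iInter fun a => isClosed_le ?_ continuous_const
  exact continuous_normSq.comp (continuous_id.matrix_mulVec continuous_const)

theorem isCompact_closedRectBall : IsCompact (closedRectBall F m q) := by
  have h1 : IsCompact (Set.univ.pi fun _ : Fin m => Set.univ.pi fun _ : Fin q =>
      Metric.closedBall (0 : F) 1) :=
    isCompact_univ_pi fun _ => isCompact_univ_pi fun _ => isCompact_closedBall _ _
  refine IsCompact.of_isClosed_subset h1 isClosed_closedRectBall ?_
  intro w hw i _ j _
  rw [mem_closedBall_zero_iff]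
  have h := hw (Pi.single j 1)
  rw [normSq_single, mulVec_single_one] at h
  have h2 : ‖w i j‖ ^ 2 ≤ normSq (w.col j) :=
    Finset.single_le_sum (f := fun i => ‖w i j‖ ^ 2) (fun _ _ => by positivity) (Finset.mem_univ i)
  exact (sq_le_one_iff₀ (norm_nonneg _)).1 (h2.trans h)

/-- For a contraction `w` and `0 < r < 1` the matrix `r w` is strictly contractive; let `r` tend to
one. -/
theorem closedRectBall_subset_closure : closedRectBall F m q ⊆ closure (rectBall F m q) := by
  intro w hw
  have h1 : Filter.Tendsto (fun r : ℝ => r • w) (nhdsWithin 1 (Iio 1)) (nhds ((1 : ℝ) • w)) :=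
    ((continuous_id.smul continuous_const).tendsto (1 : ℝ)).mono_left nhdsWithin_le_nhds
  rw [one_smul] at h1
  refine mem_closure_of_tendsto h1 ?_
  have h2 : Ioo (0 : ℝ) 1 ∈ nhdsWithin (1 : ℝ) (Iio 1) := Ioo_mem_nhdsLT zero_lt_one
  filter_upwards [h2] with r hr a ha
  have h3 : 0 < normSq a := (normSq_nonneg a).lt_of_ne fun h => ha (normSq_eq_zero.1 h.symm)
  change normSq ((r • w) *ᵥ a) < normSq a
  rw [smul_mulVec, normSq_smul]
  have := hw a
  have h4 : r ^ 2 < 1 := by nlinarith [hr.1, hr.2]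
  nlinarith [normSq_nonneg (w *ᵥ a)]

theorem neg_one_mem_closedRectBall : (-1 : Matrix (Fin q) (Fin q) F) ∈ closedRectBall F q q := by
  intro a
  simp [normSq, neg_mulVec]

theorem exists_one_sub_gram_eq_gram {w : Matrix (Fin m) (Fin q) F}
    (hw : w ∈ closedRectBall F m q) : ∃ R : Matrix (Fin q) (Fin q) F, 1 - wᴴ * w = Rᴴ * R := by
  obtain ⟨v, hv, r, hr, -, h⟩ := exists_one_sub_gram_eq hw
  refine ⟨realDiag F (fun i => Real.sqrt (r i)) * vᴴ, ?_⟩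
  rw [h, conjTranspose_mul, conjTranspose_conjTranspose, realDiag_conjTranspose, mul_assoc, mul_assoc,
    ← mul_assoc (realDiag F fun i => Real.sqrt (r i)), realDiag_mul]
  simp only [Real.mul_self_sqrt (hr _).1]

theorem normSq_col_eq_zero {A : Matrix (Fin q) (Fin q) F}
    (h : ∀ j, normSq (fun i => A i j) = 0) : A = 0 := by
  ext i j
  exact congrFun (normSq_eq_zero.1 (h j)) i

/-- `Real.arccos` vanishes exactly on `[1, ∞)`, so all singular values are at least one and `X`
shortens no vector, in particular no coordinate vector. -/
theorem one_le_normSq_col_of_singularAngles_eq_zero {X : Matrix (Fin q) (Fin q) F}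
    (h : singularAngles X = 0) (j : Fin q) : 1 ≤ normSq fun i => X i j := by
  obtain ⟨u, hu, v, hv, e⟩ := exists_eq_mul_singularSpectrum_mul X
  have h1 : ∀ i, 1 ≤ singularSpectrum X i := by
    intro i
    have := congrFun (congrArg Subtype.val h) i.rev
    change Real.arccos (singularSpectrum X i.rev.rev) = 0 at this
    rwa [Fin.rev_rev, Real.arccos_eq_zero] at this
  have h2 : (fun i => X i j) = u *ᵥ fun i => singularSpectrum X i • v i j := by
    ext i
    conv_lhs => rw [e, mul_assoc, Matrix.mul_apply]
    refine Finset.sum_congr rfl fun k _ => ?_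
    rw [realDiag_mul_apply]
  rw [h2, normSq_unitary_mulVec hu, ← normSq_unitary_col hv j]
  refine Finset.sum_le_sum fun i _ => ?_
  rw [norm_smul, mul_pow]
  refine le_mul_of_one_le_left (by positivity) ?_
  rw [Real.norm_of_nonneg (zero_le_one.trans (h1 i))]
  exact one_le_pow₀ (h1 i)

theorem productAngles_one_neg_one (x : alcove q) :
    productAngles x.1 x.1 (1 : Matrix (Fin q) (Fin q) F) (-1) = 0 := by
  have h : -(sinDiag F x.1 * -1 * sinDiag F x.1) + cosDiag F x.1 * 1 * cosDiag F x.1 =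
      cosDiag F ((0 : alcove q) : Fin q → ℝ) := by
    change _ = cosDiag F (0 : Fin q → ℝ)
    simp only [mul_neg, mul_one, neg_mul, neg_neg, sinDiag_eq, cosDiag_eq, realDiag_mul, realDiag_add]
    congr 1
    ext i
    simp only [Pi.zero_apply, Real.cos_zero]
    nlinarith [Real.sin_sq_add_cos_sq (x.1 i)]
  rw [productAngles, h, singularAngles_cosDiag]

/-- A sum of Gram matrices including `X* X` equals the identity, while every column of `X` has
length at least one. Hence `X` is unitary and the other terms vanish. One of these terms gives `v
cos y = cos x X`, so `cos x` and `cos y` have the same singular values. -/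
theorem eq_of_productAngles_eq_zero {x y : alcove q} {v w : Matrix (Fin q) (Fin q) F}
    (hv : v ∈ unitary (Matrix (Fin q) (Fin q) F)) (hw : w ∈ closedRectBall F q q)
    (h : productAngles x.1 y.1 v w = 0) : x = y := by
  obtain ⟨R, hR⟩ := exists_one_sub_gram_eq_gram hw
  set sx := sinDiag F x.1 with hsx
  set cx := cosDiag F x.1 with hcx
  set sy := sinDiag F y.1 with hsy
  set cy := cosDiag F y.1 with hcy
  set X := -(sx * w * sy) + cx * v * cy with hX
  have hcol := one_le_normSq_col_of_singularAngles_eq_zero (F := F) (X := X) h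
  have hsc : ∀ z : Fin q → ℝ, sinDiag F z * sinDiag F z + cosDiag F z * cosDiag F z = 1 := by
    intro z
    rw [sinDiag_eq, cosDiag_eq, realDiag_mul, realDiag_mul, realDiag_add, ← realDiag_one]
    congr 1
    ext i
    nlinarith [Real.sin_sq_add_cos_sq (z i)]
  have hs : ∀ z : Fin q → ℝ, (sinDiag F z)ᴴ = sinDiag F z := fun z => realDiag_conjTranspose _
  have hc : ∀ z : Fin q → ℝ, (cosDiag F z)ᴴ = cosDiag F z := fun z => realDiag_conjTranspose _
  have hvv := conjTranspose_mul_self_of_unitary hv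
  -- In the expansion the mixed terms contribute `-2 X* X` by the definition of `X`, and `sin² x +
  -- cos² x = 1` contributes one `X* X`; with the last summand these cancel. The term with `R`
  -- completes `sin y w* w sin y` to `sin² y`, and `sin² y + cos² y = 1` remains.
  have key : (w * sy + sx * X)ᴴ * (w * sy + sx * X) + (v * cy - cx * X)ᴴ * (v * cy - cx * X) +
      (R * sy)ᴴ * (R * sy) + Xᴴ * X = 1 := by
    have e1 : (R * sy)ᴴ * (R * sy) = sy * sy - sy * wᴴ * w * sy := by
      rw [conjTranspose_mul, hs, mul_assoc, ← mul_assoc Rᴴ, ← hR]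
      noncomm_ring
    have e2 : Xᴴ * (sx * sx) * X + Xᴴ * (cx * cx) * X = Xᴴ * X := by
      rw [← add_mul, ← mul_add, hsc, mul_one]
    have e3 : sx * w * sy - cx * v * cy = -X := by rw [hX]; abel
    have e4 : sy * wᴴ * sx - cy * vᴴ * cx = -Xᴴ := by
      rw [← conjTranspose_neg, ← e3, conjTranspose_sub, conjTranspose_mul, conjTranspose_mul,
        conjTranspose_mul, conjTranspose_mul, hs, hs, hc, hc, mul_assoc, mul_assoc]
    rw [e1]
    simp only [conjTranspose_add, conjTranspose_sub, conjTranspose_mul, hsx, hsy, hcx, hcy, hs, hc]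
    rw [← hsx, ← hsy, ← hcx, ← hcy]
    have e5 : (sy * wᴴ + Xᴴ * sx) * (w * sy + sx * X) + (cy * vᴴ - Xᴴ * cx) * (v * cy - cx * X) +
        (sy * sy - sy * wᴴ * w * sy) + Xᴴ * X =
        (sy * wᴴ * sx - cy * vᴴ * cx) * X + Xᴴ * (sx * w * sy - cx * v * cy) +
        (Xᴴ * (sx * sx) * X + Xᴴ * (cx * cx) * X) + Xᴴ * X + sy * sy + cy * (vᴴ * v) * cy := by
      noncomm_ring
    rw [e5, e2, e3, e4, hvv, mul_one, ← hsc y.1]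
    noncomm_ring
  have hz : ∀ j, normSq (fun i => (v * cy - cx * X) i j) = 0 ∧
      normSq (fun i => (w * sy + sx * X) i j) = 0 ∧ normSq (fun i => (R * sy) i j) = 0 := by
    intro j
    have h1 := congrFun (congrFun key j) j
    simp only [Matrix.add_apply, conjTranspose_mul_self_diag, Matrix.one_apply_eq] at h1
    rw [← map_add, ← map_add, ← map_add, ← (algebraMap ℝ F).map_one, algebraMap_inj] at h1
    have h2 := hcol j
    have a1 := normSq_nonneg fun i => (v * cy - cx * X) i j
    have a2 := normSq_nonneg fun i => (w * sy + sx * X) i j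
    have a3 := normSq_nonneg fun i => (R * sy) i j
    simp only [Matrix.add_apply, Matrix.sub_apply] at h1 a1 a2 a3 ⊢
    refine ⟨?_, ?_, ?_⟩ <;> linarith
  have z1 := normSq_col_eq_zero fun j => (hz j).1
  have z2 := normSq_col_eq_zero fun j => (hz j).2.1
  have z3 := normSq_col_eq_zero fun j => (hz j).2.2
  rw [z1, z2, z3] at key
  simp only [Matrix.mul_zero, zero_add] at key
  have hXu := mem_unitary_of_conjTranspose_mul key
  have e : v * cy = cx * X := sub_eq_zero.1 z1
  have h1 : singularAngles (v * cy) = y := by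
    have := singularAngles_mul_mul hv (one_mem _) cy
    rwa [mul_one, singularAngles_cosDiag] at this
  have h2 : singularAngles (cx * X) = x := by
    have := singularAngles_mul_mul (one_mem _) hXu cx
    rwa [one_mul, singularAngles_cosDiag] at this
  rw [← h1, ← h2, e]

end Ball

theorem finiteToComplex_injective {X : Type*} [MeasurableSpace X] :
    Function.Injective (finiteToComplex : FiniteMeasure X → ComplexMeasure X) := by
  intro m n h
  apply Subtype.ext
  refine Measure.ext fun E hE => ?_
  have h1 := congrArg (fun c : ComplexMeasure X => c E) h
  simp only [finiteToComplex_apply _ hE, Complex.ofReal_inj] at h1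
  have hm := m.2
  have hn := n.2
  exact (measureReal_eq_measureReal_iff (@measure_ne_top _ _ _ hm _) (@measure_ne_top _ _ _ hn _)).1 h1

/-! ### The hypergroup for a real parameter. -/

section Hypergroup

variable (F : Type) [NormedRing F] [StarRing F] [NormedStarGroup F] [NormedAlgebra ℝ F]
  [IsScalar F] [ProperSpace F] [HasDet F] [IsScalarDet F] {q : ℕ}
  [MeasureSpace F] [BorelSpace F] [Measure.IsAddHaarMeasure (volume : Measure F)]

/-- The normalized density on the parameter space for a real exponent. -/
def realDensity (q : ℕ) (s : ℝ) (ω : BallParam F q) : ℝ :=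
  (∫ w in matrixBall F q, gramDet w ^ s)⁻¹ * paramDet ω ^ s

/-- The measure on the parameter space with the normalized density. -/
def paramLaw (q : ℕ) (s : ℝ) : Measure (BallParam F q) :=
  (paramMeasure F q).withDensity fun ω => ENNReal.ofReal (realDensity F q s ω)

variable {F} {μ : ℂ}

theorem kappa_eq_ofReal (him : μ.im = 0) :
    kappa F q μ = ((∫ w in matrixBall F q, gramDet w ^ (μ.re - gammaConst F q) : ℝ) : ℂ) := by
  rw [kappa_eq, ← integral_complex_ofReal]
  refine setIntegral_congr_fun (measurableSet_rectBall q q) fun w hw => ?_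
  have hμ : μ = (μ.re : ℂ) := Complex.ext rfl (by simp [him])
  rw [Complex.ofReal_cpow (gramDet_pos hw).le, Complex.ofReal_sub, ← hμ]

theorem integral_gramDet_rpow_pos (hq : 0 < q) (hμ : gammaConst F q - 1 < μ.re) (him : μ.im = 0) :
    0 < ∫ w in matrixBall F q, gramDet w ^ (μ.re - gammaConst F q) := by
  refine lt_of_le_of_ne (setIntegral_nonneg (measurableSet_rectBall q q) fun w hw =>
    Real.rpow_nonneg (gramDet_pos hw).le _) fun h => ?_
  have := kappa_eq_ofReal (F := F) (q := q) him
  rw [← h, Complex.ofReal_zero] at this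
  exact kappa_ne_zero hq hμ this

theorem measurable_realDensity (s : ℝ) : Measurable (realDensity F q s) :=
  (continuous_paramDet.measurable.pow_const _).const_mul _

theorem paramDensity_eq_ofReal (hq : 0 < q) (hμ : gammaConst F q - 1 < μ.re) (him : μ.im = 0) :
    ∀ᵐ ω ∂paramMeasure F q, paramDensity F q μ ω =
      (realDensity F q (μ.re - gammaConst F q) ω : ℂ) ∧
      0 < realDensity F q (μ.re - gammaConst F q) ω := by
  refine paramDet_mem.mono fun ω hω => ⟨?_, mul_pos (inv_pos.2 (integral_gramDet_rpow_pos hq hμ him))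
    (Real.rpow_pos_of_pos hω.1 _)⟩
  have h : μ = (μ.re : ℂ) := Complex.ext rfl (by simp [him])
  rw [paramDensity, realDensity, kappa_eq_ofReal him, Complex.ofReal_mul, Complex.ofReal_inv,
    Complex.ofReal_cpow hω.1.le, Complex.ofReal_sub, ← h]

theorem setIntegral_paramDensity_eq (hq : 0 < q) (hμ : gammaConst F q - 1 < μ.re) (him : μ.im = 0)
    {Z : Type*} [MeasurableSpace Z] (M : Measure Z) [IsFiniteMeasure M]
    {A : Set (Z × BallParam F q)} (hA : MeasurableSet A) :
    ∫ z in A, paramDensity F q μ z.2 ∂(M.prod (paramMeasure F q)) =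
      ((M.prod (paramLaw F q (μ.re - gammaConst F q))).real A : ℂ) := by
  have hae : ∀ᵐ z ∂(M.prod (paramMeasure F q)), paramDensity F q μ z.2 =
      (realDensity F q (μ.re - gammaConst F q) z.2 : ℂ) ∧
      0 < realDensity F q (μ.re - gammaConst F q) z.2 :=
    Measure.quasiMeasurePreserving_snd.ae (paramDensity_eq_ofReal hq hμ him)
  have hae' := ae_restrict_of_ae (s := A) hae
  rw [integral_congr_ae (hae'.mono fun z hz => hz.1), integral_complex_ofReal,
    integral_eq_lintegral_of_nonneg_ae (hae'.mono fun z hz => hz.2.le)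
      ((measurable_realDensity _).comp measurable_snd).aestronglyMeasurable, paramLaw,
    prod_withDensity_right (measurable_realDensity _).ennreal_ofReal, Measure.real,
    withDensity_apply _ hA]

theorem isProbabilityMeasure_paramLaw (hq : 0 < q) (hμ : gammaConst F q - 1 < μ.re)
    (him : μ.im = 0) : IsProbabilityMeasure (paramLaw F q (μ.re - gammaConst F q)) := by
  have h := setIntegral_paramDensity_eq (F := F) hq hμ him (Measure.dirac ()) MeasurableSet.univ
  rw [Measure.restrict_univ, integral_fun_snd, integral_paramDensity hq hμ] at h
  have h1 : ((Measure.dirac ()).prod (paramLaw F q (μ.re - gammaConst F q))) univ = 1 := by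
    have h2 : ((Measure.dirac ()).prod (paramLaw F q (μ.re - gammaConst F q))).real univ = 1 := by
      have : (((Measure.dirac ()).prod (paramLaw F q (μ.re - gammaConst F q))).real univ : ℂ) = 1 := by
        rw [← h]
        simp
      exact_mod_cast this
    rw [← ENNReal.toReal_eq_one_iff]
    exact h2
  have : SFinite (paramLaw F q (μ.re - gammaConst F q)) := by
    unfold paramLaw
    infer_instance
  rw [← univ_prod_univ, Measure.prod_prod] at h1
  exact ⟨by simpa using h1⟩

/-- The product of two positive measures as a positive measure. -/
def finiteConv (P : Measure (BallParam F q)) [IsFiniteMeasure P] (m n : FiniteMeasure (alcove q)) :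
    FiniteMeasure (alcove q) :=
  ⟨(((m : Measure (alcove q)).prod (n : Measure (alcove q))).prod P).map
    fun z => paramProduct z.1.1 z.1.2 z.2, inferInstance⟩

/-- The product of two point measures as a probability measure. -/
def pointLaw (P : Measure (BallParam F q)) [IsProbabilityMeasure P] (x y : alcove q) :
    ProbabilityMeasure (alcove q) :=
  ⟨P.map fun ω => paramProduct x y ω, Measure.isProbabilityMeasure_map
    (measurable_paramProduct measurable_const measurable_const measurable_id).aemeasurable⟩

theorem alcoveConv_eq_finiteConv (hq : 0 < q) (hμ : gammaConst F q - 1 < μ.re) (him : μ.im = 0)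
    [IsFiniteMeasure (paramLaw F q (μ.re - gammaConst F q))] (m n : FiniteMeasure (alcove q)) :
    alcoveConv F q μ (finiteToComplex m) (finiteToComplex n) =
      finiteToComplex (finiteConv (paramLaw F q (μ.re - gammaConst F q)) m n) := by
  ext A hA
  rw [alcoveConv_finiteToComplex hq hμ, VectorMeasure.map_apply _ measurable_paramProduct_uncurry hA,
    withDensityᵥ_apply (integrable_paramDensity_snd hq hμ _) (measurable_paramProduct_uncurry hA),
    finiteToComplex_apply _ hA, setIntegral_paramDensity_eq hq hμ him _
      (measurable_paramProduct_uncurry hA)]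
  congr 1
  exact (map_measureReal_apply measurable_paramProduct_uncurry hA).symm

theorem finiteConv_diracFinite (P : Measure (BallParam F q)) [IsProbabilityMeasure P]
    (x y : alcove q) :
    finiteConv P (diracFinite x) (diracFinite y) = (pointLaw P x y).toFiniteMeasure := by
  apply Subtype.ext
  change (((Measure.dirac x).prod (Measure.dirac y)).prod P).map _ = P.map _
  rw [Measure.dirac_prod_dirac, Measure.dirac_prod, Measure.map_map measurable_paramProduct_uncurry
    measurable_prodMk_left]
  rfl

/-- The density is positive almost everywhere, so a null set of the law is null for `dv dw`, which
charges every nonempty open subset of `U₀` times the open ball. -/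
theorem paramLaw_pos (hq : 0 < q) (hμ : gammaConst F q - 1 < μ.re) (him : μ.im = 0)
    {O : Set (BallParam F q)} (hO : IsOpen O) (hne : (O ∩ univ ×ˢ rectBall F q q).Nonempty) :
    0 < paramLaw F q (μ.re - gammaConst F q) O := by
  rw [pos_iff_ne_zero]
  intro h0
  have h1 : paramMeasure F q O = 0 := by
    refine withDensity_absolutelyContinuous' (measurable_realDensity _).ennreal_ofReal.aemeasurable
      ((paramDensity_eq_ofReal hq hμ him).mono fun ω hω => ?_) h0
    simpa using hω.2
  have h2 : paramMeasure F q = ((normalizedHaar (unitaryComponent F q)).prod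
      (volume : Measure (Matrix (Fin q) (Fin q) F))).restrict (univ ×ˢ rectBall F q q) := by
    rw [paramMeasure, matrixBall_eq, ← Measure.prod_restrict, Measure.restrict_univ]
  rw [h2, Measure.restrict_apply hO.measurableSet] at h1
  have : (volume : Measure (Matrix (Fin q) (Fin q) F)).IsOpenPosMeasure :=
    inferInstanceAs ((volume : Measure (Fin q → Fin q → F)).IsOpenPosMeasure)
  exact (hO.inter (isOpen_univ.prod (isOpen_rectBall q q))).measure_ne_zero _ hne h1

/-- The compact set over which the supports of the products of point measures are parametrized. -/
def closedParam (F : Type) [NormedRing F] [StarRing F] [NormedStarGroup F] [NormedAlgebra ℝ F]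
    [ProperSpace F] [IsScalar F] (q : ℕ) : Set (BallParam F q) := univ ×ˢ closedRectBall F q q

theorem isCompact_closedParam : IsCompact (closedParam F q) :=
  isCompact_univ.prod isCompact_closedRectBall

theorem paramLaw_compl (s : ℝ) : paramLaw F q s (univ ×ˢ rectBall F q q)ᶜ = 0 := by
  refine withDensity_absolutelyContinuous _ _ ?_
  have h2 : paramMeasure F q = ((normalizedHaar (unitaryComponent F q)).prod
      (volume : Measure (Matrix (Fin q) (Fin q) F))).restrict (univ ×ˢ rectBall F q q) := by
    rw [paramMeasure, matrixBall_eq, ← Measure.prod_restrict, Measure.restrict_univ]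
  have hm : MeasurableSet ((univ : Set (unitaryComponent F q)) ×ˢ rectBall F q q) :=
    MeasurableSet.univ.prod (measurableSet_rectBall q q)
  rw [h2, Measure.restrict_apply hm.compl, compl_inter_self, measure_empty]

theorem continuous_paramProduct_right (x y : alcove q) :
    Continuous fun ω : BallParam F q => paramProduct x y ω :=
  continuous_paramProduct continuous_const continuous_const continuous_id

theorem pointLaw_apply (P : Measure (BallParam F q)) [IsProbabilityMeasure P] (x y : alcove q)
    {A : Set (alcove q)} (hA : MeasurableSet A) :
    (pointLaw P x y : Measure (alcove q)) A = P ((fun ω => paramProduct x y ω) ⁻¹' A) :=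
  Measure.map_apply (continuous_paramProduct_right x y).measurable hA

/-- The image of the closed parameter set is compact and carries full mass. Conversely, the preimage
of a neighbourhood of an image point meets the open ball, which is dense in the closed one, and has
positive mass by `paramLaw_pos`. -/
theorem support_pointLaw (hq : 0 < q) (hμ : gammaConst F q - 1 < μ.re) (him : μ.im = 0)
    [IsProbabilityMeasure (paramLaw F q (μ.re - gammaConst F q))] (x y : alcove q) :
    (pointLaw (paramLaw F q (μ.re - gammaConst F q)) x y : Measure (alcove q)).support =
      (fun ω => paramProduct x y ω) '' closedParam F q := by
  have hc := continuous_paramProduct_right (F := F) x y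
  apply Subset.antisymm
  · refine Measure.support_subset_of_isClosed (isCompact_closedParam.image hc).isClosed ?_
    rw [mem_ae_iff, pointLaw_apply _ _ _ (isCompact_closedParam.image hc).isClosed.measurableSet.compl]
    refine measure_mono_null ?_ (paramLaw_compl (F := F) (q := q) (μ.re - gammaConst F q))
    intro ω hω hω'
    exact hω ⟨ω, ⟨trivial, rectBall_subset_closedRectBall _ _ hω'.2⟩, rfl⟩
  · rintro _ ⟨ω, hω, rfl⟩
    rw [Measure.mem_support_iff_forall]
    intro U hU
    obtain ⟨V, hVU, hV, hωV⟩ := mem_nhds_iff.1 hU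
    refine lt_of_lt_of_le ?_ (measure_mono hVU)
    rw [pointLaw_apply _ _ _ hV.measurableSet]
    refine paramLaw_pos hq hμ him (hV.preimage hc) ?_
    have h1 : ω ∈ closure ((univ : Set (unitaryComponent F q)) ×ˢ rectBall F q q) := by
      rw [closure_prod_eq, closure_univ]
      exact ⟨trivial, closedRectBall_subset_closure hω.2⟩
    exact mem_closure_iff.1 h1 _ (hV.preimage hc) hωV

/-- Meeting `V` is a union over the parameters of open conditions. Lying in `W` is open by the tube
lemma, since the parameter set is compact. -/
theorem isOpen_support_condition (V W : Set (alcove q)) (hV : IsOpen V) (hW : IsOpen W)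
    (S : alcove q → alcove q → Set (alcove q))
    (hS : ∀ x y, S x y = (fun ω => paramProduct x y ω) '' closedParam F q) :
    IsOpen {z : alcove q × alcove q | (S z.1 z.2 ∩ V).Nonempty ∧ S z.1 z.2 ⊆ W} := by
  have hc : Continuous fun z : (alcove q × alcove q) × BallParam F q =>
      paramProduct z.1.1 z.1.2 z.2 :=
    continuous_paramProduct (by fun_prop) (by fun_prop) (by fun_prop)
  have h1 : {z : alcove q × alcove q | (S z.1 z.2 ∩ V).Nonempty} =
      ⋃ ω ∈ closedParam F q, (fun z : alcove q × alcove q => paramProduct z.1 z.2 ω) ⁻¹' V := by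
    ext z
    simp only [mem_iUnion, mem_preimage, hS, Set.mem_ofPred_eq]
    constructor
    · rintro ⟨_, ⟨ω, hω, rfl⟩, hv⟩
      exact ⟨ω, hω, hv⟩
    · rintro ⟨ω, hω, hv⟩
      exact ⟨_, ⟨ω, hω, rfl⟩, hv⟩
  have h2 : {z : alcove q × alcove q | S z.1 z.2 ⊆ W} =
      {z | ∀ ω ∈ closedParam F q, paramProduct z.1 z.2 ω ∈ W} := by
    ext z
    simp only [hS, Set.mem_ofPred_eq, image_subset_iff]
    rfl
  have h3 : IsOpen {z : alcove q × alcove q | (S z.1 z.2 ∩ V).Nonempty} := by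
    rw [h1]
    refine isOpen_biUnion fun ω _ => hV.preimage ?_
    exact continuous_paramProduct continuous_fst continuous_snd continuous_const
  have h4 : IsOpen {z : alcove q × alcove q | S z.1 z.2 ⊆ W} := by
    rw [h2, isOpen_iff_mem_nhds]
    intro z hz
    exact isCompact_closedParam.eventually_forall_of_forall_eventually fun ω hω =>
      hc.continuousAt.eventually (hW.mem_nhds (hz ω hω))
  exact h3.inter h4

/-- The hypergroup for a real parameter. -/
def alcoveHypergroup (hq : 0 < q) (hμ : gammaConst F q - 1 < μ.re) (him : μ.im = 0) :
    Hypergroup (alcove q) :=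
  have := isProbabilityMeasure_paramLaw (F := F) hq hμ him
  { conv := alcoveConv F q μ
    assoc := alcoveConv_assoc hq hμ
    nonneg := fun m n => ⟨_, alcoveConv_eq_finiteConv hq hμ him m n⟩
    weaklyContinuous := weaklyContinuous_alcoveConv hq hμ
    point := pointLaw (paramLaw F q (μ.re - gammaConst F q))
    conv_point := fun x y => by
      rw [pointMass_eq, pointMass_eq, alcoveConv_eq_finiteConv hq hμ him, finiteConv_diracFinite]
    isCompact_support := fun x y => Measure.isClosed_support.isCompact
    continuous_support := fun V W hV hW => isOpen_support_condition (F := F) V W hV hW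
      (fun x y => (pointLaw (paramLaw F q (μ.re - gammaConst F q)) x y :
        Measure (alcove q)).support) (support_pointLaw hq hμ him)
    e := 0
    e_conv := fun x => alcoveConv_zero_left hq hμ _
    conv_e := fun x => by rw [alcoveConv_comm hq hμ, alcoveConv_zero_left hq hμ]
    inv := id
    continuous_inv := continuous_id
    inv_inv := fun _ => rfl
    -- For the identity involution this is commutativity, read back from complex to positive
    -- measures by injectivity.
    point_inv := fun x y => by
      rw [Measure.map_id]
      refine congrArg (fun m : FiniteMeasure (alcove q) => (m : Measure (alcove q)))
        (finiteToComplex_injective (a₁ := (pointLaw (paramLaw F q (μ.re - gammaConst F q)) x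
          y).toFiniteMeasure) (a₂ := (pointLaw (paramLaw F q (μ.re - gammaConst F q)) y
          x).toFiniteMeasure) ?_)
      rw [← finiteConv_diracFinite, ← finiteConv_diracFinite, ← alcoveConv_eq_finiteConv hq hμ him,
        ← alcoveConv_eq_finiteConv hq hμ him, alcoveConv_comm hq hμ]
    e_mem_support_iff := fun x y => by
      rw [support_pointLaw hq hμ him]
      constructor
      · rintro ⟨ω, hω, h⟩
        exact eq_of_productAngles_eq_zero ω.1.1.2 hω.2 h
      · rintro rfl
        -- For `v = 1` and `w = -1` the matrix is `sin² x + cos² x = 1`. This `w` belongs to the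
        -- closed parameter set though not to the open ball.
        exact ⟨(1, -1), ⟨trivial, neg_one_mem_closedRectBall⟩, productAngles_one_neg_one x⟩ }

end Hypergroup

end Grassmann

/-! ### The alcove as the double coset space. -/

namespace Grassmann
open Set ENNReal

section DoubleCosetSpace

variable {F : Type} [NormedRing F] [StarRing F] [NormedStarGroup F] [NormedAlgebra ℝ F]
  [IsScalar F] [ProperSpace F] [HasDet F] [IsScalarDet F] {p q : ℕ} [MeasureSpace F] [BorelSpace F]

theorem coset_mul_mul (k l : grassmannK F p q) (u : grassmannU F p q) :
    coset (k.1 * u * l.1) = coset u :=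
  ((DoubleCoset.eq _ _ _ _).2 ⟨k.1, k.2, l.1, l.2, rfl⟩).symm

theorem coset_torus_angles (hqp : q < p) (u : grassmannU F p q) :
    coset (torus hqp.le (angles u).1) = coset u := by
  obtain ⟨k, l, h⟩ := exists_eq_mul_torus_mul hqp u
  rw [← coset_mul_mul k l, ← h]

/-- The parameter in the alcove of a double coset. -/
def cosetAngles : GrassmannCosets F p q → alcove q :=
  Quotient.lift angles fun a b h => by
    obtain ⟨k, hk, l, hl, rfl⟩ := DoubleCoset.rel_iff.1 h
    exact (angles_mul_mul ⟨k, hk⟩ ⟨l, hl⟩ a).symm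

theorem continuous_torus (hqp : q ≤ p) :
    Continuous fun x : alcove q => torus (F := F) hqp x.1 := by
  refine isInducing_toMat.continuous_iff.2 ?_
  change Continuous fun x : alcove q => rotationMatrix F p q x.1
  have h : ∀ i, Continuous fun x : alcove q => x.1 i := fun i =>
    (continuous_apply i).comp continuous_subtype_val
  have ha : ∀ {f : alcove q → ℝ}, Continuous f → Continuous fun x => algebraMap ℝ F (f x) :=
    fun hf => (algebraMapCLM ℝ F).continuous.comp hf
  refine Continuous.matrix_fromBlocks (Continuous.matrix_diagonal (continuous_pi fun i => ha ?_))
    (continuous_matrix fun i j => ha ?_) (continuous_matrix fun i j => ha ?_)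
    (Continuous.matrix_diagonal (continuous_pi fun i => ha (Real.continuous_cos.comp (h i))))
  · split_ifs
    · exact Real.continuous_cos.comp (h _)
    · exact continuous_const
  · split_ifs
    · exact (Real.continuous_sin.comp (h _)).neg
    · exact continuous_const
  · split_ifs
    · exact Real.continuous_sin.comp (h _)
    · exact continuous_const

/-- The alcove as the double coset space. -/
def alcoveHomeomorph (hqp : q < p) : alcove q ≃ₜ GrassmannCosets F p q where
  toFun x := coset (torus hqp.le x.1)
  invFun := cosetAngles
  left_inv x := angles_torus hqp.le x
  right_inv := by
    rintro ⟨u⟩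
    exact coset_torus_angles hqp u
  continuous_toFun := continuous_quotient_mk'.comp (continuous_torus hqp.le)
  continuous_invFun := continuous_angles.quotient_lift _

theorem alcoveHomeomorph_angles (hqp : q < p) (u : grassmannU F p q) :
    alcoveHomeomorph hqp (angles u) = coset u := coset_torus_angles hqp u

/-- The angles classify the double cosets and are invariant under inversion. -/
theorem coset_inv (hqp : q < p) (u : grassmannU F p q) : coset u⁻¹ = coset u := by
  rw [← alcoveHomeomorph_angles hqp, angles_inv, alcoveHomeomorph_angles hqp]

theorem alcoveHomeomorph_zero (hqp : q < p) :
    alcoveHomeomorph (F := F) hqp 0 = coset 1 := by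
  have h : torus (F := F) hqp.le ((0 : alcove q) : Fin q → ℝ) = 1 :=
    toMat_injective (rotationMatrix_zero hqp.le)
  exact congrArg coset h

end DoubleCosetSpace

/-! ### Identification with the double coset convolution. -/

section Law

variable {F : Type} [NormedRing F] [StarRing F] [NormedStarGroup F] [NormedAlgebra ℝ F]
  [IsScalar F] [ProperSpace F] [HasDet F] [IsScalarDet F] {p q : ℕ} [MeasureSpace F] [BorelSpace F]
  [Measure.IsAddHaarMeasure (volume : Measure F)] {μ : ℂ}

/-- Since `γ - 1 = d(q - 1/2)`, the condition on `μ = pd/2` reads `p > 2q - 1`. -/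
theorem add_le_of_gammaConst_lt (hμ : gammaConst F q - 1 < μ.re)
    (hp : μ = p * Module.finrank ℝ F / 2) : q + q ≤ p := by
  have h1 : μ.re = p * Module.finrank ℝ F / 2 := by
    rw [hp, ← Complex.ofReal_re (p * Module.finrank ℝ F / 2)]
    push_cast
    rfl
  rw [h1, gammaConst] at hμ
  have hd : (0 : ℝ) ≤ Module.finrank ℝ F := Nat.cast_nonneg _
  by_contra h
  have h2 : (p : ℝ) + 1 ≤ q + q := by exact_mod_cast (not_le.1 h)
  nlinarith

/-- For `p = 2q + n` the exponent `μ - γ` is `d/2 - 1 + n d/2`, so the two laws are proportional.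
Both are probability measures, hence equal, and the constants need not be computed. -/
theorem map_angles_eq (hq : 0 < q) (hμ : gammaConst F q - 1 < μ.re)
    (hp : μ = p * Module.finrank ℝ F / 2) (hqp : q ≤ p) (x y : alcove q) :
    (normalizedHaar (grassmannK F p q)).map (fun k => angles (torus hqp x.1 * k.1 * torus hqp y.1)) =
      (paramLaw F q (μ.re - gammaConst F q)).map fun ω => paramProduct x y ω := by
  have h1 : μ = ((p * Module.finrank ℝ F / 2 : ℝ) : ℂ) := by rw [hp]; push_cast; rfl
  have him : μ.im = 0 := by rw [h1]; exact Complex.ofReal_im _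
  have hre : μ.re = p * Module.finrank ℝ F / 2 := by rw [h1]; exact Complex.ofReal_re _
  obtain ⟨n, hn⟩ := Nat.exists_eq_add_of_le (add_le_of_gammaConst_lt hμ hp)
  obtain ⟨C, h0, ht, hC⟩ := exists_lintegral_angles_eq_param (F := F) hq hn hqp
  have hs : μ.re - gammaConst F q =
      (Module.finrank ℝ F / 2 - 1 : ℝ) + n * (Module.finrank ℝ F / 2 : ℝ) := by
    rw [hre, gammaConst, hn]; push_cast; ring
  set c := (∫ w in matrixBall F q, gramDet w ^ (μ.re - gammaConst F q))⁻¹ with hc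
  have hcpos : 0 < c := inv_pos.2 (integral_gramDet_rpow_pos hq hμ him)
  have hprob := isProbabilityMeasure_paramLaw (F := F) hq hμ him
  have hm : Measurable fun ω : BallParam F q => paramProduct x y ω :=
    measurable_paramProduct measurable_const measurable_const measurable_id
  have hm' : Measurable fun k : grassmannK F p q =>
      angles (torus hqp x.1 * k.1 * torus hqp y.1) :=
    (continuous_angles.comp (by fun_prop)).measurable
  have hlaw : ∀ f : alcove q → ℝ≥0∞, Measurable f →
      ∫⁻ ω, f (paramProduct x y ω) ∂paramLaw F q (μ.re - gammaConst F q) =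
      ENNReal.ofReal c * ∫⁻ ω, f (paramProduct x y ω) * paramWeight n ω ∂paramMeasure F q := by
    intro f hf
    have hfm : Measurable fun ω : BallParam F q => f (paramProduct x y ω) := hf.comp hm
    rw [paramLaw, lintegral_withDensity_eq_lintegral_mul _
      (measurable_realDensity _).ennreal_ofReal hfm, ← lintegral_const_mul' _ _ (by simp)]
    refine lintegral_congr fun ω => ?_
    rw [Pi.mul_apply, realDensity, ENNReal.ofReal_mul hcpos.le, paramWeight, ← hs]
    ring
  have hC' : ∀ f : alcove q → ℝ≥0∞, Measurable f →
      ∫⁻ k : grassmannK F p q, f (angles (torus hqp x.1 * k.1 * torus hqp y.1))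
        ∂normalizedHaar (grassmannK F p q) = C * (ENNReal.ofReal c)⁻¹ *
      ∫⁻ ω, f (paramProduct x y ω) ∂paramLaw F q (μ.re - gammaConst F q) := by
    intro f hf
    rw [hC x y f hf, hlaw f hf, mul_assoc, ← mul_assoc (ENNReal.ofReal c)⁻¹,
      ENNReal.inv_mul_cancel (by simpa using hcpos) (by simp), one_mul]
  have hone := hC' (fun _ => 1) measurable_const
  simp only [lintegral_const, measure_univ, mul_one] at hone
  refine Measure.ext_of_lintegral _ fun f hf => ?_
  rw [lintegral_map hf hm', lintegral_map hf hm, hC' f hf, ← hone, one_mul]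

theorem cintegral_finiteToComplex {X : Type*} [MeasurableSpace X] (m : FiniteMeasure X)
    {f : X → ℝ} (hf : Measurable f) {C : ℝ} (hC : ∀ x, ‖f x‖ ≤ C) :
    cintegral (finiteToComplex m) f = ((∫ x, f x ∂(m : Measure X) : ℝ) : ℂ) := by
  rw [finiteToComplex_eq, cintegral_withDensity (integrable_const _) hf hC, ← integral_complex_ofReal]
  simp

theorem map_angles_eq_torus (hqp : q < p) (g h : grassmannU F p q) :
    (normalizedHaar (grassmannK F p q)).map (fun k => angles (g * k.1 * h)) =
    (normalizedHaar (grassmannK F p q)).map (fun k => angles (torus hqp.le (angles g).1 * k.1 *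
        torus hqp.le (angles h).1)) := by
  have hm : ∀ g h : grassmannU F p q, Measurable fun k : grassmannK F p q => angles (g * k.1 * h) :=
    fun g h => (continuous_angles.comp (by fun_prop)).measurable
  refine Measure.ext_of_lintegral _ fun f hf => ?_
  rw [lintegral_map hf (hm _ _), lintegral_map hf (hm _ _), lintegral_angles_eq hqp]

/-- The convolution of the alcove is the double coset convolution. -/
theorem cintegral_alcoveConv_eq_cosetConv (hq : 0 < q) (hμ : gammaConst F q - 1 < μ.re)
    (hp : μ = p * Module.finrank ℝ F / 2) (hqp : q < p) (g h : grassmannU F p q)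
    (f : C(GrassmannCosets F p q, ℝ)) :
    cintegral (alcoveConv F q μ (pointMass (angles g)) (pointMass (angles h)))
      (f ∘ alcoveHomeomorph hqp) = cosetConv F g h f := by
  have him : μ.im = 0 := by
    have h1 : μ = ((p * Module.finrank ℝ F / 2 : ℝ) : ℂ) := by rw [hp]; push_cast; rfl
    rw [h1]; exact Complex.ofReal_im _
  have hprob := isProbabilityMeasure_paramLaw (F := F) hq hμ him
  set φ : C(alcove q, ℝ) := f.comp ⟨_, (alcoveHomeomorph hqp).continuous⟩ with hφ
  change cintegral _ φ = _
  rw [pointMass_eq, pointMass_eq, alcoveConv_eq_finiteConv hq hμ him, finiteConv_diracFinite,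
    cintegral_finiteToComplex _ φ.continuous.measurable φ.norm_coe_le_norm]
  congr 1
  change ∫ x, φ x ∂((paramLaw F q (μ.re - gammaConst F q)).map fun ω =>
    paramProduct (angles g) (angles h) ω) = _
  have hm : Measurable fun k : grassmannK F p q => angles (g * k.1 * h) :=
    (continuous_angles.comp (by fun_prop)).measurable
  rw [← map_angles_eq hq hμ hp hqp.le, ← map_angles_eq_torus hqp,
    integral_map hm.aemeasurable φ.continuous.measurable.aestronglyMeasurable, cosetConv]
  refine integral_congr_ae (Filter.Eventually.of_forall fun k => ?_)
  exact congrArg f (alcoveHomeomorph_angles hqp _)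

end Law

end Grassmann

/-! ### Averaging over the identity component of `K`. -/

namespace Grassmann
open Set ENNReal

section ComponentK

variable {F : Type} [NormedRing F] [StarRing F] [NormedStarGroup F] [NormedAlgebra ℝ F]
  [IsScalar F] [ProperSpace F] [HasDet F] [IsScalarDet F] {p q : ℕ} [MeasureSpace F] [BorelSpace F]

theorem mul_rotation_apply_right {m n : Type*} [Fintype n] [DecidableEq n] {i j : n} (hij : i ≠ j)
    (ε : F) (c s : ℝ) (A : Matrix m n F) (k : m) :
    (A * rotation i j ε c s) k j = c • A k j - s • (A k i * star ε) := by
  simp only [rotation, Matrix.add_apply, Matrix.sub_apply, Matrix.smul_apply, Matrix.mul_smul,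
    Matrix.mul_add, Matrix.mul_sub, Matrix.mul_one, mul_single_apply_same,
    mul_single_apply_of_ne _ _ _ _ _ hij.symm]
  rw [mul_one]
  module

theorem rotation_apply_of_ne {n : Type*} [Fintype n] [DecidableEq n] {i j : n} (hij : i ≠ j)
    (ε : F) (c s : ℝ) {k l : n} (hkl : k ≠ l) (h1 : l = i → k ≠ j) (h2 : l = j → k ≠ i) :
    rotation i j ε c s k l = 0 := by
  rw [← Matrix.one_mul (rotation i j ε c s)]
  by_cases hi : l = i
  · subst hi
    rw [mul_rotation_apply_left hij]
    simp [hkl, h1 rfl]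
  · by_cases hj : l = j
    · subst hj
      rw [mul_rotation_apply_right hij]
      simp [hkl, h2 rfl]
    · rw [mul_rotation_apply_of_ne hi hj]
      simp [hkl]

/-- The rotations inside the blocks belong to the identity component. -/
theorem exists_mem_component_rotation {i j : Fin p ⊕ Fin q} (hij : i ≠ j)
    (hb : i.isLeft = j.isLeft) {ε : F} (hε : ‖ε‖ = 1) {c s : ℝ} (hcs : c ^ 2 + s ^ 2 = 1) :
    ∃ g ∈ Subgroup.connectedComponentOfOne (grassmannK F p q),
      toMat g.1 = rotation i j ε c s := by
  refine rotation_mem_component (fun g : grassmannK F p q => toMat g.1)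
    (isInducing_toMat.comp Topology.IsInducing.subtypeVal)
    (fun g hg => Subtype.ext (toMat_injective hg)) (fun θ => ?_) hcs
  refine ⟨⟨ofMat _ (rotation_mem_unitary hij hε (Real.cos_sq_add_sin_sq θ)) (det_rotation hij hε θ),
    ?_, ?_⟩, rfl⟩
  · ext k l
    refine rotation_apply_of_ne hij _ _ _ Sum.inl_ne_inr ?_ ?_ <;> rintro rfl rfl <;> simp at hb
  · ext k l
    refine rotation_apply_of_ne hij _ _ _ Sum.inr_ne_inl ?_ ?_ <;> rintro rfl rfl <;> simp at hb

/-- Every element of `K` becomes diagonal after multiplication with the identity component. -/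
theorem exists_component_mul_isDiag (k : grassmannK F p q) :
    ∃ w ∈ Subgroup.connectedComponentOfOne (grassmannK F p q), (toMat (w * k).1).IsDiag := by
  set c : Fin p ⊕ Fin q → ℝ := Sum.elim (fun i => (p : ℝ) - (i : ℕ)) (fun i => (q : ℝ) - (i : ℕ))
    with hc
  set S : Set (Matrix (Fin p ⊕ Fin q) (Fin p ⊕ Fin q) F) :=
    (fun w : grassmannK F p q => toMat (w * k).1) ''
      (Subgroup.connectedComponentOfOne (grassmannK F p q) : Set (grassmannK F p q)) with hS
  have hScomp : IsCompact S := by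
    refine (isClosed_connectedComponent.isCompact).image ?_
    exact continuous_toMat.comp (continuous_subtype_val.comp (continuous_mul_const k))
  -- The relation admits only rotations inside a block, which lie in the identity component of `K`.
  -- The weights are distinct and decrease along each block, and normality keeps the coset stable.
  obtain ⟨v', ⟨w, hw, rfl⟩, h1, h2⟩ := exists_orthogonal_columns (realDiag F c) hScomp
    ⟨_, 1, one_mem _, rfl⟩ (c := Sum.elim (fun i => -(i : ℝ)) (fun i => -((p + i : ℕ) : ℝ)))
    (by
      rintro (i | i) (j | j) h <;> simp only [Sum.elim_inl, Sum.elim_inr, neg_inj, Nat.cast_inj] at h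
      · simpa [Fin.val_inj] using h
      · have := i.2; omega
      · have := j.2; omega
      · simpa [Fin.val_inj] using h)
    (r := fun i j => i.isLeft = j.isLeft) (fun _ _ h => h.symm) (by
      rintro _ ⟨w, hw, rfl⟩ i j hb hij ε a b hε hab
      obtain ⟨g, hg, hgr⟩ := exists_mem_component_rotation (F := F) hij hb hε hab
      refine ⟨w * (k * g * k⁻¹), mul_mem hw (conj_mem_connectedComponentOfOne hg k), ?_⟩
      rw [← hgr]
      change toMat (w * (k * g * k⁻¹) * k).1 = toMat (w * k * g).1
      simp [mul_assoc])
  refine ⟨w, hw, ?_⟩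
  have hX : realDiag F c = fromBlocks (realDiag F fun i : Fin p => (p : ℝ) - (i : ℕ)) 0 0
      (realDiag F fun i : Fin q => (q : ℝ) - (i : ℕ)) := by
    rw [realDiag, realDiag, realDiag, fromBlocks_diagonal]
    congr 1
    ext (i | i) <;> rfl
  set a := blockOne (w * k) with ha
  set b := blockTwo (w * k) with hb
  have hprod : realDiag F c * toMat (w * k).1 =
      fromBlocks ((realDiag F fun i : Fin p => (p : ℝ) - (i : ℕ)) * a) 0 0
        ((realDiag F fun i : Fin q => (q : ℝ) - (i : ℕ)) * b) := by
    rw [hX, toMat_coe, fromBlocks_multiply, ← ha, ← hb]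
    simp only [Matrix.mul_zero, Matrix.zero_mul, add_zero, zero_add]
  have hdiag : ∀ {n : ℕ} {u : Matrix (Fin n) (Fin n) F} (_ : u ∈ unitary (Matrix (Fin n) (Fin n) F))
      (_ : ∀ i j, i ≠ j → (((realDiag F fun i : Fin n => (n : ℝ) - (i : ℕ)) * u)ᴴ *
        ((realDiag F fun i : Fin n => (n : ℝ) - (i : ℕ)) * u)) i j = 0)
      (_ : ∀ i j, i < j → normSq (fun k => ((realDiag F fun i : Fin n => (n : ℝ) - (i : ℕ)) * u) k j)
        ≤ normSq (fun k => ((realDiag F fun i : Fin n => (n : ℝ) - (i : ℕ)) * u) k i)),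
      u.IsDiag := by
    intro n u hu h1 h2 i j hij
    refine apply_eq_zero_of_gram_eq_realDiag hu (strictAnti_reversed n) reversed_nonneg
      (σ := fun i => √(normSq fun k => ((realDiag F fun i : Fin n => (n : ℝ) - (i : ℕ)) * u) k i))
      (fun i j hij => ?_) (fun i => Real.sqrt_nonneg _) ?_ hij
    · rcases hij.eq_or_lt with rfl | h
      · exact le_rfl
      · exact Real.sqrt_le_sqrt (h2 i j h)
    · ext i j
      by_cases hij : i = j
      · subst hij
        rw [conjTranspose_mul_self_diag, realDiag_apply_self, Real.sq_sqrt (normSq_nonneg _)]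
      · rw [h1 i j hij]
        simp [realDiag, hij]
  have hg : (realDiag F c * toMat (w * k).1)ᴴ * (realDiag F c * toMat (w * k).1) =
      fromBlocks (((realDiag F fun i : Fin p => (p : ℝ) - (i : ℕ)) * a)ᴴ *
        ((realDiag F fun i : Fin p => (p : ℝ) - (i : ℕ)) * a)) 0 0
        (((realDiag F fun i : Fin q => (q : ℝ) - (i : ℕ)) * b)ᴴ *
        ((realDiag F fun i : Fin q => (q : ℝ) - (i : ℕ)) * b)) := by
    rw [hprod, fromBlocks_conjTranspose, fromBlocks_multiply]
    simp
  have hn1 : ∀ j, normSq (fun s => (realDiag F c * toMat (w * k).1) s (Sum.inl j)) =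
      normSq fun s => ((realDiag F fun i : Fin p => (p : ℝ) - (i : ℕ)) * a) s j := by
    intro j
    rw [hprod]
    simp [normSq]
  have hn2 : ∀ j, normSq (fun s => (realDiag F c * toMat (w * k).1) s (Sum.inr j)) =
      normSq fun s => ((realDiag F fun i : Fin q => (q : ℝ) - (i : ℕ)) * b) s j := by
    intro j
    rw [hprod]
    simp [normSq]
  have ha' : a.IsDiag := by
    refine hdiag (blockOne_mem _) (fun i j hij => ?_) fun i j hij => ?_
    · have := h1 (Sum.inl i) (Sum.inl j) rfl (by simpa using hij)
      beta_reduce at this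
      rwa [hg] at this
    · rw [← hn1, ← hn1]
      exact h2 (Sum.inl i) (Sum.inl j) rfl (by simpa using hij)
  have hb' : b.IsDiag := by
    refine hdiag (blockTwo_mem _) (fun i j hij => ?_) fun i j hij => ?_
    · have := h1 (Sum.inr i) (Sum.inr j) rfl (by simpa using hij)
      beta_reduce at this
      rwa [hg] at this
    · rw [← hn2, ← hn2]
      exact h2 (Sum.inr i) (Sum.inr j) rfl (by simpa using hij)
  rw [toMat_coe]
  exact ha'.fromBlocks hb'

/-- Two rotations move a phase from one diagonal entry to another. -/
theorem exists_mem_component_phase {i j : Fin p ⊕ Fin q} (hij : i ≠ j)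
    (hb : i.isLeft = j.isLeft) {ε : F} (hε : ‖ε‖ = 1) :
    ∃ g ∈ Subgroup.connectedComponentOfOne (grassmannK F p q), ∀ n : grassmannK F p q,
      (toMat n.1).IsDiag → (toMat (n * g).1).IsDiag ∧
      toMat (n * g).1 i i = toMat n.1 i i * star ε ∧
      ∀ l, l ≠ i → l ≠ j → toMat (n * g).1 l l = toMat n.1 l l := by
  -- A quarter turn twisted by `ε`, followed by an untwisted quarter turn back, multiplies column
  -- `i` by `ε*` and column `j` by `ε`.
  obtain ⟨g, hg, hgr⟩ := exists_mem_component_rotation (F := F) hij hb hε (c := 0) (s := 1) (by norm_num)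
  obtain ⟨h, hh, hhr⟩ := exists_mem_component_rotation (F := F) hij hb (norm_one (α := F)) (c := 0)
    (s := -1) (by norm_num)
  refine ⟨g * h, mul_mem hg hh, fun n hn => ?_⟩
  have e : toMat (n * (g * h)).1 = toMat n.1 * rotation i j ε 0 1 * rotation i j 1 0 (-1) := by
    rw [← hgr, ← hhr, ← mul_assoc]
    rfl
  have ei : ∀ k, toMat (n * (g * h)).1 k i = toMat n.1 k i * star ε := by
    intro k
    rw [e, mul_rotation_apply_left hij, mul_rotation_apply_right hij]
    simp
  have ej : ∀ k, toMat (n * (g * h)).1 k j = toMat n.1 k j * ε := by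
    intro k
    rw [e, mul_rotation_apply_right hij, mul_rotation_apply_left hij]
    simp
  have el : ∀ k l, l ≠ i → l ≠ j → toMat (n * (g * h)).1 k l = toMat n.1 k l := by
    intro k l hi hj
    rw [e, mul_rotation_apply_of_ne hi hj, mul_rotation_apply_of_ne hi hj]
  refine ⟨fun k l hkl => ?_, ei i, fun l => el l l⟩
  beta_reduce
  by_cases hi : l = i
  · subst hi; rw [ei, hn hkl, zero_mul]
  · by_cases hj : l = j
    · subst hj; rw [ej, hn hkl, zero_mul]
    · rw [el _ _ hi hj, hn hkl]

theorem norm_apply_self_of_isDiag {n : Type*} [Fintype n] [DecidableEq n] {A : Matrix n n F}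
    (hA : A ∈ unitary (Matrix n n F)) (hd : A.IsDiag) (i : n) : ‖A i i‖ = 1 := by
  have h := congrFun (congrFun (conjTranspose_mul_self_of_unitary hA) i) i
  rw [conjTranspose_mul_self_diag, one_apply_eq, ← map_one (algebraMap ℝ F), algebraMap_inj,
    normSq, Finset.sum_eq_single i (fun j _ hj => by rw [hd hj]; simp) (by simp)] at h
  exact (pow_eq_one_iff_of_nonneg (norm_nonneg _) two_ne_zero).1 h

/-- The group `K` is generated by its identity component and the centralizer of the torus. -/
theorem exists_component_mul_centralizer (hqp : q < p) (k : grassmannK F p q) :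
    ∃ w ∈ Subgroup.connectedComponentOfOne (grassmannK F p q), ∃ m : grassmannK F p q, k = w * m ∧
      (blockTwo m).IsDiag ∧
      blockOne m * coordEmbedding F hqp.le = coordEmbedding F hqp.le * blockTwo m := by
  obtain ⟨w, hw, hd⟩ := exists_component_mul_isDiag k
  -- The first `q` upper diagonal entries are matched with the lower ones, one index at a time. The
  -- compensating phase goes to the upper coordinate `p - 1`, which is not among the first `q`
  -- because `q < p`.
  have key : ∀ j ≤ q, ∃ g ∈ Subgroup.connectedComponentOfOne (grassmannK F p q),
      (toMat (w * k * g).1).IsDiag ∧ ∀ i : Fin q, (i : ℕ) < j →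
        toMat (w * k * g).1 (Sum.inl (Fin.castLE hqp.le i)) (Sum.inl (Fin.castLE hqp.le i)) =
        toMat (w * k * g).1 (Sum.inr i) (Sum.inr i) := by
    intro j
    induction j with
    | zero => exact fun _ => ⟨1, one_mem _, by simpa using hd, by simp⟩
    | succ j ih =>
      intro hj
      obtain ⟨g, hg, hgd, hge⟩ := ih (Nat.le_of_succ_le hj)
      set i₀ : Fin q := ⟨j, hj⟩ with hi₀
      set A := toMat (w * k * g).1 with hA
      set s : Fin p ⊕ Fin q := Sum.inl (Fin.castLE hqp.le i₀) with hs
      set t : Fin p ⊕ Fin q := Sum.inl ⟨p - 1, by omega⟩ with ht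
      have hst : s ≠ t := by
        intro h
        have := congrArg Fin.val (Sum.inl_injective h)
        simp [hi₀] at this
        omega
      have hns := norm_apply_self_of_isDiag (toMat_mem _) hgd s
      have hni := norm_apply_self_of_isDiag (toMat_mem _) hgd (Sum.inr i₀)
      rw [← hA] at hns hni
      -- With `a` and `b` the upper and lower entries, `ε = b* a` turns `a` into `a ε* = a a* b =
      -- b`.
      obtain ⟨r, hr, hrn⟩ := exists_mem_component_phase (F := F) (p := p) (q := q) hst rfl
        (ε := star (A (Sum.inr i₀) (Sum.inr i₀)) * A s s)
        (by rw [norm_mul, _root_.norm_star, hns, hni, one_mul])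
      obtain ⟨h1, h2, h3⟩ := hrn _ hgd
      refine ⟨g * r, mul_mem hg hr, by rwa [← mul_assoc], fun i hi => ?_⟩
      rw [← mul_assoc, h3 (Sum.inr i) (by simp [hs]) (by simp [ht])]
      rcases Nat.lt_succ_iff_lt_or_eq.1 hi with h | h
      · rw [h3]
        · exact hge i h
        · intro h'
          have := congrArg Fin.val (Sum.inl_injective h')
          simp [hi₀] at this
          omega
        · intro h'
          have := congrArg Fin.val (Sum.inl_injective h')
          simp at this
          omega
      · obtain rfl : i = i₀ := Fin.ext h
        rw [h2, ← hA, star_mul, star_star, ← mul_assoc, mul_star_self_eq, hns]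
        simp
  obtain ⟨g, hg, hgd, hge⟩ := key q le_rfl
  set m := w * k * g with hm
  -- From `m = w k g` one gets `k = w⁻¹ (m g⁻¹ m⁻¹) m`; the first two factors are in the identity
  -- component because it is normal.
  refine ⟨w⁻¹ * (m * g⁻¹ * m⁻¹), mul_mem (inv_mem hw)
    (conj_mem_connectedComponentOfOne (inv_mem hg) m), m, by rw [hm]; group,
    fun i j hij => hgd (by simpa using hij), ?_⟩
  rw [mul_coordEmbedding]
  ext i j
  rw [submatrix_apply, id, mul_apply, Finset.sum_eq_single j]
  · by_cases hij : i = Fin.castLE hqp.le j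
    · subst hij
      have h1 : coordEmbedding F hqp.le (Fin.castLE hqp.le j) j = 1 := one_apply_eq _
      rw [h1, one_mul]
      exact hge j j.2
    · have := hgd (i := Sum.inl i) (j := Sum.inl (Fin.castLE hqp.le j)) (by simpa using hij)
      simpa [coordEmbedding, blockOne, one_apply, hij, toBlocks₁₁] using this
  · intro l _ hl
    have := hgd (i := Sum.inr l) (j := Sum.inr j) (by simpa using hl)
    simp [blockTwo, toBlocks₂₂, this]
  · simp

/-- The centralizer of the torus can be absorbed. -/
theorem angles_mul_mul_torus (hqp : q < p) (u : grassmannU F p q) {m : grassmannK F p q}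
    (hm : (blockTwo m).IsDiag)
    (hm' : blockOne m * coordEmbedding F hqp.le = coordEmbedding F hqp.le * blockTwo m)
    (y : Fin q → ℝ) : angles (u * m.1 * torus hqp.le y) = angles (u * torus hqp.le y) := by
  obtain ⟨a, b, h⟩ := exists_eq_mul_torus_mul hqp u
  generalize (angles u).1 = x at h
  have h1 : angles (u * m.1 * torus hqp.le y) =
      angles (torus hqp.le x * (b * m).1 * torus hqp.le y) := by
    rw [← angles_mul_mul a 1 (torus hqp.le x * (b * m).1 * torus hqp.le y), h]
    simp [mul_assoc]
  have h2 : angles (u * torus hqp.le y) = angles (torus hqp.le x * b.1 * torus hqp.le y) := by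
    rw [← angles_mul_mul a 1 (torus hqp.le x * b.1 * torus hqp.le y), h]
    simp [mul_assoc]
  -- The element `m` multiplies `v` and `w` from the right by the same diagonal unitary matrix,
  -- which the product formula ignores.
  rw [h1, h2, angles_torus_mul_mul, angles_torus_mul_mul, blockTwo_mul, blockOne_mul,
    Matrix.mul_assoc, Matrix.mul_assoc (blockOne b), hm', ← Matrix.mul_assoc (blockOne b),
    ← Matrix.mul_assoc, productAngles_mul_diagonal (blockTwo_mem m) (fun i j hij => hm hij),
    Matrix.mul_assoc]

instance : SecondCountableTopology (Subgroup.connectedComponentOfOne (grassmannK F p q)) :=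
  TopologicalSpace.Subtype.secondCountableTopology _

/-- The average over the identity component does not depend on the component. -/
theorem lintegral_component_mul (hqp : q < p) (g h : grassmannU F p q) (k : grassmannK F p q)
    (f : alcove q → ℝ≥0∞) :
    ∫⁻ w : Subgroup.connectedComponentOfOne (grassmannK F p q), f (angles (g * (w.1 * k).1 * h))
      ∂normalizedHaar (Subgroup.connectedComponentOfOne (grassmannK F p q)) =
    ∫⁻ w : Subgroup.connectedComponentOfOne (grassmannK F p q), f (angles (g * w.1.1 * h))
      ∂normalizedHaar (Subgroup.connectedComponentOfOne (grassmannK F p q)) := by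
  obtain ⟨c, d, hh⟩ := exists_eq_mul_torus_mul hqp h
  generalize (angles h).1 = y at hh
  -- With `h = c b_y d` and `k c = (c v c⁻¹) c m`, the factor `m` is absorbed next to `b_y`. What
  -- remains of `k` is `c v c⁻¹`, an element of the identity component, which Haar invariance
  -- removes.
  obtain ⟨v, hv, m, hvm, hm, hm'⟩ := exists_component_mul_centralizer hqp (c⁻¹ * k * c)
  have hk : k * c = c * v * c⁻¹ * c * m := by
    rw [show k * c = c * (c⁻¹ * k * c) by group, hvm]
    group
  have e : ∀ w : Subgroup.connectedComponentOfOne (grassmannK F p q),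
      angles (g * (w.1 * k).1 * h) = angles (g *
        (w * ⟨c * v * c⁻¹, conj_mem_connectedComponentOfOne hv c⟩ :
          Subgroup.connectedComponentOfOne (grassmannK F p q)).1.1 * h) := by
    intro w
    have h1 : g * (w.1 * k).1 * h =
        (1 : grassmannK F p q).1 * (g * (w.1 * (c * v * c⁻¹ * c)).1 * m.1 * torus hqp.le y) * d.1 := by
      have : (w.1 * k).1 * h = (w.1 * (k * c)).1 * torus hqp.le y * d.1 := by
        rw [hh]; simp [mul_assoc]
      rw [mul_assoc, this, hk]
      simp [mul_assoc]
    have h2 : g * (w.1 * (c * v * c⁻¹)).1 * h =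
        (1 : grassmannK F p q).1 * (g * (w.1 * (c * v * c⁻¹ * c)).1 * torus hqp.le y) * d.1 := by
      rw [hh]; simp [mul_assoc]
    change _ = angles (g * (w.1 * (c * v * c⁻¹)).1 * h)
    rw [h1, h2, angles_mul_mul, angles_mul_mul, angles_mul_mul_torus hqp _ hm hm']
  simp only [e]
  exact lintegral_mul_right_normalizedHaar
    (fun w : Subgroup.connectedComponentOfOne (grassmannK F p q) => f (angles (g * w.1.1 * h)))
    ⟨c * v * c⁻¹, conj_mem_connectedComponentOfOne hv c⟩

/-- Haar measure of `K` is invariant under left multiplication by the identity component, and the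
averages over all its cosets agree by `lintegral_component_mul`. -/
theorem map_angles_component (hqp : q < p) (g h : grassmannU F p q) :
    (normalizedHaar (Subgroup.connectedComponentOfOne (grassmannK F p q))).map
      (fun w => angles (g * w.1.1 * h)) =
    (normalizedHaar (grassmannK F p q)).map fun k => angles (g * k.1 * h) := by
  have hm : Measurable fun k : grassmannK F p q => angles (g * k.1 * h) :=
    (continuous_angles.comp (by fun_prop)).measurable
  have hm' : Measurable fun w : Subgroup.connectedComponentOfOne (grassmannK F p q) =>
      angles (g * w.1.1 * h) := (continuous_angles.comp (by fun_prop)).measurable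
  refine Measure.ext_of_lintegral _ fun f hf => ?_
  rw [lintegral_map hf hm, lintegral_map hf hm']
  have hfm : Measurable fun k : grassmannK F p q => f (angles (g * k.1 * h)) := hf.comp hm
  have ha : Measurable fun z : grassmannK F p q ×
      Subgroup.connectedComponentOfOne (grassmannK F p q) => z.2.1 * z.1 :=
    ((continuous_subtype_val.comp continuous_snd).mul continuous_fst).measurable
  rw [lintegral_eq_of_lintegral_smul (ν := normalizedHaar (grassmannK F p q))
    (η := normalizedHaar (Subgroup.connectedComponentOfOne (grassmannK F p q)))
    (fun w k => w.1 * k) ha (fun w => measurePreserving_mul_left _ _) hfm,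
    lintegral_congr fun k => lintegral_component_mul hqp g h k f, lintegral_const, measure_univ,
    mul_one]

theorem cosetConvComponent_eq (hqp : q < p) (g h : grassmannU F p q)
    (f : C(GrassmannCosets F p q, ℝ)) : cosetConvComponent F g h f = cosetConv F g h f := by
  have hm : Measurable fun k : grassmannK F p q => angles (g * k.1 * h) :=
    (continuous_angles.comp (by fun_prop)).measurable
  have hm' : Measurable fun w : Subgroup.connectedComponentOfOne (grassmannK F p q) =>
      angles (g * w.1.1 * h) := (continuous_angles.comp (by fun_prop)).measurable
  have hφ : Continuous fun x => f (alcoveHomeomorph (F := F) hqp x) :=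
    f.continuous.comp (alcoveHomeomorph hqp).continuous
  have hc := congrArg (fun M : Measure (alcove q) => ∫ x, f (alcoveHomeomorph hqp x) ∂M)
    (map_angles_component hqp g h)
  beta_reduce at hc
  rw [integral_map hm.aemeasurable hφ.measurable.aestronglyMeasurable,
    integral_map hm'.aemeasurable hφ.measurable.aestronglyMeasurable] at hc
  simp only [alcoveHomeomorph_angles] at hc
  exact hc

end ComponentK

end Grassmann

end

/-! ### The theorem. -/

namespace Grassmann

/-- The three scalar fields are treated at once: besides Haar measure, only the properties in
`IsScalar` and `IsScalarDet` enter. -/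
theorem convolution_structure {F : Type} [NormedRing F] [StarRing F] [NormedStarGroup F]
    [NormedAlgebra ℝ F] [IsScalar F] [ProperSpace F] [HasDet F] [IsScalarDet F] [MeasureSpace F]
    [BorelSpace F] [Measure.IsAddHaarMeasure (volume : Measure F)]
    (q : ℕ) (hq : 0 < q) (μ : ℂ) (hμ : gammaConst F q - 1 < μ.re) :
    IntegrableOn (ballDensity F q μ) (matrixBall F q) ∧ kappa F q μ ≠ 0 ∧
    ∃ conv : MeasureProduct (alcove q),
      (∀ (x y : alcove q) (f : C(alcove q, ℝ)),
        cintegral (conv (pointMass x) (pointMass y)) f = pointConv F q μ x y f) ∧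
      WeaklyContinuous conv ∧
      (∀ a b c, conv (conv a b) c = conv a (conv b c)) ∧
      (∀ a b, conv a b = conv b a) ∧
      (∀ a, conv (pointMass 0) a = a) ∧
      (∀ x y, conv (pointMass x) (pointMass y) Set.univ = 1) ∧
      (μ.im = 0 → ∃ H : Hypergroup (alcove q), H.conv = conv ∧ H.e = 0 ∧ H.inv = id) ∧
      (∀ p : ℕ, μ = p * Module.finrank ℝ F / 2 →
        ∃ Φ : alcove q ≃ₜ GrassmannCosets F p q,
          (∀ x : alcove q, ∃ b : grassmannU F p q,
            (b : Matrix (Fin p ⊕ Fin q) (Fin p ⊕ Fin q) F) = rotationMatrix F p q x.1 ∧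
            Φ x = coset b) ∧
          (∀ (g h : grassmannU F p q) (f : C(GrassmannCosets F p q, ℝ)),
            cintegral (conv (pointMass (Φ.symm (coset g))) (pointMass (Φ.symm (coset h)))) (f ∘ Φ) =
              cosetConv F g h f ∧
            cosetConvComponent F g h f = cosetConv F g h f) ∧
          Φ 0 = coset 1 ∧
          ∀ g : grassmannU F p q, coset g⁻¹ = coset g) := by
  refine ⟨integrableOn_ballDensity hq hμ, kappa_ne_zero hq hμ, alcoveConv F q μ,
    cintegral_alcoveConv_pointMass_eq_pointConv hq hμ, weaklyContinuous_alcoveConv hq hμ,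
    alcoveConv_assoc hq hμ, alcoveConv_comm hq hμ, alcoveConv_zero_left hq hμ,
    alcoveConv_univ hq hμ, fun him => ⟨alcoveHypergroup (F := F) hq hμ him, rfl, rfl, rfl⟩,
    fun p hp => ?_⟩
  have hqp : q < p := lt_of_lt_of_le (by omega) (add_le_of_gammaConst_lt hμ hp)
  exact ⟨alcoveHomeomorph hqp, fun x => ⟨torus hqp.le x.1, rfl, rfl⟩,
    fun g h f => ⟨cintegral_alcoveConv_eq_cosetConv hq hμ hp hqp g h f,
      cosetConvComponent_eq hqp g h f⟩,
    alcoveHomeomorph_zero hqp, coset_inv hqp⟩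

end Grassmann

theorem theorem6p2 (𝔽 : ScalarField)
    (h𝔽 : 𝔽 = ScalarField.real ∨ 𝔽 = ScalarField.complex ∨ 𝔽 = ScalarField.quaternion)
    (q : ℕ) (hq : 0 < q) (μ : ℂ) (hμ : gammaConst 𝔽 q - 1 < μ.re) :
    IntegrableOn (ballDensity 𝔽 q μ) (matrixBall 𝔽 q) ∧ kappa 𝔽 q μ ≠ 0 ∧
    ∃ conv : MeasureProduct (alcove q),
      (∀ (x y : alcove q) (f : C(alcove q, ℝ)),
        cintegral (conv (pointMass x) (pointMass y)) f = pointConv 𝔽 q μ x y f) ∧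
      WeaklyContinuous conv ∧
      (∀ a b c, conv (conv a b) c = conv a (conv b c)) ∧
      (∀ a b, conv a b = conv b a) ∧
      (∀ a, conv (pointMass 0) a = a) ∧
      (∀ x y, conv (pointMass x) (pointMass y) Set.univ = 1) ∧
      (μ.im = 0 → ∃ H : Hypergroup (alcove q), H.conv = conv ∧ H.e = 0 ∧ H.inv = id) ∧
      (∀ p : ℕ, μ = p * Module.finrank ℝ 𝔽 / 2 →
        ∃ Φ : alcove q ≃ₜ GrassmannCosets 𝔽 p q,
          (∀ x : alcove q, ∃ b : grassmannU 𝔽 p q,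
            (b : Matrix (Fin p ⊕ Fin q) (Fin p ⊕ Fin q) 𝔽) = rotationMatrix 𝔽 p q x.1 ∧
            Φ x = coset b) ∧
          (∀ (g h : grassmannU 𝔽 p q) (f : C(GrassmannCosets 𝔽 p q, ℝ)),
            cintegral (conv (pointMass (Φ.symm (coset g))) (pointMass (Φ.symm (coset h)))) (f ∘ Φ) =
              cosetConv 𝔽 g h f ∧
            cosetConvComponent 𝔽 g h f = cosetConv 𝔽 g h f) ∧
          Φ 0 = coset 1 ∧
          ∀ g : grassmannU 𝔽 p q, coset g⁻¹ = coset g) := by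
  rcases h𝔽 with rfl | rfl | rfl
  · exact Grassmann.convolution_structure (F := ℝ) q hq μ hμ
  · exact Grassmann.convolution_structure (F := ℂ) q hq μ hμ
  · have : Measure.IsAddHaarMeasure (volume : Measure ℍ[ℝ]) := inferInstance
    exact Grassmann.convolution_structure (F := ℍ[ℝ]) q hq μ hμ
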